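/- **Theorem 3.3.** Let $n\ge 1$, and let $\rho:\mathbb R^n\to(0,\infty)$ be such that for some $l_0>0$ and $C_0>1$ $$\frac1{C_0}\Big(1+\frac{|x-y|}{\rho(x)}\Big)^{-l_0}\le\frac{\rho(y)}{\rho(x)}\le C_0\Big(1+\frac{|x-y|}{\rho(x)}\Big)^{\frac{l_0}{l_0+1}}\qquad(x,y\in\mathbb R^n).$$ For a ball $B=B(x_0,r)$ and $\theta\ge 0$ put $\lambda B=B(x_0,\lambda r)$, $r(B)=r$ and $\Psi_\theta(B)=(1+r/\rho(x_0))^\theta$. Functions are real- or complex-valued. A weight is a nonnegative locally integrable function $\omega$, and $\|f\|_{L^p(\omega)}=(\int|f|^p\omega\,dx)^{1/p}$. For $1<t<\infty$, $\omega\in A_t^{\rho,\infty}$ means that for some $\theta\ge0$ $$\sup_B\Big(\frac1{\Psi_\theta(B)|B|}\int_B\omega\Big)\Big(\frac1{\Psi_\theta(B)|B|}\int_B\omega^{-\frac1{t-1}}\Big)^{t-1}<\infty .$$ For $1\le s\le\infty$, $\omega\in RH_s^{loc}$ means that $\big(\frac1{|B|}\int_B\omega^s\big)^{1/s}\le C\frac1{|B|}\int_B\omega$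 with one constant $C$ for all balls $B=B(x_0,r)$ with $r<\rho(x_0)$ (essential supremum over $B$ on the left if $s=\infty$; no condition on the weight if $s=1$). For $\theta>0$, $b\in BMO_{\theta}(\rho)$ means that $b$ is locally integrable and $$\|b\|_{BMO_\theta(\rho)}=\sup_B\frac1{\Psi_\theta(B)|B|}\int_B|b-b_B|<\infty,\qquad b_B=\frac1{|B|}\int_Bb .$$ Let $1\le p_0<q_0\le\infty$. Let $T:L^{p_0}(\mathbb R^n)\to L^{p_0}(\mathbb R^n)$ be a bounded sublinear operator: $|T(f+g)|\le|Tf|+|Tg|$ and $|T(cf)|=|c||Tf|$ a.e., and $\|Tf\|_{L^{p_0}}\le M\|f\|_{L^{p_0}}$ for some constant $M$. Let $\{A_r\}_{r>0}$ be a family of maps from $L_c^\infty$ (bounded functions with compact support) into $L^{p_0}$. Let $c_0>0$, let $k\ge0$ be an integer, and let $(\alpha_j)_{j\ge1}$ be nonnegative numbers with $\sum_{j\ge1}\alpha_jj^k<\infty$. Assume that for every $\theta>0$ there is a constant $C_\theta$ such that for all $f\in L_c^\infty$ the following hold. (i) For every ball $B=B(x_0,r)$ with $r<\rho(x_0)$,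 with $\bar B=c_0B$ and $B_{j+1}=2^{j+1}\bar B$, $$\Big(\frac1{|\bar B|}\int_{\bar B}|T(I-A_{r(\bar B)})f|^{p_0}\Big)^{1/p_0}\le C_\theta\sum_{j=1}^\infty\alpha_j\Big(\frac1{\Psi_\theta(B_{j+1})|B_{j+1}|}\int_{B_{j+1}}|f|^{p_0}\Big)^{1/p_0}.$$ (ii) For every ball $B=B(x_0,r)$ with $r\ge\rho(x_0)$, with $B_{j+1}=2^{j+1}B$, $$\Big(\frac1{\Psi_\theta(B)|B|}\int_{B}|Tf|^{p_0}\Big)^{1/p_0}\le C_\theta\sum_{j=1}^\infty\alpha_j\Big(\frac1{\Psi_\theta(B_{j+1})|B_{j+1}|}\int_{B_{j+1}}|f|^{p_0}\Big)^{1/p_0}.$$ (iii) For every ball $B=B(x_0,r)$ with $r<\rho(x_0)$, with $\bar B=c_0B$ and $B_{j+1}=2^{j+1}\bar B$, $$\Big(\frac1{|\bar B|}\int_{\bar B}|TA_{r(\bar B)}f|^{q_0}\Big)^{1/q_0}\le C_\theta\sum_{j=1}^\infty\alpha_j\Big(\frac1{\Psi_\theta(B_{j+1})|B_{j+1}|}\int_{B_{j+1}}|Tf|^{p_0}\Big)^{1/p_0}$$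 (essential supremum over $\bar B$ on the left if $q_0=\infty$). Let $p_0<p<q_0$ (or $p=q_0$ when $q_0<\infty$), let $\omega\in A_{p/p_0}^{\rho,\infty}\cap RH^{loc}_{(q_0/p)'}$, where $(q_0/p)'$ is the exponent conjugate to $q_0/p$, and let $\theta_1>0$. Then there is a constant $C$ such that for all $f\in L_c^\infty$ and $b\in BMO_{\theta_1}(\rho)$ the $k$-th order commutator $T_b^kf(x)=T\big((b(x)-b)^kf\big)(x)$ is well defined and $$\|T_b^kf\|_{L^p(\omega)}\le C\,\|b\|_{BMO_{\theta_1}(\rho)}^k\,\|f\|_{L^p(\omega)} .$$ Here $T_b^kf$ is understood as follows: for each scalar $c$ the function $(c-b)^kf$ belongs to $L^{p_0}$, one chooses representatives $\Phi_c$ of $T((c-b)^kf)$ such that $c\mapsto|\Phi_c(x)|$ is continuous for a.e. $x$, and puts $T_b^kf(x)=\Phi_{b(x)}(x)$. "Well defined" means that such a choice exists; the inequality holds for every such choice (and $|T_b^kf|$ does not depend on the choice, up to null sets). -/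

import Mathlib

open MeasureTheory Metric
open scoped NNReal ENNReal

noncomputable section

/-- `IsAdmissible ρ`: `ρ` is a positive function on `ℝⁿ` such that, for some `l₀ > 0` and `C₀ > 1`,
`C₀⁻¹ (1 + |x - y| / ρ x)^(-l₀) ≤ ρ y / ρ x ≤ C₀ (1 + |x - y| / ρ x)^(l₀ / (l₀ + 1))`. -/
structure IsAdmissible {n : ℕ} (ρ : EuclideanSpace ℝ (Fin n) → ℝ) : Prop where
  pos : ∀ x, 0 < ρ x
  slowly_varying : ∃ l₀ C₀ : ℝ, 0 < l₀ ∧ 1 < C₀ ∧ ∀ x y,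
    1 / C₀ * (1 + dist x y / ρ x) ^ (-l₀) ≤ ρ y / ρ x ∧
      ρ y / ρ x ≤ C₀ * (1 + dist x y / ρ x) ^ (l₀ / (l₀ + 1))

/-- `Ψ_θ(B) = (1 + r / ρ x₀)^θ` for the ball `B = B(x₀, r)`, as an extended nonnegative number. -/
def psi {n : ℕ} (ρ : EuclideanSpace ℝ (Fin n) → ℝ) (θ : ℝ) (x₀ : EuclideanSpace ℝ (Fin n))
    (r : ℝ) : ℝ≥0∞ :=
  ENNReal.ofReal ((1 + r / ρ x₀) ^ θ)

/-- Normalised Lebesgue measure `|B|⁻¹ dy` on the ball `B = B(x₀, r)`. Thus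
`eLpNorm f q (avgMeasure x₀ r)` is `(|B|⁻¹ ∫_B |f|^q)^(1/q)` for `0 < q < ∞`, and the essential
supremum of `|f|` over `B` for `q = ∞`. -/
def avgMeasure {n : ℕ} (x₀ : EuclideanSpace ℝ (Fin n)) (r : ℝ) :
    Measure (EuclideanSpace ℝ (Fin n)) :=
  (volume (ball x₀ r))⁻¹ • volume.restrict (ball x₀ r)

/-- The measure `(Ψ_θ(B) |B|)⁻¹ dy` on the ball `B = B(x₀, r)`. Thus
`eLpNorm f q (psiMeasure ρ θ x₀ r)` is `((Ψ_θ(B) |B|)⁻¹ ∫_B |f|^q)^(1/q)` for `0 < q < ∞`. -/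
def psiMeasure {n : ℕ} (ρ : EuclideanSpace ℝ (Fin n) → ℝ) (θ : ℝ)
    (x₀ : EuclideanSpace ℝ (Fin n)) (r : ℝ) : Measure (EuclideanSpace ℝ (Fin n)) :=
  (psi ρ θ x₀ r * volume (ball x₀ r))⁻¹ • volume.restrict (ball x₀ r)

/-- A weight: a nonnegative locally integrable function on `ℝⁿ`. -/
structure IsWeight {n : ℕ} (ω : EuclideanSpace ℝ (Fin n) → ℝ) : Prop where
  nonneg : ∀ x, 0 ≤ ω x
  locallyIntegrable : LocallyIntegrable ω volume

/-- The class `A_t^{ρ,θ}`, for `1 < t < ∞`. The power `ω^(-1/(t-1))` is `∞` where `ω = 0`. -/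
def MuckenhouptRho {n : ℕ} (ρ : EuclideanSpace ℝ (Fin n) → ℝ) (θ t : ℝ)
    (ω : EuclideanSpace ℝ (Fin n) → ℝ) : Prop :=
  ∃ C : ℝ≥0, ∀ (x₀ : EuclideanSpace ℝ (Fin n)) (r : ℝ), 0 < r →
    (∫⁻ y, ENNReal.ofReal (ω y) ∂(psiMeasure ρ θ x₀ r)) *
      (∫⁻ y, ENNReal.ofReal (ω y) ^ (-1 / (t - 1)) ∂(psiMeasure ρ θ x₀ r)) ^ (t - 1) ≤ C

/-- The class `A_t^{ρ,∞} = ⋃_{θ ≥ 0} A_t^{ρ,θ}`, for `1 < t < ∞`. -/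
def MuckenhouptRhoInfty {n : ℕ} (ρ : EuclideanSpace ℝ (Fin n) → ℝ) (t : ℝ)
    (ω : EuclideanSpace ℝ (Fin n) → ℝ) : Prop :=
  ∃ θ : ℝ, 0 ≤ θ ∧ MuckenhouptRho ρ θ t ω

/-- The local reverse Hölder class `RH_s^loc`, for `1 ≤ s ≤ ∞`:
`(|B|⁻¹ ∫_B ω^s)^(1/s) ≤ C |B|⁻¹ ∫_B ω` for all balls `B = B(x₀, r)` with `r < ρ x₀`
(essential supremum on the left if `s = ∞`; no condition on the weight if `s = 1`). -/
def ReverseHolderLoc {n : ℕ} (ρ : EuclideanSpace ℝ (Fin n) → ℝ) (s : ℝ≥0∞)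
    (ω : EuclideanSpace ℝ (Fin n) → ℝ) : Prop :=
  ∃ C : ℝ≥0, ∀ (x₀ : EuclideanSpace ℝ (Fin n)) (r : ℝ), 0 < r → r < ρ x₀ →
    eLpNorm ω s (avgMeasure x₀ r) ≤ C * ∫⁻ y, ENNReal.ofReal (ω y) ∂(avgMeasure x₀ r)

/-- The measure `ω dx`; `eLpNorm f p (weightMeasure ω)` is the norm of `L^p(ω)`. -/
def weightMeasure {n : ℕ} (ω : EuclideanSpace ℝ (Fin n) → ℝ) :
    Measure (EuclideanSpace ℝ (Fin n)) :=
  volume.withDensity fun x => ENNReal.ofReal (ω x)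

/-- `‖b‖_{BMO_θ(ρ)} = sup_B (Ψ_θ(B) |B|)⁻¹ ∫_B |b - b_B|`, where `b_B` is the mean of `b` over the
ball `B`. -/
def bmoNorm {n : ℕ} {𝕜 : Type*} [RCLike 𝕜] (ρ : EuclideanSpace ℝ (Fin n) → ℝ) (θ : ℝ)
    (b : EuclideanSpace ℝ (Fin n) → 𝕜) : ℝ≥0∞ :=
  ⨆ (x₀ : EuclideanSpace ℝ (Fin n)) (r : ℝ) (_ : 0 < r),
    ∫⁻ y, ‖b y - ⨍ z in ball x₀ r, b z ∂volume‖ₑ ∂(psiMeasure ρ θ x₀ r)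

/-- `b ∈ BMO_θ(ρ)`. -/
structure MemBMO {n : ℕ} {𝕜 : Type*} [RCLike 𝕜] (ρ : EuclideanSpace ℝ (Fin n) → ℝ) (θ : ℝ)
    (b : EuclideanSpace ℝ (Fin n) → 𝕜) : Prop where
  locallyIntegrable : LocallyIntegrable b volume
  bmoNorm_lt_top : bmoNorm ρ θ b < ∞

/-- `L_c^∞(ℝⁿ)`, the essentially bounded functions with compact support, as a subset of `L^{p₀}`. -/
def LcInfty (n : ℕ) (𝕜 : Type*) [RCLike 𝕜] (p₀ : ℝ≥0) :
    Set (Lp (α := EuclideanSpace ℝ (Fin n)) 𝕜 (p₀ : ℝ≥0∞) volume) :=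
  {f | MemLp f ∞ volume ∧ ∃ R : ℝ, ∀ᵐ x ∂volume, x ∉ ball (0 : EuclideanSpace ℝ (Fin n)) R → f x = 0}

/-- `T` is a bounded sublinear operator on `L^{p₀}(ℝⁿ)`:
`|T(f + g)| ≤ |Tf| + |Tg|` and `|T(c f)| = |c| |Tf|` almost everywhere, and
`‖Tf‖_{p₀} ≤ M ‖f‖_{p₀}`. -/
structure IsBoundedSublinear {n : ℕ} {𝕜 : Type*} [RCLike 𝕜] {p₀ : ℝ≥0}
    (T : Lp (α := EuclideanSpace ℝ (Fin n)) 𝕜 (p₀ : ℝ≥0∞) volume →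
      Lp (α := EuclideanSpace ℝ (Fin n)) 𝕜 (p₀ : ℝ≥0∞) volume) : Prop where
  norm_add_le : ∀ f g, ∀ᵐ x ∂volume, ‖T (f + g) x‖ ≤ ‖T f x‖ + ‖T g x‖
  norm_smul : ∀ (c : 𝕜) f, ∀ᵐ x ∂volume, ‖T (c • f) x‖ = ‖c‖ * ‖T f x‖
  bounded : ∃ M : ℝ≥0, ∀ f, ‖T f‖ ≤ M * ‖f‖

/-- `F` is the `k`-th order commutator `T_b^k f`, that is `F(x) = T((b(x) - b)^k f)(x)`.

As `T` takes values in a space of almost everywhere classes, evaluating at `x` a function that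
itself depends on `x` needs a choice of representatives: `Φ c` is a representative of
`T((c - b)^k f)` for every scalar `c` (every `(c - b)^k f` being in `L^{p₀}`), chosen such that
`|Φ c x|` is continuous in `c` for almost every `x`, and `F(x) = Φ (b x) x`.
Any two families `Φ` of this kind satisfy, for almost every `x`, `|Φ c x| = |Φ' c x|` for all `c`
(a countable dense set of scalars `c` suffices), so that `|F|` is determined almost everywhere. -/
def IsCommutator {n : ℕ} {𝕜 : Type*} [RCLike 𝕜] {p₀ : ℝ≥0}
    (T : Lp (α := EuclideanSpace ℝ (Fin n)) 𝕜 (p₀ : ℝ≥0∞) volume →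
      Lp (α := EuclideanSpace ℝ (Fin n)) 𝕜 (p₀ : ℝ≥0∞) volume)
    (b : EuclideanSpace ℝ (Fin n) → 𝕜) (k : ℕ)
    (f : Lp (α := EuclideanSpace ℝ (Fin n)) 𝕜 (p₀ : ℝ≥0∞) volume)
    (F : EuclideanSpace ℝ (Fin n) → 𝕜) : Prop :=
  ∃ Φ : 𝕜 → EuclideanSpace ℝ (Fin n) → 𝕜,
    (∀ c : 𝕜, ∃ g : Lp (α := EuclideanSpace ℝ (Fin n)) 𝕜 (p₀ : ℝ≥0∞) volume,
      (∀ᵐ y ∂volume, g y = (c - b y) ^ k * f y) ∧ (∀ᵐ x ∂volume, Φ c x = T g x)) ∧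
    (∀ᵐ x ∂volume, Continuous fun c => ‖Φ c x‖) ∧
    (∀ᵐ x ∂volume, F x = Φ (b x) x)

end

noncomputable section

/-! ### Balls and averages, the growth factor `psi`, and the regularity of the critical radius. -/

section Geometry

variable {n : ℕ}

/-! ### Volumes of balls and averages -/

/-! The proof is a good-λ argument with two operators, in the style of Auscher and Martell, run on
cubes whose side is a small multiple of the critical radius and iterated over the order of the
commutator. Put t = p/p₀, μ = ω dx, β = ‖b‖, and take b bounded at first. Let F = |T_b^k f|^{p₀},
and let G be a multiple of the p₀-th power of β^k Mf + Σ_{i<k} β^{k-i} M(T_b^i f) (`commMajorant`),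
where Mh = (M_θ h^{p₀s})^{1/(p₀s)} with s slightly above 1 (`maximalPow`).

On a ball B containing x', a binomial expansion about the mean b_B compares T_b^k f with T((b_B -
b)^k f), up to lower commutators times powers of |b - b_B|. Writing I = (I - A) + A, hypothesis (i)
produces a part g of F whose mean over B is at most G(x'). Hypothesis (iii) together with the
reverse Hölder condition produces a part H whose L^t(μ) mean is controlled by G(x') and by the means
of F over larger balls (`OffDiagonalEstimates.exists_splitting`). At radii comparable to ρ,
hypothesis (ii) bounds the mean of F by G alone (`OffDiagonalEstimates.exists_avg_commAbs_le`); this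
is the base level. By John–Nirenberg the oscillation of b over the j-th dilate costs a factor of
order j^k, which the sum of α_j j^k pays for, and a power of Ψ, which is paid for by using the
hypotheses with a large θ.

The engine is `exists_local_estimate`, a bound of F by G in L^t(μ) on one cube. Level sets of F at
heights ΛK^i are decomposed into stopping cells. In a cell where G is small somewhere, the next I
level sets are covered by level sets of the maximal functions of g and of H. The first are small in
μ because μ is uniformly absolutely continuous on small balls. For the second, the strong type (t,t)
bounds the sum over all I levels by a constant independent of I, and averaging over a large number I
of levels makes this absorbable (`sum_range_le_of_sum_shift_le`). No integrability of H beyond the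
exponent t is used, so the reverse Hölder condition need not self-improve and p = q₀ is allowed.
With Lebesgue measure in place of μ the same theorem yields the John–Nirenberg inequality.

Cubes are glued without a covering lemma, by integrating over the centres of balls whose radius
varies slowly and applying Tonelli. On the side of the weights, the dual weight satisfies a reverse
Hölder inequality on small balls, so the A_t condition holds with a smaller exponent in a form that
tolerates powers of Ψ (`DualWeights.exists_weakTypeCondition`); by interpolation M is bounded on
L^p(ω), and induction on k ends the bounded case.

Two points remain. T is only sublinear, so T((b(x) - b)^k f)(x) is defined through a version of
|T((c - b)^k f)(x)| that is continuous in c (`commNorm`). Unbounded b is reached by truncation and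
Fatou's lemma (`IsBoundedSublinear.eLpNorm_commAbs_le_of_truncate`). -/

lemma volume_ball_mul (x y : EuclideanSpace ℝ (Fin n)) {c r : ℝ} (hc : 0 < c) :
    volume (ball x (c * r)) = ENNReal.ofReal (c ^ n) * volume (ball y r) := by
  rw [Measure.addHaar_ball_mul_of_pos _ _ hc, finrank_euclideanSpace_fin,
    Measure.addHaar_ball_center volume y]

lemma volume_ball_le_mul (x y : EuclideanSpace ℝ (Fin n)) {c r r' : ℝ} (hc : 0 < c)
    (h : r' ≤ c * r) : volume (ball x r') ≤ ENNReal.ofReal (c ^ n) * volume (ball y r) := by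
  rw [← volume_ball_mul x y hc]
  exact measure_mono (ball_subset_ball h)

lemma volume_ball_ne_top (x : EuclideanSpace ℝ (Fin n)) (r : ℝ) : volume (ball x r) ≠ ∞ :=
  measure_ball_lt_top.ne

lemma volume_ball_ne_zero (x : EuclideanSpace ℝ (Fin n)) {r : ℝ} (hr : 0 < r) :
    volume (ball x r) ≠ 0 := (measure_ball_pos volume x hr).ne'

lemma lintegral_avgMeasure (x : EuclideanSpace ℝ (Fin n)) (r : ℝ)
    (h : EuclideanSpace ℝ (Fin n) → ℝ≥0∞) :
    ∫⁻ y, h y ∂avgMeasure x r = (volume (ball x r))⁻¹ * ∫⁻ y in ball x r, h y := by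
  rw [avgMeasure, lintegral_smul_measure, smul_eq_mul]

lemma lintegral_psiMeasure (ρ : EuclideanSpace ℝ (Fin n) → ℝ) (θ : ℝ)
    (x : EuclideanSpace ℝ (Fin n)) (r : ℝ) (h : EuclideanSpace ℝ (Fin n) → ℝ≥0∞) :
    ∫⁻ y, h y ∂psiMeasure ρ θ x r
      = (psi ρ θ x r * volume (ball x r))⁻¹ * ∫⁻ y in ball x r, h y := by
  rw [psiMeasure, lintegral_smul_measure, smul_eq_mul]

lemma setLIntegral_ball_eq_mul_avg (x : EuclideanSpace ℝ (Fin n)) {r : ℝ} (hr : 0 < r)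
    (h : EuclideanSpace ℝ (Fin n) → ℝ≥0∞) :
    ∫⁻ y in ball x r, h y = volume (ball x r) * ∫⁻ y, h y ∂avgMeasure x r := by
  rw [lintegral_avgMeasure, ← mul_assoc,
    ENNReal.mul_inv_cancel (volume_ball_ne_zero x hr) (volume_ball_ne_top x r), one_mul]

lemma isProbabilityMeasure_avgMeasure (x : EuclideanSpace ℝ (Fin n)) {r : ℝ} (hr : 0 < r) :
    IsProbabilityMeasure (avgMeasure x r) := by
  constructor
  rw [avgMeasure, Measure.smul_apply, Measure.restrict_apply_univ, smul_eq_mul,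
    ENNReal.inv_mul_cancel (volume_ball_ne_zero x hr) (volume_ball_ne_top x r)]

lemma avgMeasure_absolutelyContinuous (x : EuclideanSpace ℝ (Fin n)) (r : ℝ) :
    avgMeasure x r ≪ volume.restrict (ball x r) :=
  Measure.smul_absolutelyContinuous

lemma avgMeasure_absolutelyContinuous_volume (x : EuclideanSpace ℝ (Fin n)) (r : ℝ) :
    avgMeasure x r ≪ volume :=
  (avgMeasure_absolutelyContinuous x r).trans Measure.restrict_le_self.absolutelyContinuous

/-- Averages over comparable nested balls. -/
lemma avg_le_mul_avg {x y : EuclideanSpace ℝ (Fin n)} {c r s : ℝ} (hc : 0 < c) (hr : 0 < r)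
    (hs : 0 < s) (hsc : s ≤ c * r) (hsub : ball x r ⊆ ball y s)
    (h : EuclideanSpace ℝ (Fin n) → ℝ≥0∞) :
    ∫⁻ z, h z ∂avgMeasure x r ≤ ENNReal.ofReal (c ^ n) * ∫⁻ z, h z ∂avgMeasure y s := by
  have h1 : ∫⁻ z in ball x r, h z ≤ ∫⁻ z in ball y s, h z := lintegral_mono_set hsub
  rw [lintegral_avgMeasure x r]
  calc (volume (ball x r))⁻¹ * ∫⁻ z in ball x r, h z
      ≤ (volume (ball x r))⁻¹ * (volume (ball y s) * ∫⁻ y, h y ∂avgMeasure y s) := by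
        rw [← setLIntegral_ball_eq_mul_avg y hs]; gcongr
    _ ≤ (volume (ball x r))⁻¹ * ((ENNReal.ofReal (c ^ n) * volume (ball x r)) *
          ∫⁻ y, h y ∂avgMeasure y s) := by
        gcongr; exact volume_ball_le_mul y x hc hsc
    _ = ((volume (ball x r))⁻¹ * volume (ball x r)) *
          (ENNReal.ofReal (c ^ n) * ∫⁻ y, h y ∂avgMeasure y s) := by ring
    _ = _ := by
        rw [ENNReal.inv_mul_cancel (volume_ball_ne_zero x hr) (volume_ball_ne_top x r), one_mul]

/-! ### The function `psi` -/

variable {ρ : EuclideanSpace ℝ (Fin n) → ℝ}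

lemma IsAdmissible.one_le_base (hρ : IsAdmissible ρ) (x : EuclideanSpace ℝ (Fin n)) {r : ℝ}
    (hr : 0 ≤ r) : 1 ≤ 1 + r / ρ x := by
  have := div_nonneg hr (hρ.pos x).le
  linarith

lemma IsAdmissible.one_le_psi (hρ : IsAdmissible ρ) {θ : ℝ} (hθ : 0 ≤ θ)
    (x : EuclideanSpace ℝ (Fin n)) {r : ℝ} (hr : 0 ≤ r) : 1 ≤ psi ρ θ x r := by
  rw [psi, ENNReal.one_le_ofReal]
  exact Real.one_le_rpow (hρ.one_le_base x hr) hθ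

lemma psi_ne_top (ρ : EuclideanSpace ℝ (Fin n) → ℝ) (θ : ℝ) (x : EuclideanSpace ℝ (Fin n))
    (r : ℝ) : psi ρ θ x r ≠ ∞ := ENNReal.ofReal_ne_top

lemma IsAdmissible.psi_ne_zero (hρ : IsAdmissible ρ) (θ : ℝ)
    (x : EuclideanSpace ℝ (Fin n)) {r : ℝ} (hr : 0 ≤ r) : psi ρ θ x r ≠ 0 := by
  rw [psi, ne_eq, ENNReal.ofReal_eq_zero, not_le]
  exact Real.rpow_pos_of_pos (by linarith [hρ.one_le_base x hr]) _

lemma psi_zero (ρ : EuclideanSpace ℝ (Fin n) → ℝ) (x : EuclideanSpace ℝ (Fin n)) (r : ℝ) :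
    psi ρ 0 x r = 1 := by simp [psi]

lemma psiMeasure_zero (ρ : EuclideanSpace ℝ (Fin n) → ℝ) (x : EuclideanSpace ℝ (Fin n)) (r : ℝ) :
    psiMeasure ρ 0 x r = avgMeasure x r := by simp [psiMeasure, psi_zero, avgMeasure]

lemma IsAdmissible.psi_add (hρ : IsAdmissible ρ) (θ₁ θ₂ : ℝ)
    (x : EuclideanSpace ℝ (Fin n)) {r : ℝ} (hr : 0 ≤ r) :
    psi ρ (θ₁ + θ₂) x r = psi ρ θ₁ x r * psi ρ θ₂ x r := by
  have := hρ.one_le_base x hr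
  rw [psi, psi, psi, ← ENNReal.ofReal_mul (by positivity), Real.rpow_add (by linarith)]

lemma IsAdmissible.psi_rpow (hρ : IsAdmissible ρ) (θ : ℝ) {a : ℝ}
    (x : EuclideanSpace ℝ (Fin n)) {r : ℝ} (hr : 0 ≤ r) :
    psi ρ θ x r ^ a = psi ρ (θ * a) x r := by
  have := hρ.one_le_base x hr
  rw [psi, psi, ENNReal.ofReal_rpow_of_pos (Real.rpow_pos_of_pos (by linarith) _),
    ← Real.rpow_mul (by linarith)]

lemma IsAdmissible.psi_mono (hρ : IsAdmissible ρ) {θ₁ θ₂ r₁ r₂ : ℝ} (hθ : θ₁ ≤ θ₂) (hθ₁ : 0 ≤ θ₁)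
    (x : EuclideanSpace ℝ (Fin n)) (hr : 0 ≤ r₁) (hr₂ : r₁ ≤ r₂) :
    psi ρ θ₁ x r₁ ≤ psi ρ θ₂ x r₂ := by
  have h1 := hρ.one_le_base x hr
  have h2 : r₁ / ρ x ≤ r₂ / ρ x := by gcongr; exact (hρ.pos x).le
  apply ENNReal.ofReal_le_ofReal
  calc (1 + r₁ / ρ x) ^ θ₁ ≤ (1 + r₁ / ρ x) ^ θ₂ := Real.rpow_le_rpow_of_exponent_le h1 hθ
    _ ≤ _ := Real.rpow_le_rpow (by linarith) (by linarith) (hθ₁.trans hθ)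

lemma IsAdmissible.psi_le_mul (hρ : IsAdmissible ρ) {θ c r r' : ℝ} (hθ : 0 ≤ θ) (hc : 1 ≤ c)
    (x : EuclideanSpace ℝ (Fin n)) (hr : 0 ≤ r) (hr0 : 0 ≤ r') (hr' : r' ≤ c * r) :
    psi ρ θ x r' ≤ ENNReal.ofReal (c ^ θ) * psi ρ θ x r := by
  have h1 := hρ.one_le_base x hr
  have h2 : r' / ρ x ≤ c * r / ρ x := by gcongr; exact (hρ.pos x).le
  have h3 := hρ.one_le_base x hr0
  have hc0 : 0 ≤ c := by linarith
  rw [psi, psi, ← ENNReal.ofReal_mul (by positivity), ← Real.mul_rpow hc0 (by linarith)]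
  apply ENNReal.ofReal_le_ofReal
  apply Real.rpow_le_rpow (by linarith) _ hθ
  rw [mul_div_assoc] at h2
  linarith

lemma IsAdmissible.psi_le_of_le (hρ : IsAdmissible ρ) {θ c r : ℝ} (hθ : 0 ≤ θ)
    (x : EuclideanSpace ℝ (Fin n)) (hr : 0 ≤ r) (hr' : r ≤ c * ρ x) :
    psi ρ θ x r ≤ ENNReal.ofReal ((1 + c) ^ θ) := by
  have h1 := hρ.one_le_base x hr
  have h2 : r / ρ x ≤ c := by rwa [div_le_iff₀ (hρ.pos x)]
  apply ENNReal.ofReal_le_ofReal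
  exact Real.rpow_le_rpow (by linarith) (by linarith) hθ

lemma lintegral_psiMeasure_eq (hρ : IsAdmissible ρ) (θ : ℝ)
    (x : EuclideanSpace ℝ (Fin n)) {r : ℝ} (hr : 0 ≤ r) (h : EuclideanSpace ℝ (Fin n) → ℝ≥0∞) :
    ∫⁻ y, h y ∂psiMeasure ρ θ x r = (psi ρ θ x r)⁻¹ * ∫⁻ y, h y ∂avgMeasure x r := by
  rw [lintegral_psiMeasure, lintegral_avgMeasure, ENNReal.mul_inv
    (.inl (hρ.psi_ne_zero θ x hr)) (.inl (psi_ne_top ρ θ x r)), mul_assoc]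

lemma lintegral_avg_eq_mul_psi (hρ : IsAdmissible ρ) (θ : ℝ)
    (x : EuclideanSpace ℝ (Fin n)) {r : ℝ} (hr : 0 ≤ r) (h : EuclideanSpace ℝ (Fin n) → ℝ≥0∞) :
    ∫⁻ y, h y ∂avgMeasure x r = psi ρ θ x r * ∫⁻ y, h y ∂psiMeasure ρ θ x r := by
  rw [lintegral_psiMeasure_eq hρ θ x hr, ← mul_assoc, ENNReal.mul_inv_cancel
    (hρ.psi_ne_zero θ x hr) (psi_ne_top ρ θ x r), one_mul]

lemma psiMeasure_le_avgMeasure (hρ : IsAdmissible ρ) {θ : ℝ} (hθ : 0 ≤ θ)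
    (x : EuclideanSpace ℝ (Fin n)) {r : ℝ} (hr : 0 ≤ r) (h : EuclideanSpace ℝ (Fin n) → ℝ≥0∞) :
    ∫⁻ y, h y ∂psiMeasure ρ θ x r ≤ ∫⁻ y, h y ∂avgMeasure x r := by
  rw [lintegral_avg_eq_mul_psi hρ θ x hr]
  exact le_mul_of_one_le_left' (hρ.one_le_psi hθ x hr)

/-! ### Comparison of the values of `ρ` -/

lemma IsAdmissible.exists_local_comparison (hρ : IsAdmissible ρ) :
    ∃ κ : ℝ, 0 < κ ∧ κ ≤ 1 ∧ ∀ x y, dist x y ≤ ρ x → κ * ρ x ≤ ρ y ∧ κ * ρ y ≤ ρ x := by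
  obtain ⟨l, C, hl, hC, h⟩ := hρ.slowly_varying
  have hl1 : (1:ℝ) ≤ 2 ^ l := Real.one_le_rpow (by norm_num) hl.le
  have hC0 : 0 < C := by linarith
  refine ⟨(C * 2 ^ l)⁻¹, by positivity, inv_le_one_of_one_le₀ (by nlinarith), fun x y hxy => ?_⟩
  have hx := hρ.pos x
  have hy := hρ.pos y
  obtain ⟨h1, h2⟩ := h x y
  set d := dist x y / ρ x with hd
  have hd0 : 0 ≤ d := div_nonneg dist_nonneg hx.le
  have hd1 : d ≤ 1 := by rwa [hd, div_le_one hx]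
  constructor
  · have h3 : (2:ℝ) ^ (-l) ≤ (1 + d) ^ (-l) :=
      Real.rpow_le_rpow_of_nonpos (by linarith) (by linarith) (by linarith)
    have h4 : (C * 2 ^ l)⁻¹ ≤ ρ y / ρ x := by
      refine le_trans (le_of_eq ?_) (le_trans
        (mul_le_mul_of_nonneg_left h3 (by positivity : 0 ≤ 1 / C)) h1)
      rw [Real.rpow_neg (by norm_num), mul_inv, one_div]
    rwa [le_div_iff₀ hx] at h4
  · have h3 : (1 + d) ^ (l / (l + 1)) ≤ 2 ^ l := by
      calc (1 + d) ^ (l / (l + 1)) ≤ 2 ^ (l / (l + 1)) :=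
            Real.rpow_le_rpow (by linarith) (by linarith) (by positivity)
        _ ≤ 2 ^ l := Real.rpow_le_rpow_of_exponent_le (by norm_num)
            (div_le_self hl.le (by linarith))
    have h4 : ρ y / ρ x ≤ C * 2 ^ l := h2.trans (by gcongr)
    rw [div_le_iff₀ hx] at h4
    rw [inv_mul_le_iff₀ (by positivity)]
    exact h4

lemma IsAdmissible.exists_growth (hρ : IsAdmissible ρ) :
    ∃ l C : ℝ, 0 < l ∧ 1 < C ∧ ∀ x y, ρ x ≤ C * (1 + dist x y / ρ x) ^ l * ρ y := by
  obtain ⟨l, C, hl, hC, h⟩ := hρ.slowly_varying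
  refine ⟨l, C, hl, hC, fun x y => ?_⟩
  have hx := hρ.pos x
  have h1 := (h x y).1
  have hd0 : 0 ≤ dist x y / ρ x := div_nonneg dist_nonneg hx.le
  have hpos : 0 < (1 + dist x y / ρ x) ^ l := Real.rpow_pos_of_pos (by linarith) _
  rw [Real.rpow_neg (by linarith), le_div_iff₀ hx, one_div, ← mul_inv,
    inv_mul_le_iff₀ (by positivity)] at h1
  exact h1

/-- The critical radius function may be replaced by a `1`-Lipschitz one. -/
lemma IsAdmissible.exists_lipschitz (hρ : IsAdmissible ρ) :
    ∃ (τ : EuclideanSpace ℝ (Fin n) → ℝ) (κ : ℝ), 0 < κ ∧ κ ≤ 1 ∧ (∀ x, τ x ≤ ρ x) ∧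
      (∀ x, κ * ρ x ≤ τ x) ∧ ∀ x y, τ x ≤ τ y + dist x y := by
  obtain ⟨κ, hκ, hκ1, h⟩ := hρ.exists_local_comparison
  have hb : ∀ x, BddBelow (Set.range fun y => ρ y + dist x y) := fun x =>
    ⟨0, by rintro _ ⟨y, rfl⟩; have := hρ.pos y; positivity⟩
  -- The infimal convolution of ρ with the distance. The lower bound κρ(x) comes from the comparison
  -- of values when y is within ρ(x) of x, and from the distance itself otherwise.
  refine ⟨fun x => ⨅ y, (ρ y + dist x y), κ, hκ, hκ1, fun x => ?_, fun x => ?_, fun x y => ?_⟩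
  · simpa using ciInf_le (hb x) x
  · refine le_ciInf fun y => ?_
    have hx := hρ.pos x
    have hy := hρ.pos y
    rcases le_or_gt (dist x y) (ρ x) with hd | hd
    · have := (h x y hd).1
      have := dist_nonneg (x := x) (y := y)
      linarith
    · nlinarith
  · rw [← sub_le_iff_le_add]
    refine le_ciInf fun v => ?_
    have h1 := ciInf_le (hb x) v
    have h2 := dist_triangle x y v
    linarith

end Geometry

/-! ### Integrals recovered from averages over balls of slowly varying radius. -/

section Averaging

variable {n : ℕ}

lemma measurableSet_dist_lt {η : EuclideanSpace ℝ (Fin n) → ℝ} (hη : Measurable η) :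
    MeasurableSet {q : EuclideanSpace ℝ (Fin n) × EuclideanSpace ℝ (Fin n) |
      dist q.2 q.1 < η q.1} :=
  measurableSet_lt (measurable_snd.dist measurable_fst) (hη.comp measurable_fst)

lemma measurable_of_half_lipschitz {η : EuclideanSpace ℝ (Fin n) → ℝ}
    (hlip : ∀ x y, η x ≤ η y + dist x y / 2) : Measurable η := by
  have : LipschitzWith 1 η := by
    refine LipschitzWith.of_dist_le_mul fun x y => ?_
    have h1 := hlip x y
    have h2 := hlip y x
    rw [dist_comm y x] at h2
    have h3 : 0 ≤ dist x y := dist_nonneg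
    rw [Real.dist_eq, abs_le, NNReal.coe_one]
    constructor <;> linarith
  exact this.continuous.measurable

/-- Tonelli: the point y is weighted by the total of 1/|B(z, η z)| over the centres z whose ball
contains it. The next two lemmas bound this weight from above and from below. -/
lemma lintegral_avg_ball_eq {η : EuclideanSpace ℝ (Fin n) → ℝ} (hη : Measurable η)
    {h : EuclideanSpace ℝ (Fin n) → ℝ≥0∞} (hh : Measurable h) (S : Set (EuclideanSpace ℝ (Fin n))) :
    ∫⁻ z in S, ∫⁻ y, h y ∂avgMeasure z (η z) =
      ∫⁻ y, h y * ∫⁻ z in S, {z | dist y z < η z}.indicator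
        (fun z => (volume (ball z (η z)))⁻¹) z := by
  have hv : Measurable fun z => (volume (ball z (η z)))⁻¹ := by
    refine Measurable.inv ?_
    have h1 := measurable_measure_prodMk_left (ν := (volume : Measure (EuclideanSpace ℝ (Fin n))))
      (measurableSet_dist_lt hη)
    exact h1
  have hJ : Measurable fun q : EuclideanSpace ℝ (Fin n) × EuclideanSpace ℝ (Fin n) =>
      {q : EuclideanSpace ℝ (Fin n) × EuclideanSpace ℝ (Fin n) | dist q.2 q.1 < η q.1}.indicator
        (fun q => (volume (ball q.1 (η q.1)))⁻¹) q :=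
    (hv.comp measurable_fst).indicator (measurableSet_dist_lt hη)
  calc ∫⁻ z in S, ∫⁻ y, h y ∂avgMeasure z (η z)
      = ∫⁻ z in S, ∫⁻ y, h y *
          {q : EuclideanSpace ℝ (Fin n) × EuclideanSpace ℝ (Fin n) | dist q.2 q.1 < η q.1}.indicator
          (fun q => (volume (ball q.1 (η q.1)))⁻¹) (z, y) := by
        congr 1 with z
        rw [lintegral_avgMeasure, ← lintegral_indicator measurableSet_ball,
          ← lintegral_const_mul _ (hh.indicator measurableSet_ball)]
        congr 1 with y
        by_cases hy : dist y z < η z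
        · rw [Set.indicator_of_mem (show y ∈ ball z (η z) from hy), Set.indicator_of_mem
            (show (z, y) ∈ {q : EuclideanSpace ℝ (Fin n) × EuclideanSpace ℝ (Fin n) |
              dist q.2 q.1 < η q.1} from hy), mul_comm]
        · rw [Set.indicator_of_notMem (show y ∉ ball z (η z) from hy), Set.indicator_of_notMem
            (show (z, y) ∉ {q : EuclideanSpace ℝ (Fin n) × EuclideanSpace ℝ (Fin n) |
              dist q.2 q.1 < η q.1} from hy), mul_zero, mul_zero]
    _ = ∫⁻ y, ∫⁻ z in S, h y *
          {q : EuclideanSpace ℝ (Fin n) × EuclideanSpace ℝ (Fin n) | dist q.2 q.1 < η q.1}.indicator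
          (fun q => (volume (ball q.1 (η q.1)))⁻¹) (z, y) := by
        rw [lintegral_lintegral_swap]
        exact ((hh.comp measurable_snd).mul hJ).aemeasurable
    _ = _ := by
        congr 1 with y
        exact lintegral_const_mul _ (hJ.comp measurable_prodMk_right)

/-- If y lies in B(z, η z), the slope 1/2 forces 2/3 η(y) ≤ η(z) ≤ 2 η(y). Hence z ranges over B(y,
2 η(y)) and the weight is at most (2/(2/3))^n = 3^n. This plays the role of bounded overlap. -/
lemma lintegral_avg_ball_le {η : EuclideanSpace ℝ (Fin n) → ℝ} (hpos : ∀ x, 0 < η x)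
    (hlip : ∀ x y, η x ≤ η y + dist x y / 2) {h : EuclideanSpace ℝ (Fin n) → ℝ≥0∞}
    (hh : Measurable h) :
    ∫⁻ z, ∫⁻ y, h y ∂avgMeasure z (η z) ≤ ENNReal.ofReal (3 ^ n) * ∫⁻ y, h y := by
  have hη := measurable_of_half_lipschitz hlip
  have := lintegral_avg_ball_eq hη hh Set.univ
  simp only [Measure.restrict_univ] at this
  rw [this, ← lintegral_const_mul _ hh]
  refine lintegral_mono fun y => ?_
  rw [mul_comm]
  gcongr
  calc ∫⁻ z, {z | dist y z < η z}.indicator (fun z => (volume (ball z (η z)))⁻¹) z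
      ≤ ∫⁻ z, (ball y (2 * η y)).indicator
        (fun _ => (volume (ball y (2 / 3 * η y)))⁻¹) z := by
        refine lintegral_mono fun z => ?_
        by_cases hz : dist y z < η z
        · have h1 := hlip z y
          have h2 := hlip y z
          rw [dist_comm z y] at h1
          rw [Set.indicator_of_mem (by exact hz), Set.indicator_of_mem
            (by rw [mem_ball, dist_comm]; linarith), ENNReal.inv_le_inv,
            Measure.addHaar_ball_center volume z, Measure.addHaar_ball_center volume y]
          exact measure_mono (ball_subset_ball (by linarith))
        · rw [Set.indicator_of_notMem (by exact hz)]; exact zero_le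
    _ = volume (ball y (2 * η y)) * (volume (ball y (2 / 3 * η y)))⁻¹ := by
        rw [lintegral_indicator_const measurableSet_ball, mul_comm]
    _ ≤ _ := by
        have h0 : 0 < 2 / 3 * η y := by have := hpos y; positivity
        rw [← div_eq_mul_inv, ENNReal.div_le_iff (volume_ball_ne_zero y h0)
          (volume_ball_ne_top y _)]
        exact volume_ball_le_mul y y (by norm_num) (by linarith)

/-- If the `η`-ball around each point of `U` is seen from inside `S`, the integral over `U` is
controlled by the averages over the `η`-balls with centre in `S`. -/
lemma setLIntegral_le_lintegral_avg_ball {η : EuclideanSpace ℝ (Fin n) → ℝ} (hpos : ∀ x, 0 < η x)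
    (hlip : ∀ x y, η x ≤ η y + dist x y / 2) {h : EuclideanSpace ℝ (Fin n) → ℝ≥0∞}
    (hh : Measurable h) {U S : Set (EuclideanSpace ℝ (Fin n))} (hS : MeasurableSet S)
    (hU : MeasurableSet U) (hUS : ∀ x ∈ U, ball x (η x) ⊆ S) :
    ∫⁻ y in U, h y ≤ ENNReal.ofReal (3 ^ n) * ∫⁻ z in S, ∫⁻ y, h y ∂avgMeasure z (η z) := by
  have hη := measurable_of_half_lipschitz hlip
  rw [lintegral_avg_ball_eq hη hh S, ← lintegral_indicator hU,
    ← lintegral_const_mul' _ _ ENNReal.ofReal_ne_top]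
  refine lintegral_mono fun y => ?_
  by_cases hy : y ∈ U
  · rw [Set.indicator_of_mem hy, mul_left_comm]
    refine le_mul_of_one_le_right' ?_
    have h0 : 0 < 1 / 2 * η y := by have := hpos y; positivity
    -- For z within η(y)/2 of y one has 3/4 η(y) ≤ η(z) ≤ 5/4 η(y), so the ball at z contains y.
    -- These centres alone give weight at least (2/5)^n, and 5/2 ≤ 3.
    calc (1 : ℝ≥0∞) = volume (ball y (1 / 2 * η y)) * (volume (ball y (1 / 2 * η y)))⁻¹ := by
          rw [ENNReal.mul_inv_cancel (volume_ball_ne_zero y h0) (volume_ball_ne_top y _)]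
      _ ≤ volume (ball y (1 / 2 * η y)) *
          (ENNReal.ofReal (3 ^ n) * (volume (ball y (5 / 4 * η y)))⁻¹) := by
          gcongr
          have h1 : 0 < 5 / 4 * η y := by have := hpos y; positivity
          rw [← div_eq_mul_inv, ENNReal.le_div_iff_mul_le (.inl (volume_ball_ne_zero y h1))
            (.inl (volume_ball_ne_top y _)), mul_comm, ← div_eq_mul_inv,
            ENNReal.div_le_iff (volume_ball_ne_zero y h0) (volume_ball_ne_top y _)]
          exact volume_ball_le_mul y y (by norm_num) (by linarith)
      _ = ENNReal.ofReal (3 ^ n) * ∫⁻ z, (ball y (1 / 2 * η y)).indicator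
            (fun _ => (volume (ball y (5 / 4 * η y)))⁻¹) z := by
          rw [lintegral_indicator_const measurableSet_ball]; ring
      _ ≤ ENNReal.ofReal (3 ^ n) * ∫⁻ z in S, {z | dist y z < η z}.indicator
            (fun z => (volume (ball z (η z)))⁻¹) z := by
          refine mul_le_mul_right ?_ _
          rw [← lintegral_indicator hS]
          refine lintegral_mono fun z => ?_
          by_cases hz : z ∈ ball y (1 / 2 * η y)
          · have hz' := hz
            rw [mem_ball, dist_comm] at hz'
            have h1 := hlip z y
            have h2 := hlip y z
            rw [dist_comm z y] at h1
            have hp := hpos y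
            have hzS : z ∈ S := hUS y hy (ball_subset_ball (by linarith) hz)
            rw [Set.indicator_of_mem hz, Set.indicator_of_mem hzS, Set.indicator_of_mem
              (show z ∈ {z | dist y z < η z} from by simp only [Set.mem_ofPred_eq]; linarith),
              ENNReal.inv_le_inv,
              Measure.addHaar_ball_center volume z, Measure.addHaar_ball_center volume y]
            exact measure_mono (ball_subset_ball (by linarith))
          · rw [Set.indicator_of_notMem hz]; exact zero_le
  · rw [Set.indicator_of_notMem hy]; exact zero_le

end Averaging

/-! ### Discrete layer-cake inequalities along geometric levels. -/

section GeometricSums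

/-- Sum of a geometric progression truncated at height `h`. -/
lemma sum_range_rpow_indicator_le {K : ℝ≥0∞} {s : ℝ} (hs : 0 < s) (hK : 2 ≤ K ^ s)
    (lam h : ℝ≥0∞) (I : ℕ) :
    ∑ j ∈ Finset.range I, (if lam * K ^ j < h then (lam * K ^ j) ^ s else 0) ≤ 2 * h ^ s := by
  have key : ∀ I : ℕ, ∑ j ∈ Finset.range I, (lam * K ^ j) ^ s ≤ (lam * K ^ I) ^ s := by
    intro I
    induction I with
    | zero => simp
    | succ I ih =>
      rw [Finset.sum_range_succ]
      calc _ ≤ (lam * K ^ I) ^ s + (lam * K ^ I) ^ s := by gcongr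
        _ = 2 * (lam * K ^ I) ^ s := by ring
        _ ≤ K ^ s * (lam * K ^ I) ^ s := by gcongr
        _ = _ := by rw [← ENNReal.mul_rpow_of_nonneg _ _ hs.le]; congr 1; ring
  induction I with
  | zero => simp
  | succ I ih =>
    rw [Finset.sum_range_succ]
    by_cases hI : lam * K ^ I < h
    · rw [if_pos hI]
      calc _ ≤ (lam * K ^ I) ^ s + (lam * K ^ I) ^ s := by
            gcongr
            refine le_trans (Finset.sum_le_sum fun j _ => ?_) (key I)
            split_ifs <;> simp
        _ = 2 * (lam * K ^ I) ^ s := by ring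
        _ ≤ _ := by gcongr
    · rw [if_neg hI, add_zero]; exact ih

lemma tsum_rpow_indicator_le {K : ℝ≥0∞} {s : ℝ} (hs : 0 < s) (hK : 2 ≤ K ^ s)
    (lam h : ℝ≥0∞) :
    ∑' j : ℕ, (if lam * K ^ j < h then (lam * K ^ j) ^ s else 0) ≤ 2 * h ^ s := by
  rw [ENNReal.tsum_eq_iSup_nat]
  exact iSup_le fun I => sum_range_rpow_indicator_le hs hK lam h I

/-- The last level below h already suffices, since the next one is at least h. For h = ∞ every term
is present and bounded below, so the sum diverges. -/
lemma rpow_le_tsum_indicator {K : ℝ≥0∞} {s : ℝ} (hs : 0 < s) (hK : 1 < K) (hK' : K ≠ ∞)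
    {lam h : ℝ≥0∞} (hlam : lam ≠ 0) (hlam' : lam ≠ ∞) (hlt : lam < h) :
    h ^ s ≤ ∑' j : ℕ, (if lam * K ^ j < h then (lam * K ^ (j + 1)) ^ s else 0) := by
  rcases eq_or_ne h ∞ with rfl | hh
  · have h1 : ∀ j : ℕ, lam * K ^ j < ∞ := fun j =>
      ENNReal.mul_lt_top hlam'.lt_top (ENNReal.pow_lt_top hK'.lt_top)
    have h2 : ∑' _ : ℕ, lam ^ s = ∞ := ENNReal.tsum_const_eq_top_of_ne_zero
      (by rw [ne_eq, ENNReal.rpow_eq_zero_iff]; rintro (⟨h, -⟩ | ⟨h, -⟩) <;> contradiction)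
    rw [ENNReal.top_rpow_of_pos hs]
    refine h2.ge.trans ?_
    refine ENNReal.tsum_le_tsum fun j => ?_
    rw [if_pos (h1 j)]
    gcongr
    exact le_mul_of_one_le_right' (one_le_pow₀ hK.le)
  · have hex : ∃ j : ℕ, h ≤ lam * K ^ j := by
      have ht : Filter.Tendsto (fun j : ℕ => lam * K ^ j) Filter.atTop (nhds (lam * ∞)) :=
        ENNReal.Tendsto.const_mul (ENNReal.tendsto_pow_atTop_nhds_top_iff.2 hK) (.inl (by simp))
      rw [ENNReal.mul_top hlam] at ht
      obtain ⟨j, hj⟩ := (ht.eventually (lt_mem_nhds hh.lt_top)).exists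
      exact ⟨j, hj.le⟩
    classical
    have hj := Nat.find_spec hex
    set j := Nat.find hex with hjdef
    have hj0 : j ≠ 0 := by
      intro h0
      rw [h0, pow_zero, mul_one] at hj
      exact absurd hlt (not_lt.2 hj)
    obtain ⟨i, hi⟩ := Nat.exists_eq_succ_of_ne_zero hj0
    have hlt' : lam * K ^ i < h := not_le.1 (Nat.find_min hex (by omega))
    refine le_trans ?_ (ENNReal.le_tsum i)
    rw [if_pos hlt']
    rw [hi] at hj
    gcongr

end GeometricSums

/-! ### The maximal function adapted to ρ: weak type and interpolation. -/

section Maximal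

variable {n : ℕ} {ρ : EuclideanSpace ℝ (Fin n) → ℝ}

/-- The uncentred maximal function with respect to the measures `psiMeasure ρ θ`. -/
def maximalRho (ρ : EuclideanSpace ℝ (Fin n) → ℝ) (θ : ℝ) (h : EuclideanSpace ℝ (Fin n) → ℝ≥0∞)
    (x : EuclideanSpace ℝ (Fin n)) : ℝ≥0∞ :=
  ⨆ (y : EuclideanSpace ℝ (Fin n)) (r : ℝ) (_ : x ∈ ball y r), ∫⁻ z, h z ∂psiMeasure ρ θ y r

lemma lt_maximalRho_iff {θ : ℝ} {h : EuclideanSpace ℝ (Fin n) → ℝ≥0∞}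
    {x : EuclideanSpace ℝ (Fin n)} {lam : ℝ≥0∞} :
    lam < maximalRho ρ θ h x ↔ ∃ y r, x ∈ ball y r ∧ lam < ∫⁻ z, h z ∂psiMeasure ρ θ y r := by
  simp only [maximalRho, lt_iSup_iff, exists_prop]

lemma lintegral_psiMeasure_le_maximalRho {θ : ℝ} (h : EuclideanSpace ℝ (Fin n) → ℝ≥0∞)
    {x y : EuclideanSpace ℝ (Fin n)} {r : ℝ} (hx : x ∈ ball y r) :
    ∫⁻ z, h z ∂psiMeasure ρ θ y r ≤ maximalRho ρ θ h x :=
  le_iSup_of_le y (le_iSup_of_le r (le_iSup_of_le hx le_rfl))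

/-- Being uncentred, the maximal function has open superlevel sets, whatever h is. -/
lemma measurable_maximalRho (ρ : EuclideanSpace ℝ (Fin n) → ℝ) (θ : ℝ)
    (h : EuclideanSpace ℝ (Fin n) → ℝ≥0∞) :
    Measurable (maximalRho ρ θ h) := by
  refine measurable_of_Ioi fun lam => ?_
  have : maximalRho ρ θ h ⁻¹' Set.Ioi lam = ⋃ (y : EuclideanSpace ℝ (Fin n)) (r : ℝ)
      (_ : lam < ∫⁻ z, h z ∂psiMeasure ρ θ y r), ball y r := by
    ext x
    simp only [Set.mem_preimage, Set.mem_Ioi, lt_maximalRho_iff, Set.mem_iUnion, exists_prop]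
    exact exists_congr fun _ => exists_congr fun _ => and_comm
  rw [this]
  exact (isOpen_iUnion fun y => isOpen_iUnion fun r => isOpen_iUnion fun _ =>
    isOpen_ball).measurableSet

lemma maximalRho_add_le {θ : ℝ} {f g h : EuclideanSpace ℝ (Fin n) → ℝ≥0∞} (hf : Measurable f)
    (hfgh : h ≤ᵐ[volume] fun x => f x + g x) (x : EuclideanSpace ℝ (Fin n)) :
    maximalRho ρ θ h x ≤ maximalRho ρ θ f x + maximalRho ρ θ g x := by
  refine iSup_le fun y => iSup_le fun r => iSup_le fun hx => ?_
  calc ∫⁻ z, h z ∂psiMeasure ρ θ y r ≤ ∫⁻ z, (f z + g z) ∂psiMeasure ρ θ y r := by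
        refine lintegral_mono_ae ?_
        refine (Measure.AbsolutelyContinuous.ae_le ?_) hfgh
        exact Measure.smul_absolutelyContinuous.trans
          Measure.restrict_le_self.absolutelyContinuous
    _ = ∫⁻ z, f z ∂psiMeasure ρ θ y r + ∫⁻ z, g z ∂psiMeasure ρ θ y r := lintegral_add_left hf _
    _ ≤ _ := by gcongr <;> exact lintegral_psiMeasure_le_maximalRho _ hx

/-- The condition on a measure `μ` which gives the weak type `(u, u)` of the maximal function. -/
def WeakTypeCondition (ρ : EuclideanSpace ℝ (Fin n) → ℝ) (θ u : ℝ)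
    (μ : Measure (EuclideanSpace ℝ (Fin n))) (C : ℝ≥0∞) : Prop :=
  ∀ (y : EuclideanSpace ℝ (Fin n)) (r : ℝ), 0 < r → ∀ h : EuclideanSpace ℝ (Fin n) → ℝ≥0∞,
    Measurable h →
    (∫⁻ z, h z ∂psiMeasure ρ θ y r) ^ u * μ (ball y (4 * r)) ≤ C * ∫⁻ z in ball y r, h z ^ u ∂μ

/-- Vitali selection: the condition is applied to disjoint balls whose fourfold dilates cover the
level set, which is why it involves the measure of the dilate. -/
lemma WeakTypeCondition.weak_type {θ u : ℝ} (hu : 0 < u)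
    {μ : Measure (EuclideanSpace ℝ (Fin n))} {C : ℝ≥0∞} (hW : WeakTypeCondition ρ θ u μ C)
    {h : EuclideanSpace ℝ (Fin n) → ℝ≥0∞} (hh : Measurable h) (lam : ℝ≥0∞) :
    lam ^ u * μ {x | lam < maximalRho ρ θ h x} ≤ C * ∫⁻ z, h z ^ u ∂μ := by
  -- Vitali's lemma needs bounded radii. The level set is exhausted by the sets A R seen by balls of
  -- radius at most R, and R is sent to infinity at the end.
  let A : ℕ → Set (EuclideanSpace ℝ (Fin n)) := fun R => {x | ∃ (y : EuclideanSpace ℝ (Fin n))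
    (r : ℝ), r ≤ R ∧ x ∈ ball y r ∧
    lam < ∫⁻ z, h z ∂psiMeasure ρ θ y r}
  have hA : {x | lam < maximalRho ρ θ h x} = ⋃ R, A R := by
    ext x
    simp only [Set.mem_ofPred_eq, lt_maximalRho_iff, Set.mem_iUnion, A]
    constructor
    · rintro ⟨y, r, h1, h2⟩
      obtain ⟨R, hR⟩ := exists_nat_ge r
      exact ⟨R, y, r, hR, h1, h2⟩
    · rintro ⟨R, y, r, -, h1, h2⟩
      exact ⟨y, r, h1, h2⟩
  have hmono : Monotone A := by
    rintro R S hRS x ⟨y, r, h0, h1, h2⟩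
    exact ⟨y, r, h0.trans (by exact_mod_cast hRS), h1, h2⟩
  rw [hA, hmono.measure_iUnion, ENNReal.mul_iSup]
  refine iSup_le fun R => ?_
  let t : Set (EuclideanSpace ℝ (Fin n) × ℝ) := {q | 0 < q.2 ∧ q.2 ≤ R ∧
    lam < ∫⁻ z, h z ∂psiMeasure ρ θ q.1 q.2}
  obtain ⟨v, hvt, hdisj, hcov⟩ := Vitali.exists_disjoint_subfamily_covering_enlargement_ball t
    Prod.fst Prod.snd R (fun a ha => ha.2.1) 4 (by norm_num)
  have hcount : v.Countable := hdisj.countable_of_isOpen (fun _ _ => isOpen_ball)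
    fun a ha => ⟨a.1, mem_ball_self (hvt ha).1⟩
  have hsub : A R ⊆ ⋃ q ∈ v, ball q.1 (4 * q.2) := by
    rintro x ⟨y, r, h0, h1, h2⟩
    obtain ⟨b, hb, hsub⟩ := hcov (y, r) ⟨pos_of_mem_ball h1, h0, h2⟩
    exact Set.mem_biUnion hb (hsub h1)
  calc lam ^ u * μ (A R) ≤ lam ^ u * ∑' q : v, μ (ball q.1.1 (4 * q.1.2)) := by
        gcongr
        exact (measure_mono hsub).trans (measure_biUnion_le μ hcount _)
    _ = ∑' q : v, lam ^ u * μ (ball q.1.1 (4 * q.1.2)) := ENNReal.tsum_mul_left.symm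
    _ ≤ ∑' q : v, C * ∫⁻ z in ball q.1.1 q.1.2, h z ^ u ∂μ := by
        refine ENNReal.tsum_le_tsum fun q => le_trans ?_ (hW _ _ (hvt q.2).1 h hh)
        gcongr
        exact (hvt q.2).2.2.le
    _ = C * ∫⁻ z in ⋃ q ∈ v, ball q.1 q.2, h z ^ u ∂μ := by
        rw [ENNReal.tsum_mul_left, lintegral_biUnion hcount (fun _ _ => measurableSet_ball) hdisj]
    _ ≤ _ := by gcongr; exact Measure.restrict_le_self

lemma IsAdmissible.maximalRho_const_le (hρ : IsAdmissible ρ) {θ : ℝ} (hθ : 0 ≤ θ) (c : ℝ≥0∞)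
    (x : EuclideanSpace ℝ (Fin n)) : maximalRho ρ θ (fun _ => c) x ≤ c := by
  refine iSup_le fun y => iSup_le fun r => iSup_le fun hx => ?_
  have hr := pos_of_mem_ball hx
  refine (psiMeasure_le_avgMeasure hρ hθ y hr.le _).trans ?_
  have := isProbabilityMeasure_avgMeasure y hr
  simp

/-- Marcinkiewicz interpolation between the weak type `(u, u)` and `L^∞`. -/
lemma WeakTypeCondition.strong_type (hρ : IsAdmissible ρ) {θ u v : ℝ} (hθ : 0 ≤ θ) (hu : 0 < u)
    (huv : u < v)
    {μ : Measure (EuclideanSpace ℝ (Fin n))} {C : ℝ≥0∞} (hC : C ≠ ∞)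
    (hW : WeakTypeCondition ρ θ u μ C) :
    ∃ C' : ℝ≥0∞, C' ≠ ∞ ∧ ∀ h : EuclideanSpace ℝ (Fin n) → ℝ≥0∞, Measurable h →
      ∫⁻ x, maximalRho ρ θ h x ^ v ∂μ ≤ C' * ∫⁻ x, h x ^ v ∂μ := by
  have hs : 0 < v - u := sub_pos.2 huv
  have hv : 0 < v := hu.trans huv
  -- the ratio of the levels
  set K : ℝ≥0∞ := 2 ^ (max 1 (v - u)⁻¹) with hKdef
  have hKtop : K ≠ ∞ := by simp [hKdef]
  -- K ≥ 2 lets h be cut at height lam/K with room to spare in the subadditivity of the maximal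
  -- function. K^(v-u) ≥ 2 makes the level sums geometric.
  have hK2 : 2 ≤ K := by
    calc (2 : ℝ≥0∞) = 2 ^ (1:ℝ) := by simp
      _ ≤ K := ENNReal.rpow_le_rpow_of_exponent_le (by norm_num) (le_max_left _ _)
  have hKs : 2 ≤ K ^ (v - u) := by
    rw [hKdef, ← ENNReal.rpow_mul]
    calc (2 : ℝ≥0∞) = 2 ^ (1:ℝ) := by simp
      _ ≤ _ := ENNReal.rpow_le_rpow_of_exponent_le (by norm_num) ?_
    calc (1:ℝ) = (v - u)⁻¹ * (v - u) := by field_simp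
      _ ≤ _ := by gcongr; exact le_max_right _ _
  have hK1 : 1 < K := lt_of_lt_of_le (by norm_num) hK2
  have hK0 : K ≠ 0 := (zero_lt_one.trans hK1).ne'
  refine ⟨K ^ v * C * K ^ v * 2, by
    refine ENNReal.mul_ne_top (ENNReal.mul_ne_top (ENNReal.mul_ne_top ?_ hC) ?_) (by simp) <;>
    exact ENNReal.rpow_ne_top_of_nonneg hv.le hKtop, fun h hh => ?_⟩
  have hM := measurable_maximalRho ρ θ h
  -- the estimate at one level
  have hlevel : ∀ lam : ℝ≥0∞, lam ≠ ∞ → μ {x | lam < maximalRho ρ θ h x} * lam ^ u ≤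
      C * K ^ u * ∫⁻ x in {x | lam * K⁻¹ < h x}, h x ^ u ∂μ := by
    intro lam hlam
    have hS : MeasurableSet {x | lam * K⁻¹ < h x} := measurableSet_lt measurable_const hh
    have hsub : {x | lam < maximalRho ρ θ h x} ⊆
        {x | lam * K⁻¹ < maximalRho ρ θ ({x | lam * K⁻¹ < h x}.indicator h) x} := by
      intro x hx
      -- The part of h below lam/K has maximal function at most lam/K ≤ lam/2, so the part above
      -- must carry the level set.
      have h1 : maximalRho ρ θ h x ≤ maximalRho ρ θ ({x | lam * K⁻¹ < h x}.indicator h) x +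
          maximalRho ρ θ (fun _ => lam * K⁻¹) x := by
        refine maximalRho_add_le (hh.indicator hS) (Filter.Eventually.of_forall fun z => ?_) x
        show h z ≤ {x | lam * K⁻¹ < h x}.indicator h z + lam * K⁻¹
        by_cases hz : lam * K⁻¹ < h z
        · rw [Set.indicator_of_mem (by exact hz)]; exact le_self_add
        · rw [Set.indicator_of_notMem (by exact hz), zero_add]; exact not_lt.1 hz
      by_contra hcon
      simp only [Set.mem_ofPred_eq, not_lt] at hcon hx
      have h2 : maximalRho ρ θ h x ≤ lam * K⁻¹ + lam * K⁻¹ :=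
        h1.trans (add_le_add hcon (hρ.maximalRho_const_le hθ _ x))
      have h3 : lam * K⁻¹ + lam * K⁻¹ ≤ lam := by
        calc lam * K⁻¹ + lam * K⁻¹ = lam * (2 * K⁻¹) := by ring
          _ ≤ lam * (K * K⁻¹) := by gcongr
          _ = lam := by rw [ENNReal.mul_inv_cancel hK0 hKtop, mul_one]
      exact absurd (hx.trans_le (h2.trans h3)) (lt_irrefl _)
    have hweak := hW.weak_type hu (hh.indicator hS) (lam * K⁻¹)
    have h4 : ∫⁻ z, ({x | lam * K⁻¹ < h x}.indicator h z) ^ u ∂μ =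
        ∫⁻ x in {x | lam * K⁻¹ < h x}, h x ^ u ∂μ := by
      rw [← lintegral_indicator hS]
      congr 1 with z
      by_cases hz : z ∈ {x | lam * K⁻¹ < h x}
      · rw [Set.indicator_of_mem hz, Set.indicator_of_mem hz]
      · rw [Set.indicator_of_notMem hz, Set.indicator_of_notMem hz, ENNReal.zero_rpow_of_pos hu]
    rw [h4] at hweak
    calc μ {x | lam < maximalRho ρ θ h x} * lam ^ u
        = K ^ u * ((lam * K⁻¹) ^ u * μ {x | lam < maximalRho ρ θ h x}) := by
          have : lam ^ u = K ^ u * (lam * K⁻¹) ^ u := by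
            rw [← ENNReal.mul_rpow_of_nonneg _ _ hu.le, mul_left_comm,
              ENNReal.mul_inv_cancel hK0 hKtop, mul_one]
          rw [this]; ring
      _ ≤ K ^ u * (C * ∫⁻ x in {x | lam * K⁻¹ < h x}, h x ^ u ∂μ) := by
          refine mul_le_mul_right (le_trans ?_ hweak) _
          exact mul_le_mul_right (measure_mono hsub) _
      _ = _ := by ring
  -- truncation from below
  have htrunc : ∀ lam : ℝ≥0∞, lam ≠ 0 → lam ≠ ∞ →
      ∫⁻ x in {x | lam < maximalRho ρ θ h x}, maximalRho ρ θ h x ^ v ∂μ ≤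
        K ^ v * C * K ^ v * 2 * ∫⁻ x, h x ^ v ∂μ := by
    intro lam hlam hlam'
    have hlj : ∀ j : ℕ, lam * K ^ j ≠ ∞ := fun j =>
      ENNReal.mul_ne_top hlam' (ENNReal.pow_ne_top hKtop)
    have hlj0 : ∀ j : ℕ, lam * K ^ j ≠ 0 := fun j => mul_ne_zero hlam (pow_ne_zero _ hK0)
    calc ∫⁻ x in {x | lam < maximalRho ρ θ h x}, maximalRho ρ θ h x ^ v ∂μ
        ≤ ∫⁻ x in {x | lam < maximalRho ρ θ h x}, ∑' j : ℕ,
          (if lam * K ^ j < maximalRho ρ θ h x then (lam * K ^ (j + 1)) ^ v else 0) ∂μ := by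
          refine setLIntegral_mono' (measurableSet_lt measurable_const hM) fun x hx => ?_
          exact rpow_le_tsum_indicator hv hK1 hKtop hlam hlam' hx
      _ ≤ ∫⁻ x, ∑' j : ℕ,
          (if lam * K ^ j < maximalRho ρ θ h x then (lam * K ^ (j + 1)) ^ v else 0) ∂μ :=
          setLIntegral_le_lintegral _ _
      _ = ∑' j : ℕ, (lam * K ^ (j + 1)) ^ v * μ {x | lam * K ^ j < maximalRho ρ θ h x} := by
          rw [lintegral_tsum fun j => (Measurable.ite (measurableSet_lt measurable_const hM)
            measurable_const measurable_const).aemeasurable]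
          congr 1 with j
          rw [← lintegral_indicator_const (measurableSet_lt measurable_const hM)]
          congr 1 with x
          simp only [Set.indicator_apply, Set.mem_ofPred_eq]
      _ ≤ ∑' j : ℕ, K ^ v * (C * K ^ v) * ∫⁻ x,
          (if lam * K⁻¹ * K ^ j < h x then (lam * K⁻¹ * K ^ j) ^ (v - u) * h x ^ u else 0) ∂μ := by
          refine ENNReal.tsum_le_tsum fun j => ?_
          have e1 : (lam * K ^ (j + 1)) ^ v =
              K ^ v * ((lam * K ^ j) ^ (v - u) * (lam * K ^ j) ^ u) := by
            rw [← ENNReal.rpow_add _ _ (hlj0 j) (hlj j), sub_add_cancel,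
              ← ENNReal.mul_rpow_of_nonneg _ _ hv.le]
            congr 1; ring
          have e2 : lam * K ^ j * K⁻¹ = lam * K⁻¹ * K ^ j := by ring
          have e3 : (lam * K ^ j) ^ (v - u) = K ^ (v - u) * (lam * K⁻¹ * K ^ j) ^ (v - u) := by
            rw [← ENNReal.mul_rpow_of_nonneg _ _ hs.le]
            congr 1
            calc lam * K ^ j = (K * K⁻¹) * (lam * K ^ j) := by
                  rw [ENNReal.mul_inv_cancel hK0 hKtop, one_mul]
              _ = _ := by ring
          have e4 : K ^ v = K ^ (v - u) * K ^ u := by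
            rw [← ENNReal.rpow_add _ _ hK0 hKtop, sub_add_cancel]
          have hl := hlevel _ (hlj j)
          rw [e2] at hl
          have hSj : MeasurableSet {x | lam * K⁻¹ * K ^ j < h x} :=
            measurableSet_lt measurable_const hh
          have e5 : ∫⁻ x, (if lam * K⁻¹ * K ^ j < h x then
              (lam * K⁻¹ * K ^ j) ^ (v - u) * h x ^ u else 0) ∂μ =
              (lam * K⁻¹ * K ^ j) ^ (v - u) * ∫⁻ x in {x | lam * K⁻¹ * K ^ j < h x}, h x ^ u ∂μ := by
            rw [← lintegral_const_mul _ (hh.pow_const u), ← lintegral_indicator hSj]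
            congr 1 with x
            simp only [Set.indicator_apply, Set.mem_ofPred_eq]
          rw [e1, e5]
          calc _ = K ^ v * (lam * K ^ j) ^ (v - u) *
                (μ {x | lam * K ^ j < maximalRho ρ θ h x} * (lam * K ^ j) ^ u) := by ring
            _ ≤ K ^ v * (lam * K ^ j) ^ (v - u) *
                (C * K ^ u * ∫⁻ x in {x | lam * K⁻¹ * K ^ j < h x}, h x ^ u ∂μ) := by gcongr
            _ = _ := by rw [e3]; nth_rewrite 3 [e4]; ring
      _ = K ^ v * (C * K ^ v) * ∫⁻ x, ∑' j : ℕ,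
          (if lam * K⁻¹ * K ^ j < h x then (lam * K⁻¹ * K ^ j) ^ (v - u) * h x ^ u else 0) ∂μ := by
          rw [ENNReal.tsum_mul_left, lintegral_tsum fun j =>
            (Measurable.ite (measurableSet_lt measurable_const hh)
            ((hh.pow_const u).const_mul _) measurable_const).aemeasurable]
      _ ≤ K ^ v * (C * K ^ v) * ∫⁻ x, 2 * h x ^ v ∂μ := by
          gcongr with x
          have e6 : ∀ j : ℕ, (if lam * K⁻¹ * K ^ j < h x then
              (lam * K⁻¹ * K ^ j) ^ (v - u) * h x ^ u else 0) =
              (if lam * K⁻¹ * K ^ j < h x then (lam * K⁻¹ * K ^ j) ^ (v - u) else 0) * h x ^ u :=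
            fun j => by split_ifs <;> simp
          simp_rw [e6]
          rw [ENNReal.tsum_mul_right]
          calc _ ≤ 2 * h x ^ (v - u) * h x ^ u := by
                gcongr; exact tsum_rpow_indicator_le hs hKs _ _
            _ = 2 * h x ^ v := by
                rw [mul_assoc, ← ENNReal.rpow_add_of_nonneg _ _ hs.le hu.le, sub_add_cancel]
      _ = _ := by rw [lintegral_const_mul _ (hh.pow_const v)]; ring
  -- let the truncation tend to zero
  have hsup : ∫⁻ x, maximalRho ρ θ h x ^ v ∂μ = ⨆ i : ℕ,
      ∫⁻ x in {x | (2⁻¹ : ℝ≥0∞) ^ i < maximalRho ρ θ h x}, maximalRho ρ θ h x ^ v ∂μ := by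
    simp_rw [← lintegral_indicator (measurableSet_lt (measurable_const (a := _)) hM)]
    rw [← lintegral_iSup]
    · congr 1 with x
      refine le_antisymm ?_ (iSup_le fun i => Set.indicator_le_self _ _ _)
      rcases eq_or_ne (maximalRho ρ θ h x) 0 with h0 | h0
      · rw [h0, ENNReal.zero_rpow_of_pos hv]; exact zero_le
      · obtain ⟨i, hi⟩ := ENNReal.exists_inv_two_pow_lt h0
        refine le_iSup_of_le i ?_
        rw [Set.indicator_of_mem (by exact hi)]
    · exact fun i => (hM.pow_const v).indicator (measurableSet_lt measurable_const hM)
    · intro i j hij x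
      refine Set.indicator_le_indicator_of_subset (fun y hy => ?_) (fun _ => zero_le) x
      have hy' : (2⁻¹ : ℝ≥0∞) ^ i < maximalRho ρ θ h y := hy
      refine lt_of_le_of_lt ?_ hy'
      exact pow_le_pow_of_le_one zero_le (by simp) hij
  rw [hsup]
  exact iSup_le fun i => htrunc _ (by simp) (by simp)

/-- The unweighted weak type `(1, 1)` condition. -/
lemma weakTypeCondition_volume (hρ : IsAdmissible ρ) {θ : ℝ} (hθ : 0 ≤ θ) :
    WeakTypeCondition ρ θ 1 volume (ENNReal.ofReal (4 ^ n)) := by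
  intro y r hr h hh
  simp only [ENNReal.rpow_one]
  rw [setLIntegral_ball_eq_mul_avg y hr]
  calc _ ≤ (∫⁻ z, h z ∂avgMeasure y r) * (ENNReal.ofReal (4 ^ n) * volume (ball y r)) := by
        exact mul_le_mul' (psiMeasure_le_avgMeasure hρ hθ y hr.le h)
          (volume_ball_le_mul y y (by norm_num) le_rfl)
    _ = _ := by ring

end Maximal

/-! ### Dyadic cells and stopping sets for averages over balls. -/

section Cells

variable {n : ℕ}

/-- The index of the dyadic cell of generation `k` containing `x`, in the grid generated by the cube
with centre `z` and side length `ℓ`. -/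
def gridIndex (z : EuclideanSpace ℝ (Fin n)) (ℓ : ℝ) (k : ℕ) (x : EuclideanSpace ℝ (Fin n)) :
    Fin n → ℤ :=
  fun i => ⌊(2 : ℝ) ^ k * ((x i - z i) / ℓ + 1 / 2)⌋

/-- The dyadic cell of generation `k` containing `x`. -/
def cell (z : EuclideanSpace ℝ (Fin n)) (ℓ : ℝ) (k : ℕ) (x : EuclideanSpace ℝ (Fin n)) :
    Set (EuclideanSpace ℝ (Fin n)) :=
  {y | gridIndex z ℓ k y = gridIndex z ℓ k x}

variable {z : EuclideanSpace ℝ (Fin n)} {ℓ : ℝ} {k : ℕ} {x y : EuclideanSpace ℝ (Fin n)}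

lemma mem_cell : y ∈ cell z ℓ k x ↔ gridIndex z ℓ k y = gridIndex z ℓ k x := Iff.rfl

lemma mem_cell_self : x ∈ cell z ℓ k x := rfl

lemma cell_eq_of_mem (h : y ∈ cell z ℓ k x) : cell z ℓ k y = cell z ℓ k x := by
  rw [mem_cell] at h
  ext v
  rw [mem_cell, mem_cell, h]

lemma gridIndex_eq_div (k : ℕ) (x : EuclideanSpace ℝ (Fin n)) (i : Fin n) :
    gridIndex z ℓ k x i = gridIndex z ℓ (k + 1) x i / 2 := by
  have := Int.floor_div_natCast ((2 : ℝ) ^ (k + 1) * ((x i - z i) / ℓ + 1 / 2)) 2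
  simp only [gridIndex]
  rw [Nat.cast_ofNat, Nat.cast_ofNat] at this
  rw [← this]
  congr 1
  ring

lemma cell_succ_subset : cell z ℓ (k + 1) x ⊆ cell z ℓ k x := by
  intro y hy
  rw [mem_cell] at hy ⊢
  funext i
  rw [gridIndex_eq_div k y, gridIndex_eq_div k x, hy]

lemma cell_anti {m : ℕ} (h : k ≤ m) : cell z ℓ m x ⊆ cell z ℓ k x := by
  induction m, h using Nat.le_induction with
  | base => exact subset_rfl
  | succ m _ ih => exact cell_succ_subset.trans ih

lemma measurable_gridIndex : Measurable (gridIndex z ℓ k) := by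
  refine measurable_pi_lambda _ fun i => ?_
  refine Int.measurable_floor.comp ?_
  fun_prop

lemma measurableSet_cell : MeasurableSet (cell z ℓ k x) :=
  measurable_gridIndex (measurableSet_singleton _)

lemma cell_eq_preimage (hℓ : 0 < ℓ) : cell z ℓ k x = (fun y : EuclideanSpace ℝ (Fin n) => y.ofLp) ⁻¹'
    Set.univ.pi fun i => Set.Ico (z i + ℓ * (gridIndex z ℓ k x i / 2 ^ k - 1 / 2))
      (z i + ℓ * (gridIndex z ℓ k x i / 2 ^ k - 1 / 2) + ℓ / 2 ^ k) := by
  ext y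
  rw [mem_cell, funext_iff, Set.mem_preimage, Set.mem_univ_pi]
  refine forall_congr' fun i => ?_
  rw [Set.mem_Ico]
  set m := gridIndex z ℓ k x i
  rw [gridIndex, Int.floor_eq_iff]
  have h2 : (0 : ℝ) < 2 ^ k := by positivity
  have e : (2 : ℝ) ^ k * ((y i - z i) / ℓ + 1 / 2) =
      m + (y i - (z i + ℓ * (m / 2 ^ k - 1 / 2))) * (2 ^ k / ℓ) := by
    field_simp; ring
  have e2 : (0 : ℝ) < 2 ^ k / ℓ := by positivity
  rw [e]
  refine and_congr ?_ ?_
  · rw [le_add_iff_nonneg_right, mul_nonneg_iff_of_pos_right e2, sub_nonneg]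
  · rw [add_lt_add_iff_left, ← lt_div_iff₀ e2, sub_lt_iff_lt_add', one_div_div]

lemma volume_cell (hℓ : 0 < ℓ) : volume (cell z ℓ k x) = ENNReal.ofReal ((ℓ / 2 ^ k) ^ n) := by
  rw [cell_eq_preimage hℓ, (PiLp.volume_preserving_ofLp (Fin n)).measure_preimage
    (MeasurableSet.univ_pi fun i => measurableSet_Ico).nullMeasurableSet, Real.volume_pi_Ico]
  simp only [add_sub_cancel_left, Finset.prod_const, Finset.card_univ, Fintype.card_fin]
  rw [ENNReal.ofReal_pow (by positivity)]

/-- The factor n + 1 replaces √n as a bound of the diameter, and keeps the inequality strict. -/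
lemma dist_lt_of_mem_cell (hℓ : 0 < ℓ) (h : y ∈ cell z ℓ k x) : dist y x < (n + 1) * ℓ / 2 ^ k := by
  have h2 : (0 : ℝ) < ℓ / 2 ^ k := by positivity
  have hx := mem_cell_self (z := z) (ℓ := ℓ) (k := k) (x := x)
  rw [cell_eq_preimage hℓ, Set.mem_preimage, Set.mem_univ_pi] at h hx
  have hi : ∀ i, dist (y i) (x i) ^ 2 ≤ (ℓ / 2 ^ k) ^ 2 := by
    intro i
    have h3 := h i
    have h4 := hx i
    rw [Set.mem_Ico] at h3 h4
    refine pow_le_pow_left₀ dist_nonneg ?_ 2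
    rw [Real.dist_eq, abs_le]
    constructor <;> linarith
  rw [EuclideanSpace.dist_eq, mul_div_assoc, Real.sqrt_lt' (by positivity)]
  calc ∑ i, dist (y i) (x i) ^ 2 ≤ ∑ _i : Fin n, (ℓ / 2 ^ k) ^ 2 := Finset.sum_le_sum fun i _ => hi i
    _ = n * (ℓ / 2 ^ k) ^ 2 := by simp
    _ < ((n + 1) * (ℓ / 2 ^ k)) ^ 2 := by
      rw [mul_pow]
      have h5 : (n : ℝ) < (n + 1) ^ 2 := by
        have : (0 : ℝ) ≤ n := n.cast_nonneg
        nlinarith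
      gcongr

lemma cell_subset_ball (hℓ : 0 < ℓ) : cell z ℓ k x ⊆ ball x ((n + 1) * ℓ / 2 ^ k) :=
  fun _ h => dist_lt_of_mem_cell hℓ h

lemma ball_subset_cell_zero (hℓ : 0 < ℓ) : ball z (ℓ / 2) ⊆ cell z ℓ 0 z := by
  intro y hy
  have hz : gridIndex z ℓ 0 z = 0 := by
    funext i
    simp only [gridIndex, pow_zero, sub_self, zero_div, zero_add, one_mul, Pi.zero_apply,
      Int.floor_eq_iff]
    norm_num
  rw [mem_cell, hz]
  funext i
  simp only [gridIndex, pow_zero, one_mul, Pi.zero_apply, Int.floor_eq_iff]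
  have h1 : |y i - z i| < ℓ / 2 := by
    refine lt_of_le_of_lt ?_ (mem_ball.1 hy)
    rw [EuclideanSpace.dist_eq, ← Real.sqrt_sq_eq_abs]
    refine Real.sqrt_le_sqrt ?_
    refine le_trans (le_of_eq ?_) (Finset.single_le_sum (f := fun i => dist (y i) (z i) ^ 2)
      (fun _ _ => sq_nonneg _) (Finset.mem_univ i))
    simp [Real.dist_eq]
  rw [abs_lt] at h1
  have e : (y i - z i) / ℓ + 1 / 2 = (y i - z i + ℓ / 2) / ℓ := by field_simp
  rw [e]
  constructor
  · simp only [Int.cast_zero]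
    exact div_nonneg (by linarith) hℓ.le
  · rw [div_lt_iff₀ hℓ]
    simp only [Int.cast_zero, zero_add, one_mul]
    linarith

lemma cell_zero_subset_ball (hℓ : 0 < ℓ) : cell z ℓ 0 z ⊆ ball z ((n + 1) * ℓ) := by
  have := cell_subset_ball (z := z) (k := 0) (x := z) hℓ
  simpa using this

/-! ### Stopping times -/

/-- Some ball of radius less than `8 (n + 1) ℓ` containing the cell has an average of `F` larger than
`lam`. -/
def Stops (F : EuclideanSpace ℝ (Fin n) → ℝ≥0∞) (z : EuclideanSpace ℝ (Fin n)) (ℓ : ℝ) (lam : ℝ≥0∞)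
    (k : ℕ) (x : EuclideanSpace ℝ (Fin n)) : Prop :=
  ∃ (y : EuclideanSpace ℝ (Fin n)) (r : ℝ), r < 8 * ((n + 1) * ℓ) ∧ cell z ℓ k x ⊆ ball y r ∧
    lam < ∫⁻ v, F v ∂avgMeasure y r

/-- The union of the subcells of the initial cell at which `Stops` holds. -/
def stopSet (F : EuclideanSpace ℝ (Fin n) → ℝ≥0∞) (z : EuclideanSpace ℝ (Fin n)) (ℓ : ℝ)
    (lam : ℝ≥0∞) : Set (EuclideanSpace ℝ (Fin n)) :=
  {x | x ∈ cell z ℓ 0 z ∧ ∃ k, Stops F z ℓ lam k x}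

variable {F : EuclideanSpace ℝ (Fin n) → ℝ≥0∞} {lam : ℝ≥0∞}

lemma Stops.mono {m : ℕ} (h : Stops F z ℓ lam k x) (hkm : k ≤ m) : Stops F z ℓ lam m x := by
  obtain ⟨y, r, h1, h2, h3⟩ := h
  exact ⟨y, r, h1, (cell_anti hkm).trans h2, h3⟩

lemma Stops.congr (h : Stops F z ℓ lam k x) (hy : y ∈ cell z ℓ k x) : Stops F z ℓ lam k y := by
  obtain ⟨v, r, h1, h2, h3⟩ := h
  exact ⟨v, r, h1, by rwa [cell_eq_of_mem hy], h3⟩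

lemma stops_congr (hy : y ∈ cell z ℓ k x) : Stops F z ℓ lam k y ↔ Stops F z ℓ lam k x :=
  ⟨fun h => h.congr (mem_cell.1 hy).symm, fun h => h.congr hy⟩

lemma stopSet_subset : stopSet F z ℓ lam ⊆ cell z ℓ 0 z := fun _ hx => hx.1

lemma stopSet_anti {lam' : ℝ≥0∞} (h : lam ≤ lam') : stopSet F z ℓ lam' ⊆ stopSet F z ℓ lam := by
  rintro x ⟨hx, k, y, r, h1, h2, h3⟩
  exact ⟨hx, k, y, r, h1, h2, h.trans_lt h3⟩

/-- Because the initial cell does not stop and stopping passes to subcells, the stopping set is the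
countable disjoint union of the cells that stop while their parent does not. Any comparison of
measures may therefore be checked on such cells. -/
lemma measurableSet_stopSet_and_measure_le (h0 : ¬ Stops F z ℓ lam 0 z) :
    MeasurableSet (stopSet F z ℓ lam) ∧
    ∀ ν₁ ν₂ : Measure (EuclideanSpace ℝ (Fin n)),
      (∀ k x, x ∈ cell z ℓ 0 z → ¬ Stops F z ℓ lam k x → Stops F z ℓ lam (k + 1) x →
        ν₁ (cell z ℓ (k + 1) x) ≤ ν₂ (cell z ℓ (k + 1) x)) →
      ν₁ (stopSet F z ℓ lam) ≤ ν₂ (stopSet F z ℓ lam) := by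
  classical
  let S : ℕ × (Fin n → ℤ) → Set (EuclideanSpace ℝ (Fin n)) := fun q =>
    {x | x ∈ cell z ℓ 0 z ∧ ¬ Stops F z ℓ lam q.1 x ∧ Stops F z ℓ lam (q.1 + 1) x ∧
      gridIndex z ℓ (q.1 + 1) x = q.2}
  have hS : ∀ q, S q = ∅ ∨ ∃ x, x ∈ cell z ℓ 0 z ∧ ¬ Stops F z ℓ lam q.1 x ∧
      Stops F z ℓ lam (q.1 + 1) x ∧ S q = cell z ℓ (q.1 + 1) x := by
    intro q
    rcases (S q).eq_empty_or_nonempty with h | ⟨x, hx1, hx2, hx3, hx4⟩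
    · exact .inl h
    · refine .inr ⟨x, hx1, hx2, hx3, ?_⟩
      ext y
      constructor
      · rintro ⟨-, -, -, hy⟩
        rw [mem_cell, hy, hx4]
      · intro hy
        have hy' : y ∈ cell z ℓ q.1 x := cell_succ_subset hy
        refine ⟨?_, ?_, ?_, ?_⟩
        · rw [← cell_eq_of_mem hx1]; exact cell_anti (Nat.zero_le _) hy'
        · rwa [stops_congr hy']
        · rwa [stops_congr hy]
        · rw [← hx4]; exact hy
  have hmeas : ∀ q, MeasurableSet (S q) := by
    intro q
    rcases hS q with h | ⟨x, -, -, -, h⟩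
    · rw [h]; exact MeasurableSet.empty
    · rw [h]; exact measurableSet_cell
  have hunion : stopSet F z ℓ lam = ⋃ q, S q := by
    ext x
    rw [Set.mem_iUnion]
    constructor
    · rintro ⟨hx, hex⟩
      have h0x : ¬ Stops F z ℓ lam 0 x := by rwa [stops_congr hx]
      have hf := Nat.find_spec hex
      obtain ⟨m, hm⟩ : ∃ m, Nat.find hex = m + 1 :=
        Nat.exists_eq_succ_of_ne_zero fun h => h0x (h ▸ hf)
      rw [hm] at hf
      exact ⟨(m, gridIndex z ℓ (m + 1) x), hx, Nat.find_min hex (by omega), hf, rfl⟩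
    · rintro ⟨q, hx1, -, hx3, -⟩
      exact ⟨hx1, _, hx3⟩
  have hdisj : Pairwise (Function.onFun Disjoint S) := by
    rintro ⟨k, a⟩ ⟨m, b⟩ hne
    refine Set.disjoint_left.2 ?_
    rintro x ⟨-, h2, h3, h4⟩ ⟨-, h2', h3', h4'⟩
    simp only at h2 h3 h4 h2' h3' h4'
    have e1 : k = m := by
      refine le_antisymm ?_ ?_ <;> by_contra hlt
      · exact h2 (h3'.mono (by omega))
      · exact h2' (h3.mono (by omega))
    subst e1
    exact hne (by rw [← h4, ← h4'])
  rw [hunion]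
  refine ⟨MeasurableSet.iUnion hmeas, fun ν₁ ν₂ hν => ?_⟩
  rw [measure_iUnion hdisj hmeas, measure_iUnion hdisj hmeas]
  refine ENNReal.tsum_le_tsum fun q => ?_
  rcases hS q with h | ⟨x, h1, h2, h3, h⟩
  · simp [h]
  · rw [h]; exact hν _ x h1 h2 h3

/-- The lowest level of the stopping time argument. -/
def baseLevel (F : EuclideanSpace ℝ (Fin n) → ℝ≥0∞) (z : EuclideanSpace ℝ (Fin n)) (ℓ : ℝ) : ℝ≥0∞ :=
  ENNReal.ofReal ((64 * (n + 1)) ^ n) * ∫⁻ v, F v ∂avgMeasure z (32 * ((n + 1) * ℓ))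

lemma avg_le_baseLevel (hℓ : 0 < ℓ) {r : ℝ} (hr : ℓ / 2 ≤ r)
    (hsub : ball y r ⊆ ball z (32 * ((n + 1) * ℓ))) :
    ∫⁻ v, F v ∂avgMeasure y r ≤ baseLevel F z ℓ := by
  have hn : (0 : ℝ) ≤ n := n.cast_nonneg
  refine avg_le_mul_avg (by positivity) (by linarith) (by positivity) ?_ hsub F
  calc 32 * ((n + 1) * ℓ) = 64 * (n + 1) * (ℓ / 2) := by ring
    _ ≤ _ := by gcongr

lemma radius_lt_of_ball_subset_ball (hn : 1 ≤ n) {a b : EuclideanSpace ℝ (Fin n)} {r s : ℝ}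
    (hs : 0 < s) (h : ball a s ⊆ ball b r) : s ≤ r := by
  have : Nonempty (Fin n) := ⟨⟨0, hn⟩⟩
  have hr : 0 < r := pos_of_mem_ball (h (mem_ball_self hs))
  by_contra hlt
  rw [not_le] at hlt
  have h1 : volume (ball a s) ≤ volume (ball b r) := measure_mono h
  have h2 : volume (ball a s) = ENNReal.ofReal ((s / r) ^ n) * volume (ball b r) := by
    rw [← volume_ball_mul a b (by positivity), div_mul_cancel₀ _ hr.ne']
  have h3 : 1 < ENNReal.ofReal ((s / r) ^ n) := by
    rw [ENNReal.one_lt_ofReal]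
    exact one_lt_pow₀ (by rwa [one_lt_div hr]) (by omega)
  rw [h2] at h1
  refine absurd h1 (not_le.2 ?_)
  calc volume (ball b r) = 1 * volume (ball b r) := (one_mul _).symm
    _ < _ := (ENNReal.mul_lt_mul_iff_left (volume_ball_ne_zero b hr) (volume_ball_ne_top b r)).2 h3

/-- A ball containing the initial cell contains B(z, ℓ/2), hence has radius at least ℓ/2. With the
upper bound 8(n+1)ℓ on its radius it stays in B(z, 32(n+1)ℓ). The base level carries the ratio
64(n+1) of these two radii. -/
lemma not_stops_zero (hn : 1 ≤ n) (hℓ : 0 < ℓ) (hlam : baseLevel F z ℓ ≤ lam) :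
    ¬ Stops F z ℓ lam 0 z := by
  rintro ⟨y, r, h1, h2, h3⟩
  refine absurd h3 (not_lt.2 (le_trans ?_ hlam))
  have hN : 0 < (n + 1) * ℓ := by positivity
  have hz : z ∈ ball y r := h2 mem_cell_self
  refine avg_le_baseLevel hℓ (radius_lt_of_ball_subset_ball hn (by positivity)
    ((ball_subset_cell_zero hℓ).trans h2)) (ball_subset_ball' ?_)
  rw [mem_ball, dist_comm] at hz
  linarith

/-- This is what is gained by testing balls rather than the cells themselves. If 3r is admissible,
B(x, 3r) contains both the nonstopping cell and B(y, r), at the price of 3^n. Otherwise r is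
comparable to ℓ and the base level takes over. -/
lemma avg_le_of_not_stops (hℓ : 0 < ℓ) (hlam : baseLevel F z ℓ ≤ lam)
    (hx : x ∈ cell z ℓ 0 z) (hst : ¬ Stops F z ℓ lam k x) {r : ℝ}
    (hr : (n + 1) * ℓ / 2 ^ (k + 1) ≤ r) (hyx : dist y x < 2 * r) (hrR : r < 8 * ((n + 1) * ℓ)) :
    ∫⁻ v, F v ∂avgMeasure y r ≤ ENNReal.ofReal (3 ^ n) * lam := by
  have hN : 0 < (n + 1) * ℓ := by positivity
  have hr0 : 0 < r := lt_of_lt_of_le (by positivity) hr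
  have h3r : ball y r ⊆ ball x (3 * r) := ball_subset_ball' (by linarith)
  rcases lt_or_ge (3 * r) (8 * ((n + 1) * ℓ)) with h | h
  · have h1 : cell z ℓ k x ⊆ ball x (3 * r) := by
      refine (cell_subset_ball hℓ).trans (ball_subset_ball ?_)
      rw [pow_succ, ← div_div] at hr
      linarith
    have h2 : ∫⁻ v, F v ∂avgMeasure x (3 * r) ≤ lam :=
      not_lt.1 fun hlt => hst ⟨x, 3 * r, h, h1, hlt⟩
    refine (avg_le_mul_avg (by norm_num) hr0 (by positivity) le_rfl h3r F).trans ?_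
    gcongr
  · have hxz : dist x z < (n + 1) * ℓ := by
      have := cell_zero_subset_ball hℓ hx
      rwa [mem_ball] at this
    have h1 : ∫⁻ v, F v ∂avgMeasure y r ≤ baseLevel F z ℓ := by
      refine avg_le_baseLevel hℓ ?_ (ball_subset_ball' ?_)
      · have hn : (0 : ℝ) ≤ n := n.cast_nonneg
        have : ℓ ≤ (n + 1) * ℓ := by nlinarith
        linarith
      · have := dist_triangle y x z
        linarith
    refine (h1.trans hlam).trans (le_mul_of_one_le_left' ?_)
    rw [ENNReal.one_le_ofReal]
    exact one_le_pow₀ (by norm_num)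

/-- Localization: above height 3^n lam, larger balls near a cell with a nonstopping parent are
excluded by `avg_le_of_not_stops`. Only small balls can witness the higher level, and they see F
only near the cell. -/
lemma exists_small_ball_of_mem_stopSet (hℓ : 0 < ℓ) (hlam : baseLevel F z ℓ ≤ lam)
    (hx : x ∈ cell z ℓ 0 z) (hst : ¬ Stops F z ℓ lam k x) {lam' : ℝ≥0∞}
    (hlam' : ENNReal.ofReal (3 ^ n) * lam ≤ lam') (hy : y ∈ cell z ℓ (k + 1) x)
    (hy' : y ∈ stopSet F z ℓ lam') :
    ∃ v r, y ∈ ball v r ∧ r < (n + 1) * ℓ / 2 ^ (k + 1) ∧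
      ball v r ⊆ ball x (3 * ((n + 1) * ℓ / 2 ^ (k + 1))) ∧ lam' < ∫⁻ v, F v ∂avgMeasure v r := by
  obtain ⟨-, m, v, r, h1, h2, h3⟩ := hy'
  have hyv : y ∈ ball v r := h2 mem_cell_self
  have hyx := dist_lt_of_mem_cell hℓ hy
  have hvx := dist_triangle_left v x y
  rw [mem_ball] at hyv
  have hr : r < (n + 1) * ℓ / 2 ^ (k + 1) := by
    by_contra hge
    rw [not_lt] at hge
    refine absurd h3 (not_lt.2 (le_trans ?_ hlam'))
    refine avg_le_of_not_stops hℓ hlam hx hst hge ?_ h1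
    linarith
  exact ⟨v, r, hyv, hr, ball_subset_ball' (by linarith), h3⟩

/-- Lebesgue differentiation, transferred from closed to open balls; spheres are null because n ≥ 1.
-/
lemma ae_tendsto_avg_ball (hn : 1 ≤ n) (hF : Measurable F) (s : ℝ)
    (hFfin : ∫⁻ v in ball z s, F v ≠ ∞) :
    ∀ᵐ x, x ∈ ball z s → Filter.Tendsto (fun r => ∫⁻ v, F v ∂avgMeasure x r)
      (nhdsWithin 0 (Set.Ioi 0)) (nhds (F x)) := by
  have : Nonempty (Fin n) := ⟨⟨0, hn⟩⟩
  have h1 := (Besicovitch.vitaliFamily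
    (volume : Measure (EuclideanSpace ℝ (Fin n)))).ae_tendsto_lintegral_div
    (f := (ball z s).indicator F) (hF.indicator measurableSet_ball).aemeasurable
    (by rwa [lintegral_indicator measurableSet_ball])
  filter_upwards [h1] with x hx hxs
  rw [Set.indicator_of_mem hxs] at hx
  have h2 := hx.comp (Besicovitch.tendsto_filterAt volume x)
  refine h2.congr' ?_
  have hd : 0 < s - dist x z := sub_pos.2 (mem_ball.1 hxs)
  filter_upwards [self_mem_nhdsWithin, mem_nhdsWithin_of_mem_nhds (Iio_mem_nhds hd)] with r hr hr'
  simp only [Set.mem_Ioi, Set.mem_Iio] at hr hr'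
  have hsub : closedBall x r ⊆ ball z s := closedBall_subset_ball' (by linarith)
  have hae : (ball x r : Set _) =ᵐ[volume] closedBall x r := by
    refine ball_subset_closedBall.eventuallyLE.antisymm ?_
    rw [ae_le_set, closedBall_sdiff_ball]
    exact Measure.addHaar_sphere volume x r
  rw [Function.comp_apply, lintegral_avgMeasure, ENNReal.div_eq_inv_mul,
    Measure.addHaar_closedBall_eq_addHaar_ball, setLIntegral_congr hae]
  congr 1
  exact setLIntegral_congr_fun measurableSet_closedBall fun v hv =>
    Set.indicator_of_mem (hsub hv) F

/-- Outside the stopping set the centred balls of radius (n+1)ℓ/2^k contain the cells of x and have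
means at most lam; differentiation gives the bound. The exceptional null set does not depend on lam.
-/
lemma ae_le_of_notMem_stopSet (hn : 1 ≤ n) (hℓ : 0 < ℓ) (hF : Measurable F)
    (hFfin : ∫⁻ v in ball z ((n + 1) * ℓ), F v ≠ ∞) :
    ∀ᵐ x, x ∈ cell z ℓ 0 z → ∀ lam, x ∉ stopSet F z ℓ lam → F x ≤ lam := by
  filter_upwards [ae_tendsto_avg_ball hn hF _ hFfin] with x hx hxc lam hxl
  have ht : Filter.Tendsto (fun k : ℕ => (n + 1) * ℓ / 2 ^ k) Filter.atTop
      (nhdsWithin 0 (Set.Ioi 0)) := by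
    rw [tendsto_nhdsWithin_iff]
    refine ⟨?_, Filter.Eventually.of_forall fun k => by
      simp only [Set.mem_Ioi]; positivity⟩
    have := (tendsto_pow_atTop_nhds_zero_of_lt_one (r := (1 / 2 : ℝ)) (by norm_num)
      (by norm_num)).const_mul ((n + 1) * ℓ)
    rw [mul_zero] at this
    refine this.congr fun k => ?_
    rw [one_div, inv_pow, div_eq_mul_inv]
  refine le_of_tendsto ((hx (cell_zero_subset_ball hℓ hxc)).comp ht)
    (Filter.Eventually.of_forall fun k => ?_)
  refine not_lt.1 fun hlt => hxl ⟨hxc, k, x, _, ?_, cell_subset_ball hℓ, hlt⟩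
  have hN : 0 < (n + 1) * ℓ := by positivity
  have h1 : (n + 1) * ℓ / 2 ^ k ≤ (n + 1) * ℓ :=
    div_le_self hN.le (one_le_pow₀ (by norm_num))
  linarith

end Cells

/-! ### Reverse Hölder inequality on small balls from a local A_∞ condition. -/

section ReverseHolder

variable {n : ℕ} {ρ : EuclideanSpace ℝ (Fin n) → ℝ}

/-- The ratio of the volumes of a cell and of the ball used as its enlargement. -/
def cellRatio (n : ℕ) : ℝ≥0∞ :=
  ENNReal.ofReal ((3 * (n + 1)) ^ n) * volume (ball (0 : EuclideanSpace ℝ (Fin n)) 1)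

lemma cellRatio_ne_top (n : ℕ) : cellRatio n ≠ ∞ :=
  ENNReal.mul_ne_top ENNReal.ofReal_ne_top (volume_ball_ne_top _ _)

lemma volume_ball_eq_cellRatio_mul {z x v : EuclideanSpace ℝ (Fin n)} {ℓ : ℝ} (hℓ : 0 < ℓ) (k : ℕ) :
    volume (ball v (3 * ((n + 1) * ℓ / 2 ^ k))) = cellRatio n * volume (cell z ℓ k x) := by
  have h1 : (0:ℝ) < 3 * ((n + 1) * ℓ / 2 ^ k) := by positivity
  rw [← mul_one (3 * ((n + 1) * ℓ / 2 ^ k)), volume_ball_mul v 0 h1, volume_cell hℓ, cellRatio,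
    mul_right_comm, ← ENNReal.ofReal_mul (by positivity), ← mul_pow]
  congr 3
  ring

lemma volume_cell_ne_top {z x : EuclideanSpace ℝ (Fin n)} {ℓ : ℝ} (hℓ : 0 < ℓ) (k : ℕ) :
    volume (cell z ℓ k x) ≠ ∞ := by
  rw [volume_cell hℓ]; exact ENNReal.ofReal_ne_top

/-- A quantitative local `A_∞` condition. -/
def LocalAInfty (ρ : EuclideanSpace ℝ (Fin n) → ℝ) (t : ℝ) (C : ℝ≥0∞)
    (μ : Measure (EuclideanSpace ℝ (Fin n))) : Prop :=
  ∀ (x : EuclideanSpace ℝ (Fin n)) (r : ℝ), 0 < r → r ≤ ρ x →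
    ∀ S ⊆ ball x r, MeasurableSet S →
      volume S ^ t * μ (ball x r) ≤ C * volume (ball x r) ^ t * μ S

lemma LocalAInfty.measure_ball_le {t : ℝ} {C : ℝ≥0∞} {μ : Measure (EuclideanSpace ℝ (Fin n))}
    (ht : 0 < t) (h : LocalAInfty ρ t C μ) {x : EuclideanSpace ℝ (Fin n)} {r : ℝ} (hr : 0 < r)
    (hrρ : r ≤ ρ x) {S : Set (EuclideanSpace ℝ (Fin n))} (hS : S ⊆ ball x r)
    (hSm : MeasurableSet S) {c : ℝ≥0∞} (hc : volume (ball x r) ≤ c * volume S) :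
    μ (ball x r) ≤ C * c ^ t * μ S := by
  have h1 := h x r hr hrρ S hS hSm
  have hB0 : volume (ball x r) ^ t ≠ 0 := by
    rw [ne_eq, ENNReal.rpow_eq_zero_iff]
    rintro (⟨h, -⟩ | ⟨h, -⟩)
    · exact volume_ball_ne_zero x hr h
    · exact volume_ball_ne_top x r h
  have hBt : volume (ball x r) ^ t ≠ ∞ := ENNReal.rpow_ne_top_of_nonneg ht.le (volume_ball_ne_top x r)
  have h2 : volume (ball x r) ^ t * μ (ball x r) ≤
      volume (ball x r) ^ t * (C * c ^ t * μ S) := by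
    calc volume (ball x r) ^ t * μ (ball x r) ≤ (c * volume S) ^ t * μ (ball x r) := by gcongr
      _ = c ^ t * (volume S ^ t * μ (ball x r)) := by
          rw [ENNReal.mul_rpow_of_nonneg _ _ ht.le, mul_assoc]
      _ ≤ c ^ t * (C * volume (ball x r) ^ t * μ S) := by gcongr
      _ = _ := by ring
  exact (ENNReal.mul_le_mul_iff_right hB0 hBt).1 h2

/-- By localization the higher stopping set inside the cell lies in a level set of the maximal
function of F restricted to B(x, 3l). The mean of F there is at most 3^n lam and the weak type (1,1)
constant is 4^n, whence 12^n. -/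
lemma volume_stopSet_inter_cell_le {F : EuclideanSpace ℝ (Fin n) → ℝ≥0∞} (hF : Measurable F)
    (hρ : IsAdmissible ρ) {z x : EuclideanSpace ℝ (Fin n)} {ℓ : ℝ}
    (hℓ : 0 < ℓ) {lam K : ℝ≥0∞} (hlam : baseLevel F z ℓ ≤ lam) {k : ℕ} (hx : x ∈ cell z ℓ 0 z)
    (hst : ¬ Stops F z ℓ lam k x) (hlam0 : lam ≠ 0) (hlam' : lam ≠ ∞)
    (hK : ENNReal.ofReal (3 ^ n) ≤ K) :
    K * volume (stopSet F z ℓ (K * lam) ∩ cell z ℓ (k + 1) x) ≤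
      ENNReal.ofReal (12 ^ n) * cellRatio n * volume (cell z ℓ (k + 1) x) := by
  set l := (n + 1) * ℓ / 2 ^ (k + 1) with hl
  have hN : 0 < (n + 1) * ℓ := by positivity
  have hl0 : 0 < l := by positivity
  have hlN : l ≤ (n + 1) * ℓ := div_le_self hN.le (one_le_pow₀ (by norm_num))
  have hBl : ∫⁻ v, F v ∂avgMeasure x (3 * l) ≤ ENNReal.ofReal (3 ^ n) * lam := by
    refine avg_le_of_not_stops hℓ hlam hx hst ?_ ?_ ?_
    · rw [← hl]; linarith
    · rw [dist_self]; positivity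
    · linarith
  have hsub : stopSet F z ℓ (K * lam) ∩ cell z ℓ (k + 1) x ⊆
      {v | K * lam < maximalRho ρ 0 ((ball x (3 * l)).indicator F) v} := by
    rintro y ⟨hy1, hy2⟩
    obtain ⟨v, r, h1, -, h3, h4⟩ := exists_small_ball_of_mem_stopSet hℓ hlam hx hst
      (mul_le_mul_left hK lam) hy2 hy1
    rw [Set.mem_ofPred_eq, lt_maximalRho_iff]
    refine ⟨v, r, h1, h4.trans_le ?_⟩
    rw [psiMeasure_zero, lintegral_avgMeasure, lintegral_avgMeasure]
    gcongr 1
    refine setLIntegral_mono' measurableSet_ball fun u hu => ?_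
    rw [Set.indicator_of_mem (h3 hu)]
  have hw := (weakTypeCondition_volume hρ (le_refl (0 : ℝ))).weak_type one_pos
    (hF.indicator (measurableSet_ball (x := x) (ε := 3 * l))) (K * lam)
  simp only [ENNReal.rpow_one] at hw
  rw [lintegral_indicator measurableSet_ball, setLIntegral_ball_eq_mul_avg x (by positivity)] at hw
  have h5 : lam * (K * volume (stopSet F z ℓ (K * lam) ∩ cell z ℓ (k + 1) x)) ≤
      lam * (ENNReal.ofReal (12 ^ n) * cellRatio n * volume (cell z ℓ (k + 1) x)) := by
    calc _ = K * lam * volume (stopSet F z ℓ (K * lam) ∩ cell z ℓ (k + 1) x) := by ring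
      _ ≤ _ := mul_le_mul_right (measure_mono hsub) _
      _ ≤ _ := hw
      _ ≤ ENNReal.ofReal (4 ^ n) * (volume (ball x (3 * l)) * (ENNReal.ofReal (3 ^ n) * lam)) := by
          gcongr
      _ = _ := by
          rw [hl, volume_ball_eq_cellRatio_mul (z := z) (x := x) hℓ (k + 1),
            show (12 : ℝ) ^ n = 4 ^ n * 3 ^ n by rw [← mul_pow]; norm_num,
            ENNReal.ofReal_mul (by positivity)]
          ring
  exact (ENNReal.mul_le_mul_iff_right hlam0 hlam').1 h5

/-- Reverse Hölder inequality on small balls. -/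
theorem LocalAInfty.exists_reverse_holder (hn : 1 ≤ n) (hρ : IsAdmissible ρ) {κ : ℝ} (hκ1 : κ ≤ 1)
    (hκ : ∀ x y, dist x y ≤ ρ x → κ * ρ x ≤ ρ y ∧ κ * ρ y ≤ ρ x)
    {t : ℝ} (ht : 0 < t) {C : ℝ≥0∞} (hC : C ≠ ∞) {w : EuclideanSpace ℝ (Fin n) → ℝ≥0∞}
    (hw : Measurable w) (hfin : ∀ x r, ∫⁻ y in ball x r, w y ≠ ∞)
    (hA : LocalAInfty ρ t C (volume.withDensity w)) :
    ∃ ε : ℝ, 0 < ε ∧ ∃ C' : ℝ≥0∞, C' ≠ ∞ ∧ ∀ (z : EuclideanSpace ℝ (Fin n)) (r : ℝ), 0 < r →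
      64 * ((n + 1) * r) ≤ κ * ρ z →
      ∫⁻ y, w y ^ (1 + ε) ∂avgMeasure z r ≤ C' * (∫⁻ y, w y ∂avgMeasure z r) ^ (1 + ε) := by
  set μ := volume.withDensity w with hμ
  have hμball : ∀ x r, μ (ball x r) = ∫⁻ y in ball x r, w y := fun x r =>
    withDensity_apply _ measurableSet_ball
  set c₁ := cellRatio n with hc₁
  have hc₁t : c₁ ≠ ∞ := cellRatio_ne_top n
  -- The first summand makes each stopping set fill at most half of every stopping cell of the
  -- previous level. The second meets the requirement of the localization lemma.
  set K : ℝ≥0∞ := 2 * (ENNReal.ofReal (12 ^ n) * c₁) + ENNReal.ofReal (3 ^ n) with hKdef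
  have hKt : K ≠ ∞ := ENNReal.add_ne_top.2 ⟨ENNReal.mul_ne_top (by simp)
    (ENNReal.mul_ne_top ENNReal.ofReal_ne_top hc₁t), ENNReal.ofReal_ne_top⟩
  have h3K : ENNReal.ofReal (3 ^ n) ≤ K := le_add_self
  have hK1 : 1 < K := by
    refine lt_of_lt_of_le ?_ h3K
    rw [ENNReal.one_lt_ofReal]
    exact one_lt_pow₀ (by norm_num) (by omega)
  have hK0 : K ≠ 0 := (zero_lt_one.trans hK1).ne'
  -- The complement of the next stopping set fills half of Q, and the ball around Q has c₁ times the
  -- volume of Q, so A_∞ gives μ(Q) ≤ D μ(Q \ E). The summand 1 ensures D ≥ 1.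
  set D : ℝ≥0∞ := C * (2 * c₁) ^ t + 1 with hD
  have hDt : D ≠ ∞ := ENNReal.add_ne_top.2 ⟨ENNReal.mul_ne_top hC
    (ENNReal.rpow_ne_top_of_nonneg ht.le (ENNReal.mul_ne_top (by simp) hc₁t)), by simp⟩
  have hD1 : 1 ≤ D := le_add_self
  have hD0 : D ≠ 0 := (zero_lt_one.trans_le hD1).ne'
  -- choice of the exponent
  obtain ⟨ε, hε, hβ⟩ : ∃ ε : ℝ, 0 < ε ∧ K ^ ε * (1 - D⁻¹) < 1 := by
    have h1 : Filter.Tendsto (fun ε : ℝ => ENNReal.ofReal (K.toReal ^ ε) * (1 - D⁻¹))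
        (nhdsWithin 0 (Set.Ioi 0)) (nhds (ENNReal.ofReal (K.toReal ^ (0:ℝ)) * (1 - D⁻¹))) := by
      refine ENNReal.Tendsto.mul_const (ENNReal.tendsto_ofReal ?_) (.inl (by simp))
      refine (Real.continuousAt_const_rpow ?_).tendsto.mono_left nhdsWithin_le_nhds
      exact (ENNReal.toReal_pos hK0 hKt).ne'
    rw [Real.rpow_zero, ENNReal.ofReal_one, one_mul] at h1
    have h2 : 1 - D⁻¹ < 1 := ENNReal.sub_lt_self (by simp) (by simp) (by simpa using hDt)
    obtain ⟨ε, he1, he2⟩ := ((h1.eventually (gt_mem_nhds h2)).and self_mem_nhdsWithin).exists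
    refine ⟨ε, he2, ?_⟩
    rwa [← ENNReal.ofReal_rpow_of_pos (ENNReal.toReal_pos hK0 hKt),
      ENNReal.ofReal_toReal hKt] at he1
  set β := 1 - D⁻¹ with hβdef
  -- Sum of the series of (K^ε β)^i: the growth K^ε of the heights is beaten by the decay β of the
  -- measures of the stopping sets.
  set Sg : ℝ≥0∞ := 1 + K ^ ε * (1 - K ^ ε * β)⁻¹ with hSg
  have hSgt : Sg ≠ ∞ := by
    refine ENNReal.add_ne_top.2 ⟨by simp, ENNReal.mul_ne_top
      (ENNReal.rpow_ne_top_of_nonneg hε.le hKt) ?_⟩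
    rw [ne_eq, ENNReal.inv_eq_top, tsub_eq_zero_iff_le, not_le]
    exact hβ
  set cN : ℝ≥0∞ := ENNReal.ofReal ((64 * (n + 1)) ^ n) with hcN
  set D' : ℝ≥0∞ := C * cN ^ t with hD'
  have hD't : D' ≠ ∞ := ENNReal.mul_ne_top hC
    (ENNReal.rpow_ne_top_of_nonneg ht.le ENNReal.ofReal_ne_top)
  refine ⟨ε, hε, Sg * ((cN * D') ^ ε * D'), ENNReal.mul_ne_top hSgt (ENNReal.mul_ne_top
    (ENNReal.rpow_ne_top_of_nonneg hε.le (ENNReal.mul_ne_top ENNReal.ofReal_ne_top hD't)) hD't),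
    fun z r hr hrρ => ?_⟩
  set ℓ := 2 * r with hℓdef
  have hℓ : 0 < ℓ := by positivity
  have hρz := hρ.pos z
  have hN : 0 < (n + 1) * ℓ := by positivity
  have hNr : 64 * ((n + 1) * r) = 32 * ((n + 1) * ℓ) := by rw [hℓdef]; ring
  have hκρ : κ * ρ z ≤ ρ z := by nlinarith
  -- comparison of the large ball with the small one
  have hdoub : μ (ball z (32 * ((n + 1) * ℓ))) ≤ D' * μ (ball z r) := by
    refine hA.measure_ball_le ht (by positivity) (by linarith) (ball_subset_ball ?_)
      measurableSet_ball ?_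
    · rw [← hNr]
      have : (0:ℝ) ≤ n := n.cast_nonneg
      nlinarith
    · refine volume_ball_le_mul z z (by positivity) (le_of_eq ?_)
      rw [← hNr]; ring
  set Λ := baseLevel w z ℓ with hΛ
  have hΛle : Λ ≤ cN * D' * ∫⁻ y, w y ∂avgMeasure z r := by
    rw [hΛ, baseLevel, mul_assoc]
    refine mul_le_mul_right ?_ _
    rw [lintegral_avgMeasure, lintegral_avgMeasure, ← hμball, ← hμball,
      mul_left_comm D' _ (μ (ball z r))]
    refine mul_le_mul' (ENNReal.inv_le_inv.2 (measure_mono (ball_subset_ball ?_))) hdoub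
    rw [← hNr]
    have : (0:ℝ) ≤ n := n.cast_nonneg
    nlinarith
  have hΛt : Λ ≠ ∞ := by
    rw [hΛ, baseLevel, lintegral_avgMeasure]
    exact ENNReal.mul_ne_top ENNReal.ofReal_ne_top (ENNReal.mul_ne_top
      (by simpa using volume_ball_ne_zero z (by positivity)) (hfin _ _))
  have hballcell : ball z r ⊆ cell z ℓ 0 z := by
    have := ball_subset_cell_zero (z := z) hℓ
    rwa [hℓdef, mul_div_cancel_left₀ _ (two_ne_zero)] at this
  have hcellball : cell z ℓ 0 z ⊆ ball z (32 * ((n + 1) * ℓ)) :=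
    (cell_zero_subset_ball hℓ).trans (ball_subset_ball (by linarith))
  have hmain : ∫⁻ y in cell z ℓ 0 z, w y ^ (1 + ε) ≤ Sg * (Λ ^ ε * μ (cell z ℓ 0 z)) := by
    rcases eq_or_ne Λ 0 with h0 | h0
    · rw [hΛ, baseLevel, lintegral_avgMeasure, mul_eq_zero, mul_eq_zero] at h0
      have h1 : ∫⁻ y in ball z (32 * ((n + 1) * ℓ)), w y = 0 := by
        rcases h0 with h0 | h0 | h0
        · rw [ENNReal.ofReal_eq_zero] at h0
          exact absurd h0 (not_le.2 (by positivity))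
        · rw [ENNReal.inv_eq_zero] at h0
          exact absurd h0 (volume_ball_ne_top _ _)
        · exact h0
      rw [lintegral_eq_zero_iff hw] at h1
      refine le_of_eq_of_le ?_ zero_le
      rw [lintegral_eq_zero_iff (hw.pow_const _)]
      filter_upwards [ae_restrict_of_ae_restrict_of_subset hcellball h1] with y hy
      rw [hy, Pi.zero_apply, ENNReal.zero_rpow_of_pos (by positivity)]
    · let E : ℕ → Set (EuclideanSpace ℝ (Fin n)) := fun i => stopSet w z ℓ (Λ * K ^ i)
      have hlev : ∀ i, Λ ≤ Λ * K ^ i := fun i => le_mul_of_one_le_right' (one_le_pow₀ hK1.le)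
      have hlev0 : ∀ i, Λ * K ^ i ≠ 0 := fun i => mul_ne_zero h0 (pow_ne_zero _ hK0)
      have hlevt : ∀ i, Λ * K ^ i ≠ ∞ := fun i => ENNReal.mul_ne_top hΛt (ENNReal.pow_ne_top hKt)
      have hEm : ∀ i, MeasurableSet (E i) := fun i =>
        (measurableSet_stopSet_and_measure_le (not_stops_zero hn hℓ (hlev i))).1
      -- Written additively to avoid subtraction in `ℝ≥0∞`. Both sides are values of measures on E
      -- i, so the inequality is checked on first stopping cells.
      have hstep : ∀ i, D * μ (E (i + 1)) + μ (E i) ≤ D * μ (E i) := by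
        intro i
        have hE1 : E (i + 1) = stopSet w z ℓ (K * (Λ * K ^ i)) := by
          simp only [E]; congr 1; ring
        have h1 := (measurableSet_stopSet_and_measure_le (not_stops_zero hn hℓ (hlev i))).2
          (D • μ.restrict (E (i + 1)) + μ) (D • μ) ?_
        · simp only [Measure.add_apply, Measure.smul_apply, smul_eq_mul] at h1
          rw [Measure.restrict_apply (hEm i), Set.inter_eq_self_of_subset_right
            (stopSet_anti (by gcongr; exacts [hK1.le, Nat.le_succ i]))] at h1
          exact h1
        · intro k x hx hst _
          have h2 := volume_stopSet_inter_cell_le hw hρ hℓ (hlev i) hx hst (hlev0 i) (hlevt i) h3K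
          rw [← hE1] at h2
          set Q := cell z ℓ (k + 1) x with hQ
          have hQm : MeasurableSet Q := measurableSet_cell
          simp only [Measure.add_apply, Measure.smul_apply, smul_eq_mul]
          rw [Measure.restrict_apply hQm]
          have h3 : volume (E (i + 1) ∩ Q) ≤ 2⁻¹ * volume Q := by
            have h4 : K * volume (E (i + 1) ∩ Q) ≤ K * (2⁻¹ * volume Q) := by
              refine h2.trans ?_
              rw [← mul_assoc]
              refine mul_le_mul_left ?_ _
              calc ENNReal.ofReal (12 ^ n) * c₁ = 2 * (ENNReal.ofReal (12 ^ n) * c₁) * 2⁻¹ := by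
                    rw [mul_right_comm, ENNReal.mul_inv_cancel (by simp) (by simp), one_mul]
                _ ≤ K * 2⁻¹ := by gcongr; exact le_self_add
            exact (ENNReal.mul_le_mul_iff_right hK0 hKt).1 h4
          have hQt : volume Q ≠ ∞ := volume_cell_ne_top hℓ _
          have hsplit : volume (E (i + 1) ∩ Q) + volume (Q \ E (i + 1)) = volume Q := by
            rw [Set.inter_comm]; exact measure_inter_add_sdiff Q (hEm _)
          have h5 : volume Q ≤ 2 * volume (Q \ E (i + 1)) := by
            have h6 : 2⁻¹ * volume Q + 2⁻¹ * volume Q ≤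
                2⁻¹ * volume Q + volume (Q \ E (i + 1)) := by
              rw [← add_mul, ENNReal.inv_two_add_inv_two, one_mul, ← hsplit]
              gcongr
              rw [hsplit]; exact h3
            have h7 := ENNReal.le_of_add_le_add_left
              (ENNReal.mul_ne_top (by simp) hQt) h6
            calc volume Q = 2 * (2⁻¹ * volume Q) := by
                  rw [← mul_assoc, ENNReal.mul_inv_cancel (by simp) (by simp), one_mul]
              _ ≤ _ := by gcongr
          set l := (n + 1) * ℓ / 2 ^ (k + 1) with hl
          have hlN : l ≤ (n + 1) * ℓ := div_le_self hN.le (one_le_pow₀ (by norm_num))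
          have hl0 : 0 < l := by positivity
          have hxz : dist z x ≤ ρ z := by
            have := cell_zero_subset_ball hℓ hx
            rw [mem_ball, dist_comm] at this
            linarith
          have hQB : Q ⊆ ball x (3 * l) :=
            (cell_subset_ball hℓ).trans (ball_subset_ball (by rw [← hl]; linarith))
          have h8 : μ (ball x (3 * l)) ≤ C * (2 * c₁) ^ t * μ (Q \ E (i + 1)) := by
            refine hA.measure_ball_le ht (by positivity) ?_ (Set.sdiff_subset.trans hQB)
              (hQm.diff (hEm _)) ?_
            · have := (hκ z x hxz).1
              linarith
            · rw [hl, volume_ball_eq_cellRatio_mul (z := z) (x := x) hℓ (k + 1), ← hQ, ← hc₁,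
                mul_right_comm, mul_comm]
              gcongr
          have h9 : μ Q ≤ D * μ (Q \ E (i + 1)) :=
            (measure_mono hQB).trans (h8.trans (by gcongr; exact le_self_add))
          calc D * μ (Q ∩ E (i + 1)) + μ Q ≤ D * μ (Q ∩ E (i + 1)) + D * μ (Q \ E (i + 1)) := by
                gcongr
            _ = D * μ Q := by rw [← mul_add, measure_inter_add_sdiff Q (hEm _)]
      have hEt : ∀ i, μ (E i) ≠ ∞ := fun i => by
        refine ne_top_of_le_ne_top ?_ (measure_mono (μ := μ) (stopSet_subset.trans hcellball :
          E i ⊆ _))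
        rw [hμball]; exact hfin _ _
      have hdecay : ∀ i, μ (E i) ≤ β ^ i * μ (cell z ℓ 0 z) := by
        intro i
        induction i with
        | zero => rw [pow_zero, one_mul]; exact measure_mono stopSet_subset
        | succ i ih =>
          have h1 := hstep i
          have h2 : μ (E (i + 1)) + D⁻¹ * μ (E i) ≤ μ (E i) := by
            have h3 : D * (μ (E (i + 1)) + D⁻¹ * μ (E i)) ≤ D * μ (E i) := by
              rw [mul_add, ← mul_assoc, ENNReal.mul_inv_cancel hD0 hDt, one_mul]; exact h1
            exact (ENNReal.mul_le_mul_iff_right hD0 hDt).1 h3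
          have h4 : μ (E (i + 1)) ≤ β * μ (E i) := by
            rw [hβdef, ENNReal.sub_mul (fun _ _ => hEt i), one_mul]
            exact ENNReal.le_sub_of_add_le_right (ENNReal.mul_ne_top (by simpa using hD0) (hEt i)) h2
          calc μ (E (i + 1)) ≤ β * (β ^ i * μ (cell z ℓ 0 z)) := h4.trans (by gcongr)
            _ = _ := by ring
      have hae := ae_le_of_notMem_stopSet (z := z) hn hℓ hw (hfin _ _)
      calc ∫⁻ y in cell z ℓ 0 z, w y ^ (1 + ε)
          = ∫⁻ y in cell z ℓ 0 z, w y * w y ^ ε := by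
            congr 1 with y
            rw [ENNReal.rpow_add_of_nonneg _ _ zero_le_one hε.le, ENNReal.rpow_one]
        _ ≤ ∫⁻ y in cell z ℓ 0 z, w y * (Λ ^ ε +
              ∑' i : ℕ, (E i).indicator (fun _ => (Λ * K ^ (i + 1)) ^ ε) y) := by
            refine setLIntegral_mono_ae' measurableSet_cell ?_
            filter_upwards [hae] with y hy hyc
            gcongr
            rcases le_or_gt (w y) Λ with h | h
            · exact le_add_right (by gcongr)
            · refine le_add_left ((rpow_le_tsum_indicator hε hK1 hKt h0 hΛt h).trans ?_)
              refine ENNReal.tsum_le_tsum fun i => ?_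
              split_ifs with hi
              · rw [Set.indicator_of_mem]
                by_contra hcon
                exact absurd (hy hyc _ hcon) (not_le.2 hi)
              · exact zero_le
        -- One factor w is absorbed into μ; only w^ε is expanded over the levels, so the decay of
        -- μ(E i) is what matters.
        _ ≤ ∫⁻ y in cell z ℓ 0 z, (Λ ^ ε +
              ∑' i : ℕ, (E i).indicator (fun _ => (Λ * K ^ (i + 1)) ^ ε) y) ∂μ := by
            have hgm : Measurable fun y => Λ ^ ε +
                ∑' i : ℕ, (E i).indicator (fun _ => (Λ * K ^ (i + 1)) ^ ε) y :=
              measurable_const.add (Measurable.tsum fun i => measurable_const.indicator (hEm i))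
            rw [hμ, setLIntegral_withDensity_eq_setLIntegral_mul _ hw hgm measurableSet_cell]
            rfl
        _ = Λ ^ ε * μ (cell z ℓ 0 z) +
              ∑' i : ℕ, (Λ * K ^ (i + 1)) ^ ε * μ (E i) := by
            rw [lintegral_add_left measurable_const, lintegral_const, Measure.restrict_apply_univ,
              lintegral_tsum fun i => (measurable_const.indicator (hEm i)).aemeasurable]
            congr 2 with i
            rw [lintegral_indicator_const (hEm i), Measure.restrict_apply (hEm i),
              Set.inter_eq_self_of_subset_left stopSet_subset]
        _ ≤ Λ ^ ε * μ (cell z ℓ 0 z) +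
              ∑' i : ℕ, (Λ ^ ε * μ (cell z ℓ 0 z)) * (K ^ ε * (K ^ ε * β) ^ i) := by
            refine add_le_add_right (ENNReal.tsum_le_tsum fun i => ?_) _
            refine (mul_le_mul_right (hdecay i) _).trans (le_of_eq ?_)
            rw [ENNReal.mul_rpow_of_nonneg _ _ hε.le, ← ENNReal.rpow_natCast, ← ENNReal.rpow_mul,
              mul_comm _ ε, ENNReal.rpow_mul, ENNReal.rpow_natCast]
            ring
        _ = _ := by
            rw [ENNReal.tsum_mul_left, ENNReal.tsum_mul_left, ENNReal.tsum_geometric, hSg]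
            ring
  have hμcell : μ (cell z ℓ 0 z) ≤ D' * μ (ball z r) := (measure_mono hcellball).trans hdoub
  rw [lintegral_avgMeasure]
  calc (volume (ball z r))⁻¹ * ∫⁻ y in ball z r, w y ^ (1 + ε)
      ≤ (volume (ball z r))⁻¹ * (Sg * ((cN * D' * ∫⁻ y, w y ∂avgMeasure z r) ^ ε *
          (D' * μ (ball z r)))) := by
        gcongr
        exact (lintegral_mono_set hballcell).trans (hmain.trans (by gcongr))
    _ = Sg * ((cN * D') ^ ε * D') * ((∫⁻ y, w y ∂avgMeasure z r) ^ ε *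
          ((volume (ball z r))⁻¹ * μ (ball z r))) := by
        rw [ENNReal.mul_rpow_of_nonneg _ _ hε.le]; ring
    _ = _ := by
        rw [hμball, ← lintegral_avgMeasure, add_comm 1 ε, ENNReal.rpow_add_of_nonneg _ _ hε.le
          zero_le_one, ENNReal.rpow_one]

end ReverseHolder

/-! ### Dual weights and the improvement of the exponent in the A_t condition. -/

section Openness

variable {n : ℕ} {ρ : EuclideanSpace ℝ (Fin n) → ℝ}

/-- A radius function, slowly varying and small compared with both `ρ` and `r`, but not too small
near a ball of radius `r`. -/
lemma IsAdmissible.exists_radius (hρ : IsAdmissible ρ) {δ : ℝ} (hδ : 0 < δ) :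
    ∃ c N : ℝ, 0 < c ∧ 0 ≤ N ∧ ∀ r : ℝ, 0 < r → ∃ η : EuclideanSpace ℝ (Fin n) → ℝ,
      (∀ z, 0 < η z) ∧ (∀ x y, η x ≤ η y + dist x y / 2) ∧ (∀ z, η z ≤ r / 2) ∧
      (∀ z, η z ≤ δ * ρ z) ∧
      ∀ x z, dist x z ≤ 2 * r → 4 * r ≤ c * (1 + r / ρ x) ^ N * η z := by
  obtain ⟨τ, κ, hκ, -, hτρ, hρτ, hlip⟩ := hρ.exists_lipschitz
  obtain ⟨l, C, hl, hC, hgr⟩ := hρ.exists_growth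
  set δ' := min δ (1 / 2) with hδ'
  have hδ'0 : 0 < δ' := lt_min hδ (by norm_num)
  have hτ0 : ∀ z, 0 < τ z := fun z => lt_of_lt_of_le (mul_pos hκ (hρ.pos z)) (hρτ z)
  have hC0 : 0 < C := by linarith
  refine ⟨8 + 4 * (C * 2 ^ l / (δ' * κ)), l + 1, by positivity, by linarith, fun r hr => ?_⟩
  -- Smallness with respect to ρ and r and slope at most 1/2 are built in. Within 2r of x the
  -- Lipschitz radius loses at most a power of 1 + r/ρ(x), by the growth bound for ρ.
  refine ⟨fun z => min (δ' * τ z) (r / 2), fun z => lt_min (mul_pos hδ'0 (hτ0 z)) (by positivity),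
    fun x y => ?_, fun z => min_le_right _ _, fun z => ?_, fun x z hxz => ?_⟩
  · have h1 : δ' * τ x ≤ δ' * τ y + dist x y / 2 := by
      have h2 := mul_le_mul_of_nonneg_left (hlip x y) hδ'0.le
      have h3 : δ' * dist x y ≤ 1 / 2 * dist x y :=
        mul_le_mul_of_nonneg_right (min_le_right _ _) dist_nonneg
      linarith
    rw [← min_add_add_right]
    refine min_le_min h1 ?_
    have : 0 ≤ dist x y := dist_nonneg
    linarith
  · refine (min_le_left _ _).trans ?_
    exact mul_le_mul (min_le_left _ _) (hτρ z) (hτ0 z).le hδ.le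
  · have hx := hρ.pos x
    have hz := hρ.pos z
    have hb : 1 ≤ 1 + r / ρ x := hρ.one_le_base x hr.le
    have hb1 : 1 ≤ (1 + r / ρ x) ^ (l + 1) := Real.one_le_rpow hb (by linarith)
    simp only
    rcases min_choice (δ' * τ z) (r / 2) with h | h
    · rw [h]
      have h1 : ρ x ≤ C * (2 ^ l * (1 + r / ρ x) ^ l) * ρ z := by
        refine (hgr x z).trans ?_
        rw [← Real.mul_rpow (by norm_num) (by linarith)]
        have : dist x z / ρ x ≤ 2 * (r / ρ x) := by
          rw [← mul_div_assoc]; gcongr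
        have h0 : 0 ≤ dist x z / ρ x := by positivity
        gcongr
        linarith
      have h2 : r ≤ (1 + r / ρ x) * ρ x := by
        rw [add_mul, div_mul_cancel₀ _ hx.ne']; linarith
      have h3 : ρ z ≤ κ⁻¹ * τ z := by
        rw [le_inv_mul_iff₀ hκ]; exact hρτ z
      have hp : 0 < (1 + r / ρ x) ^ l := Real.rpow_pos_of_pos (by linarith) _
      calc 4 * r ≤ 4 * ((1 + r / ρ x) * (C * (2 ^ l * (1 + r / ρ x) ^ l) * (κ⁻¹ * τ z))) := by
            gcongr
            refine h2.trans ?_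
            gcongr
            exact h1.trans (by gcongr)
        _ = 4 * (C * 2 ^ l / (δ' * κ)) * ((1 + r / ρ x) ^ (l + 1)) * (δ' * τ z) := by
            rw [Real.rpow_add (by linarith), Real.rpow_one]
            field_simp
        _ ≤ _ := by
            have := hτ0 z
            gcongr
            linarith
    · rw [h]
      have : (8:ℝ) ≤ 8 + 4 * (C * 2 ^ l / (δ' * κ)) := by
        have : 0 < C * 2 ^ l / (δ' * κ) := by positivity
        linarith
      have h8 := mul_le_mul this hb1 zero_le_one (by linarith)
      have h9 := mul_le_mul_of_nonneg_right h8 (by linarith : 0 ≤ r / 2)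
      linarith

/-- A pair of dual weights: `w σ^(t-1) = 1`, both locally integrable, with an `A_t` bound which grows
polynomially with the size of the balls. -/
structure DualWeights (ρ : EuclideanSpace ℝ (Fin n) → ℝ) (t θ : ℝ) (C : ℝ≥0∞)
    (w σ : EuclideanSpace ℝ (Fin n) → ℝ≥0∞) : Prop where
  measurable_left : Measurable w
  measurable_right : Measurable σ
  mul_eq_one : ∀ᵐ x, w x * σ x ^ (t - 1) = 1
  lintegral_left_ne_top : ∀ x r, ∫⁻ y in ball x r, w y ≠ ∞
  lintegral_right_ne_top : ∀ x r, ∫⁻ y in ball x r, σ y ≠ ∞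
  avg_mul_avg_le : ∀ x r, 0 < r →
    (∫⁻ y, w y ∂avgMeasure x r) * (∫⁻ y, σ y ∂avgMeasure x r) ^ (t - 1) ≤ C * psi ρ θ x r

/-- Hölder's inequality for h = (w^{1/t} h)·σ^{(t-1)/t}. It is the only use made of the duality of
the two weights, and it is applied again below with σ^{1+ε} and a smaller exponent. -/
lemma rpow_setLIntegral_le {t : ℝ} (ht : 1 < t) {w σ h : EuclideanSpace ℝ (Fin n) → ℝ≥0∞}
    (hw : Measurable w) (hσ : Measurable σ) (hh : Measurable h)
    (hwσ : ∀ᵐ x, w x * σ x ^ (t - 1) = 1) (S : Set (EuclideanSpace ℝ (Fin n))) :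
    (∫⁻ x in S, h x) ^ t ≤ (∫⁻ x in S, w x * h x ^ t) * (∫⁻ x in S, σ x) ^ (t - 1) := by
  have ht0 : 0 < t := by linarith
  have hconj := Real.HolderConjugate.conjExponent ht
  have hq : Real.conjExponent t = t / (t - 1) := rfl
  have h1 := ENNReal.lintegral_mul_le_Lp_mul_Lq (volume.restrict S) hconj
    (f := fun x => w x ^ t⁻¹ * h x) (g := fun x => σ x ^ ((t - 1) / t))
    ((hw.pow_const _).mul hh).aemeasurable (hσ.pow_const _).aemeasurable
  have e1 : ∫⁻ x in S, h x = ∫⁻ x in S, ((fun x => w x ^ t⁻¹ * h x) *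
      fun x => σ x ^ ((t - 1) / t)) x := by
    refine lintegral_congr_ae (ae_restrict_of_ae ?_)
    filter_upwards [hwσ] with x hx
    rw [Pi.mul_apply, mul_right_comm]
    have : w x ^ t⁻¹ * σ x ^ ((t - 1) / t) = 1 := by
      rw [div_eq_mul_inv, ENNReal.rpow_mul, ← ENNReal.mul_rpow_of_nonneg _ _ (by positivity), hx,
        ENNReal.one_rpow]
    rw [this, one_mul]
  have e2 : ∀ x, (w x ^ t⁻¹ * h x) ^ t = w x * h x ^ t := fun x => by
    rw [ENNReal.mul_rpow_of_nonneg _ _ ht0.le, ← ENNReal.rpow_mul, inv_mul_cancel₀ ht0.ne',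
      ENNReal.rpow_one]
  have e3 : ∀ x, (σ x ^ ((t - 1) / t)) ^ (Real.conjExponent t) = σ x := fun x => by
    rw [← ENNReal.rpow_mul, hq, div_mul_div_cancel₀ ht0.ne', div_self (by linarith),
      ENNReal.rpow_one]
  rw [e1]
  simp_rw [e2, e3] at h1
  calc _ ≤ ((∫⁻ x in S, w x * h x ^ t) ^ (1 / t) * (∫⁻ x in S, σ x) ^ (1 / Real.conjExponent t)) ^ t :=
        ENNReal.rpow_le_rpow h1 ht0.le
    _ = _ := by
        rw [ENNReal.mul_rpow_of_nonneg _ _ ht0.le, ← ENNReal.rpow_mul, ← ENNReal.rpow_mul,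
          one_div_mul_cancel ht0.ne', ENNReal.rpow_one, hq, one_div_div,
          div_mul_cancel₀ _ ht0.ne']

lemma DualWeights.measure_mul_le (hρ : IsAdmissible ρ) {t θ : ℝ} {C : ℝ≥0∞} (ht : 1 < t)
    (hθ : 0 ≤ θ) {w σ : EuclideanSpace ℝ (Fin n) → ℝ≥0∞} (h : DualWeights ρ t θ C w σ)
    {x : EuclideanSpace ℝ (Fin n)} {r : ℝ} (hr : 0 < r) (hrρ : r ≤ ρ x) :
    (∫⁻ y in ball x r, w y) * (∫⁻ y in ball x r, σ y) ^ (t - 1) ≤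
      C * ENNReal.ofReal (2 ^ θ) * volume (ball x r) ^ t := by
  have h1 := h.avg_mul_avg_le x r hr
  have h2 : psi ρ θ x r ≤ ENNReal.ofReal (2 ^ θ) := by
    have := hρ.psi_le_of_le (c := 1) hθ x hr.le (by linarith)
    norm_num at this
    exact this
  rw [setLIntegral_ball_eq_mul_avg x hr, setLIntegral_ball_eq_mul_avg x hr,
    ENNReal.mul_rpow_of_nonneg _ _ (by linarith)]
  calc _ = ((∫⁻ y, w y ∂avgMeasure x r) * (∫⁻ y, σ y ∂avgMeasure x r) ^ (t - 1)) *
        (volume (ball x r) * volume (ball x r) ^ (t - 1)) := by ring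
    _ ≤ C * ENNReal.ofReal (2 ^ θ) * (volume (ball x r) * volume (ball x r) ^ (t - 1)) := by
        exact mul_le_mul_left (h1.trans (mul_le_mul_right h2 _)) _
    _ = _ := by
        congr 1
        nth_rewrite 1 [← ENNReal.rpow_one (volume (ball x r))]
        rw [← ENNReal.rpow_add_of_nonneg _ _ zero_le_one (by linarith)]
        congr 1; ring

/-- Hölder with h = 1 gives |S|^t ≤ w(S) σ(S)^{t-1}; multiply by w(B) and bound σ(S) by σ(B). -/
lemma DualWeights.localAInfty_left (hρ : IsAdmissible ρ) {t θ : ℝ} {C : ℝ≥0∞} (ht : 1 < t)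
    (hθ : 0 ≤ θ) {w σ : EuclideanSpace ℝ (Fin n) → ℝ≥0∞} (h : DualWeights ρ t θ C w σ) :
    LocalAInfty ρ t (C * ENNReal.ofReal (2 ^ θ)) (volume.withDensity w) := by
  intro x r hr hrρ S hS hSm
  have h1 := rpow_setLIntegral_le ht h.measurable_left h.measurable_right
    (measurable_const (a := (1 : ℝ≥0∞))) h.mul_eq_one S
  simp only [lintegral_const, Measure.restrict_apply_univ, one_mul, ENNReal.one_rpow, mul_one] at h1
  rw [withDensity_apply _ measurableSet_ball, withDensity_apply _ hSm]
  calc _ ≤ ((∫⁻ y in S, w y) * (∫⁻ y in S, σ y) ^ (t - 1)) * ∫⁻ y in ball x r, w y := by gcongr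
    _ ≤ ((∫⁻ y in S, w y) * (∫⁻ y in ball x r, σ y) ^ (t - 1)) * ∫⁻ y in ball x r, w y := by
        have : (∫⁻ y in S, σ y) ≤ ∫⁻ y in ball x r, σ y := lintegral_mono_set hS
        gcongr
    _ = ((∫⁻ y in ball x r, w y) * (∫⁻ y in ball x r, σ y) ^ (t - 1)) * ∫⁻ y in S, w y := by ring
    _ ≤ _ := mul_le_mul_left (h.measure_mul_le hρ ht hθ hr hrρ) _

/-- The same computation multiplied by σ(B)^{t-1} and with w(S) bounded by w(B); the root of order t
- 1 is taken at the end. -/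
lemma DualWeights.localAInfty_right (hρ : IsAdmissible ρ) {t θ : ℝ} {C : ℝ≥0∞} (ht : 1 < t)
    (hθ : 0 ≤ θ) {w σ : EuclideanSpace ℝ (Fin n) → ℝ≥0∞} (h : DualWeights ρ t θ C w σ) :
    LocalAInfty ρ (t / (t - 1)) ((C * ENNReal.ofReal (2 ^ θ)) ^ (t - 1)⁻¹)
      (volume.withDensity σ) := by
  intro x r hr hrρ S hS hSm
  have ht1 : 0 < t - 1 := by linarith
  have h1 := rpow_setLIntegral_le ht h.measurable_left h.measurable_right
    (measurable_const (a := (1 : ℝ≥0∞))) h.mul_eq_one S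
  simp only [lintegral_const, Measure.restrict_apply_univ, one_mul, ENNReal.one_rpow, mul_one] at h1
  rw [withDensity_apply _ measurableSet_ball, withDensity_apply _ hSm]
  have h2 : volume S ^ t * (∫⁻ y in ball x r, σ y) ^ (t - 1) ≤
      C * ENNReal.ofReal (2 ^ θ) * volume (ball x r) ^ t * (∫⁻ y in S, σ y) ^ (t - 1) := by
    calc _ ≤ ((∫⁻ y in S, w y) * (∫⁻ y in S, σ y) ^ (t - 1)) *
          (∫⁻ y in ball x r, σ y) ^ (t - 1) := by gcongr
      _ ≤ ((∫⁻ y in ball x r, w y) * (∫⁻ y in S, σ y) ^ (t - 1)) *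
          (∫⁻ y in ball x r, σ y) ^ (t - 1) := by
          have : (∫⁻ y in S, w y) ≤ ∫⁻ y in ball x r, w y := lintegral_mono_set hS
          gcongr
      _ = ((∫⁻ y in ball x r, w y) * (∫⁻ y in ball x r, σ y) ^ (t - 1)) *
          (∫⁻ y in S, σ y) ^ (t - 1) := by ring
      _ ≤ _ := mul_le_mul_left (h.measure_mul_le hρ ht hθ hr hrρ) _
  have h3 := ENNReal.rpow_le_rpow h2 (inv_nonneg.2 ht1.le)
  simpa only [ENNReal.mul_rpow_of_nonneg _ _ (inv_nonneg.2 ht1.le), ← ENNReal.rpow_mul,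
    mul_inv_cancel₀ ht1.ne', ENNReal.rpow_one, ← div_eq_mul_inv] using h3

/-- A weak form, valid for all balls, of the reverse Hölder inequality for the dual weight. -/
lemma avg_rpow_le_of_reverse_holder (hρ : IsAdmissible ρ)
    {σ : EuclideanSpace ℝ (Fin n) → ℝ≥0∞} (hσ : Measurable σ) {ε δ : ℝ} (hε : 0 < ε) (hδ : 0 < δ)
    {C : ℝ≥0∞} (hC : C ≠ ∞)
    (hRH : ∀ (z : EuclideanSpace ℝ (Fin n)) (r : ℝ), 0 < r → r ≤ δ * ρ z →
      ∫⁻ y, σ y ^ (1 + ε) ∂avgMeasure z r ≤ C * (∫⁻ y, σ y ∂avgMeasure z r) ^ (1 + ε)) :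
    ∃ N : ℝ, 0 ≤ N ∧ ∃ C' : ℝ≥0∞, C' ≠ ∞ ∧ ∀ (x : EuclideanSpace ℝ (Fin n)) (r : ℝ), 0 < r →
      ∫⁻ y, σ y ^ (1 + ε) ∂avgMeasure x r ≤
        C' * psi ρ N x r * (∫⁻ y, σ y ∂avgMeasure x (4 * r)) ^ (1 + ε) := by
  obtain ⟨c, N, hc, hN, hrad⟩ := hρ.exists_radius hδ
  refine ⟨N * n * ε, by positivity, ENNReal.ofReal (3 ^ n) * (C * (ENNReal.ofReal (c ^ n) ^ ε *
    (ENNReal.ofReal (3 ^ n) * ENNReal.ofReal (4 ^ n)))), ?_, fun x r hr => ?_⟩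
  · have : ENNReal.ofReal (c ^ n) ^ ε ≠ ∞ := ENNReal.rpow_ne_top_of_nonneg hε.le ENNReal.ofReal_ne_top
    finiteness
  obtain ⟨η, hη0, hηlip, hηr, hηρ, hηc⟩ := hrad r hr
  set A := ∫⁻ y, σ y ∂avgMeasure x (4 * r) with hA
  have hb : 1 ≤ 1 + r / ρ x := hρ.one_le_base x hr.le
  have hη2 : ∀ z ∈ ball x (2 * r), ball z (η z) ⊆ ball x (4 * r) := fun z hz => by
    refine ball_subset_ball' ?_
    rw [mem_ball] at hz
    linarith [hηr z]
  have h1 : ∀ z ∈ ball x (2 * r), ∫⁻ y, σ y ∂avgMeasure z (η z) ≤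
      ENNReal.ofReal (c ^ n) * psi ρ (N * n) x r * A := by
    intro z hz
    have hz' := hz
    rw [mem_ball, dist_comm] at hz'
    have h2 := avg_le_mul_avg (c := c * (1 + r / ρ x) ^ N) (by positivity) (hη0 z)
      (by positivity : 0 < 4 * r) (hηc x z hz'.le) (hη2 z hz) σ
    refine h2.trans (le_of_eq ?_)
    rw [mul_pow, ENNReal.ofReal_mul (by positivity), psi, Real.rpow_mul (by linarith),
      Real.rpow_natCast]
  have h3 : ∫⁻ y in ball x r, σ y ^ (1 + ε) ≤ ENNReal.ofReal (3 ^ n) *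
      (C * ((ENNReal.ofReal (c ^ n) * psi ρ (N * n) x r * A) ^ ε *
        (ENNReal.ofReal (3 ^ n) * ∫⁻ y in ball x (4 * r), σ y))) := by
    calc _ ≤ ENNReal.ofReal (3 ^ n) * ∫⁻ z in ball x (2 * r), ∫⁻ y, σ y ^ (1 + ε)
            ∂avgMeasure z (η z) := by
          refine setLIntegral_le_lintegral_avg_ball hη0 hηlip (hσ.pow_const _) measurableSet_ball
            measurableSet_ball fun z hz => ball_subset_ball' ?_
          rw [mem_ball] at hz
          linarith [hηr z]
      _ ≤ ENNReal.ofReal (3 ^ n) * ∫⁻ z in ball x (2 * r),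
            C * ((ENNReal.ofReal (c ^ n) * psi ρ (N * n) x r * A) ^ ε *
              ∫⁻ y, (ball x (4 * r)).indicator σ y ∂avgMeasure z (η z)) := by
          refine mul_le_mul_right (setLIntegral_mono' measurableSet_ball fun z hz => ?_) _
          have e1 : ∫⁻ y, (ball x (4 * r)).indicator σ y ∂avgMeasure z (η z) =
              ∫⁻ y, σ y ∂avgMeasure z (η z) := by
            rw [lintegral_avgMeasure, lintegral_avgMeasure]
            congr 1
            exact setLIntegral_congr_fun measurableSet_ball fun y hy =>
              Set.indicator_of_mem (hη2 z hz hy) σ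
          rw [e1]
          refine (hRH z (η z) (hη0 z) (hηρ z)).trans (mul_le_mul_right ?_ _)
          -- Of the 1 + ε powers of the small mean, ε are bounded by the mean over B(x, 4r) at
          -- polynomial cost. The remaining one is integrated over the centres.
          rw [add_comm 1 ε, ENNReal.rpow_add_of_nonneg _ _ hε.le zero_le_one, ENNReal.rpow_one]
          exact mul_le_mul_left (ENNReal.rpow_le_rpow (h1 z hz) hε.le) _
      _ ≤ ENNReal.ofReal (3 ^ n) * ∫⁻ z,
            C * ((ENNReal.ofReal (c ^ n) * psi ρ (N * n) x r * A) ^ ε *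
              ∫⁻ y, (ball x (4 * r)).indicator σ y ∂avgMeasure z (η z)) :=
          mul_le_mul_right (setLIntegral_le_lintegral _ _) _
      _ ≤ _ := by
          -- For A = ∞ and C ≠ 0 the right side is infinite; otherwise the constants may be taken
          -- out of the integral.
          rcases eq_or_ne A ∞ with hAt | hAt
          · rcases eq_or_ne C 0 with hC0 | hC0
            · simp [hC0]
            · have h4 : ∫⁻ y in ball x (4 * r), σ y = ∞ := by
                rw [setLIntegral_ball_eq_mul_avg x (by positivity), ← hA, hAt,
                  ENNReal.mul_top (volume_ball_ne_zero x (by positivity))]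
              have h5 : ENNReal.ofReal (c ^ n) * psi ρ (N * n) x r ≠ 0 := by
                refine mul_ne_zero ?_ (hρ.psi_ne_zero _ x hr.le)
                simp only [ne_eq, ENNReal.ofReal_eq_zero, not_le]
                positivity
              have h6 : ENNReal.ofReal (3 ^ n) ≠ 0 := by
                simp only [ne_eq, ENNReal.ofReal_eq_zero, not_le]
                positivity
              rw [h4, hAt, ENNReal.mul_top h5, ENNReal.top_rpow_of_pos hε, ENNReal.mul_top h6,
                ENNReal.top_mul_top, ENNReal.mul_top hC0, ENNReal.mul_top h6]
              exact le_top
          · rw [lintegral_const_mul' _ _ hC, lintegral_const_mul' _ _ (by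
              refine ENNReal.rpow_ne_top_of_nonneg hε.le ?_
              have := psi_ne_top ρ (N * n) x r
              finiteness)]
            refine mul_le_mul_right (mul_le_mul_right (mul_le_mul_right ?_ _) _) _
            rw [← lintegral_indicator measurableSet_ball]
            exact lintegral_avg_ball_le hη0 hηlip (hσ.indicator measurableSet_ball)
  rw [lintegral_avgMeasure]
  have e4 : ∫⁻ y in ball x (4 * r), σ y = ENNReal.ofReal (4 ^ n) * volume (ball x r) * A := by
    rw [setLIntegral_ball_eq_mul_avg x (by positivity), ← hA, volume_ball_mul x x (by norm_num)]
  rw [e4, ENNReal.mul_rpow_of_nonneg _ _ hε.le, ENNReal.mul_rpow_of_nonneg _ _ hε.le,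
    hρ.psi_rpow _ x hr.le] at h3
  have hA1 : A ^ (1 + ε) = A ^ ε * A := by
    rw [add_comm 1 ε, ENNReal.rpow_add_of_nonneg _ _ hε.le zero_le_one, ENNReal.rpow_one]
  calc _ ≤ _ := mul_le_mul_right h3 _
    _ = ((volume (ball x r))⁻¹ * volume (ball x r)) * (ENNReal.ofReal (3 ^ n) *
          (C * (ENNReal.ofReal (c ^ n) ^ ε *
          (ENNReal.ofReal (3 ^ n) * ENNReal.ofReal (4 ^ n)))) * psi ρ (N * n * ε) x r *
          (A ^ ε * A)) := by ring
    _ = _ := by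
        rw [ENNReal.inv_mul_cancel (volume_ball_ne_zero x hr) (volume_ball_ne_top x r), one_mul, hA1]

/-- The maximal function satisfies a weak type condition with an exponent smaller than `t`. -/
theorem DualWeights.exists_weakTypeCondition (hn : 1 ≤ n) (hρ : IsAdmissible ρ) {t θ : ℝ}
    {C : ℝ≥0∞} (ht : 1 < t) (hθ : 0 ≤ θ) (hC : C ≠ ∞)
    {w σ : EuclideanSpace ℝ (Fin n) → ℝ≥0∞} (h : DualWeights ρ t θ C w σ) :
    ∃ u, 1 < u ∧ u < t ∧ ∃ θ', 0 ≤ θ' ∧ ∃ C' : ℝ≥0∞, C' ≠ ∞ ∧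
      WeakTypeCondition ρ θ' u (volume.withDensity w) C' := by
  obtain ⟨κ, hκ, hκ1, hκρ⟩ := hρ.exists_local_comparison
  have ht1 : 0 < t - 1 := by linarith
  obtain ⟨ε, hε, C₁, hC₁, hRH⟩ := (h.localAInfty_right hρ ht hθ).exists_reverse_holder hn hρ hκ1 hκρ
    (by positivity) (ENNReal.rpow_ne_top_of_nonneg (by positivity) (by finiteness))
    h.measurable_right h.lintegral_right_ne_top
  obtain ⟨N, hN, C₂, hC₂, hbig⟩ := avg_rpow_le_of_reverse_holder hρ h.measurable_right hε
    (δ := κ / (64 * (n + 1))) (by positivity) hC₁ fun z r hr hrz => hRH z r hr (by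
      rw [div_mul_eq_mul_div, le_div_iff₀ (by positivity)] at hrz
      linarith)
  -- Chosen so that (1+ε)(u-1) = t-1, which makes σ^{1+ε} the dual weight of w for the exponent u.
  set u := 1 + (t - 1) / (1 + ε) with hu
  have hu0 : 0 < (t - 1) / (1 + ε) := by positivity
  have hut : (1 + ε) * (u - 1) = t - 1 := by rw [hu, add_sub_cancel_left]; field_simp
  have hu1 : 1 < u := by linarith
  have hu2 : u < t := by
    have : (t - 1) / (1 + ε) < t - 1 := div_lt_self ht1 (by linarith)
    linarith
  -- The new growth exponent adds the loss of the weak reverse Hölder inequality, raised to the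
  -- power u - 1, to that of the A_t bound. Both are paid by the factor Ψ^{-u} on the left.
  refine ⟨u, hu1, hu2, N * (u - 1) + θ, by
    have : 0 ≤ u - 1 := by linarith
    positivity, C₂ ^ (u - 1) * (C * ENNReal.ofReal (4 ^ θ) * ENNReal.ofReal (4 ^ n)), ?_, ?_⟩
  · have := ENNReal.rpow_ne_top_of_nonneg (by linarith : 0 ≤ u - 1) hC₂
    finiteness
  intro y r hr f hf
  have hwσ : ∀ᵐ x, w x * (σ x ^ (1 + ε)) ^ (u - 1) = 1 := by
    filter_upwards [h.mul_eq_one] with x hx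
    rw [← ENNReal.rpow_mul, hut, hx]
  have h1 := rpow_setLIntegral_le hu1 h.measurable_left (h.measurable_right.pow_const (1 + ε)) hf hwσ
    (ball y r)
  have h2 : ∫⁻ z in ball y r, f z ^ u ∂volume.withDensity w = ∫⁻ z in ball y r, w z * f z ^ u := by
    rw [setLIntegral_withDensity_eq_setLIntegral_mul _ h.measurable_left (hf.pow_const u)
      measurableSet_ball]
    rfl
  have hu0' : 0 ≤ u - 1 := by linarith
  set θ' := N * (u - 1) + θ with hθ'
  have hθ'0 : 0 ≤ θ' := by positivity
  set V := volume (ball y r) with hV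
  have hV0 : V ≠ 0 := volume_ball_ne_zero y hr
  have hVt : V ≠ ∞ := volume_ball_ne_top y r
  set P := psi ρ θ' y r with hP
  have hP0 : P ≠ 0 := hρ.psi_ne_zero _ y hr.le
  have hPt : P ≠ ∞ := psi_ne_top _ _ _ _
  have hP1 : 1 ≤ P := hρ.one_le_psi hθ'0 y hr.le
  set A := ∫⁻ z, σ z ∂avgMeasure y (4 * r) with hA
  have h3 : (∫⁻ z in ball y r, σ z ^ (1 + ε)) ^ (u - 1) ≤
      V ^ (u - 1) * (C₂ ^ (u - 1) * psi ρ (N * (u - 1)) y r * A ^ (t - 1)) := by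
    rw [setLIntegral_ball_eq_mul_avg y hr, ENNReal.mul_rpow_of_nonneg _ _ hu0']
    refine mul_le_mul_right ((ENNReal.rpow_le_rpow (hbig y r hr) hu0').trans (le_of_eq ?_)) _
    rw [ENNReal.mul_rpow_of_nonneg _ _ hu0', ENNReal.mul_rpow_of_nonneg _ _ hu0',
      hρ.psi_rpow _ y hr.le, ← ENNReal.rpow_mul, hut]
  have h4 : volume.withDensity w (ball y (4 * r)) =
      ENNReal.ofReal (4 ^ n) * V * ∫⁻ z, w z ∂avgMeasure y (4 * r) := by
    rw [withDensity_apply _ measurableSet_ball, setLIntegral_ball_eq_mul_avg y (by positivity),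
      volume_ball_mul y y (by norm_num)]
  have h5 := h.avg_mul_avg_le y (4 * r) (by positivity)
  have h6 : psi ρ θ y (4 * r) ≤ ENNReal.ofReal (4 ^ θ) * psi ρ θ y r :=
    hρ.psi_le_mul hθ (by norm_num) y hr.le (by positivity) le_rfl
  set J := ∫⁻ z in ball y r, w z * f z ^ u with hJ
  rw [h2, lintegral_psiMeasure, ENNReal.mul_rpow_of_nonneg _ _ (by linarith), h4]
  have hVu : V * V ^ (u - 1) = V ^ u := by
    nth_rewrite 1 [← ENNReal.rpow_one V]
    rw [← ENNReal.rpow_add_of_nonneg _ _ zero_le_one hu0']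
    congr 1; ring
  have hPu : P ≤ P ^ u := by
    nth_rewrite 1 [← ENNReal.rpow_one P]
    exact ENNReal.rpow_le_rpow_of_exponent_le hP1 hu1.le
  have hPadd : psi ρ (N * (u - 1)) y r * psi ρ θ y r = P := by
    rw [hP, hθ', hρ.psi_add _ _ y hr.le]
  have hcancel : ((P * V)⁻¹) ^ u * (P ^ u * V ^ u) = 1 := by
    rw [← ENNReal.mul_rpow_of_nonneg _ _ (by linarith), ← ENNReal.mul_rpow_of_nonneg _ _ (by linarith),
      ENNReal.inv_mul_cancel (mul_ne_zero hP0 hV0) (ENNReal.mul_ne_top hPt hVt), ENNReal.one_rpow]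
  calc ((P * V)⁻¹) ^ u * (∫⁻ z in ball y r, f z) ^ u *
        (ENNReal.ofReal (4 ^ n) * V * ∫⁻ z, w z ∂avgMeasure y (4 * r))
      ≤ ((P * V)⁻¹) ^ u * (J * (V ^ (u - 1) * (C₂ ^ (u - 1) * psi ρ (N * (u - 1)) y r *
          A ^ (t - 1)))) * (ENNReal.ofReal (4 ^ n) * V * ∫⁻ z, w z ∂avgMeasure y (4 * r)) := by
        refine mul_le_mul_left (mul_le_mul_right (h1.trans (mul_le_mul_right h3 _)) _) _
    _ = ((P * V)⁻¹) ^ u * (psi ρ (N * (u - 1)) y r * (V * V ^ (u - 1))) * (C₂ ^ (u - 1) *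
          ENNReal.ofReal (4 ^ n) * J) * ((∫⁻ z, w z ∂avgMeasure y (4 * r)) * A ^ (t - 1)) := by ring
    _ ≤ ((P * V)⁻¹) ^ u * (psi ρ (N * (u - 1)) y r * (V * V ^ (u - 1))) * (C₂ ^ (u - 1) *
          ENNReal.ofReal (4 ^ n) * J) * (C * (ENNReal.ofReal (4 ^ θ) * psi ρ θ y r)) :=
        mul_le_mul_right (h5.trans (mul_le_mul_right h6 _)) _
    _ = ((P * V)⁻¹) ^ u * ((psi ρ (N * (u - 1)) y r * psi ρ θ y r) * V ^ u) * (C₂ ^ (u - 1) *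
          (C * ENNReal.ofReal (4 ^ θ) * ENNReal.ofReal (4 ^ n)) * J) := by rw [hVu]; ring
    _ ≤ ((P * V)⁻¹) ^ u * (P ^ u * V ^ u) * (C₂ ^ (u - 1) *
          (C * ENNReal.ofReal (4 ^ θ) * ENNReal.ofReal (4 ^ n)) * J) := by
        rw [hPadd]; gcongr
    _ = _ := by rw [hcancel, one_mul]

end Openness

/-! ### Ingredients of the good-λ argument. -/

section GoodLambda

variable {n : ℕ} {ρ : EuclideanSpace ℝ (Fin n) → ℝ}

/-- Uniform absolute continuity on small balls. -/
def SmallnessCondition (ρ : EuclideanSpace ℝ (Fin n) → ℝ) (κ : ℝ)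
    (μ : Measure (EuclideanSpace ℝ (Fin n))) : Prop :=
  ∀ η : ℝ≥0∞, η ≠ 0 → ∃ γ : ℝ≥0∞, γ ≠ 0 ∧ ∀ (x : EuclideanSpace ℝ (Fin n)) (r : ℝ), 0 < r →
    64 * ((n + 1) * r) ≤ κ * ρ x → ∀ S ⊆ ball x r, MeasurableSet S →
      volume S ≤ γ * volume (ball x r) → μ S ≤ η * μ (ball x r)

lemma smallnessCondition_volume (κ : ℝ) :
    SmallnessCondition ρ κ (volume : Measure (EuclideanSpace ℝ (Fin n))) :=
  fun η hη => ⟨η, hη, fun _ _ _ _ _ _ _ h => h⟩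

/-- Hölder on S gives μ(S)^{1+ε} ≤ (∫_B w^{1+ε}) |S|^ε, and the reverse Hölder inequality turns the
first factor into μ(B)^{1+ε}/|B|^ε. -/
lemma smallnessCondition_of_reverse_holder {κ ε : ℝ} (hε : 0 < ε) {C : ℝ≥0∞} (hC : C ≠ ∞)
    {w : EuclideanSpace ℝ (Fin n) → ℝ≥0∞} (hw : Measurable w)
    (hRH : ∀ (z : EuclideanSpace ℝ (Fin n)) (r : ℝ), 0 < r → 64 * ((n + 1) * r) ≤ κ * ρ z →
      ∫⁻ y, w y ^ (1 + ε) ∂avgMeasure z r ≤ C * (∫⁻ y, w y ∂avgMeasure z r) ^ (1 + ε)) :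
    SmallnessCondition ρ κ (volume.withDensity w) := by
  intro η hη
  obtain ⟨γ, hγ0, hγ⟩ : ∃ γ : ℝ≥0∞, γ ≠ 0 ∧ C * γ ^ ε ≤ η ^ (1 + ε) := by
    have h0 : η ^ (1 + ε) ≠ 0 := by
      rw [ne_eq, ENNReal.rpow_eq_zero_iff]
      rintro (⟨h, -⟩ | ⟨-, h⟩)
      · exact hη h
      · linarith
    refine ⟨(η ^ (1 + ε) / (C + 1)) ^ ε⁻¹, ?_, ?_⟩
    · rw [ne_eq, ENNReal.rpow_eq_zero_iff]
      rintro (⟨h, -⟩ | ⟨-, h⟩)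
      · rw [ENNReal.div_eq_zero_iff] at h
        rcases h with h | h
        · exact h0 h
        · exact ENNReal.add_ne_top.2 ⟨hC, ENNReal.one_ne_top⟩ h
      · exact absurd (inv_pos.2 hε) (not_lt.2 h.le)
    · rw [← ENNReal.rpow_mul, inv_mul_cancel₀ hε.ne', ENNReal.rpow_one, mul_comm]
      refine (mul_le_mul_right (le_self_add (a := C) (b := 1)) _).trans
        (ENNReal.div_mul_cancel (by simp) (by finiteness)).le
  refine ⟨γ, hγ0, fun x r hr hrρ S hS hSm hSγ => ?_⟩
  have h1 := rpow_setLIntegral_le (t := 1 + ε) (by linarith) (w := fun _ => 1) (σ := fun _ => 1)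
    measurable_const measurable_const hw (by simp) S
  simp only [one_mul, lintegral_const, Measure.restrict_apply_univ, add_sub_cancel_left] at h1
  have h2 := hRH x r hr hrρ
  rw [withDensity_apply _ hSm, withDensity_apply _ measurableSet_ball]
  have hε1 : 0 < 1 + ε := by linarith
  rw [← ENNReal.rpow_le_rpow_iff hε1, ENNReal.mul_rpow_of_nonneg _ _ hε1.le]
  set V := volume (ball x r) with hV
  set a := ∫⁻ y, w y ∂avgMeasure x r with ha
  have hVV : V * V ^ ε = V ^ (1 + ε) := by
    rw [ENNReal.rpow_add_of_nonneg _ _ zero_le_one hε.le, ENNReal.rpow_one]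
  calc (∫⁻ y in S, w y) ^ (1 + ε) ≤ (∫⁻ y in S, w y ^ (1 + ε)) * volume S ^ ε := h1
    _ ≤ (∫⁻ y in ball x r, w y ^ (1 + ε)) * (γ * V) ^ ε :=
        mul_le_mul' (lintegral_mono_set hS) (ENNReal.rpow_le_rpow hSγ hε.le)
    _ ≤ (V * (C * a ^ (1 + ε))) * (γ * V) ^ ε := by
        rw [setLIntegral_ball_eq_mul_avg x hr]; gcongr
    _ = (C * γ ^ ε) * (V * V ^ ε * a ^ (1 + ε)) := by
        rw [ENNReal.mul_rpow_of_nonneg _ _ hε.le]; ring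
    _ ≤ η ^ (1 + ε) * (V * V ^ ε * a ^ (1 + ε)) := by gcongr
    _ = _ := by
        rw [setLIntegral_ball_eq_mul_avg x hr, ENNReal.mul_rpow_of_nonneg _ _ hε1.le, hVV]

/-- The estimate on one stopping cell. -/
lemma sum_measure_stopSet_inter_cell_le (hρ : IsAdmissible ρ) {κ : ℝ}
    (hκ1 : κ ≤ 1) (hκ : ∀ x y, dist x y ≤ ρ x → κ * ρ x ≤ ρ y ∧ κ * ρ y ≤ ρ x)
    {t θ : ℝ} (ht : 1 ≤ t) (hθ : 0 ≤ θ)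
    {μ : Measure (EuclideanSpace ℝ (Fin n))}
    {CM : ℝ≥0∞} (hM : ∀ h : EuclideanSpace ℝ (Fin n) → ℝ≥0∞, Measurable h →
      ∫⁻ x, maximalRho ρ θ h x ^ t ∂μ ≤ CM * ∫⁻ x, h x ^ t ∂μ)
    {z x : EuclideanSpace ℝ (Fin n)} {ℓ : ℝ} (hℓ : 0 < ℓ) (hℓρ : 32 * ((n + 1) * ℓ) ≤ κ * ρ z)
    {F g H : EuclideanSpace ℝ (Fin n) → ℝ≥0∞} (hg : Measurable g) (hH : Measurable H)
    {lam K A D η γ q : ℝ≥0∞} (hlam : baseLevel F z ℓ ≤ lam) (hlam0 : lam ≠ 0) (hlam' : lam ≠ ∞)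
    (hK : ENNReal.ofReal (3 ^ n) ≤ K) (hKt : 2 ≤ K ^ t) (hK1 : 1 ≤ K)
    {k : ℕ} (hx : x ∈ cell z ℓ 0 z) (hst : ¬ Stops F z ℓ lam k x) {I : ℕ}
    (hq : q = (2 * ENNReal.ofReal (2 ^ θ))⁻¹)
    (hFgH : ∀ᵐ v, v ∈ ball x (3 * ((n + 1) * ℓ / 2 ^ (k + 1))) → F v ≤ g v + H v)
    (hgle : ∫⁻ v, g v ∂avgMeasure x (3 * ((n + 1) * ℓ / 2 ^ (k + 1))) ≤ γ * lam)
    (hHle : ∫⁻ v in ball x (3 * ((n + 1) * ℓ / 2 ^ (k + 1))), H v ^ t ∂μ ≤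
      A * lam ^ t * μ (ball x (3 * ((n + 1) * ℓ / 2 ^ (k + 1)))))
    (hD : μ (ball x (3 * ((n + 1) * ℓ / 2 ^ (k + 1)))) ≤ D * μ (cell z ℓ (k + 1) x))
    (hsmall : ∀ S ⊆ ball x (3 * ((n + 1) * ℓ / 2 ^ (k + 1))), MeasurableSet S →
      volume S ≤ ENNReal.ofReal (4 ^ n) * q⁻¹ * γ *
        volume (ball x (3 * ((n + 1) * ℓ / 2 ^ (k + 1)))) →
      μ S ≤ η * μ (ball x (3 * ((n + 1) * ℓ / 2 ^ (k + 1)))))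
    (hη : η * D * ∑ j ∈ Finset.range I, (K ^ (j + 1)) ^ t ≤ 1) :
    ∑ j ∈ Finset.range I, (lam * K ^ (j + 1)) ^ t *
        μ (stopSet F z ℓ (lam * K ^ (j + 1)) ∩ cell z ℓ (k + 1) x) ≤
      (1 + 2 * (q⁻¹) ^ t * CM * A * D) * lam ^ t * μ (cell z ℓ (k + 1) x) := by
  set l := (n + 1) * ℓ / 2 ^ (k + 1) with hl
  set B := ball x (3 * l) with hB
  set Q := cell z ℓ (k + 1) x with hQ
  have ht0 : 0 < t := by linarith
  have hN : 0 < (n + 1) * ℓ := by positivity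
  have hl0 : 0 < l := by positivity
  have hlN : l ≤ (n + 1) * ℓ := div_le_self hN.le (one_le_pow₀ (by norm_num))
  have hQB : Q ⊆ B := (cell_subset_ball hℓ).trans (ball_subset_ball (by rw [← hl]; linarith))
  have hQm : MeasurableSet Q := measurableSet_cell
  have hBm : MeasurableSet B := measurableSet_ball
  have h2θ0 : ENNReal.ofReal (2 ^ θ) ≠ 0 := by
    simp only [ne_eq, ENNReal.ofReal_eq_zero, not_le]; positivity
  have hq0 : q ≠ 0 := by rw [hq, ne_eq, ENNReal.inv_eq_zero]; finiteness
  have hqt : q ≠ ∞ := by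
    rw [hq, ne_eq, ENNReal.inv_eq_top]; exact mul_ne_zero (by simp) h2θ0
  have hqq : q⁻¹ = 2 * ENNReal.ofReal (2 ^ θ) := by rw [hq, inv_inv]
  set Mg := maximalRho ρ θ (B.indicator g) with hMg
  set MH := maximalRho ρ θ (B.indicator H) with hMH
  have hxz : dist x z < (n + 1) * ℓ := cell_zero_subset_ball hℓ hx
  have hρz := hρ.pos z
  -- reduction to the maximal functions of the two pieces
  have hsub : ∀ j, stopSet F z ℓ (lam * K ^ (j + 1)) ∩ Q ⊆
      (Q ∩ {v | q * (lam * K ^ (j + 1)) < Mg v}) ∪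
        (Q ∩ {v | q * (lam * K ^ (j + 1)) < MH v}) := by
    rintro j y ⟨hy1, hy2⟩
    set lam' := lam * K ^ (j + 1) with hlam'def
    have hlamK : ENNReal.ofReal (3 ^ n) * lam ≤ lam' := by
      rw [hlam'def, mul_comm]
      refine mul_le_mul_right (hK.trans ?_) _
      calc K = K ^ 1 := (pow_one K).symm
        _ ≤ _ := pow_le_pow_right₀ hK1 (by omega)
    obtain ⟨v, r, h1, h2, h3, h4⟩ := exists_small_ball_of_mem_stopSet hℓ hlam hx hst hlamK hy2 hy1
    have hr0 : 0 < r := pos_of_mem_ball h1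
    have hvx : dist v x < 3 * l := mem_ball.1 (h3 (mem_ball_self hr0))
    have hvz : dist z v ≤ ρ z := by
      have := dist_triangle v x z
      rw [dist_comm z v]
      nlinarith
    have hrv : r ≤ 1 * ρ v := by
      have := (hκ z v hvz).1
      linarith
    have hpsi : psi ρ θ v r ≤ ENNReal.ofReal (2 ^ θ) := by
      have := hρ.psi_le_of_le hθ v hr0.le hrv
      norm_num at this
      exact this
    -- The witnessing ball is smaller than ρ at its centre, so Ψ_θ ≤ 2^θ there. A mean exceeding
    -- lam' thus forces one of the two maximal functions above q lam', with q = 1/(2·2^θ).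
    have h5 : ∫⁻ u, F u ∂avgMeasure v r ≤ ENNReal.ofReal (2 ^ θ) * (Mg y + MH y) := by
      rw [lintegral_avg_eq_mul_psi hρ θ v hr0.le]
      refine mul_le_mul' hpsi ?_
      have h6 : ∫⁻ u, F u ∂psiMeasure ρ θ v r = ∫⁻ u, B.indicator F u ∂psiMeasure ρ θ v r := by
        rw [lintegral_psiMeasure, lintegral_psiMeasure]
        congr 1
        exact setLIntegral_congr_fun measurableSet_ball fun u hu =>
          (Set.indicator_of_mem (h3 hu) F).symm
      rw [h6]
      refine (lintegral_psiMeasure_le_maximalRho _ h1).trans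
        (maximalRho_add_le (hg.indicator hBm) ?_ y)
      filter_upwards [hFgH] with u hu
      by_cases huB : u ∈ B
      · simpa only [Set.indicator_of_mem huB] using hu huB
      · simp only [Set.indicator_of_notMem huB, add_zero, le_refl]
    have h7 : lam' < ENNReal.ofReal (2 ^ θ) * (Mg y + MH y) := h4.trans_le h5
    by_contra hcon
    simp only [Set.mem_union, Set.mem_inter_iff, hy2, true_and, Set.mem_ofPred_eq, not_or,
      not_lt] at hcon
    refine absurd h7 (not_lt.2 ?_)
    calc ENNReal.ofReal (2 ^ θ) * (Mg y + MH y) ≤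
          ENNReal.ofReal (2 ^ θ) * (q * lam' + q * lam') := by
            gcongr; exacts [hcon.1, hcon.2]
      _ = q⁻¹ * q * lam' := by rw [hqq]; ring
      _ = lam' := by rw [ENNReal.inv_mul_cancel hq0 hqt, one_mul]
  -- the first piece
  have hfirst : ∀ j, μ (Q ∩ {v | q * (lam * K ^ (j + 1)) < Mg v}) ≤ η * (D * μ Q) := by
    intro j
    refine le_trans (hsmall _ (Set.inter_subset_left.trans hQB) (hQm.inter
      (measurableSet_lt measurable_const (measurable_maximalRho _ _ _))) ?_)
      (mul_le_mul_right hD _)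
    have hw := (weakTypeCondition_volume hρ hθ).weak_type one_pos (hg.indicator hBm)
      (q * (lam * K ^ (j + 1)))
    simp only [ENNReal.rpow_one] at hw
    rw [lintegral_indicator hBm, setLIntegral_ball_eq_mul_avg x (by positivity)] at hw
    have h1 : q * lam * volume (Q ∩ {v | q * (lam * K ^ (j + 1)) < Mg v}) ≤
        q * lam * (ENNReal.ofReal (4 ^ n) * q⁻¹ * γ * volume B) := by
      calc _ ≤ q * (lam * K ^ (j + 1)) * volume {v | q * (lam * K ^ (j + 1)) < Mg v} := by
            refine mul_le_mul' (mul_le_mul_right ?_ _) (measure_mono Set.inter_subset_right)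
            exact le_mul_of_one_le_right' (one_le_pow₀ hK1)
        _ ≤ _ := hw
        _ ≤ ENNReal.ofReal (4 ^ n) * (volume B * (γ * lam)) := by gcongr
        _ = (q * q⁻¹) * (ENNReal.ofReal (4 ^ n) * (volume B * (γ * lam))) := by
            rw [ENNReal.mul_inv_cancel hq0 hqt, one_mul]
        _ = _ := by ring
    exact (ENNReal.mul_le_mul_iff_right (mul_ne_zero hq0 hlam0) (ENNReal.mul_ne_top hqt hlam')).1 h1
  -- the second piece
  have hsecond : ∑ j ∈ Finset.range I, (lam * K ^ (j + 1)) ^ t *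
      μ (Q ∩ {v | q * (lam * K ^ (j + 1)) < MH v}) ≤
        2 * (q⁻¹) ^ t * CM * (A * lam ^ t * μ B) := by
    have hMHm : Measurable MH := measurable_maximalRho _ _ _
    calc _ ≤ ∑ j ∈ Finset.range I, ∫⁻ v, (q⁻¹) ^ t * (if q * (lam * K) * K ^ j < MH v then
            (q * (lam * K) * K ^ j) ^ t else 0) ∂μ := by
          refine Finset.sum_le_sum fun j _ => ?_
          have e1 : q * (lam * K) * K ^ j = q * (lam * K ^ (j + 1)) := by ring
          have e2 : (lam * K ^ (j + 1)) ^ t = (q⁻¹) ^ t * (q * (lam * K ^ (j + 1))) ^ t := by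
            rw [← ENNReal.mul_rpow_of_nonneg _ _ ht0.le, ← mul_assoc, ENNReal.inv_mul_cancel hq0 hqt,
              one_mul]
          rw [e1, lintegral_const_mul _ (Measurable.ite (measurableSet_lt measurable_const hMHm)
            measurable_const measurable_const)]
          have e3 : ∫⁻ v, (if q * (lam * K ^ (j + 1)) < MH v then
              (q * (lam * K ^ (j + 1))) ^ t else 0) ∂μ =
              (q * (lam * K ^ (j + 1))) ^ t * μ {v | q * (lam * K ^ (j + 1)) < MH v} := by
            rw [← lintegral_indicator_const (measurableSet_lt measurable_const hMHm)]
            congr 1 with v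
            simp only [Set.indicator_apply, Set.mem_ofPred_eq]
          rw [e3, e2, mul_assoc]
          exact mul_le_mul_right (mul_le_mul_right (measure_mono Set.inter_subset_right) _) _
      _ = ∫⁻ v, (q⁻¹) ^ t * ∑ j ∈ Finset.range I, (if q * (lam * K) * K ^ j < MH v then
            (q * (lam * K) * K ^ j) ^ t else 0) ∂μ := by
          rw [← lintegral_finsetSum _ fun j _ => (Measurable.ite (measurableSet_lt measurable_const
            hMHm) measurable_const measurable_const).const_mul _]
          simp_rw [Finset.mul_sum]
      _ ≤ ∫⁻ v, (q⁻¹) ^ t * (2 * MH v ^ t) ∂μ := by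
          gcongr with v
          exact sum_range_rpow_indicator_le ht0 hKt _ _ _
      _ = 2 * (q⁻¹) ^ t * ∫⁻ v, MH v ^ t ∂μ := by
          rw [lintegral_const_mul _ ((hMHm.pow_const t).const_mul 2),
            lintegral_const_mul _ (hMHm.pow_const t)]
          ring
      _ ≤ 2 * (q⁻¹) ^ t * (CM * ∫⁻ v, (B.indicator H v) ^ t ∂μ) := by
          gcongr; exact hM _ (hH.indicator hBm)
      _ = 2 * (q⁻¹) ^ t * CM * ∫⁻ v in B, H v ^ t ∂μ := by
          rw [← mul_assoc]
          congr 1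
          rw [← lintegral_indicator hBm]
          congr 1 with v
          by_cases hv : v ∈ B
          · simp only [Set.indicator_of_mem hv]
          · simp only [Set.indicator_of_notMem hv, ENNReal.zero_rpow_of_pos ht0]
      _ ≤ _ := by gcongr
  calc _ ≤ ∑ j ∈ Finset.range I, ((lam * K ^ (j + 1)) ^ t *
          μ (Q ∩ {v | q * (lam * K ^ (j + 1)) < Mg v}) + (lam * K ^ (j + 1)) ^ t *
          μ (Q ∩ {v | q * (lam * K ^ (j + 1)) < MH v})) := by
        refine Finset.sum_le_sum fun j _ => ?_
        rw [← mul_add]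
        exact mul_le_mul_right ((measure_mono (hsub j)).trans (measure_union_le _ _)) _
    _ ≤ ∑ j ∈ Finset.range I, (lam * K ^ (j + 1)) ^ t * (η * (D * μ Q)) +
          2 * (q⁻¹) ^ t * CM * (A * lam ^ t * (D * μ Q)) := by
        rw [Finset.sum_add_distrib]
        refine add_le_add (Finset.sum_le_sum fun j _ => mul_le_mul_right (hfirst j) _)
          (hsecond.trans (by gcongr))
    _ = (η * D * ∑ j ∈ Finset.range I, (K ^ (j + 1)) ^ t) * (lam ^ t * μ Q) +
          2 * (q⁻¹) ^ t * CM * (A * lam ^ t * (D * μ Q)) := by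
        congr 1
        rw [Finset.mul_sum, Finset.sum_mul]
        refine Finset.sum_congr rfl fun j _ => ?_
        rw [ENNReal.mul_rpow_of_nonneg _ _ ht0.le]
        ring
    -- The g-part costs η D Σ (K^{j+1})^t ≤ 1, because η was allowed to depend on I. The H-part has
    -- a constant free of I.
    _ ≤ 1 * (lam ^ t * μ Q) + 2 * (q⁻¹) ^ t * CM * (A * lam ^ t * (D * μ Q)) := by gcongr
    _ = _ := by ring

/-- Absorption: a sequence dominated, on average over the next `I` terms, by a small multiple of
itself is summable. -/
lemma sum_range_le_of_sum_shift_le {a e : ℕ → ℝ≥0∞} {C : ℝ≥0∞} (hC1 : 1 ≤ C) {I : ℕ}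
    (hI : 2 * C ≤ I) (ha : ∀ i, a i ≠ ∞) (hC : C ≠ ∞)
    (h : ∀ i, ∑ j ∈ Finset.range I, a (i + j + 1) ≤ C * a i + e i) (m : ℕ) :
    ∑ i ∈ Finset.range m, a i ≤
      ∑ i ∈ Finset.range m, e i + I * ∑ i ∈ Finset.range I, a i := by
  set S := ∑ i ∈ Finset.range m, a i with hS
  have hSt : S ≠ ∞ := ENNReal.sum_ne_top.2 fun i _ => ha i
  -- Every shift of the sum misses at most the first I terms.
  have h1 : ∀ j ∈ Finset.range I, S ≤ ∑ i ∈ Finset.range m, a (i + j + 1) +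
      ∑ i ∈ Finset.range I, a i := by
    intro j hj
    rw [Finset.mem_range] at hj
    calc S ≤ ∑ i ∈ Finset.range (m + (j + 1)), a i :=
          Finset.sum_le_sum_of_subset (Finset.range_mono (by omega))
      _ = ∑ i ∈ Finset.range (j + 1), a i + ∑ i ∈ Finset.range m, a (j + 1 + i) := by
          rw [add_comm m, Finset.sum_range_add]
      _ ≤ ∑ i ∈ Finset.range I, a i + ∑ i ∈ Finset.range m, a (i + j + 1) := by
          gcongr with i hi
          · omega
          · exact le_of_eq (by congr 1; omega)
      _ = _ := add_comm _ _
  have h2 : (I : ℝ≥0∞) * S ≤ C * S + (∑ i ∈ Finset.range m, e i +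
      I * ∑ i ∈ Finset.range I, a i) := by
    calc (I : ℝ≥0∞) * S = ∑ j ∈ Finset.range I, S := by simp
      _ ≤ ∑ j ∈ Finset.range I, (∑ i ∈ Finset.range m, a (i + j + 1) +
            ∑ i ∈ Finset.range I, a i) := Finset.sum_le_sum h1
      _ = ∑ i ∈ Finset.range m, ∑ j ∈ Finset.range I, a (i + j + 1) +
            I * ∑ i ∈ Finset.range I, a i := by
          rw [Finset.sum_add_distrib, Finset.sum_comm]; simp
      _ ≤ ∑ i ∈ Finset.range m, (C * a i + e i) + I * ∑ i ∈ Finset.range I, a i := by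
          gcongr with i; exact h i
      _ = _ := by rw [Finset.sum_add_distrib, ← Finset.mul_sum, hS]; ring
  -- Summing over I ≥ 2C shifts counts S at least 2C times on the left against C times on the right.
  -- S is a finite partial sum, so one C S can be cancelled.
  have h3 : C * S + C * S ≤ C * S + (∑ i ∈ Finset.range m, e i +
      I * ∑ i ∈ Finset.range I, a i) := by
    refine le_trans ?_ h2
    rw [← two_mul, ← mul_assoc]
    gcongr
  have h4 := ENNReal.le_of_add_le_add_left (ENNReal.mul_ne_top hC hSt) h3
  exact (le_mul_of_one_le_left' hC1).trans h4

end GoodLambda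

/-! ### The local good-λ theorem. -/

section LocalEstimate

variable {n : ℕ} {ρ : EuclideanSpace ℝ (Fin n) → ℝ}

/-- Layer-cake bound for the cells that are charged to the set where G is large. -/
lemma sum_rpow_mul_measure_lt_le {X : Type*} [MeasurableSpace X] {μ : Measure X} {G : X → ℝ≥0∞}
    (hG : Measurable G) {S : Set X} {K b : ℝ≥0∞} {t : ℝ} (ht : 0 < t) (hK : 2 ≤ K ^ t) (m : ℕ) :
    ∑ i ∈ Finset.range m, (b * K ^ i) ^ t * μ.restrict {x | b * K ^ i < G x} S ≤
      2 * ∫⁻ x in S, G x ^ t ∂μ := by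
  calc _ = ∑ i ∈ Finset.range m, ∫⁻ x in S, (if b * K ^ i < G x then (b * K ^ i) ^ t else 0) ∂μ := by
        refine Finset.sum_congr rfl fun i _ => ?_
        rw [Measure.restrict_apply' (measurableSet_lt measurable_const hG), Set.inter_comm,
          ← Measure.restrict_apply (measurableSet_lt measurable_const hG),
          ← lintegral_indicator_const (measurableSet_lt measurable_const hG)]
        congr 1 with x
        simp only [Set.indicator_apply, Set.mem_ofPred_eq]
    _ = ∫⁻ x in S, ∑ i ∈ Finset.range m, (if b * K ^ i < G x then (b * K ^ i) ^ t else 0) ∂μ :=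
        (lintegral_finsetSum _ fun i _ => Measurable.ite (measurableSet_lt measurable_const hG)
          measurable_const measurable_const).symm
    _ ≤ ∫⁻ x in S, 2 * G x ^ t ∂μ := by
        gcongr with x
        exact sum_range_rpow_indicator_le ht hK _ _ _
    _ = _ := lintegral_const_mul _ (hG.pow_const t)

/-- Local weighted estimate for functions which on small balls split into a part with a small mean
and a part with a higher integrability. -/
theorem exists_local_estimate (hn : 1 ≤ n) (hρ : IsAdmissible ρ) {κ : ℝ} (hκ0 : 0 < κ)
    (hκ1 : κ ≤ 1) (hκ : ∀ x y, dist x y ≤ ρ x → κ * ρ x ≤ ρ y ∧ κ * ρ y ≤ ρ x)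
    {t θ : ℝ} (ht : 1 ≤ t) (hθ : 0 ≤ θ)
    {μ : Measure (EuclideanSpace ℝ (Fin n))} (hμ : μ ≪ volume) (hμfin : ∀ x r, μ (ball x r) ≠ ∞)
    {t₀ : ℝ} (ht₀ : 0 < t₀) {C₀ : ℝ≥0∞} (hC₀ : C₀ ≠ ∞) (hA : LocalAInfty ρ t₀ C₀ μ)
    (hS : SmallnessCondition ρ κ μ)
    {CM : ℝ≥0∞} (hCM : CM ≠ ∞) (hM : ∀ h : EuclideanSpace ℝ (Fin n) → ℝ≥0∞, Measurable h →
      ∫⁻ x, maximalRho ρ θ h x ^ t ∂μ ≤ CM * ∫⁻ x, h x ^ t ∂μ) {A : ℝ≥0∞} (hAt : A ≠ ∞) :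
    ∃ C : ℝ≥0∞, C ≠ ∞ ∧ ∀ (z : EuclideanSpace ℝ (Fin n)) (ℓ : ℝ), 0 < ℓ →
      100 * (n + 1) ^ 2 * ℓ ≤ κ ^ 2 * ρ z →
      ∀ F G : EuclideanSpace ℝ (Fin n) → ℝ≥0∞, Measurable F → Measurable G →
      (∫⁻ y in ball z (32 * ((n + 1) * ℓ)), F y ≠ ∞) →
      (∀ x ∈ ball z ((n + 1) * ℓ), ∫⁻ y, F y ∂avgMeasure z (32 * ((n + 1) * ℓ)) ≤ G x) →
      (∀ x ∈ ball z ((n + 1) * ℓ), ∀ r, 0 < r → r ≤ 2 * ((n + 1) * ℓ) → ∀ lam : ℝ≥0∞, lam ≠ ∞ →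
        (∀ r', r ≤ r' → r' < 8 * ((n + 1) * ℓ) → ∫⁻ y, F y ∂avgMeasure x r' ≤ lam) →
        ∀ x' ∈ ball x r, ∃ g H : EuclideanSpace ℝ (Fin n) → ℝ≥0∞, Measurable g ∧ Measurable H ∧
          (∀ᵐ v, v ∈ ball x r → F v ≤ g v + H v) ∧ ∫⁻ v, g v ∂avgMeasure x r ≤ G x' ∧
          ∫⁻ v in ball x r, H v ^ t ∂μ ≤ A * (lam + G x') ^ t * μ (ball x r)) →
      ∫⁻ y in ball z (ℓ / 2), F y ^ t ∂μ ≤ C * ∫⁻ y in ball z ((n + 1) * ℓ), G y ^ t ∂μ := by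
  have ht0 : 0 < t := by linarith
  set K : ℝ≥0∞ := ENNReal.ofReal (3 ^ n) with hKdef
  have hKt : K ≠ ∞ := ENNReal.ofReal_ne_top
  have hK2 : 2 ≤ K := by
    have h1 : (2:ℝ) ≤ 3 ^ n :=
      calc (2:ℝ) ≤ 3 ^ 1 := by norm_num
        _ ≤ 3 ^ n := pow_le_pow_right₀ (by norm_num) hn
    calc (2 : ℝ≥0∞) = ENNReal.ofReal 2 := by norm_num
      _ ≤ K := ENNReal.ofReal_le_ofReal h1
  have hK1 : 1 < K := lt_of_lt_of_le (by norm_num) hK2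
  have hK0 : K ≠ 0 := (zero_lt_one.trans hK1).ne'
  have hK2t : 2 ≤ K ^ t := by
    calc (2 : ℝ≥0∞) ≤ K ^ (1:ℝ) := by rwa [ENNReal.rpow_one]
      _ ≤ K ^ t := ENNReal.rpow_le_rpow_of_exponent_le hK1.le ht
  set q : ℝ≥0∞ := (2 * ENNReal.ofReal (2 ^ θ))⁻¹ with hq
  have hqinv : q⁻¹ = 2 * ENNReal.ofReal (2 ^ θ) := by rw [hq, inv_inv]
  have hqinvt : q⁻¹ ≠ ∞ := by rw [hqinv]; finiteness
  set D : ℝ≥0∞ := C₀ * cellRatio n ^ t₀ with hD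
  have hDt : D ≠ ∞ := ENNReal.mul_ne_top hC₀
    (ENNReal.rpow_ne_top_of_nonneg ht₀.le (cellRatio_ne_top n))
  set A' : ℝ≥0∞ := A * (K + 1) ^ t with hA'
  have hA't : A' ≠ ∞ := ENNReal.mul_ne_top hAt
    (ENNReal.rpow_ne_top_of_nonneg ht0.le (by finiteness))
  set C₂ : ℝ≥0∞ := 1 + 2 * (q⁻¹) ^ t * CM * A' * D with hC₂
  have hC₂t : C₂ ≠ ∞ := by
    have := ENNReal.rpow_ne_top_of_nonneg ht0.le hqinvt
    finiteness
  -- The order of choices is essential: C₂ does not involve I, then I absorbs C₂, then η is fixed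
  -- from I, and γ from η.
  obtain ⟨I, hI⟩ : ∃ I : ℕ, 2 * C₂ ≤ I := by
    obtain ⟨I, hI⟩ := ENNReal.exists_nat_gt (ENNReal.mul_ne_top (by simp : (2 : ℝ≥0∞) ≠ ∞) hC₂t)
    exact ⟨I, hI.le⟩
  set SI : ℝ≥0∞ := ∑ j ∈ Finset.range I, (K ^ (j + 1)) ^ t with hSI
  have hSIt : SI ≠ ∞ := ENNReal.sum_ne_top.2 fun j _ =>
    ENNReal.rpow_ne_top_of_nonneg ht0.le (ENNReal.pow_ne_top hKt)
  set η : ℝ≥0∞ := (D * SI)⁻¹ with hη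
  have hη0 : η ≠ 0 := by rw [hη, ne_eq, ENNReal.inv_eq_zero]; exact ENNReal.mul_ne_top hDt hSIt
  have hη1 : η * D * SI ≤ 1 := by rw [mul_assoc]; exact ENNReal.inv_mul_le_one _
  obtain ⟨γ₀, hγ₀, hsm⟩ := hS η hη0
  set c₄ : ℝ≥0∞ := ENNReal.ofReal (4 ^ n) * q⁻¹ with hc₄
  have hc₄t : c₄ ≠ ∞ := ENNReal.mul_ne_top ENNReal.ofReal_ne_top hqinvt
  -- c₄ is the weak type (1,1) constant for the maximal function of g at height q lam. Also γ ≤ 1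
  -- lets G(x') be bounded by lam in the estimate of H.
  set γ : ℝ≥0∞ := min 1 (γ₀ / c₄) with hγ
  have hγ0 : γ ≠ 0 := by
    rw [hγ, ne_eq, ← nonpos_iff_eq_zero, min_le_iff, not_or, nonpos_iff_eq_zero,
      nonpos_iff_eq_zero]
    exact ⟨one_ne_zero, by rw [ENNReal.div_eq_zero_iff]; tauto⟩
  have hγ1 : γ ≤ 1 := min_le_left _ _
  have hγt : γ ≠ ∞ := ne_top_of_le_ne_top (by simp) hγ1
  have hγ₀' : c₄ * γ ≤ γ₀ := by
    calc c₄ * γ ≤ c₄ * (γ₀ / c₄) := by gcongr; exact min_le_right _ _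
      _ ≤ γ₀ := ENNReal.mul_div_le
  set cN : ℝ≥0∞ := ENNReal.ofReal ((64 * (n + 1)) ^ n) with hcN
  set PI : ℝ≥0∞ := ∑ i ∈ Finset.range I, (K ^ i) ^ t with hPI
  have hPIt : PI ≠ ∞ := ENNReal.sum_ne_top.2 fun j _ =>
    ENNReal.rpow_ne_top_of_nonneg ht0.le (ENNReal.pow_ne_top hKt)
  refine ⟨cN ^ t + K ^ t * (SI * (γ⁻¹) ^ t * 2 + I * (PI * cN ^ t)), ?_, ?_⟩
  · have h1 := ENNReal.rpow_ne_top_of_nonneg ht0.le (ENNReal.inv_ne_top.2 hγ0)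
    have h2 : cN ^ t ≠ ∞ := ENNReal.rpow_ne_top_of_nonneg ht0.le ENNReal.ofReal_ne_top
    have h3 := ENNReal.rpow_ne_top_of_nonneg ht0.le hKt
    finiteness
  intro z ℓ hℓ hℓρ F G hF hG hFfin hbase hloc
  have hρz := hρ.pos z
  have hN : 0 < (n + 1) * ℓ := by positivity
  have hn0 : (1:ℝ) ≤ n := by exact_mod_cast hn
  have hκ2 : κ ^ 2 * ρ z ≤ κ * ρ z := by
    have : κ ^ 2 ≤ κ := by nlinarith
    gcongr
  have hscale : 32 * ((n + 1) * ℓ) ≤ κ * ρ z := by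
    refine le_trans ?_ (hℓρ.trans hκ2)
    nlinarith
  set Λ := baseLevel F z ℓ with hΛ
  have hΛle : ∀ x ∈ ball z ((n + 1) * ℓ), Λ ≤ cN * G x := fun x hx =>
    mul_le_mul_right (hbase x hx) _
  have hΛt : Λ ≠ ∞ := by
    rw [hΛ, baseLevel, lintegral_avgMeasure]
    exact ENNReal.mul_ne_top ENNReal.ofReal_ne_top (ENNReal.mul_ne_top
      (by simpa using volume_ball_ne_zero z (by positivity)) hFfin)
  have hc0b : cell z ℓ 0 z ⊆ ball z ((n + 1) * ℓ) := cell_zero_subset_ball hℓ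
  have hbb : ball z ((n + 1) * ℓ) ⊆ ball z (32 * ((n + 1) * ℓ)) := ball_subset_ball (by linarith)
  set J := ∫⁻ y in cell z ℓ 0 z, G y ^ t ∂μ with hJ
  have hJle : J ≤ ∫⁻ y in ball z ((n + 1) * ℓ), G y ^ t ∂μ := lintegral_mono_set hc0b
  have hΛJ : Λ ^ t * μ (cell z ℓ 0 z) ≤ cN ^ t * J := by
    rw [hJ, ← lintegral_const_mul _ (hG.pow_const t)]
    calc Λ ^ t * μ (cell z ℓ 0 z) = ∫⁻ _ in cell z ℓ 0 z, Λ ^ t ∂μ := by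
          rw [lintegral_const, Measure.restrict_apply_univ]
      _ ≤ _ := by
          refine setLIntegral_mono' measurableSet_cell fun y hy => ?_
          rw [← ENNReal.mul_rpow_of_nonneg _ _ ht0.le]
          exact ENNReal.rpow_le_rpow (hΛle y (hc0b hy)) ht0.le
  refine le_trans ?_ (mul_le_mul_right hJle _)
  refine (lintegral_mono_set (ball_subset_cell_zero hℓ)).trans ?_
  -- If the base level vanishes then F is zero a.e. on the large ball, and the geometric levels
  -- would degenerate.
  rcases eq_or_ne Λ 0 with h0 | h0
  · have h1 : ∫⁻ y in ball z (32 * ((n + 1) * ℓ)), F y = 0 := by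
      rw [setLIntegral_ball_eq_mul_avg z (by positivity)]
      rw [hΛ, baseLevel, mul_eq_zero] at h0
      rcases h0 with h0 | h0
      · rw [ENNReal.ofReal_eq_zero] at h0
        exact absurd h0 (not_le.2 (by positivity))
      · rw [h0, mul_zero]
    rw [lintegral_eq_zero_iff hF] at h1
    refine le_of_eq_of_le ?_ zero_le
    rw [lintegral_eq_zero_iff (hF.pow_const _)]
    have h2 := ae_restrict_of_ae_restrict_of_subset (hc0b.trans hbb) h1
    filter_upwards [(hμ.restrict _).ae_le h2] with y hy
    rw [hy, Pi.zero_apply, ENNReal.zero_rpow_of_pos ht0]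
  let E : ℕ → Set (EuclideanSpace ℝ (Fin n)) := fun i => stopSet F z ℓ (Λ * K ^ i)
  have hlev : ∀ i, Λ ≤ Λ * K ^ i := fun i => le_mul_of_one_le_right' (one_le_pow₀ hK1.le)
  have hlev0 : ∀ i, Λ * K ^ i ≠ 0 := fun i => mul_ne_zero h0 (pow_ne_zero _ hK0)
  have hlevt : ∀ i, Λ * K ^ i ≠ ∞ := fun i => ENNReal.mul_ne_top hΛt (ENNReal.pow_ne_top hKt)
  have hEm : ∀ i, MeasurableSet (E i) := fun i =>
    (measurableSet_stopSet_and_measure_le (not_stops_zero hn hℓ (hlev i))).1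
  have hcellfin : μ (cell z ℓ 0 z) ≠ ∞ := ne_top_of_le_ne_top (hμfin _ _) (measure_mono hc0b)
  let a : ℕ → ℝ≥0∞ := fun i => (Λ * K ^ i) ^ t * μ (E i)
  have hat : ∀ i, a i ≠ ∞ := fun i => ENNReal.mul_ne_top
    (ENNReal.rpow_ne_top_of_nonneg ht0.le (hlevt i))
    (ne_top_of_le_ne_top hcellfin (measure_mono stopSet_subset))
  let e : ℕ → ℝ≥0∞ := fun i => SI * (γ⁻¹) ^ t *
    ((γ * Λ * K ^ i) ^ t * μ.restrict {v | γ * Λ * K ^ i < G v} (cell z ℓ 0 z))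
  have hstep : ∀ i, ∑ j ∈ Finset.range I, a (i + j + 1) ≤ C₂ * a i + e i := by
    intro i
    set lam := Λ * K ^ i with hlam
    have hlevj : ∀ j, Λ * K ^ (i + j + 1) = lam * K ^ (j + 1) := fun j => by rw [hlam]; ring
    have hEsub : ∀ j, E (i + j + 1) ⊆ E i := fun j => stopSet_anti (by
      gcongr
      · exact hK1.le
      · omega)
    have hsumlam : ∑ j ∈ Finset.range I, (lam * K ^ (j + 1)) ^ t = SI * lam ^ t := by
      rw [hSI, Finset.sum_mul]
      exact Finset.sum_congr rfl fun j _ => by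
        rw [ENNReal.mul_rpow_of_nonneg _ _ ht0.le, mul_comm]
    -- The claim is an inequality between two measures of E i, one summing the restrictions to the
    -- next I stopping sets, the other adding to μ its restriction to {G > γ lam}. It suffices to
    -- prove it on first stopping cells.
    have h1 := (measurableSet_stopSet_and_measure_le (not_stops_zero hn hℓ (hlev i))).2
      (∑ j ∈ Finset.range I, (lam * K ^ (j + 1)) ^ t • μ.restrict (E (i + j + 1)))
      ((C₂ * lam ^ t) • μ + (SI * lam ^ t) • μ.restrict {v | γ * lam < G v}) ?_
    · simp only [Measure.add_apply, Measure.smul_apply, smul_eq_mul, Measure.finsetSum_apply] at h1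
      calc ∑ j ∈ Finset.range I, a (i + j + 1)
          = ∑ j ∈ Finset.range I, (lam * K ^ (j + 1)) ^ t * μ.restrict (E (i + j + 1)) (E i) := by
            refine Finset.sum_congr rfl fun j _ => ?_
            rw [Measure.restrict_apply (hEm i), Set.inter_eq_self_of_subset_right (hEsub j)]
            simp only [a, hlevj]
        _ ≤ _ := h1
        _ ≤ C₂ * lam ^ t * μ (E i) + SI * lam ^ t * μ.restrict {v | γ * lam < G v}
              (cell z ℓ 0 z) := by
            gcongr
            exact stopSet_subset
        _ = _ := by
            have e1 : lam ^ t = (γ⁻¹) ^ t * (γ * lam) ^ t := by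
              rw [← ENNReal.mul_rpow_of_nonneg _ _ ht0.le, ← mul_assoc,
                ENNReal.inv_mul_cancel hγ0 hγt, one_mul]
            have e2 : γ * Λ * K ^ i = γ * lam := by rw [hlam]; ring
            simp only [a, e, e2]
            rw [← hlam]
            nth_rewrite 2 [e1]
            ring
    · intro k x hx hst _
      set Q := cell z ℓ (k + 1) x with hQ
      have hQm : MeasurableSet Q := measurableSet_cell
      simp only [Measure.add_apply, Measure.smul_apply, smul_eq_mul, Measure.finsetSum_apply]
      -- Either the whole cell is charged to {G > γ lam}, or there is a point x' of Q with G(x') ≤ γ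
      -- lam at which the splitting can be used.
      by_cases hcase : ∀ v ∈ Q, γ * lam < G v
      · refine le_add_left ?_
        have hQs : Q ⊆ {v | γ * lam < G v} := hcase
        rw [Measure.restrict_apply hQm, Set.inter_eq_self_of_subset_left hQs, ← hsumlam,
          Finset.sum_mul]
        refine Finset.sum_le_sum fun j _ => mul_le_mul_right ?_ _
        exact Measure.restrict_apply_le _ _
      · push Not at hcase
        obtain ⟨x', hx'Q, hx'⟩ := hcase
        refine le_add_right ?_
        set l := (n + 1) * ℓ / 2 ^ (k + 1) with hl
        have hl0 : 0 < l := by positivity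
        have hlN : l ≤ (n + 1) * ℓ / 2 := by
          have h2k : (1:ℝ) ≤ 2 ^ k := one_le_pow₀ (by norm_num)
          rw [hl, pow_succ, div_le_div_iff₀ (by positivity) (by norm_num)]
          nlinarith
        have hxb := hc0b hx
        have hxz : dist z x ≤ ρ z := by
          have := hxb
          rw [mem_ball, dist_comm] at this
          nlinarith
        have hκx := (hκ z x hxz).1
        have hκx2 : κ ^ 2 * ρ z ≤ κ * ρ x := by
          have := mul_le_mul_of_nonneg_left hκx hκ0.le
          linarith
        have hQB : Q ⊆ ball x (3 * l) :=
          (cell_subset_ball hℓ).trans (ball_subset_ball (by rw [← hl]; linarith))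
        have hvolB : volume (ball x (3 * l)) = cellRatio n * volume Q :=
          volume_ball_eq_cellRatio_mul hℓ (k + 1)
        -- The splitting is taken on B(x, 3l), which contains every ball that can witness a higher
        -- level in Q. Since the parent does not stop, larger concentric means of F are at most K
        -- lam, with K = 3^n.
        obtain ⟨g, H, hg, hH, hFgH, hgle, hHle⟩ := hloc x hxb (3 * l) (by positivity) (by linarith)
          (K * lam) (ENNReal.mul_ne_top hKt (hlevt i)) (fun r' hr1 hr2 =>
            avg_le_of_not_stops hℓ (hlev i) hx hst (by rw [← hl]; linarith)
              (by rw [dist_self]; linarith) hr2) x' (hQB hx'Q)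
        have h2 := sum_measure_stopSet_inter_cell_le (I := I) (A := A') (D := D) (η := η) (γ := γ)
          (K := K) hρ hκ1 hκ ht hθ hM hℓ hscale hg hH (hlev i) (hlev0 i) (hlevt i) le_rfl
          hK2t hK1.le hx hst hq hFgH (hgle.trans hx') ?_ ?_ ?_ hη1
        · refine le_trans (Finset.sum_le_sum fun j _ => ?_) h2
          rw [Measure.restrict_apply hQm, Set.inter_comm]
          simp only [E, hlevj]
          exact le_rfl
        · refine hHle.trans (mul_le_mul_left ?_ _)
          rw [hA', mul_assoc, ← ENNReal.mul_rpow_of_nonneg _ _ ht0.le]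
          refine mul_le_mul_right (ENNReal.rpow_le_rpow ?_ ht0.le) _
          rw [add_mul]
          refine add_le_add le_rfl (hx'.trans ?_)
          gcongr
        · refine hA.measure_ball_le ht₀ (by positivity) ?_ hQB hQm hvolB.le
          have : κ * ρ x ≤ ρ x := by nlinarith [hρ.pos x]
          nlinarith
        · intro S hSB hSm hSle
          refine hsm x (3 * l) (by positivity) ?_ S hSB hSm (hSle.trans ?_)
          · refine le_trans ?_ (hℓρ.trans hκx2)
            have : 64 * ((n + 1) * (3 * l)) ≤ 64 * ((n + 1) * (3 * ((n + 1) * ℓ / 2))) := by gcongr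
            nlinarith
          · exact mul_le_mul_left hγ₀' _
  have hsum : ∑' i, a i ≤ (SI * (γ⁻¹) ^ t * 2 + I * (PI * cN ^ t)) * J := by
    rw [ENNReal.tsum_eq_iSup_nat]
    refine iSup_le fun m => ?_
    -- Absorption leaves the charged terms, summed by the layer-cake bound, and the first I terms,
    -- which are at the base level and hence below G.
    refine (sum_range_le_of_sum_shift_le le_self_add hI hat hC₂t hstep m).trans ?_
    rw [add_mul]
    refine add_le_add ?_ ?_
    · simp only [e]
      rw [← Finset.mul_sum, mul_assoc _ 2]
      exact mul_le_mul_right (sum_rpow_mul_measure_lt_le hG ht0 hK2t m) _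
    · rw [mul_assoc]
      refine mul_le_mul_right ?_ _
      calc ∑ i ∈ Finset.range I, a i ≤ ∑ i ∈ Finset.range I, (K ^ i) ^ t *
            (Λ ^ t * μ (cell z ℓ 0 z)) := by
            refine Finset.sum_le_sum fun i _ => ?_
            simp only [a]
            rw [ENNReal.mul_rpow_of_nonneg _ _ ht0.le, mul_comm (Λ ^ t), mul_assoc]
            gcongr
            exact stopSet_subset
        _ = PI * (Λ ^ t * μ (cell z ℓ 0 z)) := by rw [hPI, Finset.sum_mul]
        _ ≤ PI * (cN ^ t * J) := by gcongr
        _ = _ := by ring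
  have hae := hμ.ae_le (ae_le_of_notMem_stopSet (z := z) hn hℓ hF
    (ne_top_of_le_ne_top hFfin (lintegral_mono_set hbb)))
  calc ∫⁻ y in cell z ℓ 0 z, F y ^ t ∂μ
      ≤ ∫⁻ y in cell z ℓ 0 z, (Λ ^ t +
          ∑' i : ℕ, (E i).indicator (fun _ => (Λ * K ^ (i + 1)) ^ t) y) ∂μ := by
        refine setLIntegral_mono_ae' measurableSet_cell ?_
        filter_upwards [hae] with y hy hyc
        rcases le_or_gt (F y) Λ with h | h
        · exact le_add_right (by gcongr)
        · refine le_add_left ((rpow_le_tsum_indicator ht0 hK1 hKt h0 hΛt h).trans ?_)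
          refine ENNReal.tsum_le_tsum fun i => ?_
          split_ifs with hi
          · rw [Set.indicator_of_mem]
            by_contra hcon
            exact absurd (hy hyc _ hcon) (not_le.2 hi)
          · exact zero_le
    _ = Λ ^ t * μ (cell z ℓ 0 z) + ∑' i : ℕ, (Λ * K ^ (i + 1)) ^ t * μ (E i) := by
        rw [lintegral_add_left measurable_const, lintegral_const, Measure.restrict_apply_univ,
          lintegral_tsum fun i => (measurable_const.indicator (hEm i)).aemeasurable]
        congr 2 with i
        rw [lintegral_indicator_const (hEm i), Measure.restrict_apply (hEm i),
          Set.inter_eq_self_of_subset_left stopSet_subset]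
    _ = Λ ^ t * μ (cell z ℓ 0 z) + K ^ t * ∑' i : ℕ, a i := by
        rw [← ENNReal.tsum_mul_left]
        congr 2 with i
        simp only [a]
        rw [← mul_assoc, ← ENNReal.mul_rpow_of_nonneg _ _ ht0.le]
        congr 2; ring
    _ ≤ cN ^ t * J + K ^ t * ((SI * (γ⁻¹) ^ t * 2 + I * (PI * cN ^ t)) * J) := by gcongr
    _ = _ := by ring

end LocalEstimate

/-! ### John–Nirenberg estimates for BMO adapted to ρ. -/

section BMO

variable {n : ℕ} {ρ : EuclideanSpace ℝ (Fin n) → ℝ} {𝕜 : Type*} [RCLike 𝕜]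
  {b : EuclideanSpace ℝ (Fin n) → 𝕜}

/-- The mean of `b` over the ball `B(x, r)`. -/
def ballMean (b : EuclideanSpace ℝ (Fin n) → 𝕜) (x : EuclideanSpace ℝ (Fin n)) (r : ℝ) : 𝕜 :=
  ⨍ y in ball x r, b y ∂volume

lemma ballMean_eq_integral (b : EuclideanSpace ℝ (Fin n) → 𝕜) (x : EuclideanSpace ℝ (Fin n))
    (r : ℝ) : ballMean b x r = ∫ y, b y ∂avgMeasure x r := by
  simp [ballMean, average, avgMeasure]

lemma integrable_avgMeasure (hb : LocallyIntegrable b volume) (x : EuclideanSpace ℝ (Fin n))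
    {r : ℝ} (hr : 0 < r) : Integrable b (avgMeasure x r) := by
  refine Integrable.smul_measure ?_ (ENNReal.inv_ne_top.2 (volume_ball_ne_zero x hr))
  exact (hb.integrableOn_isCompact (isCompact_closedBall x r)).mono_set ball_subset_closedBall

lemma enorm_ballMean_sub_le (hb : LocallyIntegrable b volume) (x : EuclideanSpace ℝ (Fin n))
    {r : ℝ} (hr : 0 < r) (c : 𝕜) :
    ‖ballMean b x r - c‖ₑ ≤ ∫⁻ y, ‖b y - c‖ₑ ∂avgMeasure x r := by
  have := isProbabilityMeasure_avgMeasure x hr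
  have h1 : ballMean b x r - c = ∫ y, (b y - c) ∂avgMeasure x r := by
    rw [integral_sub (integrable_avgMeasure hb x hr) (integrable_const c), ballMean_eq_integral]
    simp
  rw [h1]
  exact enorm_integral_le_lintegral_enorm _

lemma lintegral_sub_ballMean_le_psi_mul (hρ : IsAdmissible ρ) (θ : ℝ)
    (b : EuclideanSpace ℝ (Fin n) → 𝕜) (x : EuclideanSpace ℝ (Fin n)) {r : ℝ} (hr : 0 < r) :
    ∫⁻ y, ‖b y - ballMean b x r‖ₑ ∂avgMeasure x r ≤ psi ρ θ x r * bmoNorm ρ θ b := by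
  rw [lintegral_avg_eq_mul_psi hρ θ x hr.le]
  refine mul_le_mul_right ?_ _
  exact le_iSup_of_le x (le_iSup_of_le r (le_iSup_of_le hr le_rfl))

lemma enorm_ballMean_sub_ballMean_le (hρ : IsAdmissible ρ) (θ : ℝ)
    (hb : LocallyIntegrable b volume) {x y : EuclideanSpace ℝ (Fin n)} {c r s : ℝ} (hc : 0 < c)
    (hr : 0 < r) (hs : 0 < s) (hsc : s ≤ c * r) (hsub : ball x r ⊆ ball y s) :
    ‖ballMean b x r - ballMean b y s‖ₑ ≤
      ENNReal.ofReal (c ^ n) * (psi ρ θ y s * bmoNorm ρ θ b) :=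
  ((enorm_ballMean_sub_le hb x hr _).trans (avg_le_mul_avg hc hr hs hsc hsub _)).trans
    (mul_le_mul_right (lintegral_sub_ballMean_le_psi_mul hρ θ b y hs) _)

lemma localAInfty_volume (ρ : EuclideanSpace ℝ (Fin n) → ℝ) : LocalAInfty ρ 1 1 volume := by
  intro x r hr hrρ S hS hSm
  simp [mul_comm]

/-- Local higher integrability of functions of bounded mean oscillation. -/
lemma exists_lintegral_sub_ballMean_rpow_le_local (hn : 1 ≤ n) (hρ : IsAdmissible ρ) {κ : ℝ}
    (hκ0 : 0 < κ) (hκ1 : κ ≤ 1) (hκ : ∀ x y, dist x y ≤ ρ x → κ * ρ x ≤ ρ y ∧ κ * ρ y ≤ ρ x)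
    {θ q : ℝ} (hθ : 0 ≤ θ) (hq : 1 < q) :
    ∃ C : ℝ≥0∞, C ≠ ∞ ∧ ∀ b : EuclideanSpace ℝ (Fin n) → 𝕜, Measurable b →
      LocallyIntegrable b volume → ∀ (z : EuclideanSpace ℝ (Fin n)) (ℓ : ℝ), 0 < ℓ →
      100 * (n + 1) ^ 2 * ℓ ≤ κ ^ 2 * ρ z →
      ∫⁻ y, ‖b y - ballMean b z (32 * ((n + 1) * ℓ))‖ₑ ^ q ∂avgMeasure z (ℓ / 2) ≤
        C * bmoNorm ρ θ b ^ q := by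
  obtain ⟨CM, hCM, hM⟩ := (weakTypeCondition_volume hρ le_rfl).strong_type (v := q) hρ le_rfl
    one_pos hq ENNReal.ofReal_ne_top
  obtain ⟨C, hC, h⟩ := exists_local_estimate hn hρ hκ0 hκ1 hκ hq.le le_rfl
    Measure.AbsolutelyContinuous.rfl volume_ball_ne_top one_pos ENNReal.one_ne_top
    (localAInfty_volume ρ) (smallnessCondition_volume κ) hCM hM ENNReal.one_ne_top
  set Cψ := ENNReal.ofReal (2 ^ θ) with hCψ
  have hCψq : Cψ ^ q ≠ ∞ := ENNReal.rpow_ne_top_of_nonneg (by linarith) ENNReal.ofReal_ne_top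
  refine ⟨C * (Cψ ^ q * ENNReal.ofReal ((2 * (n + 1)) ^ n)), by finiteness,
    fun b hb hbi z ℓ hℓ hℓρ => ?_⟩
  have hN : 0 < (n + 1) * ℓ := by positivity
  have hn0 : (1:ℝ) ≤ n := by exact_mod_cast hn
  have hρz := hρ.pos z
  have hκ2 : κ ^ 2 * ρ z ≤ κ * ρ z := by
    have : κ ^ 2 ≤ κ := by nlinarith
    gcongr
  have hscale : 32 * ((n + 1) * ℓ) ≤ κ * ρ z := by
    refine le_trans ?_ (hℓρ.trans hκ2)
    nlinarith
  have hscale' : 32 * ((n + 1) * ℓ) ≤ 1 * ρ z := hscale.trans (by gcongr)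
  have hpsi : ∀ (x : EuclideanSpace ℝ (Fin n)) (r : ℝ), 0 < r → r ≤ 1 * ρ x →
      ∫⁻ y, ‖b y - ballMean b x r‖ₑ ∂avgMeasure x r ≤ Cψ * bmoNorm ρ θ b := fun x r hr hrρ =>
    (lintegral_sub_ballMean_le_psi_mul hρ θ b x hr).trans (mul_le_mul_left
      ((hρ.psi_le_of_le hθ x hr.le hrρ).trans (by rw [hCψ]; norm_num)) _)
  have hm : ∀ c : 𝕜, Measurable fun y => ‖b y - c‖ₑ := fun c => (hb.sub_const c).enorm
  -- F is the oscillation of b about its mean over the large ball and G is a constant multiple of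
  -- the norm.
  have key := h z ℓ hℓ hℓρ (fun y => ‖b y - ballMean b z (32 * ((n + 1) * ℓ))‖ₑ)
    (fun _ => Cψ * bmoNorm ρ θ b) (hm _) measurable_const ?_
    (fun x _ => hpsi z _ (by positivity) hscale') ?_
  · rw [setLIntegral_ball_eq_mul_avg z (by positivity), lintegral_const,
      Measure.restrict_apply_univ] at key
    have hv : volume (ball z ((n + 1) * ℓ)) ≤
        ENNReal.ofReal ((2 * (n + 1)) ^ n) * volume (ball z (ℓ / 2)) :=
      volume_ball_le_mul z z (by positivity) (by linarith)
    rw [← ENNReal.mul_le_mul_iff_right (volume_ball_ne_zero z (half_pos hℓ))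
      (volume_ball_ne_top z (ℓ / 2))]
    refine key.trans ?_
    calc C * ((Cψ * bmoNorm ρ θ b) ^ q * volume (ball z ((n + 1) * ℓ)))
        ≤ C * ((Cψ * bmoNorm ρ θ b) ^ q *
          (ENNReal.ofReal ((2 * (n + 1)) ^ n) * volume (ball z (ℓ / 2)))) := by gcongr
      _ = _ := by
        rw [ENNReal.mul_rpow_of_nonneg _ _ (by linarith : (0:ℝ) ≤ q)]
        ring
  · rw [setLIntegral_ball_eq_mul_avg z (by positivity)]
    have h1 : Integrable (fun y => b y - ballMean b z (32 * ((n + 1) * ℓ)))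
        (avgMeasure z (32 * ((n + 1) * ℓ))) := by
      have := isProbabilityMeasure_avgMeasure z (r := 32 * ((n + 1) * ℓ)) (by positivity)
      exact (integrable_avgMeasure hbi z (by positivity)).sub (integrable_const _)
    exact ENNReal.mul_ne_top (volume_ball_ne_top _ _) h1.2.ne
  · intro x hx r hr hr2 lam hlam hle x' hx'
    have hxz : dist z x ≤ ρ z := by
      rw [mem_ball, dist_comm] at hx
      nlinarith
    have hκx := (hκ z x hxz).1
    -- On a smaller ball, g is the oscillation about its own mean, bounded by the norm. H is the
    -- constant difference of the two means, bounded by the mean of F over that ball and hence by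
    -- lam.
    refine ⟨fun y => ‖b y - ballMean b x r‖ₑ,
      fun _ => ‖ballMean b x r - ballMean b z (32 * ((n + 1) * ℓ))‖ₑ, hm _, measurable_const,
      .of_forall fun v _ => ?_, hpsi x r hr (by linarith), ?_⟩
    · calc _ = ‖(b v - ballMean b x r) +
            (ballMean b x r - ballMean b z (32 * ((n + 1) * ℓ)))‖ₑ := by rw [sub_add_sub_cancel]
        _ ≤ _ := enorm_add_le _ _
    · rw [lintegral_const, Measure.restrict_apply_univ, one_mul]
      refine mul_le_mul_left (ENNReal.rpow_le_rpow ?_ (by linarith)) _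
      exact ((enorm_ballMean_sub_le hbi x hr _).trans
        (hle r le_rfl (by linarith))).trans le_self_add

/-- The John–Nirenberg property of `BMO_θ(ρ)`: the `L^q` oscillation over a ball is controlled by
the norm, up to a power of `1 + r / ρ x`. -/
lemma exists_lintegral_sub_ballMean_rpow_le (hn : 1 ≤ n) (hρ : IsAdmissible ρ) {θ q : ℝ}
    (hθ : 0 ≤ θ) (hq : 1 < q) :
    ∃ C : ℝ≥0∞, C ≠ ∞ ∧ ∃ θ' : ℝ, 0 ≤ θ' ∧ ∀ b : EuclideanSpace ℝ (Fin n) → 𝕜, Measurable b →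
      LocallyIntegrable b volume → ∀ (x : EuclideanSpace ℝ (Fin n)) (r : ℝ), 0 < r →
      ∫⁻ y, ‖b y - ballMean b x r‖ₑ ^ q ∂avgMeasure x r ≤
        C * psi ρ θ' x r * bmoNorm ρ θ b ^ q := by
  obtain ⟨κ, hκ0, hκ1, hκ⟩ := hρ.exists_local_comparison
  obtain ⟨C₁, hC₁, hloc⟩ := exists_lintegral_sub_ballMean_rpow_le_local (𝕜 := 𝕜) hn hρ hκ0 hκ1 hκ
    hθ hq
  obtain ⟨c, N, hc, hN, hrad⟩ := hρ.exists_radius (δ := κ ^ 2 / (200 * (n + 1) ^ 2))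
    (by positivity)
  have hq0 : 0 < q := by linarith
  have hn0 : (1:ℝ) ≤ n := by exact_mod_cast hn
  -- The ball B(z, 32(n+1)·2η(z)) with η(z) ≤ r/2 and z within 2r of x lies in B(x, L r).
  set L : ℝ := 32 * (n + 1) + 2 with hL
  have hL1 : 1 ≤ L := by rw [hL]; linarith
  set C₂ : ℝ≥0∞ := ENNReal.ofReal (L ^ θ) * (ENNReal.ofReal ((L * c) ^ n) +
    ENNReal.ofReal (L ^ n)) with hC₂
  have hC₂q : C₂ ^ q ≠ ∞ := ENNReal.rpow_ne_top_of_nonneg hq0.le (by finiteness)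
  have h2q : (2 : ℝ≥0∞) ^ (q - 1) ≠ ∞ := ENNReal.rpow_ne_top_of_nonneg (by linarith) (by simp)
  refine ⟨ENNReal.ofReal (3 ^ n) * (ENNReal.ofReal (2 ^ n) * (2 ^ (q - 1) * (C₁ + C₂ ^ q))),
    by finiteness, (N * n + θ) * q, by positivity, fun b hb hbi x r hr => ?_⟩
  obtain ⟨η, hη0, hηlip, hηr, hηρ, hη⟩ := hrad r hr
  have hL0 : 0 < L * r := by positivity
  set β := bmoNorm ρ θ b with hβ
  set P := psi ρ (N * n + θ) x r with hP
  have hP1 : 1 ≤ P := hρ.one_le_psi (by positivity) x hr.le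
  -- The local estimate is centred at means over small balls. These differ from the mean over B(x,
  -- r) by a power of 1 + r/ρ(x) times the norm, both being compared with the mean over B(x, L r).
  have hE : ∀ z ∈ ball x (2 * r), ‖ballMean b z (32 * ((n + 1) * (2 * η z))) - ballMean b x r‖ₑ ≤
      C₂ * P * β := by
    intro z hz
    have hz' : dist x z ≤ 2 * r := by rw [dist_comm]; exact (mem_ball.1 hz).le
    have hηz := hη0 z
    have hpL : psi ρ θ x (L * r) ≤ ENNReal.ofReal (L ^ θ) * psi ρ θ x r :=
      hρ.psi_le_mul hθ hL1 x hr.le hL0.le le_rfl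
    have hb1 := hρ.one_le_base x hr.le
    have hb2 : (1:ℝ) ≤ (1 + r / ρ x) ^ N := Real.one_le_rpow hb1 hN
    have e1 := enorm_ballMean_sub_ballMean_le hρ θ hbi (x := z) (y := x)
      (c := L * c * (1 + r / ρ x) ^ N) (r := 32 * ((n + 1) * (2 * η z))) (s := L * r)
      (by positivity) (by positivity) hL0 ?_ ?_
    · have e2 := enorm_ballMean_sub_ballMean_le hρ θ hbi (x := x) (y := x) (c := L) (r := r)
        (s := L * r) (by positivity) hr hL0 le_rfl (ball_subset_ball (by nlinarith))
      have e3 : ENNReal.ofReal ((L * c * (1 + r / ρ x) ^ N) ^ n) =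
          ENNReal.ofReal ((L * c) ^ n) * psi ρ (N * n) x r := by
        rw [mul_pow, ENNReal.ofReal_mul (by positivity), psi, Real.rpow_mul (by linarith),
          Real.rpow_natCast]
      have e4 : (1:ℝ≥0∞) ≤ psi ρ (N * n) x r := hρ.one_le_psi (by positivity) x hr.le
      calc _ = ‖(ballMean b z (32 * ((n + 1) * (2 * η z))) - ballMean b x (L * r)) +
            -(ballMean b x r - ballMean b x (L * r))‖ₑ := by congr 1; ring
        _ ≤ _ + _ := enorm_add_le _ _
        _ ≤ ENNReal.ofReal ((L * c) ^ n) * psi ρ (N * n) x r *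
              ((ENNReal.ofReal (L ^ θ) * psi ρ θ x r) * β) +
            ENNReal.ofReal (L ^ n) * psi ρ (N * n) x r *
              ((ENNReal.ofReal (L ^ θ) * psi ρ θ x r) * β) := by
            rw [enorm_neg]
            refine add_le_add (e1.trans ?_) (e2.trans ?_)
            · rw [e3]; gcongr
            · refine mul_le_mul' (le_mul_of_one_le_right' e4) (by gcongr)
        _ = _ := by
            rw [hC₂, hP, hρ.psi_add _ _ x hr.le]
            ring
    · have h1 := hη x z hz'
      have h2 : 0 ≤ c * (1 + r / ρ x) ^ N * η z := by positivity
      have h3 : L * r ≤ L * (c * (1 + r / ρ x) ^ N * η z) := by gcongr; linarith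
      have h4 : 0 ≤ L * (c * (1 + r / ρ x) ^ N * η z) := by positivity
      calc L * r ≤ L * (c * (1 + r / ρ x) ^ N * η z) * (32 * ((n + 1) * 2)) := by nlinarith
        _ = _ := by ring
    · refine ball_subset_ball' ?_
      have h1 := hηr z
      have h2 := (mem_ball.1 hz).le
      rw [hL]
      nlinarith
  have havg : ∀ z ∈ ball x (2 * r), ∫⁻ y, ‖b y - ballMean b x r‖ₑ ^ q ∂avgMeasure z (η z) ≤
      2 ^ (q - 1) * (C₁ + C₂ ^ q) * P ^ q * β ^ q := by
    intro z hz
    have hp := isProbabilityMeasure_avgMeasure z (hη0 z)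
    set cz := ballMean b z (32 * ((n + 1) * (2 * η z))) with hcz
    have h1 := hloc b hb hbi z (2 * η z) (by linarith [hη0 z]) (by
      have := hηρ z
      rw [div_mul_eq_mul_div, le_div_iff₀ (by positivity)] at this
      linarith)
    rw [mul_div_cancel_left₀ _ (two_ne_zero' ℝ)] at h1
    calc _ ≤ ∫⁻ y, 2 ^ (q - 1) * (‖b y - cz‖ₑ ^ q + (C₂ * P * β) ^ q) ∂avgMeasure z (η z) := by
          refine lintegral_mono fun y => ?_
          refine le_trans ?_ (ENNReal.rpow_add_le_mul_rpow_add_rpow _ _ hq.le)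
          refine ENNReal.rpow_le_rpow ?_ hq0.le
          calc _ = ‖(b y - cz) + (cz - ballMean b x r)‖ₑ := by rw [sub_add_sub_cancel]
            _ ≤ _ := enorm_add_le _ _
            _ ≤ _ := by gcongr; exact hE z hz
      _ = 2 ^ (q - 1) * (∫⁻ y, ‖b y - cz‖ₑ ^ q ∂avgMeasure z (η z) + (C₂ * P * β) ^ q) := by
          rw [lintegral_const_mul' _ _ h2q, lintegral_add_right _ measurable_const]
          simp
      _ ≤ 2 ^ (q - 1) * (C₁ * P ^ q * β ^ q + (C₂ * P * β) ^ q) := by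
          gcongr
          refine h1.trans ?_
          rw [mul_assoc]
          refine mul_le_mul_right (le_mul_of_one_le_left' ?_) _
          exact ENNReal.one_le_rpow hP1 hq0
      _ = _ := by
          rw [ENNReal.mul_rpow_of_nonneg _ _ hq0.le, ENNReal.mul_rpow_of_nonneg _ _ hq0.le]
          ring
  rw [lintegral_avgMeasure, ← ENNReal.mul_le_mul_iff_right (volume_ball_ne_zero x hr)
      (volume_ball_ne_top x r), ← mul_assoc, ENNReal.mul_inv_cancel (volume_ball_ne_zero x hr)
      (volume_ball_ne_top x r), one_mul]
  calc _ ≤ ENNReal.ofReal (3 ^ n) * ∫⁻ z in ball x (2 * r),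
        ∫⁻ y, ‖b y - ballMean b x r‖ₑ ^ q ∂avgMeasure z (η z) :=
        setLIntegral_le_lintegral_avg_ball hη0 hηlip ((hb.sub_const _).enorm.pow_const _)
          measurableSet_ball measurableSet_ball fun y hy => ball_subset_ball' (by
            have := hηr y; have := mem_ball.1 hy; linarith)
    _ ≤ ENNReal.ofReal (3 ^ n) * ∫⁻ z in ball x (2 * r),
          2 ^ (q - 1) * (C₁ + C₂ ^ q) * P ^ q * β ^ q :=
        mul_le_mul_right (setLIntegral_mono' measurableSet_ball havg) _
    _ = ENNReal.ofReal (3 ^ n) * (2 ^ (q - 1) * (C₁ + C₂ ^ q) * P ^ q * β ^ q *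
          (ENNReal.ofReal (2 ^ n) * volume (ball x r))) := by
        rw [lintegral_const, Measure.restrict_apply_univ, volume_ball_mul x x two_pos]
    _ = _ := by
        rw [hP, hρ.psi_rpow _ x hr.le]
        ring

/-- Means over concentric balls differ by at most a multiple of the number of doublings. -/
lemma enorm_ballMean_sub_ballMean_le_succ_mul (hρ : IsAdmissible ρ) {θ : ℝ} (hθ : 0 ≤ θ)
    (hb : LocallyIntegrable b volume) (x : EuclideanSpace ℝ (Fin n)) {r : ℝ} (hr : 0 < r) (m : ℕ) :
    ∀ r', r ≤ r' → r' ≤ 2 ^ m * r → ‖ballMean b x r - ballMean b x r'‖ₑ ≤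
      ENNReal.ofReal (2 ^ n) * (m + 1) * (psi ρ θ x r' * bmoNorm ρ θ b) := by
  induction m with
  | zero =>
    intro r' h1 h2
    rw [le_antisymm h1 (by simpa using h2), sub_self, enorm_zero]
    exact zero_le
  | succ m ih =>
    intro r' h1 h2
    have hr' : 0 < r' := by linarith
    -- Radii need not be dyadic: r' is halved until it is at most 2r, and the last comparison is
    -- direct.
    rcases le_or_gt r' (2 * r) with h | h
    · refine (enorm_ballMean_sub_ballMean_le hρ θ hb two_pos hr hr' h
        (ball_subset_ball h1)).trans ?_
      rw [mul_assoc]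
      exact mul_le_mul_right (le_mul_of_one_le_left' (by simp)) _
    · have h3 := ih (r' / 2) (by linarith) (by rw [pow_succ] at h2; linarith)
      have h4 := enorm_ballMean_sub_ballMean_le hρ θ hb (x := x) (y := x) two_pos (half_pos hr') hr'
        (by linarith) (ball_subset_ball (by linarith))
      have h5 := hρ.psi_mono (le_refl θ) hθ x (half_pos hr').le (half_le_self hr'.le)
      calc _ = ‖(ballMean b x r - ballMean b x (r' / 2)) +
            (ballMean b x (r' / 2) - ballMean b x r')‖ₑ := by rw [sub_add_sub_cancel]
        _ ≤ _ := enorm_add_le _ _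
        _ ≤ ENNReal.ofReal (2 ^ n) * (m + 1) * (psi ρ θ x r' * bmoNorm ρ θ b) +
            ENNReal.ofReal (2 ^ n) * (psi ρ θ x r' * bmoNorm ρ θ b) := by
            refine add_le_add (h3.trans ?_) h4
            gcongr
        _ = _ := by push_cast; ring

/-- The growth is linear in the number of doublings, so the k-th power of the oscillation costs
(m+1)^k. This is the origin of the factor j^k in the summability hypothesis. -/
lemma exists_lintegral_sub_ballMean_rpow_le_succ_mul (hn : 1 ≤ n) (hρ : IsAdmissible ρ) {θ q : ℝ}
    (hθ : 0 ≤ θ) (hq : 1 < q) :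
    ∃ C : ℝ≥0∞, C ≠ ∞ ∧ ∃ θ' : ℝ, 0 ≤ θ' ∧ ∀ b : EuclideanSpace ℝ (Fin n) → 𝕜, Measurable b →
      LocallyIntegrable b volume → ∀ (x : EuclideanSpace ℝ (Fin n)) (r r' : ℝ) (m : ℕ), 0 < r →
      r ≤ r' → r' ≤ 2 ^ m * r →
      ∫⁻ y, ‖b y - ballMean b x r‖ₑ ^ q ∂avgMeasure x r' ≤
        C * psi ρ θ' x r' * ((m + 1) * bmoNorm ρ θ b) ^ q := by
  obtain ⟨C, hC, θ', hθ', h⟩ := exists_lintegral_sub_ballMean_rpow_le (𝕜 := 𝕜) hn hρ hθ hq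
  have hq0 : 0 < q := by linarith
  set D := ENNReal.ofReal (2 ^ n) with hD
  have hDq : D ^ q ≠ ∞ := ENNReal.rpow_ne_top_of_nonneg hq0.le ENNReal.ofReal_ne_top
  have h2q : (2 : ℝ≥0∞) ^ (q - 1) ≠ ∞ := ENNReal.rpow_ne_top_of_nonneg (by linarith) (by simp)
  refine ⟨2 ^ (q - 1) * (C + D ^ q), by finiteness, θ' + θ * q, by positivity,
    fun b hb hbi x r r' m hr h1 h2 => ?_⟩
  have hr' : 0 < r' := by linarith
  have hp := isProbabilityMeasure_avgMeasure x hr'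
  have h3 := enorm_ballMean_sub_ballMean_le_succ_mul hρ hθ hbi x hr m r' h1 h2
  have hm1 : (1:ℝ≥0∞) ≤ m + 1 := by simp
  have ha := hρ.one_le_psi hθ' x hr'.le
  have hc := hρ.one_le_psi (θ := θ * q) (by positivity) x hr'.le
  calc _ ≤ ∫⁻ y, 2 ^ (q - 1) * (‖b y - ballMean b x r'‖ₑ ^ q +
          (D * (m + 1) * (psi ρ θ x r' * bmoNorm ρ θ b)) ^ q) ∂avgMeasure x r' := by
        refine lintegral_mono fun y => ?_
        refine le_trans ?_ (ENNReal.rpow_add_le_mul_rpow_add_rpow _ _ hq.le)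
        refine ENNReal.rpow_le_rpow ?_ hq0.le
        calc _ = ‖(b y - ballMean b x r') - (ballMean b x r - ballMean b x r')‖ₑ := by
              rw [sub_sub_sub_cancel_right]
          _ ≤ _ := enorm_sub_le
          _ ≤ _ := by gcongr
    _ = 2 ^ (q - 1) * (∫⁻ y, ‖b y - ballMean b x r'‖ₑ ^ q ∂avgMeasure x r' +
          (D * (m + 1) * (psi ρ θ x r' * bmoNorm ρ θ b)) ^ q) := by
        rw [lintegral_const_mul' _ _ h2q, lintegral_add_right _ measurable_const]
        simp
    _ ≤ 2 ^ (q - 1) * (C * psi ρ θ' x r' * bmoNorm ρ θ b ^ q +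
          (D * (m + 1) * (psi ρ θ x r' * bmoNorm ρ θ b)) ^ q) := by
        gcongr
        exact h b hb hbi x r' hr'
    _ ≤ 2 ^ (q - 1) * (C * (psi ρ θ' x r' * psi ρ (θ * q) x r') * ((m + 1) * bmoNorm ρ θ b) ^ q +
          D ^ q * (psi ρ θ' x r' * psi ρ (θ * q) x r') * ((m + 1) * bmoNorm ρ θ b) ^ q) := by
        refine mul_le_mul_right (add_le_add ?_ ?_) _
        · gcongr
          · exact le_mul_of_one_le_right' hc
          · exact le_mul_of_one_le_left' hm1
        · calc _ = D ^ q * psi ρ (θ * q) x r' * ((m + 1) * bmoNorm ρ θ b) ^ q := by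
                rw [← hρ.psi_rpow _ x hr'.le, ← ENNReal.mul_rpow_of_nonneg _ _ hq0.le,
                  ← ENNReal.mul_rpow_of_nonneg _ _ hq0.le]
                congr 1; ring
            _ ≤ _ := by
                gcongr
                exact le_mul_of_one_le_left' ha
    _ = _ := by rw [hρ.psi_add _ _ x hr'.le]; ring

end BMO

/-! ### Averages of powers of the oscillation times a function, bounded by a maximal function. -/

section OscillationMaximal

variable {n : ℕ} {ρ : EuclideanSpace ℝ (Fin n) → ℝ} {𝕜 : Type*} [RCLike 𝕜]

lemma eLpNorm_psiMeasure (hρ : IsAdmissible ρ) (θ : ℝ) {p : ℝ≥0} (hp : p ≠ 0)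
    (x : EuclideanSpace ℝ (Fin n)) {r : ℝ} (hr : 0 ≤ r) {ε : Type*} [ENorm ε]
    (f : EuclideanSpace ℝ (Fin n) → ε) :
    eLpNorm f p (psiMeasure ρ θ x r) =
      (psi ρ (θ * (1 / p)) x r)⁻¹ * eLpNorm f p (avgMeasure x r) := by
  rw [eLpNorm_nnreal_eq_lintegral hp, eLpNorm_nnreal_eq_lintegral hp,
    lintegral_psiMeasure_eq hρ θ x hr, ENNReal.mul_rpow_of_nonneg _ _ (by positivity),
    ENNReal.inv_rpow, hρ.psi_rpow _ x hr]

lemma eLpNorm_psiMeasure_le (hρ : IsAdmissible ρ) {θ : ℝ} (hθ : 0 ≤ θ) {p : ℝ≥0} (hp : p ≠ 0)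
    (x : EuclideanSpace ℝ (Fin n)) {r : ℝ} (hr : 0 ≤ r) {ε : Type*} [ENorm ε]
    (f : EuclideanSpace ℝ (Fin n) → ε) :
    eLpNorm f p (psiMeasure ρ θ x r) ≤ eLpNorm f p (avgMeasure x r) := by
  rw [eLpNorm_psiMeasure hρ θ hp x hr]
  refine mul_le_of_le_one_left' ?_
  rw [ENNReal.inv_le_one]
  exact hρ.one_le_psi (by positivity) x hr

lemma eLpNorm_avgMeasure_eq (hρ : IsAdmissible ρ) (θ : ℝ) {p : ℝ≥0} (hp : p ≠ 0)
    (x : EuclideanSpace ℝ (Fin n)) {r : ℝ} (hr : 0 ≤ r) {ε : Type*} [ENorm ε]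
    (f : EuclideanSpace ℝ (Fin n) → ε) :
    eLpNorm f p (avgMeasure x r) =
      psi ρ (θ * (1 / p)) x r * eLpNorm f p (psiMeasure ρ θ x r) := by
  rw [eLpNorm_psiMeasure hρ θ hp x hr, ← mul_assoc, ENNReal.mul_inv_cancel
    (hρ.psi_ne_zero _ x hr) (psi_ne_top _ _ _ _), one_mul]

/-- The maximal operator `h ↦ (M_θ h^q)^(1/q)`. -/
def maximalPow (ρ : EuclideanSpace ℝ (Fin n) → ℝ) (θ q : ℝ) (h : EuclideanSpace ℝ (Fin n) → ℝ≥0∞)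
    (x : EuclideanSpace ℝ (Fin n)) : ℝ≥0∞ :=
  maximalRho ρ θ (fun y => h y ^ q) x ^ (1 / q)

lemma measurable_maximalPow (ρ : EuclideanSpace ℝ (Fin n) → ℝ) (θ q : ℝ)
    (h : EuclideanSpace ℝ (Fin n) → ℝ≥0∞) : Measurable (maximalPow ρ θ q h) :=
  (measurable_maximalRho ρ θ _).pow_const _

/-- Weighted averages of powers of the oscillation of `b` are controlled by a maximal function. -/
lemma exists_eLpNorm_oscillation_mul_le_of_exponent (hn : 1 ≤ n) (hρ : IsAdmissible ρ) {p₀ : ℝ≥0}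
    (hp₀ : 1 ≤ p₀) {s θ₁ θ' : ℝ} (hs : 1 < s) (hθ₁ : 0 ≤ θ₁) (hθ' : 0 ≤ θ') (e : ℕ) :
    ∃ C : ℝ≥0∞, C ≠ ∞ ∧ ∃ Θ₀ : ℝ, ∀ Θ, Θ₀ ≤ Θ → ∀ b : EuclideanSpace ℝ (Fin n) → 𝕜,
      Measurable b → LocallyIntegrable b volume → ∀ h : EuclideanSpace ℝ (Fin n) → ℝ≥0∞,
      Measurable h → ∀ (x : EuclideanSpace ℝ (Fin n)) (r r' : ℝ) (m : ℕ), 0 < r → r ≤ r' →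
      r' ≤ 2 ^ m * r → ∀ x' ∈ ball x r,
      eLpNorm (fun y => ‖b y - ballMean b x r‖ₑ ^ e * h y) p₀ (psiMeasure ρ Θ x r') ≤
        C * ((m + 1) * bmoNorm ρ θ₁ b) ^ e * maximalPow ρ θ' (p₀ * s) h x' := by
  have hp0 : (0:ℝ) < p₀ := by exact_mod_cast one_pos.trans_le hp₀
  have hp1 : (1:ℝ) ≤ p₀ := by exact_mod_cast hp₀
  have hs1 : 0 < s - 1 := by linarith
  -- Hölder with 1/p₀ = 1/q + 1/(p₀ s): the oscillation goes into L^q by John–Nirenberg, the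
  -- function h into L^{p₀ s}.
  set q : ℝ := p₀ * (s / (s - 1)) with hq
  have hq1 : 1 < q := by
    have : 1 < s / (s - 1) := by rw [lt_div_iff₀ hs1]; linarith
    nlinarith
  have hps : (p₀:ℝ) < p₀ * s := by nlinarith
  have hconj : 1 / (p₀:ℝ) = 1 / q + 1 / (p₀ * s) := by
    rw [hq]; field_simp; ring
  have hosc : ∃ C : ℝ≥0∞, C ≠ ∞ ∧ ∃ θ₂ : ℝ, 0 ≤ θ₂ ∧ ∀ b : EuclideanSpace ℝ (Fin n) → 𝕜,
      Measurable b → LocallyIntegrable b volume → ∀ (x : EuclideanSpace ℝ (Fin n)) (r r' : ℝ)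
      (m : ℕ), 0 < r → r ≤ r' → r' ≤ 2 ^ m * r →
      (∫⁻ y, (‖b y - ballMean b x r‖ₑ ^ e) ^ q ∂avgMeasure x r') ^ (1 / q) ≤
        C * psi ρ θ₂ x r' * ((m + 1) * bmoNorm ρ θ₁ b) ^ e := by
    -- For e = 0 the exponent e q would not exceed 1, and the factor is 1 anyway.
    rcases Nat.eq_zero_or_pos e with rfl | he
    · refine ⟨1, by simp, 0, le_rfl, fun b hb hbi x r r' m hr h1 h2 => ?_⟩
      have := isProbabilityMeasure_avgMeasure x (hr.trans_le h1)
      simp [psi_zero]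
    · have he1 : (1:ℝ) ≤ e := by exact_mod_cast he
      obtain ⟨C, hC, θ₂, hθ₂, h⟩ := exists_lintegral_sub_ballMean_rpow_le_succ_mul (𝕜 := 𝕜)
        (q := e * q) hn hρ hθ₁ (by nlinarith)
      refine ⟨C ^ (1 / q), ENNReal.rpow_ne_top_of_nonneg (by positivity) hC, θ₂ * (1 / q),
        by positivity, fun b hb hbi x r r' m hr h1 h2 => ?_⟩
      have h3 := ENNReal.rpow_le_rpow (h b hb hbi x r r' m hr h1 h2)
        (by positivity : 0 ≤ 1 / q)
      rw [ENNReal.mul_rpow_of_nonneg _ _ (by positivity),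
        ENNReal.mul_rpow_of_nonneg _ _ (by positivity), hρ.psi_rpow _ x (hr.trans_le h1).le,
        ← ENNReal.rpow_mul] at h3
      have e1 : (e:ℝ) * q * (1 / q) = e := by field_simp
      rw [e1, ENNReal.rpow_natCast] at h3
      refine le_of_eq_of_le ?_ h3
      simp_rw [ENNReal.rpow_mul, ENNReal.rpow_natCast]
  obtain ⟨C, hC, θ₂, hθ₂, hosc⟩ := hosc
  -- Threshold at which Ψ^{-Θ/p₀} pays both for John–Nirenberg and for passing to the maximal
  -- function. The assumptions on T are later used at such a Θ.
  refine ⟨C, hC, p₀ * (θ₂ + θ' * (1 / (p₀ * s))), fun Θ hΘ b hb hbi h hh x r r' m hr h1 h2 x' hx' =>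
    ?_⟩
  have hr' : 0 < r' := hr.trans_le h1
  rw [eLpNorm_psiMeasure hρ Θ (by positivity) x hr'.le,
    eLpNorm_nnreal_eq_lintegral (by positivity)]
  simp only [enorm_eq_self]
  have hH := ENNReal.lintegral_Lp_mul_le_Lq_mul_Lr (q := q) (r := p₀ * s) hp0
    (by rw [hq]; have : 1 < s / (s - 1) := (by rw [lt_div_iff₀ hs1]; linarith)
        nlinarith) hconj (avgMeasure x r')
    (f := fun y => ‖b y - ballMean b x r‖ₑ ^ e) (g := h)
    ((hb.sub_const _).enorm.pow_const _).aemeasurable hh.aemeasurable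
  have h3 : (∫⁻ y, h y ^ (p₀ * s) ∂avgMeasure x r') ^ (1 / (p₀ * s)) ≤
      psi ρ (θ' * (1 / (p₀ * s))) x r' * maximalPow ρ θ' (p₀ * s) h x' := by
    rw [lintegral_avg_eq_mul_psi hρ θ' x hr'.le, ENNReal.mul_rpow_of_nonneg _ _ (by positivity),
      hρ.psi_rpow _ x hr'.le]
    refine mul_le_mul_right (ENNReal.rpow_le_rpow ?_ (by positivity)) _
    exact lintegral_psiMeasure_le_maximalRho _ (ball_subset_ball h1 hx')
  set a := psi ρ (Θ * (1 / p₀)) x r' with ha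
  have h4 : psi ρ θ₂ x r' * psi ρ (θ' * (1 / (p₀ * s))) x r' ≤ a := by
    rw [← hρ.psi_add _ _ x hr'.le]
    refine hρ.psi_mono ?_ (by positivity) x hr'.le le_rfl
    rw [mul_one_div Θ, le_div_iff₀ hp0]
    linarith
  calc _ ≤ a⁻¹ * ((C * psi ρ θ₂ x r' * ((m + 1) * bmoNorm ρ θ₁ b) ^ e) *
        (psi ρ (θ' * (1 / (p₀ * s))) x r' * maximalPow ρ θ' (p₀ * s) h x')) := by
        refine mul_le_mul_right (hH.trans ?_) _
        exact mul_le_mul' (hosc b hb hbi x r r' m hr h1 h2) h3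
    _ = a⁻¹ * (psi ρ θ₂ x r' * psi ρ (θ' * (1 / (p₀ * s))) x r') *
        (C * ((m + 1) * bmoNorm ρ θ₁ b) ^ e * maximalPow ρ θ' (p₀ * s) h x') := by ring
    _ ≤ a⁻¹ * a * (C * ((m + 1) * bmoNorm ρ θ₁ b) ^ e * maximalPow ρ θ' (p₀ * s) h x') := by
        gcongr
    _ ≤ _ := mul_le_of_le_one_left' (ENNReal.inv_mul_le_one _)

/-- Uniformity over the exponents up to k: sums dominate the finitely many constants and thresholds,
and the summand 1 makes Θ positive. -/
lemma exists_eLpNorm_oscillation_mul_le (hn : 1 ≤ n) (hρ : IsAdmissible ρ) {p₀ : ℝ≥0}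
    (hp₀ : 1 ≤ p₀) {s θ₁ θ' : ℝ} (hs : 1 < s) (hθ₁ : 0 ≤ θ₁) (hθ' : 0 ≤ θ') (k : ℕ) :
    ∃ C : ℝ≥0∞, C ≠ ∞ ∧ ∃ Θ : ℝ, 0 < Θ ∧ ∀ e ≤ k, ∀ b : EuclideanSpace ℝ (Fin n) → 𝕜,
      Measurable b → LocallyIntegrable b volume → ∀ h : EuclideanSpace ℝ (Fin n) → ℝ≥0∞,
      Measurable h → ∀ (x : EuclideanSpace ℝ (Fin n)) (r r' : ℝ) (m : ℕ), 0 < r → r ≤ r' →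
      r' ≤ 2 ^ m * r → ∀ x' ∈ ball x r,
      eLpNorm (fun y => ‖b y - ballMean b x r‖ₑ ^ e * h y) p₀ (psiMeasure ρ Θ x r') ≤
        C * ((m + 1) * bmoNorm ρ θ₁ b) ^ e * maximalPow ρ θ' (p₀ * s) h x' := by
  choose C hC Θ hΘ using exists_eLpNorm_oscillation_mul_le_of_exponent (𝕜 := 𝕜) hn hρ hp₀ hs hθ₁ hθ'
  refine ⟨∑ e ∈ Finset.range (k + 1), C e, ENNReal.sum_ne_top.2 fun e _ => hC e,
    1 + ∑ e ∈ Finset.range (k + 1), |Θ e|, ?_, fun e he b hb hbi h hh x r r' m hr h1 h2 x' hx' => ?_⟩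
  · have := Finset.sum_nonneg fun e (_ : e ∈ Finset.range (k + 1)) => abs_nonneg (Θ e)
    linarith
  · have hmem : e ∈ Finset.range (k + 1) := by simp; omega
    have h3 := Finset.single_le_sum (fun i _ => abs_nonneg (Θ i)) hmem
    refine (hΘ e _ ?_ b hb hbi h hh x r r' m hr h1 h2 x' hx').trans ?_
    · linarith [le_abs_self (Θ e)]
    · gcongr
      exact Finset.single_le_sum (fun i _ => zero_le) hmem

end OscillationMaximal

/-! ### Pointwise definition and algebra of commutators of a sublinear operator. -/

section Commutator

variable {n : ℕ} {𝕜 : Type*} [RCLike 𝕜] {p₀ : ℝ≥0}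
  {T : Lp (α := EuclideanSpace ℝ (Fin n)) 𝕜 (p₀ : ℝ≥0∞) volume →
    Lp (α := EuclideanSpace ℝ (Fin n)) 𝕜 (p₀ : ℝ≥0∞) volume}
  {b f : EuclideanSpace ℝ (Fin n) → 𝕜}
  {P : ℕ → Lp (α := EuclideanSpace ℝ (Fin n)) 𝕜 (p₀ : ℝ≥0∞) volume}

lemma Lp.coeFn_sum_smul {ι : Type*} (s : Finset ι) (a : ι → 𝕜)
    (g : ι → Lp (α := EuclideanSpace ℝ (Fin n)) 𝕜 (p₀ : ℝ≥0∞) volume) :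
    ∀ᵐ x, (∑ i ∈ s, a i • g i : Lp 𝕜 (p₀ : ℝ≥0∞) volume) x = ∑ i ∈ s, a i * g i x := by
  classical
  induction s using Finset.induction_on with
  | empty => exact .of_forall fun x => by simp
  | insert j s hj ih =>
    rw [Finset.sum_insert hj]
    filter_upwards [ih, Lp.coeFn_add (a j • g j) (∑ i ∈ s, a i • g i), Lp.coeFn_smul (a j) (g j)]
      with x h1 h2 h3
    rw [h2, Pi.add_apply, h1, h3, Finset.sum_insert hj]
    simp

lemma IsBoundedSublinear.nnnorm_sum_smul_le (hT : IsBoundedSublinear T) {ι : Type*} (s : Finset ι)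
    (a : ι → 𝕜) (g : ι → Lp (α := EuclideanSpace ℝ (Fin n)) 𝕜 (p₀ : ℝ≥0∞) volume) :
    ∀ᵐ x, ‖T (∑ i ∈ s, a i • g i) x‖₊ ≤ ∑ i ∈ s, ‖a i‖₊ * ‖T (g i) x‖₊ := by
  classical
  induction s using Finset.induction_on with
  | empty =>
    filter_upwards [hT.norm_smul 0 0] with x hx
    rw [zero_smul, norm_zero, zero_mul, norm_eq_zero] at hx
    simp [hx]
  | insert j s hj ih =>
    rw [Finset.sum_insert hj]
    filter_upwards [ih, hT.norm_add_le (a j • g j) (∑ i ∈ s, a i • g i), hT.norm_smul (a j) (g j)]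
      with x h1 h2 h3
    rw [Finset.sum_insert hj]
    rw [h3] at h2
    refine le_trans (b := ‖a j‖₊ * ‖T (g j) x‖₊ + ‖T (∑ i ∈ s, a i • g i) x‖₊) ?_ (by gcongr)
    exact_mod_cast h2

lemma IsBoundedSublinear.nnnorm_add_sum_smul_le (hT : IsBoundedSublinear T) {ι : Type*}
    (s : Finset ι) (a : ι → 𝕜)
    (g : ι → Lp (α := EuclideanSpace ℝ (Fin n)) 𝕜 (p₀ : ℝ≥0∞) volume)
    {u v : Lp (α := EuclideanSpace ℝ (Fin n)) 𝕜 (p₀ : ℝ≥0∞) volume}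
    (h : u = v + ∑ i ∈ s, a i • g i) :
    ∀ᵐ x, ‖T u x‖₊ ≤ ‖T v x‖₊ + ∑ i ∈ s, ‖a i‖₊ * ‖T (g i) x‖₊ := by
  filter_upwards [hT.norm_add_le v (∑ i ∈ s, a i • g i), hT.nnnorm_sum_smul_le s a g] with x h1 h2
  rw [h]
  refine le_trans (b := ‖T v x‖₊ + ‖T (∑ i ∈ s, a i • g i) x‖₊) (by exact_mod_cast h1) ?_
  gcongr

/-- The element `(c - b)^k f` of `L^{p₀}`, where `P m = b^m f`. -/
def commArg (P : ℕ → Lp (α := EuclideanSpace ℝ (Fin n)) 𝕜 (p₀ : ℝ≥0∞) volume) (k : ℕ) (c : 𝕜) :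
    Lp (α := EuclideanSpace ℝ (Fin n)) 𝕜 (p₀ : ℝ≥0∞) volume :=
  ∑ m ∈ Finset.range (k + 1), ((-1) ^ m * c ^ (k - m) * (k.choose m : 𝕜)) • P m

/-- `P m` represents `b^m f` for all `m`. -/
def IsPowerFamily (b f : EuclideanSpace ℝ (Fin n) → 𝕜)
    (P : ℕ → Lp (α := EuclideanSpace ℝ (Fin n)) 𝕜 (p₀ : ℝ≥0∞) volume) : Prop :=
  ∀ m, ∀ᵐ x, P m x = b x ^ m * f x

lemma IsPowerFamily.commArg_ae (hP : IsPowerFamily b f P) (k : ℕ) (c : 𝕜) :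
    ∀ᵐ x, commArg P k c x = (c - b x) ^ k * f x := by
  filter_upwards [ae_all_iff.2 hP, Lp.coeFn_sum_smul (Finset.range (k + 1))
    (fun m => (-1) ^ m * c ^ (k - m) * (k.choose m : 𝕜)) P] with x h1 h2
  rw [commArg, h2, sub_eq_neg_add, add_pow, Finset.sum_mul]
  refine Finset.sum_congr rfl fun m _ => ?_
  rw [h1, neg_pow (b x)]
  ring

/-- Binomial expansion of ((d - b) + (c - d))^k. Taking d = b(x) afterwards relates T((c - b)^k
f)(x) to commutators of order at most k. -/
lemma IsPowerFamily.commArg_eq_sum (hP : IsPowerFamily b f P) (k : ℕ) (c d : 𝕜) :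
    commArg P k c = ∑ m ∈ Finset.range (k + 1),
      ((c - d) ^ (k - m) * (k.choose m : 𝕜)) • commArg P m d := by
  refine Lp.ext ?_
  filter_upwards [hP.commArg_ae k c, ae_all_iff.2 fun m => hP.commArg_ae m d,
    Lp.coeFn_sum_smul (Finset.range (k + 1)) (fun m => (c - d) ^ (k - m) * (k.choose m : 𝕜))
      fun m => commArg P m d] with x h1 h2 h3
  rw [h1, h3, show c - b x = (d - b x) + (c - d) by ring, add_pow, Finset.sum_mul]
  refine Finset.sum_congr rfl fun m _ => ?_
  rw [h2]
  ring

/-- The top term b^k f has a coefficient independent of c and cancels; the coefficients of the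
others tend to zero as c and d approach each other. This yields an explicit modulus of continuity.
-/
lemma commArg_eq_add_sum (k : ℕ) (c d : 𝕜) :
    commArg P k c = commArg P k d + ∑ m ∈ Finset.range k,
      ((-1) ^ m * (c ^ (k - m) - d ^ (k - m)) * (k.choose m : 𝕜)) • P m := by
  rw [commArg, commArg, Finset.sum_range_succ, Finset.sum_range_succ, add_right_comm,
    ← Finset.sum_add_distrib]
  simp only [Nat.sub_self, pow_zero]
  congr 1
  refine Finset.sum_congr rfl fun m _ => ?_
  rw [← add_smul]
  ring_nf

/-- The modulus of continuity of `c ↦ |T((c - b)^k f)(x)|`. -/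
def commModulus (T : Lp (α := EuclideanSpace ℝ (Fin n)) 𝕜 (p₀ : ℝ≥0∞) volume →
      Lp (α := EuclideanSpace ℝ (Fin n)) 𝕜 (p₀ : ℝ≥0∞) volume)
    (P : ℕ → Lp (α := EuclideanSpace ℝ (Fin n)) 𝕜 (p₀ : ℝ≥0∞) volume) (k : ℕ) (c d : 𝕜)
    (x : EuclideanSpace ℝ (Fin n)) : ℝ≥0 :=
  ∑ m ∈ Finset.range k, ‖c ^ (k - m) - d ^ (k - m)‖₊ * k.choose m * ‖T (P m) x‖₊

lemma commModulus_self (k : ℕ) (c : 𝕜) (x : EuclideanSpace ℝ (Fin n)) :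
    commModulus T P k c c x = 0 := by simp [commModulus]

lemma commModulus_comm (k : ℕ) (c d : 𝕜) (x : EuclideanSpace ℝ (Fin n)) :
    commModulus T P k c d x = commModulus T P k d c x := by
  simp only [commModulus]
  exact Finset.sum_congr rfl fun m _ => by rw [← nnnorm_neg, neg_sub]

lemma commModulus_triangle (k : ℕ) (c d e : 𝕜) (x : EuclideanSpace ℝ (Fin n)) :
    commModulus T P k c e x ≤ commModulus T P k c d x + commModulus T P k d e x := by
  simp only [commModulus]
  rw [← Finset.sum_add_distrib]
  refine Finset.sum_le_sum fun m _ => ?_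
  rw [← add_mul, ← add_mul]
  gcongr
  rw [← sub_add_sub_cancel _ (d ^ (k - m))]
  exact nnnorm_add_le _ _

lemma continuous_commModulus (k : ℕ) (c : 𝕜) (x : EuclideanSpace ℝ (Fin n)) :
    Continuous fun d => commModulus T P k c d x := by
  unfold commModulus
  fun_prop

lemma IsBoundedSublinear.nnnorm_commArg_le_add (hT : IsBoundedSublinear T) (k : ℕ) (c d : 𝕜) :
    ∀ᵐ x, ‖T (commArg P k c) x‖₊ ≤ ‖T (commArg P k d) x‖₊ + commModulus T P k c d x := by
  filter_upwards [hT.nnnorm_add_sum_smul_le _ _ _ (commArg_eq_add_sum (P := P) k c d)] with x hx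
  simpa [commModulus, nnnorm_mul, nnnorm_pow] using hx

/-- A version of `|T((c - b)^k f)(x)|` which is continuous in `c`. -/
def commNorm (T : Lp (α := EuclideanSpace ℝ (Fin n)) 𝕜 (p₀ : ℝ≥0∞) volume →
      Lp (α := EuclideanSpace ℝ (Fin n)) 𝕜 (p₀ : ℝ≥0∞) volume)
    (P : ℕ → Lp (α := EuclideanSpace ℝ (Fin n)) 𝕜 (p₀ : ℝ≥0∞) volume) (k : ℕ) (c : 𝕜)
    (x : EuclideanSpace ℝ (Fin n)) : ℝ≥0 :=
  ⨅ i : ℕ, (‖T (commArg P k (TopologicalSpace.denseSeq 𝕜 i)) x‖₊ +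
    commModulus T P k c (TopologicalSpace.denseSeq 𝕜 i) x)

/-- As in McShane's extension, the infimum over a dense sequence of values plus modulus inherits the
modulus everywhere, by its triangle inequality. -/
lemma commNorm_le_add (k : ℕ) (c d : 𝕜) (x : EuclideanSpace ℝ (Fin n)) :
    commNorm T P k c x ≤ commNorm T P k d x + commModulus T P k c d x := by
  rw [commNorm, commNorm, ← tsub_le_iff_right]
  refine le_ciInf fun i => ?_
  rw [tsub_le_iff_right]
  refine (ciInf_le (OrderBot.bddBelow _) i).trans ?_
  rw [add_assoc, add_comm (commModulus T P k d _ x)]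
  gcongr
  exact commModulus_triangle _ _ _ _ _

lemma continuous_commNorm (k : ℕ) (x : EuclideanSpace ℝ (Fin n)) :
    Continuous fun c => commNorm T P k c x := by
  rw [continuous_iff_continuousAt]
  intro c
  rw [ContinuousAt, tendsto_iff_dist_tendsto_zero]
  have h : Filter.Tendsto (fun d => (commModulus T P k c d x : ℝ)) (nhds c) (nhds 0) := by
    have := (NNReal.continuous_coe.comp (continuous_commModulus (T := T) (P := P) k c x)).tendsto c
    simpa [commModulus_self, Function.comp_def] using this
  refine squeeze_zero (fun _ => dist_nonneg) (fun d => ?_) h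
  have h1 : (commNorm T P k c x : ℝ) ≤ commNorm T P k d x + commModulus T P k c d x := by
    exact_mod_cast commNorm_le_add k c d x
  have h2 : (commNorm T P k d x : ℝ) ≤ commNorm T P k c x + commModulus T P k c d x := by
    rw [commModulus_comm]
    exact_mod_cast commNorm_le_add k d c x
  rw [NNReal.dist_eq, abs_le]
  constructor <;> linarith

/-- One inequality is the modulus estimate along the dense sequence. For the other, each term of the
infimum is at most the value at c plus twice the modulus between c and d_i; this extends to all d by
density, and d = c is inserted. -/
lemma IsBoundedSublinear.commNorm_ae (hT : IsBoundedSublinear T) (k : ℕ) (c : 𝕜) :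
    ∀ᵐ x, commNorm T P k c x = ‖T (commArg P k c) x‖₊ := by
  filter_upwards [ae_all_iff.2 fun i : ℕ => hT.nnnorm_commArg_le_add (P := P) k c
    (TopologicalSpace.denseSeq 𝕜 i), ae_all_iff.2 fun i : ℕ => hT.nnnorm_commArg_le_add (P := P) k
    (TopologicalSpace.denseSeq 𝕜 i) c] with x h1 h2
  refine le_antisymm ?_ (le_ciInf h1)
  have h : ∀ d : 𝕜, commNorm T P k c x ≤
      ‖T (commArg P k c) x‖₊ + (commModulus T P k c d x + commModulus T P k c d x) := by
    have hcl : IsClosed {d : 𝕜 | commNorm T P k c x ≤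
        ‖T (commArg P k c) x‖₊ + (commModulus T P k c d x + commModulus T P k c d x)} :=
      isClosed_le continuous_const (continuous_const.add
        ((continuous_commModulus k c x).add (continuous_commModulus k c x)))
    intro d
    refine (TopologicalSpace.denseRange_denseSeq 𝕜).induction_on d hcl fun i => ?_
    refine (ciInf_le (OrderBot.bddBelow _) i).trans ?_
    rw [← add_assoc]
    refine add_le_add_left ((h2 i).trans ?_) _
    rw [commModulus_comm]
  simpa [commModulus_self] using h c

/-- Interchanges "for every c, for a.e. x" into "for a.e. x, for every c", after which c may be
replaced by b(x). -/
lemma ae_forall_of_continuous {p : EuclideanSpace ℝ (Fin n) → 𝕜 → Prop}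
    (hcl : ∀ᵐ x, IsClosed {c | p x c}) (h : ∀ c, ∀ᵐ x, p x c) : ∀ᵐ x, ∀ c, p x c := by
  filter_upwards [hcl, ae_all_iff.2 fun i : ℕ => h (TopologicalSpace.denseSeq 𝕜 i)] with x h1 h2 c
  exact (TopologicalSpace.denseRange_denseSeq 𝕜).induction_on c h1 h2

/-- A version of the absolute value of the commutator `T_b^k f`. -/
def commFun (T : Lp (α := EuclideanSpace ℝ (Fin n)) 𝕜 (p₀ : ℝ≥0∞) volume →
      Lp (α := EuclideanSpace ℝ (Fin n)) 𝕜 (p₀ : ℝ≥0∞) volume)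
    (P : ℕ → Lp (α := EuclideanSpace ℝ (Fin n)) 𝕜 (p₀ : ℝ≥0∞) volume)
    (b : EuclideanSpace ℝ (Fin n) → 𝕜) (k : ℕ) (x : EuclideanSpace ℝ (Fin n)) : ℝ≥0 :=
  commNorm T P k (b x) x

lemma measurable_commFun (hb : Measurable b) (k : ℕ) : Measurable (commFun T P b k) := by
  have h : ∀ g : Lp (α := EuclideanSpace ℝ (Fin n)) 𝕜 (p₀ : ℝ≥0∞) volume,
      Measurable fun x => ‖g x‖₊ := fun g => (Lp.stronglyMeasurable g).measurable.nnnorm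
  refine Measurable.iInf fun i => ((h _).add ?_)
  exact Finset.measurable_fun_sum _ fun m _ =>
    (((hb.pow_const _).sub_const _).nnnorm.mul_const _).mul (h _)

/-- Expand about d, use sublinearity, pass to all d outside one null set, and put d = b(x). -/
lemma IsBoundedSublinear.nnnorm_commArg_le (hT : IsBoundedSublinear T) (hP : IsPowerFamily b f P)
    (k : ℕ) (c : 𝕜) : ∀ᵐ x, ‖T (commArg P k c) x‖₊ ≤ ∑ m ∈ Finset.range (k + 1),
      ‖c - b x‖₊ ^ (k - m) * k.choose m * commFun T P b m x := by
  have h : ∀ᵐ x, ∀ d, ‖T (commArg P k c) x‖₊ ≤ ∑ m ∈ Finset.range (k + 1),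
      ‖c - d‖₊ ^ (k - m) * k.choose m * commNorm T P m d x := by
    refine ae_forall_of_continuous (.of_forall fun x => ?_) fun d => ?_
    · refine isClosed_le continuous_const (continuous_finsetSum _ fun m _ => ?_)
      exact Continuous.mul (by fun_prop) (continuous_commNorm m x)
    · filter_upwards [hT.nnnorm_sum_smul_le (Finset.range (k + 1))
        (fun m => (c - d) ^ (k - m) * (k.choose m : 𝕜)) (fun m => commArg P m d),
        ae_all_iff.2 fun m : ℕ => hT.commNorm_ae (P := P) m d] with x h1 h2
      rw [hP.commArg_eq_sum k c d]
      simp only [h2]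
      simpa [nnnorm_mul, nnnorm_pow] using h1
  filter_upwards [h] with x hx
  exact hx (b x)

/-- The expansion about d is solved for its top term before sublinearity is applied, then d = b(x).
-/
lemma IsBoundedSublinear.commFun_le (hT : IsBoundedSublinear T) (hP : IsPowerFamily b f P)
    (k : ℕ) (c : 𝕜) : ∀ᵐ x, commFun T P b k x ≤ ‖T (commArg P k c) x‖₊ +
      ∑ m ∈ Finset.range k, ‖c - b x‖₊ ^ (k - m) * k.choose m * commFun T P b m x := by
  have h : ∀ᵐ x, ∀ d, commNorm T P k d x ≤ ‖T (commArg P k c) x‖₊ + ∑ m ∈ Finset.range k,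
      ‖c - d‖₊ ^ (k - m) * k.choose m * commNorm T P m d x := by
    refine ae_forall_of_continuous (.of_forall fun x => ?_) fun d => ?_
    · refine isClosed_le (continuous_commNorm k x) (continuous_const.add
        (continuous_finsetSum _ fun m _ => ?_))
      exact Continuous.mul (by fun_prop) (continuous_commNorm m x)
    · have he : commArg P k d = commArg P k c + ∑ m ∈ Finset.range k,
          (-((c - d) ^ (k - m) * (k.choose m : 𝕜))) • commArg P m d := by
        rw [hP.commArg_eq_sum k c d, Finset.sum_range_succ]
        simp only [neg_smul, Finset.sum_neg_distrib]
        simp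
      filter_upwards [hT.nnnorm_add_sum_smul_le _ _ _ he,
        ae_all_iff.2 fun m : ℕ => hT.commNorm_ae (P := P) m d] with x h1 h2
      simp only [h2]
      simpa [nnnorm_mul, nnnorm_pow] using h1
  filter_upwards [h] with x hx
  exact hx (b x)

/-- Stability of the commutator under perturbation of the function `b`. -/
lemma IsBoundedSublinear.commNorm_le_add_sum (hT : IsBoundedSublinear T)
    (P P' : ℕ → Lp (α := EuclideanSpace ℝ (Fin n)) 𝕜 (p₀ : ℝ≥0∞) volume) (k : ℕ) :
    ∀ᵐ x, ∀ c, commNorm T P k c x ≤ commNorm T P' k c x + ∑ m ∈ Finset.range (k + 1),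
      ‖c‖₊ ^ (k - m) * k.choose m * ‖T (P m - P' m) x‖₊ := by
  refine ae_forall_of_continuous (.of_forall fun x => ?_) fun c => ?_
  · refine isClosed_le (continuous_commNorm k x) ((continuous_commNorm k x).add
      (continuous_finsetSum _ fun m _ => ?_))
    fun_prop
  · have he : commArg P k c = commArg P' k c + ∑ m ∈ Finset.range (k + 1),
        ((-1) ^ m * c ^ (k - m) * (k.choose m : 𝕜)) • (P m - P' m) := by
      rw [commArg, commArg, ← Finset.sum_add_distrib]
      exact Finset.sum_congr rfl fun m _ => by rw [← smul_add, add_sub_cancel]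
    filter_upwards [hT.nnnorm_add_sum_smul_le _ _ _ he, hT.commNorm_ae (P := P) k c,
      hT.commNorm_ae (P := P') k c] with x h1 h2 h3
    rw [h2, h3]
    simpa [nnnorm_mul, nnnorm_pow] using h1

variable {f : Lp (α := EuclideanSpace ℝ (Fin n)) 𝕜 (p₀ : ℝ≥0∞) volume}

/-- Uniqueness: two continuous versions of the modulus that agree a.e. for each c agree for all c
outside one null set. -/
lemma IsBoundedSublinear.nnnorm_isCommutator (hT : IsBoundedSublinear T)
    (hP : IsPowerFamily b f P) {k : ℕ} {F : EuclideanSpace ℝ (Fin n) → 𝕜}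
    (hF : IsCommutator T b k f F) : ∀ᵐ x, ‖F x‖₊ = commFun T P b k x := by
  obtain ⟨Φ, hΦ, hΦc, hΦF⟩ := hF
  have h : ∀ᵐ x, ∀ c, ‖Φ c x‖₊ = commNorm T P k c x := by
    refine ae_forall_of_continuous ?_ fun c => ?_
    · filter_upwards [hΦc] with x hx
      refine isClosed_eq ?_ (continuous_commNorm k x)
      exact Continuous.subtype_mk hx _
    · obtain ⟨g, hg, hgΦ⟩ := hΦ c
      have : g = commArg P k c := Lp.ext (by
        filter_upwards [hg, hP.commArg_ae k c] with x h1 h2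
        rw [h1, h2])
      filter_upwards [hgΦ, hT.commNorm_ae (P := P) k c] with x h1 h2
      rw [h1, h2, this]
  filter_upwards [h, hΦF] with x h1 h2
  rw [h2, h1, commFun]

lemma IsBoundedSublinear.exists_isCommutator (hT : IsBoundedSublinear T)
    (hP : IsPowerFamily b f P) (k : ℕ) : ∃ F, IsCommutator T b k f F := by
  -- The phase of T((c - b)^k f) multiplied by the continuous modulus. The value 1 at w = 0 keeps
  -- the phase unimodular, so the norm of the product is exactly `commNorm`.
  set ph : 𝕜 → 𝕜 := fun w => if w = 0 then 1 else w / (‖w‖ : 𝕜) with hph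
  have hph1 : ∀ w, ‖ph w‖ = 1 := fun w => by
    by_cases h : w = 0
    · simp [hph, h]
    · simp [hph, h, norm_div]
  have hphw : ∀ w, ph w * (‖w‖ : 𝕜) = w := fun w => by
    by_cases h : w = 0
    · simp [h]
    · have : (‖w‖ : 𝕜) ≠ 0 := by simpa using h
      simp [hph, h, this]
  refine ⟨_, fun c x => ph (T (commArg P k c) x) * ((commNorm T P k c x : ℝ) : 𝕜), fun c =>
    ⟨commArg P k c, hP.commArg_ae k c, ?_⟩, ?_, .of_forall fun x => rfl⟩
  · filter_upwards [hT.commNorm_ae (P := P) k c] with x hx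
    rw [hx, coe_nnnorm, hphw]
  · refine .of_forall fun x => ?_
    simp only [norm_mul, hph1, one_mul, RCLike.norm_ofReal, NNReal.abs_eq]
    exact NNReal.continuous_coe.comp (continuous_commNorm k x)

end Commutator

/-! ### Dual weights and a weighted Hölder inequality. -/

section Weights

variable {n : ℕ} {ρ : EuclideanSpace ℝ (Fin n) → ℝ} {ω : EuclideanSpace ℝ (Fin n) → ℝ}

lemma weightMeasure_eq_withDensity {w : EuclideanSpace ℝ (Fin n) → ℝ≥0∞}
    (h : (fun x => ENNReal.ofReal (ω x)) =ᵐ[volume] w) :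
    weightMeasure ω = volume.withDensity w := withDensity_congr_ae h

/-- A nonzero weight of class `A_t` has a dual weight. -/
lemma exists_dualWeights (hρ : IsAdmissible ρ) {t : ℝ} (ht : 1 < t) (hω : IsWeight ω)
    (hωA : MuckenhouptRhoInfty ρ t ω) (hω0 : ¬ ω =ᵐ[volume] 0) :
    ∃ w σ : EuclideanSpace ℝ (Fin n) → ℝ≥0∞, (fun x => ENNReal.ofReal (ω x)) =ᵐ[volume] w ∧
      ∃ θ : ℝ, 0 ≤ θ ∧ ∃ C : ℝ≥0∞, C ≠ ∞ ∧ DualWeights ρ t θ C w σ := by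
  obtain ⟨θ, hθ, C, hC⟩ := hωA
  have hω_meas : AEMeasurable (fun x => ENNReal.ofReal (ω x)) volume :=
    hω.locallyIntegrable.aestronglyMeasurable.aemeasurable.ennreal_ofReal
  set w := hω_meas.mk _ with hw
  have hwω : (fun x => ENNReal.ofReal (ω x)) =ᵐ[volume] w := hω_meas.ae_eq_mk
  have hwm : Measurable w := hω_meas.measurable_mk
  have ht1 : 0 < t - 1 := by linarith
  have hwt : ∀ᵐ x, w x ≠ ∞ := by
    filter_upwards [hwω] with x hx
    rw [← hx]
    exact ENNReal.ofReal_ne_top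
  set σ : EuclideanSpace ℝ (Fin n) → ℝ≥0∞ := fun x => w x ^ (-1 / (t - 1)) with hσ
  have hσm : Measurable σ := hwm.pow_const _
  have hwfin : ∀ x r, ∫⁻ y in ball x r, w y ≠ ∞ := fun x r => by
    have h1 : IntegrableOn ω (ball x r) volume :=
      (hω.locallyIntegrable.integrableOn_isCompact (isCompact_closedBall x r)).mono_set
        ball_subset_closedBall
    rw [← lintegral_congr_ae (ae_restrict_of_ae hwω)]
    exact h1.lintegral_lt_top.ne
  have hA : ∀ (x : EuclideanSpace ℝ (Fin n)) (r : ℝ), 0 < r →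
      (∫⁻ y, w y ∂psiMeasure ρ θ x r) * (∫⁻ y, σ y ∂psiMeasure ρ θ x r) ^ (t - 1) ≤ C := by
    intro x r hr
    have hac : psiMeasure ρ θ x r ≪ volume :=
      Measure.smul_absolutelyContinuous.trans Measure.restrict_le_self.absolutelyContinuous
    have e1 : ∫⁻ y, w y ∂psiMeasure ρ θ x r =
        ∫⁻ y, ENNReal.ofReal (ω y) ∂psiMeasure ρ θ x r :=
      lintegral_congr_ae (hac.ae_le (hwω.mono fun y hy => hy.symm))
    have e2 : ∫⁻ y, σ y ∂psiMeasure ρ θ x r =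
        ∫⁻ y, ENNReal.ofReal (ω y) ^ (-1 / (t - 1)) ∂psiMeasure ρ θ x r :=
      lintegral_congr_ae (hac.ae_le (hwω.mono fun y hy => by simp only [hσ, ← hy]))
    rw [e1, e2]
    exact hC x r hr
  have hA' : ∀ (x : EuclideanSpace ℝ (Fin n)) (r : ℝ), 0 < r →
      (∫⁻ y, w y ∂avgMeasure x r) * (∫⁻ y, σ y ∂avgMeasure x r) ^ (t - 1) ≤
        C * psi ρ (θ * t) x r := by
    intro x r hr
    rw [lintegral_avg_eq_mul_psi hρ θ x hr.le w, lintegral_avg_eq_mul_psi hρ θ x hr.le σ,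
      ENNReal.mul_rpow_of_nonneg _ _ ht1.le, hρ.psi_rpow _ x hr.le]
    calc _ = (psi ρ θ x r * psi ρ (θ * (t - 1)) x r) *
          ((∫⁻ y, w y ∂psiMeasure ρ θ x r) * (∫⁻ y, σ y ∂psiMeasure ρ θ x r) ^ (t - 1)) := by ring
      _ ≤ psi ρ (θ * t) x r * C := by
          rw [← hρ.psi_add _ _ x hr.le]
          refine mul_le_mul' (le_of_eq ?_) (hA x r hr)
          congr 1; ring
      _ = _ := mul_comm _ _
  -- As ω is not a.e. zero, a large enough ball has positive w-mass; infinite σ-mass there would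
  -- make the A_t product infinite. Finiteness of σ a.e. then gives w > 0 a.e.
  have hσfin : ∀ x r, ∫⁻ y in ball x r, σ y ≠ ∞ := by
    intro x r
    obtain ⟨m, hm⟩ : ∃ m : ℕ, ∫⁻ y in ball x (m + 1), w y ≠ 0 := by
      by_contra! hcon
      refine hω0 ?_
      have h1 : ∀ m : ℕ, ∀ᵐ y, y ∈ ball x ((m:ℝ) + 1) → w y = 0 := fun m => by
        have := (lintegral_eq_zero_iff hwm).1 (hcon m)
        exact (ae_restrict_iff' measurableSet_ball).1 this
      filter_upwards [ae_all_iff.2 h1, hwω] with y hy1 hy2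
      obtain ⟨m, hm⟩ := exists_nat_gt (dist y x)
      have h2 := hy1 m (mem_ball.2 (by linarith))
      rw [h2, ENNReal.ofReal_eq_zero] at hy2
      exact le_antisymm hy2 (hω.nonneg y)
    set R : ℝ := max r (m + 1) with hR
    have hR0 : 0 < R := lt_max_of_lt_right (by positivity)
    refine ne_top_of_le_ne_top ?_ (lintegral_mono_set (ball_subset_ball (le_max_left r (m + 1))))
    intro htop
    have h2 : ∫⁻ y in ball x R, w y ≠ 0 := fun h0 => hm (le_antisymm
      ((lintegral_mono_set (ball_subset_ball (le_max_right r (m + 1)))).trans h0.le) zero_le)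
    have h3 := hA' x R hR0
    rw [lintegral_avgMeasure, lintegral_avgMeasure] at h3
    rw [← hR] at htop
    rw [htop, ENNReal.mul_top (by simpa using volume_ball_ne_top x R),
      ENNReal.top_rpow_of_pos ht1, ENNReal.mul_top] at h3
    · exact ENNReal.mul_ne_top ENNReal.coe_ne_top (psi_ne_top _ _ _ _) (top_le_iff.1 h3)
    · exact mul_ne_zero (by simpa using volume_ball_ne_top x R) h2
  have hσt : ∀ᵐ x, σ x ≠ ∞ := by
    have h1 : ∀ m : ℕ, ∀ᵐ y, y ∈ ball (0 : EuclideanSpace ℝ (Fin n)) m → σ y ≠ ∞ := fun m =>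
      (ae_restrict_iff' measurableSet_ball).1
        ((ae_lt_top hσm (hσfin 0 m)).mono fun y hy => hy.ne)
    filter_upwards [ae_all_iff.2 h1] with y hy
    obtain ⟨m, hm⟩ := exists_nat_gt (dist y 0)
    exact hy m (mem_ball.2 hm)
  refine ⟨w, σ, hwω, θ * t, by positivity, C, ENNReal.coe_ne_top, hwm, hσm, ?_, hwfin, hσfin, hA'⟩
  filter_upwards [hwt, hσt] with x h1 h2
  have hw0 : w x ≠ 0 := by
    intro h0
    refine h2 ?_
    simp only [hσ, h0]
    exact ENNReal.zero_rpow_of_neg (div_neg_of_neg_of_pos (by norm_num) ht1)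
  simp only [hσ]
  rw [← ENNReal.rpow_mul, div_mul_cancel₀ _ ht1.ne', ENNReal.rpow_neg_one,
    ENNReal.mul_inv_cancel hw0 h1]

/-- Hölder's inequality with a weight in the exponent conjugate to `q / p`. -/
lemma lintegral_enorm_rpow_mul_le {X E : Type*} [MeasurableSpace X] [NormedAddCommGroup E]
    {μ : Measure X} {p : ℝ≥0} {q : ℝ≥0∞} (hp : p ≠ 0) (hpq : (p : ℝ≥0∞) ≤ q) {h : X → E}
    (hh : AEStronglyMeasurable h μ) {v : X → ℝ} (hv : AEStronglyMeasurable v μ) :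
    ∫⁻ y, ‖h y‖ₑ ^ (p : ℝ) * ENNReal.ofReal (v y) ∂μ ≤
      eLpNorm h q μ ^ (p : ℝ) * eLpNorm v (ENNReal.conjExponent (q / p)) μ := by
  have hp0 : (p : ℝ≥0∞) ≠ 0 := by simpa using hp
  have h1 : 1 ≤ q / p := by
    rw [ENNReal.le_div_iff_mul_le (.inl hp0) (.inl ENNReal.coe_ne_top), one_mul]
    exact hpq
  have hH : (q / p).HolderConjugate (q / p).conjExponent := ENNReal.HolderConjugate.conjExponent h1
  have h2 := eLpNorm_smul_le_mul_eLpNorm (r := 1) (p := q / p) (q := (q / p).conjExponent) hv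
    (φ := fun y => ‖h y‖ ^ (p : ℝ)) (hh.norm.aemeasurable.pow_const _).aestronglyMeasurable
  rw [eLpNorm_norm_rpow h (by positivity)] at h2
  have e1 : q / p * ENNReal.ofReal (p : ℝ) = q := by
    rw [ENNReal.ofReal_coe_nnreal, ENNReal.div_mul_cancel hp0 ENNReal.coe_ne_top]
  rw [e1, eLpNorm_one_eq_lintegral_enorm] at h2
  refine le_trans (lintegral_mono fun y => ?_) h2
  simp only [Pi.smul_apply', smul_eq_mul, enorm_mul]
  refine mul_le_mul' (le_of_eq ?_) (Real.ofReal_le_enorm _)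
  rw [Real.enorm_rpow_of_nonneg (norm_nonneg _) (by positivity), enorm_norm]

end Weights

/-! ### The functions b^m f belong to L^{p₀}. -/

section PowerFamily

variable {n : ℕ} {ρ : EuclideanSpace ℝ (Fin n) → ℝ} {𝕜 : Type*} [RCLike 𝕜] {p₀ : ℝ≥0}
  {b : EuclideanSpace ℝ (Fin n) → 𝕜}

lemma setLIntegral_enorm_rpow_ne_top_of_memBMO (hn : 1 ≤ n) (hρ : IsAdmissible ρ) {θ : ℝ}
    (hθ : 0 ≤ θ) (hb : Measurable b) (hbmo : MemBMO ρ θ b) {q : ℝ} (hq : 1 < q)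
    (x : EuclideanSpace ℝ (Fin n)) {r : ℝ} (hr : 0 < r) :
    ∫⁻ y in ball x r, ‖b y‖ₑ ^ q ≠ ∞ := by
  obtain ⟨C, hC, θ', hθ', h⟩ := exists_lintegral_sub_ballMean_rpow_le (𝕜 := 𝕜) hn hρ hθ hq
  have hp := isProbabilityMeasure_avgMeasure x hr
  have h2q : (2 : ℝ≥0∞) ^ (q - 1) ≠ ∞ := ENNReal.rpow_ne_top_of_nonneg (by linarith) (by simp)
  have hq0 : 0 ≤ q := by linarith
  rw [setLIntegral_ball_eq_mul_avg x hr]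
  refine ENNReal.mul_ne_top (volume_ball_ne_top x r) ?_
  set c := ballMean b x r with hc
  have h1 : ∫⁻ y, ‖b y‖ₑ ^ q ∂avgMeasure x r ≤
      2 ^ (q - 1) * (∫⁻ y, ‖b y - c‖ₑ ^ q ∂avgMeasure x r + ‖c‖ₑ ^ q) := by
    calc _ ≤ ∫⁻ y, 2 ^ (q - 1) * (‖b y - c‖ₑ ^ q + ‖c‖ₑ ^ q) ∂avgMeasure x r := by
          refine lintegral_mono fun y => ?_
          refine le_trans ?_ (ENNReal.rpow_add_le_mul_rpow_add_rpow _ _ hq.le)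
          refine ENNReal.rpow_le_rpow ?_ hq0
          simpa using enorm_add_le (b y - c) c
      _ = _ := by
          rw [lintegral_const_mul' _ _ h2q, lintegral_add_right _ measurable_const]
          simp
  refine ne_top_of_le_ne_top (ENNReal.mul_ne_top h2q (ENNReal.add_ne_top.2 ⟨?_, ?_⟩)) h1
  · refine ne_top_of_le_ne_top ?_ (h b hb hbmo.locallyIntegrable x r hr)
    exact ENNReal.mul_ne_top (ENNReal.mul_ne_top hC (psi_ne_top _ _ _ _))
      (ENNReal.rpow_ne_top_of_nonneg hq0 hbmo.bmoNorm_lt_top.ne)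
  · exact ENNReal.rpow_ne_top_of_nonneg hq0 enorm_ne_top

/-- Products of powers of `BMO` functions with bounded functions of compact support are in
`L^{p₀}`. -/
lemma exists_isPowerFamily (hn : 1 ≤ n) (hρ : IsAdmissible ρ) (hp₀ : 1 ≤ p₀) {θ : ℝ}
    (hθ : 0 ≤ θ) (hb : Measurable b) (hbmo : MemBMO ρ θ b) (f : LcInfty n 𝕜 p₀) :
    ∃ P : ℕ → Lp (α := EuclideanSpace ℝ (Fin n)) 𝕜 (p₀ : ℝ≥0∞) volume,
      IsPowerFamily b (f : Lp 𝕜 (p₀ : ℝ≥0∞) volume) P := by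
  obtain ⟨f, hf, R, hR⟩ := f
  have hp0 : (1:ℝ) ≤ p₀ := by exact_mod_cast hp₀
  have key : ∀ m : ℕ, MemLp (fun x => b x ^ m * f x) (p₀ : ℝ≥0∞) volume := by
    intro m
    refine ⟨(hb.pow_const m).aestronglyMeasurable.mul (Lp.aestronglyMeasurable f), ?_⟩
    set K : ℝ≥0∞ := eLpNorm f ∞ volume with hK
    have hKt : K ≠ ∞ := hf.2.ne
    have hfK : ∀ᵐ x, ‖f x‖ₑ ≤ K := by
      rw [hK, eLpNorm_exponent_top]
      exact enorm_ae_le_eLpNormEssSup f volume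
    set R' : ℝ := max R 1 with hR'
    have hR'0 : 0 < R' := lt_max_of_lt_right one_pos
    -- Any exponent above both m p₀ and 1 serves, since the integrability of b comes from
    -- John–Nirenberg, which needs q > 1.
    set q : ℝ := m * p₀ + 1 with hq
    have hq1 : 1 < q ∨ m = 0 := by
      rcases Nat.eq_zero_or_pos m with h | h
      · exact .inr h
      · have : (0:ℝ) < m := by exact_mod_cast h
        left; rw [hq]; nlinarith
    have hbq : ∫⁻ y in ball (0 : EuclideanSpace ℝ (Fin n)) R', ‖b y‖ₑ ^ (m * p₀ : ℝ) ≠ ∞ := by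
      rcases hq1 with h | h
      · have h2 := setLIntegral_enorm_rpow_ne_top_of_memBMO hn hρ hθ hb hbmo h 0 hR'0
        have h3 : ∫⁻ y in ball (0 : EuclideanSpace ℝ (Fin n)) R', (1 + ‖b y‖ₑ ^ q) ≠ ∞ := by
          rw [lintegral_add_left measurable_const, lintegral_const, Measure.restrict_apply_univ]
          have := volume_ball_ne_top (0 : EuclideanSpace ℝ (Fin n)) R'
          finiteness
        refine ne_top_of_le_ne_top h3 (lintegral_mono fun y => ?_)
        rcases le_or_gt ‖b y‖ₑ 1 with h4 | h4
        · exact (ENNReal.rpow_le_one h4 (by positivity)).trans le_self_add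
        · exact (ENNReal.rpow_le_rpow_of_exponent_le h4.le (by rw [hq]; linarith)).trans
            le_add_self
      · simp [h, volume_ball_ne_top]
    rw [eLpNorm_lt_top_iff_lintegral_rpow_enorm_lt_top (by positivity) ENNReal.coe_ne_top]
    refine lt_of_le_of_lt (b := ∫⁻ y, (ball (0 : EuclideanSpace ℝ (Fin n)) R').indicator
      (fun y => K ^ (p₀:ℝ) * ‖b y‖ₑ ^ (m * p₀ : ℝ)) y) (lintegral_mono_ae ?_) ?_
    · filter_upwards [hfK, hR] with y h1 h2
      rw [ENNReal.coe_toReal]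
      by_cases hy : y ∈ ball (0 : EuclideanSpace ℝ (Fin n)) R'
      · rw [Set.indicator_of_mem hy, enorm_mul, ENNReal.mul_rpow_of_nonneg _ _ (by positivity),
          enorm_pow, ENNReal.rpow_mul, ENNReal.rpow_natCast, mul_comm]
        exact mul_le_mul_left (ENNReal.rpow_le_rpow h1 (by positivity)) _
      · rw [h2 fun h => hy (ball_subset_ball (le_max_left _ _) h)]
        simp [ENNReal.zero_rpow_of_pos (show (0:ℝ) < p₀ by linarith)]
    · rw [lintegral_indicator measurableSet_ball, lintegral_const_mul' _ _
        (ENNReal.rpow_ne_top_of_nonneg (by positivity) hKt)]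
      exact (ENNReal.mul_ne_top (ENNReal.rpow_ne_top_of_nonneg (by positivity) hKt) hbq).lt_top
  exact ⟨fun m => (key m).toLp _, fun m => (key m).coeFn_toLp⟩

/-- The reason for treating bounded b first: the off-diagonal hypotheses apply only to arguments in
L_c^∞. -/
lemma commArg_mem_LcInfty {f : LcInfty n 𝕜 p₀}
    {P : ℕ → Lp (α := EuclideanSpace ℝ (Fin n)) 𝕜 (p₀ : ℝ≥0∞) volume}
    (hP : IsPowerFamily b (f : Lp 𝕜 (p₀ : ℝ≥0∞) volume) P) {N : ℝ} (hN : ∀ x, ‖b x‖ ≤ N)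
    (k : ℕ) (c : 𝕜) : commArg P k c ∈ LcInfty n 𝕜 p₀ := by
  obtain ⟨f, hf, R, hR⟩ := f
  have h := hP.commArg_ae k c
  refine ⟨?_, R, ?_⟩
  · refine hf.of_le_mul (c := (‖c‖ + N) ^ k) (Lp.aestronglyMeasurable _) ?_
    filter_upwards [h] with x hx
    rw [hx, norm_mul, norm_pow]
    gcongr
    exact (norm_sub_le _ _).trans (by gcongr; exact hN x)
  · filter_upwards [h, hR] with x h1 h2 h3
    rw [h1, h2 h3, mul_zero]

end PowerFamily

/-! ### Norms of functions with values in `ℝ≥0∞`. -/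

section ELpNormENNReal

variable {X : Type*} [MeasurableSpace X] {μ : Measure X} {p : ℝ≥0}

lemma eLpNorm_const_mul_ennreal (hp : p ≠ 0) (c : ℝ≥0∞) {h : X → ℝ≥0∞} (hh : AEMeasurable h μ) :
    eLpNorm (fun y => c * h y) p μ = c * eLpNorm h p μ := by
  have hp0 : (0:ℝ) < p := by exact_mod_cast pos_of_ne_zero hp
  rw [eLpNorm_nnreal_eq_lintegral hp, eLpNorm_nnreal_eq_lintegral hp]
  simp only [enorm_eq_self, ENNReal.mul_rpow_of_nonneg _ _ hp0.le]
  rw [lintegral_const_mul'' _ (hh.pow_const _), ENNReal.mul_rpow_of_nonneg _ _ (by positivity),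
    ← ENNReal.rpow_mul, mul_one_div_cancel hp0.ne', ENNReal.rpow_one]

lemma eLpNorm_sum_mul_le (hp : 1 ≤ p) {ι : Type*} (s : Finset ι) (a : ι → ℝ≥0∞)
    {h : ι → X → ℝ≥0∞} (hh : ∀ i, Measurable (h i)) :
    eLpNorm (fun y => ∑ i ∈ s, a i * h i y) p μ ≤ ∑ i ∈ s, a i * eLpNorm (h i) p μ := by
  have h1 := eLpNorm_sum_le (μ := μ) (s := s) (f := fun i y => a i * h i y)
    (fun i _ => ((hh i).const_mul _).aestronglyMeasurable) (by exact_mod_cast hp : 1 ≤ (p : ℝ≥0∞))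
  have e : (∑ i ∈ s, fun y => a i * h i y) = fun y => ∑ i ∈ s, a i * h i y := by
    ext y; simp
  rw [e] at h1
  refine h1.trans (Finset.sum_le_sum fun i _ => ?_)
  rw [eLpNorm_const_mul_ennreal (one_pos.trans_le hp).ne' _ (hh i).aemeasurable]

lemma lintegral_rpow_eq_eLpNorm_rpow (hp : p ≠ 0) (h : X → ℝ≥0∞) :
    ∫⁻ y, h y ^ (p : ℝ) ∂μ = eLpNorm h p μ ^ (p : ℝ) := by
  rw [eLpNorm_nnreal_pow_eq_lintegral hp]
  simp

end ELpNormENNReal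

/-! ### Off-diagonal estimates applied to (b_B - b)^i f. -/

section OffDiagonal

variable {n : ℕ} {ρ : EuclideanSpace ℝ (Fin n) → ℝ} {𝕜 : Type*} [RCLike 𝕜] {p₀ : ℝ≥0}

lemma eLpNorm_avg_le_mul_avg (hp₀ : 1 ≤ p₀) {x y : EuclideanSpace ℝ (Fin n)} {c r s : ℝ}
    (hc : 1 ≤ c) (hr : 0 < r) (hs : 0 < s) (hsc : s ≤ c * r) (hsub : ball x r ⊆ ball y s)
    {ε : Type*} [ENorm ε] (f : EuclideanSpace ℝ (Fin n) → ε) :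
    eLpNorm f p₀ (avgMeasure x r) ≤ ENNReal.ofReal (c ^ n) * eLpNorm f p₀ (avgMeasure y s) := by
  have hp0 : p₀ ≠ 0 := (one_pos.trans_le hp₀).ne'
  have hp1 : (1:ℝ) ≤ p₀ := by exact_mod_cast hp₀
  rw [eLpNorm_nnreal_eq_lintegral hp0, eLpNorm_nnreal_eq_lintegral hp0]
  refine (ENNReal.rpow_le_rpow (avg_le_mul_avg (by linarith) hr hs hsc hsub _)
    (by positivity)).trans ?_
  rw [ENNReal.mul_rpow_of_nonneg _ _ (by positivity)]
  refine mul_le_mul_left ?_ _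
  have h1 : (1:ℝ≥0∞) ≤ ENNReal.ofReal (c ^ n) := by
    rw [ENNReal.one_le_ofReal]; exact one_le_pow₀ hc
  calc _ ≤ ENNReal.ofReal (c ^ n) ^ (1:ℝ) :=
        ENNReal.rpow_le_rpow_of_exponent_le h1 (by rw [div_le_one (by linarith)]; exact hp1)
    _ = _ := ENNReal.rpow_one _

lemma psiMeasure_absolutelyContinuous (ρ : EuclideanSpace ℝ (Fin n) → ℝ) (θ : ℝ)
    (x : EuclideanSpace ℝ (Fin n)) (r : ℝ) : psiMeasure ρ θ x r ≪ volume :=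
  Measure.smul_absolutelyContinuous.trans Measure.restrict_le_self.absolutelyContinuous

/-- The three estimates for `T` and `A` with a fixed exponent `Θ`. -/
structure OffDiagonalEstimates (ρ : EuclideanSpace ℝ (Fin n) → ℝ) (q₀ : ℝ≥0∞)
    (T : Lp (α := EuclideanSpace ℝ (Fin n)) 𝕜 (p₀ : ℝ≥0∞) volume →
      Lp (α := EuclideanSpace ℝ (Fin n)) 𝕜 (p₀ : ℝ≥0∞) volume)
    (A : ℝ → LcInfty n 𝕜 p₀ → Lp (α := EuclideanSpace ℝ (Fin n)) 𝕜 (p₀ : ℝ≥0∞) volume)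
    (c₀ : ℝ) (α : ℕ+ → ℝ≥0) (Θ : ℝ) (C : ℝ≥0∞) : Prop where
  sub_small : ∀ (f : LcInfty n 𝕜 p₀) (x₀ : EuclideanSpace ℝ (Fin n)) (r : ℝ), 0 < r → r < ρ x₀ →
    eLpNorm (T (f - A (c₀ * r) f)) p₀ (avgMeasure x₀ (c₀ * r)) ≤
      C * ∑' j : ℕ+, (α j : ℝ≥0∞) *
        eLpNorm (f : Lp (α := EuclideanSpace ℝ (Fin n)) 𝕜 (p₀ : ℝ≥0∞) volume) p₀
          (psiMeasure ρ Θ x₀ (2 ^ ((j : ℕ) + 1) * (c₀ * r)))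
  large : ∀ (f : LcInfty n 𝕜 p₀) (x₀ : EuclideanSpace ℝ (Fin n)) (r : ℝ), ρ x₀ ≤ r →
    eLpNorm (T f) p₀ (psiMeasure ρ Θ x₀ r) ≤
      C * ∑' j : ℕ+, (α j : ℝ≥0∞) *
        eLpNorm (f : Lp (α := EuclideanSpace ℝ (Fin n)) 𝕜 (p₀ : ℝ≥0∞) volume) p₀
          (psiMeasure ρ Θ x₀ (2 ^ ((j : ℕ) + 1) * r))
  comp_small : ∀ (f : LcInfty n 𝕜 p₀) (x₀ : EuclideanSpace ℝ (Fin n)) (r : ℝ), 0 < r → r < ρ x₀ →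
    eLpNorm (T (A (c₀ * r) f)) q₀ (avgMeasure x₀ (c₀ * r)) ≤
      C * ∑' j : ℕ+, (α j : ℝ≥0∞) *
        eLpNorm (T f) p₀ (psiMeasure ρ Θ x₀ (2 ^ ((j : ℕ) + 1) * (c₀ * r)))

/-- Control of averages of `|b - b_B|^e h` by a maximal operator `M`. -/
def OscillationControl (ρ : EuclideanSpace ℝ (Fin n) → ℝ) (Θ : ℝ) (p₀ : ℝ≥0) (k : ℕ) (C β : ℝ≥0∞)
    (M : (EuclideanSpace ℝ (Fin n) → ℝ≥0∞) → EuclideanSpace ℝ (Fin n) → ℝ≥0∞)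
    (b : EuclideanSpace ℝ (Fin n) → 𝕜) : Prop :=
  ∀ e ≤ k, ∀ h : EuclideanSpace ℝ (Fin n) → ℝ≥0∞, Measurable h →
    ∀ (x : EuclideanSpace ℝ (Fin n)) (r r' : ℝ) (m : ℕ), 0 < r → r ≤ r' → r' ≤ 2 ^ m * r →
    ∀ x' ∈ ball x r,
    eLpNorm (fun y => ‖b y - ballMean b x r‖ₑ ^ e * h y) p₀ (psiMeasure ρ Θ x r') ≤
      C * ((m + 1) * β) ^ e * M h x'

variable {q₀ : ℝ≥0∞}
  {T : Lp (α := EuclideanSpace ℝ (Fin n)) 𝕜 (p₀ : ℝ≥0∞) volume →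
    Lp (α := EuclideanSpace ℝ (Fin n)) 𝕜 (p₀ : ℝ≥0∞) volume}
  {A : ℝ → LcInfty n 𝕜 p₀ → Lp (α := EuclideanSpace ℝ (Fin n)) 𝕜 (p₀ : ℝ≥0∞) volume}
  {c₀ : ℝ} {α : ℕ+ → ℝ≥0} {Θ : ℝ} {CT : ℝ≥0∞}
  {k : ℕ} {CO β : ℝ≥0∞}
  {M : (EuclideanSpace ℝ (Fin n) → ℝ≥0∞) → EuclideanSpace ℝ (Fin n) → ℝ≥0∞}
  {b : EuclideanSpace ℝ (Fin n) → 𝕜}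
  {f : LcInfty n 𝕜 p₀}
  {P : ℕ → Lp (α := EuclideanSpace ℝ (Fin n)) 𝕜 (p₀ : ℝ≥0∞) volume}

/-- The absolute value of a function of class `L^{p₀}`. -/
def absFun (f : Lp (α := EuclideanSpace ℝ (Fin n)) 𝕜 (p₀ : ℝ≥0∞) volume)
    (y : EuclideanSpace ℝ (Fin n)) : ℝ≥0∞ := ‖f y‖ₑ

lemma measurable_absFun (f : Lp (α := EuclideanSpace ℝ (Fin n)) 𝕜 (p₀ : ℝ≥0∞) volume) :
    Measurable (absFun f) := (Lp.stronglyMeasurable f).enorm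

lemma OscillationControl.eLpNorm_commArg_le (hO : OscillationControl ρ Θ p₀ k CO β M b)
    (hP : IsPowerFamily b (f : Lp 𝕜 (p₀ : ℝ≥0∞) volume) P) {i : ℕ} (hi : i ≤ k)
    {x x' : EuclideanSpace ℝ (Fin n)} {r r' : ℝ} {m : ℕ} (hr : 0 < r) (hrr : r ≤ r')
    (hrm : r' ≤ 2 ^ m * r) (hx' : x' ∈ ball x r) :
    eLpNorm (commArg P i (ballMean b x r)) p₀ (psiMeasure ρ Θ x r') ≤
      CO * ((m + 1) * β) ^ i * M (absFun (f : Lp 𝕜 (p₀ : ℝ≥0∞) volume)) x' := by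
  refine le_of_eq_of_le (eLpNorm_congr_enorm_ae ?_) (hO i hi _ (measurable_absFun _) x r r' m hr
    hrr hrm x' hx')
  refine (psiMeasure_absolutelyContinuous ρ Θ x r').ae_le ?_
  filter_upwards [hP.commArg_ae i (ballMean b x r)] with y hy
  rw [hy, enorm_mul, enorm_pow, enorm_eq_self, absFun, ← enorm_neg, neg_sub]

lemma natCast_add_le_three_mul (j m : ℕ) (hj : 1 ≤ j) :
    (((j + 1 + m : ℕ) : ℝ≥0∞) + 1) ≤ 3 * j * (m + 1) := by
  have : j + 1 + m + 1 ≤ 3 * j * (m + 1) := by nlinarith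
  exact_mod_cast this

/-- The j-th dilate is j + 1 + m doublings away from the ball of radius r, and j + 2 + m ≤ 3j(m+1).
This separates the summable factor (3j)^k from the dependence on m. -/
lemma OscillationControl.tsum_eLpNorm_commArg_le (hO : OscillationControl ρ Θ p₀ k CO β M b)
    (hP : IsPowerFamily b (f : Lp 𝕜 (p₀ : ℝ≥0∞) volume) P) {i : ℕ} (hi : i ≤ k)
    {x x' : EuclideanSpace ℝ (Fin n)} {r r' : ℝ} {m : ℕ} (hr : 0 < r) (hrr : r ≤ r')
    (hrm : r' ≤ 2 ^ m * r) (hx' : x' ∈ ball x r) :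
    ∑' j : ℕ+, (α j : ℝ≥0∞) * eLpNorm (commArg P i (ballMean b x r)) p₀
        (psiMeasure ρ Θ x (2 ^ ((j : ℕ) + 1) * r')) ≤
      CO * (∑' j : ℕ+, (α j : ℝ≥0∞) * (3 * (j : ℕ)) ^ k) * ((m + 1) * β) ^ i *
        M (absFun (f : Lp 𝕜 (p₀ : ℝ≥0∞) volume)) x' := by
  rw [← ENNReal.tsum_mul_left, ← ENNReal.tsum_mul_right, ← ENNReal.tsum_mul_right]
  refine ENNReal.tsum_le_tsum fun j => ?_
  have hj : 1 ≤ (j : ℕ) := j.pos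
  have h1 := hO.eLpNorm_commArg_le hP hi (m := (j : ℕ) + 1 + m) (r' := 2 ^ ((j : ℕ) + 1) * r')
    hr (hrr.trans (le_mul_of_one_le_left (hr.le.trans hrr) (one_le_pow₀ (by norm_num))))
    (by rw [pow_add _ ((j : ℕ) + 1) m, mul_assoc]; gcongr) hx'
  have h3 : (1 : ℝ≥0∞) ≤ 3 * (j : ℕ) := by exact_mod_cast (by omega : 1 ≤ 3 * (j : ℕ))
  calc _ ≤ (α j : ℝ≥0∞) * (CO * ((3 * (j : ℕ) * (m + 1)) * β) ^ i *
        M (absFun (f : Lp 𝕜 (p₀ : ℝ≥0∞) volume)) x') := by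
        refine mul_le_mul_right (h1.trans ?_) _
        gcongr
        exact natCast_add_le_three_mul j m hj
    _ = CO * ((α j : ℝ≥0∞) * (3 * (j : ℕ)) ^ i) * ((m + 1) * β) ^ i *
        M (absFun (f : Lp 𝕜 (p₀ : ℝ≥0∞) volume)) x' := by
        rw [mul_assoc (3 * ((j : ℕ) : ℝ≥0∞)), mul_pow (3 * ((j : ℕ) : ℝ≥0∞))]; ring
    _ ≤ _ := by gcongr

/-- Above the critical radius this is the estimate on large balls. A radius within m₀ doublings
below it is first enlarged to ρ(x), at a cost depending on m₀ only. -/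
lemma OffDiagonalEstimates.eLpNorm_commArg_le (hE : OffDiagonalEstimates ρ q₀ T A c₀ α Θ CT)
    (hρ : IsAdmissible ρ) (hp₀ : 1 ≤ p₀) (hΘ : 0 ≤ Θ)
    (hO : OscillationControl ρ Θ p₀ k CO β M b)
    (hP : IsPowerFamily b (f : Lp 𝕜 (p₀ : ℝ≥0∞) volume) P) {N : ℝ} (hN : ∀ x, ‖b x‖ ≤ N)
    {i : ℕ} (hi : i ≤ k) {x x' : EuclideanSpace ℝ (Fin n)} {r r' : ℝ} {m m₀ : ℕ} (hr : 0 < r)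
    (hrr : r ≤ r') (hrm : r' ≤ 2 ^ m * r) (hm₀ : ρ x ≤ 2 ^ m₀ * r') (hx' : x' ∈ ball x r) :
    eLpNorm (T (commArg P i (ballMean b x r))) p₀ (psiMeasure ρ Θ x r') ≤
      ENNReal.ofReal ((2 ^ m₀) ^ n) * ENNReal.ofReal (2 ^ (Θ * (1 / p₀))) * (m₀ + 1) ^ k *
      (CT * CO * (∑' j : ℕ+, (α j : ℝ≥0∞) * (3 * (j : ℕ)) ^ k)) * ((m + 1) * β) ^ i *
        M (absFun (f : Lp 𝕜 (p₀ : ℝ≥0∞) volume)) x' := by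
  have hp0 : p₀ ≠ 0 := (one_pos.trans_le hp₀).ne'
  set S := ∑' j : ℕ+, (α j : ℝ≥0∞) * (3 * (j : ℕ)) ^ k with hS
  set g : LcInfty n 𝕜 p₀ := ⟨_, commArg_mem_LcInfty hP hN i (ballMean b x r)⟩ with hg
  have hρx := hρ.pos x
  have h2m : (1:ℝ) ≤ 2 ^ m₀ := one_le_pow₀ (by norm_num)
  have hc1 : (1:ℝ≥0∞) ≤ ENNReal.ofReal ((2 ^ m₀) ^ n) := by
    rw [ENNReal.one_le_ofReal]; exact one_le_pow₀ h2m
  have hc2 : (1:ℝ≥0∞) ≤ ENNReal.ofReal (2 ^ (Θ * (1 / p₀))) := by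
    rw [ENNReal.one_le_ofReal]; exact Real.one_le_rpow (by norm_num) (by positivity)
  have hc3 : (1:ℝ≥0∞) ≤ ((m₀:ℝ≥0∞) + 1) ^ k := one_le_pow₀ (by simp)
  have hbound : ∀ (R : ℝ) (m' : ℕ), ρ x ≤ R → r ≤ R → R ≤ 2 ^ m' * r →
      eLpNorm (T (commArg P i (ballMean b x r))) p₀ (psiMeasure ρ Θ x R) ≤
      (CT * CO * S) * ((m' + 1) * β) ^ i * M (absFun (f : Lp 𝕜 (p₀ : ℝ≥0∞) volume)) x' := by
    intro R m' h1 h2 h3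
    refine (hE.large g x R h1).trans ?_
    calc _ ≤ CT * (CO * S * ((m' + 1) * β) ^ i *
          M (absFun (f : Lp 𝕜 (p₀ : ℝ≥0∞) volume)) x') :=
          mul_le_mul_right (hO.tsum_eLpNorm_commArg_le hP hi hr h2 h3 hx') _
      _ = _ := by ring
  rcases le_or_gt (ρ x) r' with h | h
  · refine (hbound r' m h hrr hrm).trans ?_
    refine mul_le_mul_left (mul_le_mul_left (le_mul_of_one_le_left' ?_) _) _
    exact one_le_mul (one_le_mul hc1 hc2) hc3
  · have hr' : 0 < r' := hr.trans_le hrr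
    have h1 := hbound (ρ x) (m₀ + m) le_rfl (hrr.trans h.le) (hm₀.trans (by
      rw [pow_add, mul_assoc]; gcongr))
    calc _ ≤ eLpNorm (T (commArg P i (ballMean b x r))) p₀ (avgMeasure x r') :=
          eLpNorm_psiMeasure_le hρ hΘ hp0 x hr'.le _
      _ ≤ ENNReal.ofReal ((2 ^ m₀) ^ n) *
          eLpNorm (T (commArg P i (ballMean b x r))) p₀ (avgMeasure x (ρ x)) :=
          eLpNorm_avg_le_mul_avg hp₀ h2m hr' hρx hm₀ (ball_subset_ball h.le) _
      _ = ENNReal.ofReal ((2 ^ m₀) ^ n) * (ENNReal.ofReal (2 ^ (Θ * (1 / p₀))) *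
          eLpNorm (T (commArg P i (ballMean b x r))) p₀ (psiMeasure ρ Θ x (ρ x))) := by
          rw [eLpNorm_avgMeasure_eq hρ Θ hp0 x hρx.le]
          congr 3
          rw [psi, div_self hρx.ne']
          norm_num
      _ ≤ ENNReal.ofReal ((2 ^ m₀) ^ n) * (ENNReal.ofReal (2 ^ (Θ * (1 / p₀))) *
          ((CT * CO * S) * ((m₀ + 1) ^ k * ((m + 1) * β) ^ i) *
            M (absFun (f : Lp 𝕜 (p₀ : ℝ≥0∞) volume)) x')) := by
          refine mul_le_mul_right (mul_le_mul_right (h1.trans ?_) _) _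
          gcongr
          calc _ ≤ ((((m₀:ℝ≥0∞) + 1) * (m + 1)) * β) ^ i := by
                gcongr
                have : m₀ + m + 1 ≤ (m₀ + 1) * (m + 1) := by nlinarith
                exact_mod_cast this
            _ = ((m₀:ℝ≥0∞) + 1) ^ i * ((m + 1) * β) ^ i := by rw [mul_assoc, mul_pow]
            _ ≤ _ := by gcongr; simp
      _ = _ := by ring

end OffDiagonal

/-! ### Splitting of the commutator on small balls. -/

section LocalDecomposition

variable {n : ℕ} {ρ : EuclideanSpace ℝ (Fin n) → ℝ} {𝕜 : Type*} [RCLike 𝕜] {p₀ : ℝ≥0}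
  {q₀ : ℝ≥0∞}
  {T : Lp (α := EuclideanSpace ℝ (Fin n)) 𝕜 (p₀ : ℝ≥0∞) volume →
    Lp (α := EuclideanSpace ℝ (Fin n)) 𝕜 (p₀ : ℝ≥0∞) volume}
  {A : ℝ → LcInfty n 𝕜 p₀ → Lp (α := EuclideanSpace ℝ (Fin n)) 𝕜 (p₀ : ℝ≥0∞) volume}
  {c₀ : ℝ} {α : ℕ+ → ℝ≥0} {Θ : ℝ} {CT : ℝ≥0∞}
  {k : ℕ} {CO β : ℝ≥0∞}
  {M : (EuclideanSpace ℝ (Fin n) → ℝ≥0∞) → EuclideanSpace ℝ (Fin n) → ℝ≥0∞}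
  {b : EuclideanSpace ℝ (Fin n) → 𝕜}
  {f : LcInfty n 𝕜 p₀}
  {P : ℕ → Lp (α := EuclideanSpace ℝ (Fin n)) 𝕜 (p₀ : ℝ≥0∞) volume}

/-- The absolute value of the commutator, with values in `ℝ≥0∞`. -/
def commAbs (T : Lp (α := EuclideanSpace ℝ (Fin n)) 𝕜 (p₀ : ℝ≥0∞) volume →
      Lp (α := EuclideanSpace ℝ (Fin n)) 𝕜 (p₀ : ℝ≥0∞) volume)
    (P : ℕ → Lp (α := EuclideanSpace ℝ (Fin n)) 𝕜 (p₀ : ℝ≥0∞) volume)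
    (b : EuclideanSpace ℝ (Fin n) → 𝕜) (k : ℕ) (x : EuclideanSpace ℝ (Fin n)) : ℝ≥0∞ :=
  commFun T P b k x

lemma measurable_commAbs (hb : Measurable b) (k : ℕ) : Measurable (commAbs T P b k) :=
  (measurable_commFun hb k).coe_nnreal_ennreal

/-- The contribution of the lower order commutators. -/
def lowerSum (T : Lp (α := EuclideanSpace ℝ (Fin n)) 𝕜 (p₀ : ℝ≥0∞) volume →
      Lp (α := EuclideanSpace ℝ (Fin n)) 𝕜 (p₀ : ℝ≥0∞) volume)
    (P : ℕ → Lp (α := EuclideanSpace ℝ (Fin n)) 𝕜 (p₀ : ℝ≥0∞) volume)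
    (b : EuclideanSpace ℝ (Fin n) → 𝕜) (k : ℕ) (c : 𝕜) (y : EuclideanSpace ℝ (Fin n)) : ℝ≥0∞ :=
  ∑ i ∈ Finset.range k, (k.choose i : ℝ≥0∞) * (‖b y - c‖ₑ ^ (k - i) * commAbs T P b i y)

lemma measurable_lowerSum (hb : Measurable b) (k : ℕ) (c : 𝕜) :
    Measurable (lowerSum T P b k c) :=
  Finset.measurable_fun_sum _ fun i _ =>
    (((hb.sub_const c).enorm.pow_const _).mul (measurable_commAbs hb i)).const_mul _

lemma coe_sum_eq_lowerSum (k : ℕ) (c : 𝕜) (y : EuclideanSpace ℝ (Fin n)) :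
    ((∑ m ∈ Finset.range k, ‖c - b y‖₊ ^ (k - m) * k.choose m * commFun T P b m y : ℝ≥0) : ℝ≥0∞) =
      lowerSum T P b k c y := by
  rw [lowerSum, ENNReal.ofNNReal_finsetSum]
  refine Finset.sum_congr rfl fun m _ => ?_
  rw [← nnnorm_neg, neg_sub]
  push_cast
  rw [commAbs, enorm_eq_nnnorm]
  ring

lemma IsBoundedSublinear.enorm_commArg_le (hT : IsBoundedSublinear T)
    (hP : IsPowerFamily b (f : Lp 𝕜 (p₀ : ℝ≥0∞) volume) P) (k : ℕ) (c : 𝕜) :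
    ∀ᵐ y, ‖T (commArg P k c) y‖ₑ ≤ commAbs T P b k y + lowerSum T P b k c y := by
  filter_upwards [hT.nnnorm_commArg_le hP k c] with y hy
  rw [← coe_sum_eq_lowerSum, commAbs, enorm_eq_nnnorm, ← ENNReal.coe_add, ENNReal.coe_le_coe]
  rw [Finset.sum_range_succ] at hy
  simpa [add_comm] using hy

lemma IsBoundedSublinear.commAbs_le (hT : IsBoundedSublinear T)
    (hP : IsPowerFamily b (f : Lp 𝕜 (p₀ : ℝ≥0∞) volume) P) (k : ℕ) (c : 𝕜) :
    ∀ᵐ y, commAbs T P b k y ≤ ‖T (commArg P k c) y‖ₑ + lowerSum T P b k c y := by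
  filter_upwards [hT.commFun_le hP k c] with y hy
  rw [← coe_sum_eq_lowerSum, commAbs, enorm_eq_nnnorm, ← ENNReal.coe_add, ENNReal.coe_le_coe]
  exact hy

/-- The maximal functions which control the commutator of order `k`. -/
def commMajorant (M : (EuclideanSpace ℝ (Fin n) → ℝ≥0∞) → EuclideanSpace ℝ (Fin n) → ℝ≥0∞)
    (β : ℝ≥0∞) (T : Lp (α := EuclideanSpace ℝ (Fin n)) 𝕜 (p₀ : ℝ≥0∞) volume →
      Lp (α := EuclideanSpace ℝ (Fin n)) 𝕜 (p₀ : ℝ≥0∞) volume)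
    (f : Lp (α := EuclideanSpace ℝ (Fin n)) 𝕜 (p₀ : ℝ≥0∞) volume)
    (P : ℕ → Lp (α := EuclideanSpace ℝ (Fin n)) 𝕜 (p₀ : ℝ≥0∞) volume)
    (b : EuclideanSpace ℝ (Fin n) → 𝕜) (k : ℕ) (x : EuclideanSpace ℝ (Fin n)) : ℝ≥0∞ :=
  β ^ k * M (absFun f) x + ∑ i ∈ Finset.range k, β ^ (k - i) * M (commAbs T P b i) x

lemma measurable_commMajorant (hM : ∀ h, Measurable (M h)) (k : ℕ) :
    Measurable (commMajorant M β T (f : Lp 𝕜 (p₀ : ℝ≥0∞) volume) P b k) :=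
  ((hM _).const_mul _).add (Finset.measurable_fun_sum _ fun _ _ => (hM _).const_mul _)

lemma OscillationControl.eLpNorm_lowerSum_le (hO : OscillationControl ρ Θ p₀ k CO β M b)
    (hp₀ : 1 ≤ p₀) (hb : Measurable b)
    {x x' : EuclideanSpace ℝ (Fin n)} {r r' : ℝ} {m : ℕ} (hr : 0 < r) (hrr : r ≤ r')
    (hrm : r' ≤ 2 ^ m * r) (hx' : x' ∈ ball x r) :
    eLpNorm (lowerSum T P b k (ballMean b x r)) p₀ (psiMeasure ρ Θ x r') ≤
      2 ^ k * CO * (m + 1) ^ k * commMajorant M β T (f : Lp 𝕜 (p₀ : ℝ≥0∞) volume) P b k x' := by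
  refine (eLpNorm_sum_mul_le hp₀ _ _ fun i => ((hb.sub_const _).enorm.pow_const _).mul
    (measurable_commAbs hb i)).trans ?_
  calc _ ≤ ∑ i ∈ Finset.range k, 2 ^ k * CO * (m + 1) ^ k *
        (β ^ (k - i) * M (commAbs T P b i) x') := by
        refine Finset.sum_le_sum fun i _ => ?_
        have h1 := hO (k - i) (Nat.sub_le k i) _ (measurable_commAbs (T := T) (P := P) hb i) x r r'
          m hr hrr hrm x' hx'
        have h2 : ((k.choose i : ℕ) : ℝ≥0∞) ≤ 2 ^ k := by
          exact_mod_cast Nat.choose_le_two_pow k i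
        calc _ ≤ 2 ^ k * (CO * ((m + 1) * β) ^ (k - i) * M (commAbs T P b i) x') :=
              mul_le_mul' h2 h1
          _ = 2 ^ k * CO * (m + 1) ^ (k - i) * (β ^ (k - i) * M (commAbs T P b i) x') := by
              rw [mul_pow]; ring
          _ ≤ _ := by
              refine mul_le_mul_left (mul_le_mul_right (pow_le_pow_right₀ (by simp) ?_) _) _
              exact Nat.sub_le k i
    _ = 2 ^ k * CO * (m + 1) ^ k * ∑ i ∈ Finset.range k,
        (β ^ (k - i) * M (commAbs T P b i) x') := by rw [Finset.mul_sum]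
    _ ≤ _ := mul_le_mul_right le_add_self _

lemma IsAdmissible.psi_le_two_rpow (hρ : IsAdmissible ρ) {θ r : ℝ} (hθ : 0 ≤ θ)
    (x : EuclideanSpace ℝ (Fin n)) (hr : 0 ≤ r) (hr' : r ≤ ρ x) :
    psi ρ θ x r ≤ ENNReal.ofReal (2 ^ θ) := by
  have := hρ.psi_le_of_le hθ x hr (c := 1) (by linarith)
  norm_num at this
  exact this

lemma eLpNorm_avg_le_two_rpow_mul (hρ : IsAdmissible ρ) (hΘ : 0 ≤ Θ) (hp₀ : p₀ ≠ 0)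
    (x : EuclideanSpace ℝ (Fin n)) {r : ℝ} (hr : 0 ≤ r) (hr' : r ≤ ρ x) {ε : Type*} [ENorm ε]
    (h : EuclideanSpace ℝ (Fin n) → ε) :
    eLpNorm h p₀ (avgMeasure x r) ≤
      ENNReal.ofReal (2 ^ (Θ * (1 / p₀))) * eLpNorm h p₀ (psiMeasure ρ Θ x r) := by
  rw [eLpNorm_avgMeasure_eq hρ Θ hp₀ x hr]
  exact mul_le_mul_left (hρ.psi_le_two_rpow (by positivity) x hr hr') _

/-- Averages of `T((b_B - b)^k f)` over dilates of `B`. -/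
lemma OffDiagonalEstimates.eLpNorm_commArg_le_add
    (hE : OffDiagonalEstimates ρ q₀ T A c₀ α Θ CT)
    (hT : IsBoundedSublinear T) (hρ : IsAdmissible ρ) (hp₀ : 1 ≤ p₀) (hΘ : 0 ≤ Θ) (m₀ : ℕ) :
    ∃ C : ℝ≥0∞, (CT ≠ ∞ → CO ≠ ∞ → ∑' j : ℕ+, (α j : ℝ≥0∞) * (3 * (j : ℕ)) ^ k ≠ ∞ → C ≠ ∞) ∧
    ∀ (β : ℝ≥0∞) (b : EuclideanSpace ℝ (Fin n) → 𝕜) (f : LcInfty n 𝕜 p₀)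
    (P : ℕ → Lp (α := EuclideanSpace ℝ (Fin n)) 𝕜 (p₀ : ℝ≥0∞) volume) (N : ℝ),
    OscillationControl ρ Θ p₀ k CO β M b → Measurable b →
    IsPowerFamily b (f : Lp 𝕜 (p₀ : ℝ≥0∞) volume) P → (∀ x, ‖b x‖ ≤ N) →
    ∀ (x x' : EuclideanSpace ℝ (Fin n)) (r R : ℝ), 0 < r →
    (∀ r', R ≤ r' → ρ x ≤ 2 ^ m₀ * r') → x' ∈ ball x r → ∀ lam : ℝ≥0∞,
    (∀ r', r ≤ r' → r' < R → ∫⁻ y, commAbs T P b k y ^ (p₀ : ℝ) ∂avgMeasure x r' ≤ lam) →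
    ∀ (r' : ℝ) (m : ℕ), r ≤ r' → r' ≤ 2 ^ m * r →
    eLpNorm (T (commArg P k (ballMean b x r))) p₀ (psiMeasure ρ Θ x r') ≤
      C * (m + 1) ^ k * (lam ^ (1 / (p₀ : ℝ)) +
        commMajorant M β T (f : Lp 𝕜 (p₀ : ℝ≥0∞) volume) P b k x') := by
  have hp0 : p₀ ≠ 0 := (one_pos.trans_le hp₀).ne'
  set S := ∑' j : ℕ+, (α j : ℝ≥0∞) * (3 * (j : ℕ)) ^ k with hS
  set C₁ := ENNReal.ofReal ((2 ^ m₀) ^ n) * ENNReal.ofReal (2 ^ (Θ * (1 / p₀))) *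
    (m₀ + 1) ^ k * (CT * CO * S) with hC₁
  refine ⟨1 + 2 ^ k * CO + C₁, fun h1 h2 h3 => by rw [hC₁]; finiteness,
    fun β b f P N hO hb hP hN x x' r R hr hR hx' lam hlam r' m hrr hrm => ?_⟩
  have hm1 : (1:ℝ≥0∞) ≤ (m + 1) ^ k := one_le_pow₀ (by simp)
  set Gs := commMajorant M β T (f : Lp 𝕜 (p₀ : ℝ≥0∞) volume) P b k x' with hGs
  -- Below R the means of the commutator are at most lam, and the expansion passes from T((b_B -
  -- b)^k f) to the commutator. From R on, the radius is comparable to ρ or larger and no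
  -- information on the commutator is needed.
  rcases lt_or_ge r' R with h | h
  · calc _ ≤ eLpNorm (commAbs T P b k + lowerSum T P b k (ballMean b x r)) p₀
          (psiMeasure ρ Θ x r') := by
          refine eLpNorm_mono_enorm_ae ((psiMeasure_absolutelyContinuous ρ Θ x r').ae_le ?_)
          filter_upwards [hT.enorm_commArg_le hP k (ballMean b x r)] with y hy
          simpa using hy
      _ ≤ eLpNorm (commAbs T P b k) p₀ (psiMeasure ρ Θ x r') +
          eLpNorm (lowerSum T P b k (ballMean b x r)) p₀ (psiMeasure ρ Θ x r') :=
          eLpNorm_add_le (measurable_commAbs hb k).aestronglyMeasurable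
            (measurable_lowerSum hb k _).aestronglyMeasurable (by exact_mod_cast hp₀)
      _ ≤ lam ^ (1 / (p₀ : ℝ)) + 2 ^ k * CO * (m + 1) ^ k * Gs := by
          refine add_le_add ?_ (hO.eLpNorm_lowerSum_le hp₀ hb hr hrr hrm hx')
          refine (eLpNorm_psiMeasure_le hρ hΘ hp0 x (hr.trans_le hrr).le _).trans ?_
          rw [eLpNorm_nnreal_eq_lintegral hp0]
          simp only [enorm_eq_self]
          exact ENNReal.rpow_le_rpow (hlam r' hrr h) (by positivity)
      _ ≤ (m + 1) ^ k * lam ^ (1 / (p₀ : ℝ)) + 2 ^ k * CO * (m + 1) ^ k * Gs +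
          ((2 ^ k * CO + C₁) * (m + 1) ^ k * lam ^ (1 / (p₀ : ℝ)) +
            (1 + C₁) * (m + 1) ^ k * Gs) :=
          le_add_right (add_le_add (le_mul_of_one_le_left' hm1) le_rfl)
      _ = _ := by ring
  · refine (hE.eLpNorm_commArg_le hρ hp₀ hΘ hO hP hN le_rfl hr hrr hrm (hR r' h) hx').trans ?_
    rw [← hS, ← hC₁]
    calc _ = C₁ * (m + 1) ^ k * (β ^ k * M (absFun (f : Lp 𝕜 (p₀ : ℝ≥0∞) volume)) x') := by
          rw [mul_pow]; ring
      _ ≤ (1 + 2 ^ k * CO + C₁) * (m + 1) ^ k * (lam ^ (1 / (p₀ : ℝ)) + Gs) := by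
          refine mul_le_mul' (mul_le_mul_left le_add_self _) ?_
          rw [hGs, commMajorant]
          exact le_self_add.trans le_add_self

/-- The splitting of the commutator on small balls. -/
lemma OffDiagonalEstimates.exists_splitting
    (hE : OffDiagonalEstimates ρ q₀ T A c₀ α Θ CT)
    (hT : IsBoundedSublinear T) (hρ : IsAdmissible ρ) (hp₀ : 1 ≤ p₀) (hΘ : 0 ≤ Θ)
    (hc₀ : 0 < c₀) {p : ℝ≥0} {μ : Measure (EuclideanSpace ℝ (Fin n))} {CR : ℝ≥0∞}
    (hR : ∀ (h : EuclideanSpace ℝ (Fin n) → 𝕜), AEStronglyMeasurable h volume →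
      ∀ x r, 0 < r → r < ρ x → ∫⁻ y in ball x r, ‖h y‖ₑ ^ (p : ℝ) ∂μ ≤
        CR * eLpNorm h q₀ (avgMeasure x r) ^ (p : ℝ) * μ (ball x r))
    (hCT : CT ≠ ∞) (hCO : CO ≠ ∞) (hCR : CR ≠ ∞)
    (hS : ∑' j : ℕ+, (α j : ℝ≥0∞) * (3 * (j : ℕ)) ^ k ≠ ∞) (m₀ : ℕ) :
    ∃ C B : ℝ≥0∞, C ≠ ∞ ∧ B ≠ ∞ ∧
    ∀ (β : ℝ≥0∞) (b : EuclideanSpace ℝ (Fin n) → 𝕜) (f : LcInfty n 𝕜 p₀)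
    (P : ℕ → Lp (α := EuclideanSpace ℝ (Fin n)) 𝕜 (p₀ : ℝ≥0∞) volume) (N : ℝ),
    OscillationControl ρ Θ p₀ k CO β M b → Measurable b →
    IsPowerFamily b (f : Lp 𝕜 (p₀ : ℝ≥0∞) volume) P → (∀ x, ‖b x‖ ≤ N) →
    ∀ (x x' : EuclideanSpace ℝ (Fin n)) (r R : ℝ), 0 < r → r < ρ x → r < c₀ * ρ x →
    (∀ r', R ≤ r' → ρ x ≤ 2 ^ m₀ * r') → x' ∈ ball x r → ∀ lam : ℝ≥0∞,
    (∀ r', r ≤ r' → r' < R → ∫⁻ y, commAbs T P b k y ^ (p₀ : ℝ) ∂avgMeasure x r' ≤ lam) →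
    ∃ g H : EuclideanSpace ℝ (Fin n) → ℝ≥0∞, Measurable g ∧ Measurable H ∧
      (∀ᵐ v, v ∈ ball x r → commAbs T P b k v ^ (p₀ : ℝ) ≤ g v + H v) ∧
      ∫⁻ v, g v ∂avgMeasure x r ≤
        C * commMajorant M β T (f : Lp 𝕜 (p₀ : ℝ≥0∞) volume) P b k x' ^ (p₀ : ℝ) ∧
      ∫⁻ v in ball x r, H v ^ ((p : ℝ) / p₀) ∂μ ≤ B * (lam +
        commMajorant M β T (f : Lp 𝕜 (p₀ : ℝ≥0∞) volume) P b k x' ^ (p₀ : ℝ)) ^ ((p : ℝ) / p₀) *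
        μ (ball x r) := by
  have hp0 : p₀ ≠ 0 := (one_pos.trans_le hp₀).ne'
  have hp0' : (0:ℝ) < p₀ := by exact_mod_cast one_pos.trans_le hp₀
  have hp1 : (1:ℝ) ≤ p₀ := by exact_mod_cast hp₀
  set S := ∑' j : ℕ+, (α j : ℝ≥0∞) * (3 * (j : ℕ)) ^ k with hSdef
  obtain ⟨C₄, hC₄, h4⟩ := hE.eLpNorm_commArg_le_add (k := k) (CO := CO) (M := M) hT hρ hp₀ hΘ m₀
  have hC₄ := hC₄ hCT hCO hS
  set C₁ := CT * (CO * S) + ENNReal.ofReal (2 ^ (Θ * (1 / p₀))) * (2 ^ k * CO) with hC₁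
  have hC₁t : C₁ ≠ ∞ := by rw [hC₁]; finiteness
  set e := (2 : ℝ≥0∞) ^ ((p₀ : ℝ) - 1) with he
  have het : e ≠ ∞ := ENNReal.rpow_ne_top_of_nonneg (by linarith) (by simp)
  set t : ℝ := (p : ℝ) / p₀ with ht
  have ht0 : 0 ≤ t := by positivity
  have hpt : (p : ℝ) = p₀ * t := by rw [ht]; field_simp
  set C₅ := CT * (C₄ * S) with hC₅
  have hC₅t : C₅ ≠ ∞ := by rw [hC₅]; finiteness
  refine ⟨e * C₁ ^ (p₀ : ℝ), e ^ t * (CR * C₅ ^ (p : ℝ)) * e ^ t, ?_, ?_,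
    fun β b f P N hO hb hP hN x x' r R hr hrρ hrc hR' hx' lam hlam => ?_⟩
  · exact ENNReal.mul_ne_top het (ENNReal.rpow_ne_top_of_nonneg hp0'.le hC₁t)
  · have h1 := ENNReal.rpow_ne_top_of_nonneg ht0 het
    have h2 := ENNReal.rpow_ne_top_of_nonneg (x := C₅) (y := (p:ℝ)) (by positivity) hC₅t
    finiteness
  set Gs := commMajorant M β T (f : Lp 𝕜 (p₀ : ℝ≥0∞) volume) P b k x' with hGs
  have hMf : β ^ k * M (absFun (f : Lp 𝕜 (p₀ : ℝ≥0∞) volume)) x' ≤ Gs := le_self_add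
  set c := ballMean b x r with hc
  set g : LcInfty n 𝕜 p₀ := ⟨_, commArg_mem_LcInfty hP hN k c⟩ with hg
  -- The hypotheses concern the dilate by c₀ of a subcritical ball; r < c₀ ρ(x) makes r₁ admissible.
  set r₁ := r / c₀ with hr₁
  have hr₁0 : 0 < r₁ := by positivity
  have hr₁ρ : r₁ < ρ x := by rw [hr₁, div_lt_iff₀ hc₀]; linarith
  have hcr : c₀ * r₁ = r := by rw [hr₁]; field_simp
  set V := T (g - A (c₀ * r₁) g) with hV
  set W := T (A (c₀ * r₁) g) with hW
  have hsub := hE.sub_small g x r₁ hr₁0 hr₁ρ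
  have hcomp := hE.comp_small g x r₁ hr₁0 hr₁ρ
  rw [← hV, hcr] at hsub
  rw [← hW, hcr] at hcomp
  -- U collects what is controlled by the majorant alone, namely the T(I - A) part and the lower
  -- commutators. The TA part is W, and g and H are multiples of their p₀-th powers.
  set U : EuclideanSpace ℝ (Fin n) → ℝ≥0∞ := absFun V + lowerSum T P b k c with hU
  have hUm : Measurable U := (measurable_absFun V).add (measurable_lowerSum hb k c)
  have hUle : eLpNorm U p₀ (avgMeasure x r) ≤ C₁ * Gs := by
    calc _ ≤ eLpNorm (absFun V) p₀ (avgMeasure x r) +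
          eLpNorm (lowerSum T P b k c) p₀ (avgMeasure x r) :=
          eLpNorm_add_le (measurable_absFun V).aestronglyMeasurable
            (measurable_lowerSum hb k _).aestronglyMeasurable (by exact_mod_cast hp₀)
      _ ≤ CT * (CO * S * Gs) + ENNReal.ofReal (2 ^ (Θ * (1 / p₀))) * (2 ^ k * CO * Gs) := by
          refine add_le_add ?_ ?_
          · refine le_trans (le_of_eq (eLpNorm_enorm _)) (hsub.trans (mul_le_mul_right ?_ _))
            refine (hO.tsum_eLpNorm_commArg_le hP le_rfl (m := 0) hr le_rfl (by simp) hx').trans ?_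
            rw [← hSdef, mul_assoc (CO * S)]
            refine mul_le_mul_right ?_ _
            simpa using hMf
          · refine (eLpNorm_avg_le_two_rpow_mul hρ hΘ hp0 x hr.le hrρ.le _).trans
              (mul_le_mul_right ?_ _)
            simpa using hO.eLpNorm_lowerSum_le (f := f) (T := T) (P := P) hp₀ hb (m := 0) hr le_rfl
              (by simp) hx'
      _ = _ := by rw [hC₁]; ring
  have hWle : eLpNorm W q₀ (avgMeasure x r) ≤ C₅ * (lam ^ (1 / (p₀ : ℝ)) + Gs) := by
    refine hcomp.trans ?_
    rw [hC₅, mul_assoc]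
    refine mul_le_mul_right ?_ _
    rw [hSdef, ← ENNReal.tsum_mul_left, ← ENNReal.tsum_mul_right]
    refine ENNReal.tsum_le_tsum fun j => ?_
    have h5 := h4 β b f P N hO hb hP hN x x' r R hr hR' hx' lam hlam (2 ^ ((j : ℕ) + 1) * r)
      ((j : ℕ) + 1) (le_mul_of_one_le_left hr.le (one_le_pow₀ (by norm_num))) le_rfl
    have h6 := natCast_add_le_three_mul (j : ℕ) 0 j.pos
    calc _ ≤ (α j : ℝ≥0∞) * (C₄ * (3 * (j : ℕ)) ^ k * (lam ^ (1 / (p₀ : ℝ)) + Gs)) := by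
          refine mul_le_mul_right (h5.trans ?_) _
          gcongr
          simpa using h6
      _ = _ := by ring
  refine ⟨fun v => e * U v ^ (p₀ : ℝ), fun v => e * absFun W v ^ (p₀ : ℝ),
    (hUm.pow_const _).const_mul _, ((measurable_absFun W).pow_const _).const_mul _, ?_, ?_, ?_⟩
  · have hgVW : ∀ᵐ v, ‖T (commArg P k c) v‖ₑ ≤ absFun V v + absFun W v := by
      have := hT.norm_add_le (g - A (c₀ * r₁) g) (A (c₀ * r₁) g)
      rw [sub_add_cancel] at this
      filter_upwards [this] with v hv
      rw [absFun, absFun, enorm_eq_nnnorm, enorm_eq_nnnorm, enorm_eq_nnnorm]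
      exact_mod_cast hv
    filter_upwards [hT.commAbs_le hP k c, hgVW] with v h1 h2 _
    rw [← mul_add]
    refine le_trans ?_ (ENNReal.rpow_add_le_mul_rpow_add_rpow _ _ hp1)
    refine ENNReal.rpow_le_rpow (h1.trans ((add_le_add_left h2 _).trans (le_of_eq ?_))) hp0'.le
    rw [hU, Pi.add_apply]
    ring
  · rw [lintegral_const_mul _ (hUm.pow_const _), lintegral_rpow_eq_eLpNorm_rpow hp0, mul_assoc,
      ← ENNReal.mul_rpow_of_nonneg _ _ hp0'.le]
    exact mul_le_mul_right (ENNReal.rpow_le_rpow hUle hp0'.le) _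
  · have e1 : ∀ v, (e * absFun W v ^ (p₀ : ℝ)) ^ t = e ^ t * absFun W v ^ (p : ℝ) := fun v => by
      rw [ENNReal.mul_rpow_of_nonneg _ _ ht0, ← ENNReal.rpow_mul (absFun W v), ← hpt]
    simp only [e1]
    rw [lintegral_const_mul _ ((measurable_absFun W).pow_const _)]
    calc _ ≤ e ^ t * (CR * eLpNorm W q₀ (avgMeasure x r) ^ (p : ℝ) * μ (ball x r)) :=
          mul_le_mul_right (hR _ (Lp.aestronglyMeasurable W) x r hr hrρ) _
      _ ≤ e ^ t * (CR * (C₅ ^ (p : ℝ) * (e ^ t * (lam + Gs ^ (p₀ : ℝ)) ^ t)) * μ (ball x r)) := by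
          refine mul_le_mul_right (mul_le_mul_left (mul_le_mul_right ?_ _) _) _
          refine (ENNReal.rpow_le_rpow hWle (by positivity)).trans ?_
          rw [ENNReal.mul_rpow_of_nonneg _ _ (by positivity)]
          refine mul_le_mul_right ?_ _
          rw [← ENNReal.mul_rpow_of_nonneg _ _ ht0, hpt, ENNReal.rpow_mul]
          refine ENNReal.rpow_le_rpow ?_ ht0
          refine (ENNReal.rpow_add_le_mul_rpow_add_rpow _ _ hp1).trans (le_of_eq ?_)
          rw [← ENNReal.rpow_mul lam, one_div_mul_cancel hp0'.ne', ENNReal.rpow_one]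
      _ = _ := by ring

/-- Averages of the commutator over balls of radius comparable to `ρ`. -/
lemma OffDiagonalEstimates.exists_avg_commAbs_le
    (hE : OffDiagonalEstimates ρ q₀ T A c₀ α Θ CT)
    (hT : IsBoundedSublinear T) (hρ : IsAdmissible ρ) (hp₀ : 1 ≤ p₀) (hΘ : 0 ≤ Θ)
    (hCT : CT ≠ ∞) (hCO : CO ≠ ∞)
    (hS : ∑' j : ℕ+, (α j : ℝ≥0∞) * (3 * (j : ℕ)) ^ k ≠ ∞) (m₀ : ℕ) :
    ∃ C : ℝ≥0∞, C ≠ ∞ ∧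
    ∀ (β : ℝ≥0∞) (b : EuclideanSpace ℝ (Fin n) → 𝕜) (f : LcInfty n 𝕜 p₀)
    (P : ℕ → Lp (α := EuclideanSpace ℝ (Fin n)) 𝕜 (p₀ : ℝ≥0∞) volume) (N : ℝ),
    OscillationControl ρ Θ p₀ k CO β M b → Measurable b →
    IsPowerFamily b (f : Lp 𝕜 (p₀ : ℝ≥0∞) volume) P → (∀ x, ‖b x‖ ≤ N) →
    ∀ (x x' : EuclideanSpace ℝ (Fin n)) (r : ℝ), 0 < r → r ≤ ρ x → ρ x ≤ 2 ^ m₀ * r →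
    x' ∈ ball x r → ∫⁻ y, commAbs T P b k y ^ (p₀ : ℝ) ∂avgMeasure x r ≤
      C * commMajorant M β T (f : Lp 𝕜 (p₀ : ℝ≥0∞) volume) P b k x' ^ (p₀ : ℝ) := by
  have hp0 : p₀ ≠ 0 := (one_pos.trans_le hp₀).ne'
  have hp0' : (0:ℝ) < p₀ := by exact_mod_cast one_pos.trans_le hp₀
  set S := ∑' j : ℕ+, (α j : ℝ≥0∞) * (3 * (j : ℕ)) ^ k with hSdef
  obtain ⟨C₄, hC₄, h4⟩ := hE.eLpNorm_commArg_le_add (k := k) (CO := CO) (M := M) hT hρ hp₀ hΘ m₀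
  have hC₄ := hC₄ hCT hCO hS
  set C₁ := ENNReal.ofReal (2 ^ (Θ * (1 / p₀))) * (C₄ + 2 ^ k * CO) with hC₁
  have hC₁t : C₁ ≠ ∞ := by rw [hC₁]; finiteness
  refine ⟨C₁ ^ (p₀ : ℝ), ENNReal.rpow_ne_top_of_nonneg hp0'.le hC₁t,
    fun β b f P N hO hb hP hN x x' r hr hrρ hrm hx' => ?_⟩
  set Gs := commMajorant M β T (f : Lp 𝕜 (p₀ : ℝ≥0∞) volume) P b k x' with hGs
  set c := ballMean b x r with hc
  rw [lintegral_rpow_eq_eLpNorm_rpow hp0, ← ENNReal.mul_rpow_of_nonneg _ _ hp0'.le]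
  refine ENNReal.rpow_le_rpow ?_ hp0'.le
  -- Taking R = r makes the assumption on lam vacuous, so lam = 0 is allowed.
  have h5 := h4 β b f P N hO hb hP hN x x' r r hr (fun r' hr' => hrm.trans (by gcongr)) hx' 0
    (fun r' h1 h2 => absurd h1 (not_le.2 h2)) r 0 le_rfl (by simp)
  rw [ENNReal.zero_rpow_of_pos (by positivity)] at h5
  calc _ ≤ ENNReal.ofReal (2 ^ (Θ * (1 / p₀))) *
        eLpNorm (commAbs T P b k) p₀ (psiMeasure ρ Θ x r) :=
        eLpNorm_avg_le_two_rpow_mul hρ hΘ hp0 x hr.le hrρ _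
    _ ≤ ENNReal.ofReal (2 ^ (Θ * (1 / p₀))) * eLpNorm (absFun (T (commArg P k c)) +
          lowerSum T P b k c) p₀ (psiMeasure ρ Θ x r) := by
        refine mul_le_mul_right (eLpNorm_mono_enorm_ae
          ((psiMeasure_absolutelyContinuous ρ Θ x r).ae_le ?_)) _
        filter_upwards [hT.commAbs_le hP k c] with y hy
        simpa [absFun] using hy
    _ ≤ ENNReal.ofReal (2 ^ (Θ * (1 / p₀))) *
        (eLpNorm (absFun (T (commArg P k c))) p₀ (psiMeasure ρ Θ x r) +
          eLpNorm (lowerSum T P b k c) p₀ (psiMeasure ρ Θ x r)) :=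
        mul_le_mul_right (eLpNorm_add_le (measurable_absFun _).aestronglyMeasurable
          (measurable_lowerSum hb k _).aestronglyMeasurable (by exact_mod_cast hp₀)) _
    _ ≤ ENNReal.ofReal (2 ^ (Θ * (1 / p₀))) * (C₄ * Gs + 2 ^ k * CO * Gs) := by
        refine mul_le_mul_right (add_le_add ?_ ?_) _
        · refine le_trans (le_of_eq (eLpNorm_enorm _)) ?_
          simpa using h5
        · simpa using hO.eLpNorm_lowerSum_le (f := f) (T := T) (P := P) hp₀ hb (m := 0) hr le_rfl
              (by simp) hx'
    _ = _ := by rw [hC₁]; ring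

end LocalDecomposition

/-! ### One step of the induction on the order of the commutator. -/

section WeightedStep

variable {n : ℕ} {ρ : EuclideanSpace ℝ (Fin n) → ℝ} {𝕜 : Type*} [RCLike 𝕜] {p₀ : ℝ≥0}
  {q₀ : ℝ≥0∞}
  {T : Lp (α := EuclideanSpace ℝ (Fin n)) 𝕜 (p₀ : ℝ≥0∞) volume →
    Lp (α := EuclideanSpace ℝ (Fin n)) 𝕜 (p₀ : ℝ≥0∞) volume}
  {A : ℝ → LcInfty n 𝕜 p₀ → Lp (α := EuclideanSpace ℝ (Fin n)) 𝕜 (p₀ : ℝ≥0∞) volume}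
  {c₀ : ℝ} {α : ℕ+ → ℝ≥0} {Θ : ℝ} {CT : ℝ≥0∞}
  {k : ℕ} {CO β : ℝ≥0∞}
  {M : (EuclideanSpace ℝ (Fin n) → ℝ≥0∞) → EuclideanSpace ℝ (Fin n) → ℝ≥0∞}
  {b : EuclideanSpace ℝ (Fin n) → 𝕜}
  {f : LcInfty n 𝕜 p₀}
  {P : ℕ → Lp (α := EuclideanSpace ℝ (Fin n)) 𝕜 (p₀ : ℝ≥0∞) volume}

/-- Qualitative finiteness, available for bounded b, which makes the base level of the stopping
argument finite. The bound depends on b and does not enter the final constant. -/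
lemma IsBoundedSublinear.eLpNorm_commAbs_ne_top (hT : IsBoundedSublinear T) (hp₀ : 1 ≤ p₀)
    (hb : Measurable b) (hP : IsPowerFamily b (f : Lp 𝕜 (p₀ : ℝ≥0∞) volume) P) {N : ℝ}
    (hN : ∀ x, ‖b x‖ ≤ N) (k : ℕ) : eLpNorm (commAbs T P b k) p₀ volume ≠ ∞ := by
  induction k using Nat.strong_induction_on with
  | _ k ih =>
  have hbN : ∀ y, ‖b y‖ₑ ≤ ENNReal.ofReal N := fun y => by
    rw [← ofReal_norm]; exact ENNReal.ofReal_le_ofReal (hN y)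
  have h1 : eLpNorm (commAbs T P b k) p₀ volume ≤
      eLpNorm (absFun (T (commArg P k 0))) p₀ volume + eLpNorm (lowerSum T P b k 0) p₀ volume := by
    refine le_trans (eLpNorm_mono_enorm_ae ?_) (eLpNorm_add_le
      (measurable_absFun (T (commArg P k 0))).aestronglyMeasurable
      (measurable_lowerSum hb k 0).aestronglyMeasurable (by exact_mod_cast hp₀))
    filter_upwards [hT.commAbs_le hP k 0] with y hy
    simpa [absFun] using hy
  refine ne_top_of_le_ne_top (ENNReal.add_ne_top.2 ⟨?_, ?_⟩) h1
  · rw [show eLpNorm (absFun (T (commArg P k 0))) p₀ volume = _ from eLpNorm_enorm _]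
    exact (Lp.memLp _).2.ne
  · refine ne_top_of_le_ne_top ?_ (eLpNorm_sum_mul_le hp₀ _ _ fun i =>
      ((hb.sub_const _).enorm.pow_const _).mul (measurable_commAbs hb i))
    refine ENNReal.sum_ne_top.2 fun i hi => ENNReal.mul_ne_top (by simp) ?_
    refine ne_top_of_le_ne_top (ENNReal.mul_ne_top (ENNReal.pow_ne_top ENNReal.ofReal_ne_top)
      (ih i (Finset.mem_range.1 hi))) (b := ENNReal.ofReal N ^ (k - i) *
        eLpNorm (commAbs T P b i) p₀ volume) ?_
    rw [← eLpNorm_const_mul_ennreal (one_pos.trans_le hp₀).ne' _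
      (measurable_commAbs hb i).aemeasurable]
    refine eLpNorm_mono_enorm fun y => ?_
    simp only [enorm_eq_self, sub_zero]
    gcongr
    exact hbN y

set_option maxHeartbeats 400000 in
/-- Weighted estimate of the commutator of order `k` by maximal functions of `f` and of the
commutators of lower order. -/
theorem OffDiagonalEstimates.exists_eLpNorm_commAbs_le_majorant
    (hE : OffDiagonalEstimates ρ q₀ T A c₀ α Θ CT) (hn : 1 ≤ n)
    (hT : IsBoundedSublinear T) (hρ : IsAdmissible ρ) (hp₀ : 1 ≤ p₀) (hΘ : 0 ≤ Θ)
    (hc₀ : 0 < c₀) {p : ℝ≥0} (hp : p₀ ≤ p) {w : EuclideanSpace ℝ (Fin n) → ℝ≥0∞}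
    (hw : Measurable w) (hwfin : ∀ x r, ∫⁻ y in ball x r, w y ≠ ∞)
    {t₀ : ℝ} (ht₀ : 0 < t₀) {C₀ : ℝ≥0∞} (hC₀ : C₀ ≠ ∞)
    (hA : LocalAInfty ρ t₀ C₀ (volume.withDensity w))
    (hSm : ∀ κ : ℝ, 0 < κ → κ ≤ 1 → (∀ x y, dist x y ≤ ρ x → κ * ρ x ≤ ρ y ∧ κ * ρ y ≤ ρ x) →
      SmallnessCondition ρ κ (volume.withDensity w))
    {θ : ℝ} (hθ : 0 ≤ θ) {CM : ℝ≥0∞} (hCM : CM ≠ ∞)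
    (hMs : ∀ h : EuclideanSpace ℝ (Fin n) → ℝ≥0∞, Measurable h →
      ∫⁻ x, maximalRho ρ θ h x ^ ((p : ℝ) / p₀) ∂(volume.withDensity w) ≤
        CM * ∫⁻ x, h x ^ ((p : ℝ) / p₀) ∂(volume.withDensity w))
    {CR : ℝ≥0∞} (hR : ∀ (h : EuclideanSpace ℝ (Fin n) → 𝕜), AEStronglyMeasurable h volume →
      ∀ x r, 0 < r → r < ρ x → ∫⁻ y in ball x r, ‖h y‖ₑ ^ (p : ℝ) ∂(volume.withDensity w) ≤
        CR * eLpNorm h q₀ (avgMeasure x r) ^ (p : ℝ) * volume.withDensity w (ball x r))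
    (hCT : CT ≠ ∞) (hCO : CO ≠ ∞) (hCR : CR ≠ ∞)
    (hS : ∑' j : ℕ+, (α j : ℝ≥0∞) * (3 * (j : ℕ)) ^ k ≠ ∞) (hM : ∀ h, Measurable (M h)) :
    ∃ C : ℝ≥0∞, C ≠ ∞ ∧
    ∀ (β : ℝ≥0∞) (b : EuclideanSpace ℝ (Fin n) → 𝕜) (f : LcInfty n 𝕜 p₀)
    (P : ℕ → Lp (α := EuclideanSpace ℝ (Fin n)) 𝕜 (p₀ : ℝ≥0∞) volume) (N : ℝ),
    OscillationControl ρ Θ p₀ k CO β M b → Measurable b →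
    IsPowerFamily b (f : Lp 𝕜 (p₀ : ℝ≥0∞) volume) P → (∀ x, ‖b x‖ ≤ N) →
    eLpNorm (commAbs T P b k) p (volume.withDensity w) ≤
      C * eLpNorm (commMajorant M β T (f : Lp 𝕜 (p₀ : ℝ≥0∞) volume) P b k) p
        (volume.withDensity w) := by
  have hp0 : p₀ ≠ 0 := (one_pos.trans_le hp₀).ne'
  have hp0' : (0:ℝ) < p₀ := by exact_mod_cast one_pos.trans_le hp₀
  have hpp : (p₀ : ℝ) ≤ p := by exact_mod_cast hp
  have hpr : (0:ℝ) < p := hp0'.trans_le hpp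
  have hpne : p ≠ 0 := by exact_mod_cast hpr.ne'
  set t : ℝ := (p : ℝ) / p₀ with ht
  have ht1 : 1 ≤ t := by rw [ht, one_le_div hp0']; exact hpp
  have ht0 : 0 ≤ t := by linarith
  have hpt : (p : ℝ) = p₀ * t := by rw [ht]; field_simp
  obtain ⟨κ, hκ0, hκ1, hκ⟩ := hρ.exists_local_comparison
  obtain ⟨τ, κ', hκ'0, hκ'1, hτρ, hρτ, hτlip⟩ := hρ.exists_lipschitz
  have hn0 : (1:ℝ) ≤ n := by exact_mod_cast hn
  -- Cubes have side δτ(z). The first entry meets the scale condition of the local theorem; the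
  -- second keeps all radii in the splitting below c₀ρ at their centres.
  set δ : ℝ := min (κ ^ 2 / (100 * (n + 1) ^ 2)) (c₀ * κ / (4 * (n + 1))) with hδ
  have hδ0 : 0 < δ := lt_min (by positivity) (by positivity)
  have hδ1 : 100 * (n + 1) ^ 2 * δ ≤ κ ^ 2 := by
    have := min_le_left (κ ^ 2 / (100 * ((n:ℝ) + 1) ^ 2)) (c₀ * κ / (4 * (n + 1)))
    rw [← hδ, le_div_iff₀ (by positivity)] at this
    linarith
  have hδ2 : 4 * (n + 1) * δ ≤ c₀ * κ := by
    have := min_le_right (κ ^ 2 / (100 * ((n:ℝ) + 1) ^ 2)) (c₀ * κ / (4 * (n + 1)))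
    rw [← hδ, le_div_iff₀ (by positivity)] at this
    linarith
  have hκκ : κ ^ 2 ≤ κ := by nlinarith
  have hδ3 : 64 * (n + 1) * δ ≤ κ := by nlinarith
  have hδ4 : (n + 1) * δ ≤ 1 / 2 := by linarith
  have hδ5 : δ ≤ 1 / 2 := (le_mul_of_one_le_left hδ0.le (by linarith)).trans hδ4
  -- Number of doublings bringing any radius at least δτ(z) up to ρ(x) for nearby x, through κ'ρ ≤ τ
  -- and the comparison constant κ.
  obtain ⟨m₀, hm₀⟩ := pow_unbounded_of_one_lt (1 / (κ * (δ * κ'))) (one_lt_two (α := ℝ))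
  have hm₀ : 1 ≤ 2 ^ m₀ * (κ * (δ * κ')) := by
    rw [div_lt_iff₀ (by positivity)] at hm₀
    exact hm₀.le
  have hτ0 : ∀ z, 0 < τ z := fun z =>
    (mul_pos hκ'0 (hρ.pos z)).trans_le (hρτ z)
  obtain ⟨C₁, B, hC₁, hB, hsplit⟩ := hE.exists_splitting (k := k) (CO := CO) (M := M) hT hρ hp₀ hΘ
    hc₀ hR hCT hCO hCR hS m₀
  obtain ⟨C₂, hC₂, havg⟩ := hE.exists_avg_commAbs_le (k := k) (CO := CO) (M := M) hT hρ hp₀ hΘ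
    hCT hCO hS m₀
  have hμ : volume.withDensity w ≪ (volume : Measure (EuclideanSpace ℝ (Fin n))) :=
    withDensity_absolutelyContinuous _ _
  have hμfin : ∀ x r, volume.withDensity w (ball x r) ≠ ∞ := fun x r => by
    rw [withDensity_apply _ measurableSet_ball]; exact hwfin x r
  obtain ⟨CL, hCL, hloc⟩ := exists_local_estimate hn hρ hκ0 hκ1 hκ ht1 hθ hμ hμfin ht₀ hC₀ hA
    (hSm κ hκ0 hκ1 hκ) hCM hMs hB
  set cG : ℝ≥0∞ := 1 + C₁ + C₂ with hcG
  set K : ℝ≥0∞ := ENNReal.ofReal (3 ^ n) * (CL * ENNReal.ofReal ((2 * (n + 1)) ^ n) *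
    ENNReal.ofReal (3 ^ n)) * cG ^ t with hK
  have hKt : K ≠ ∞ := by
    have := ENNReal.rpow_ne_top_of_nonneg (x := cG) ht0 (by rw [hcG]; finiteness)
    rw [hK]; finiteness
  refine ⟨K ^ (1 / (p : ℝ)), ENNReal.rpow_ne_top_of_nonneg (by positivity) hKt,
    fun β b f P N hO hb hP hN => ?_⟩
  set F := commAbs T P b k with hF
  set Gs := commMajorant M β T (f : Lp 𝕜 (p₀ : ℝ≥0∞) volume) P b k with hGs
  have hFm : Measurable F := measurable_commAbs hb k
  have hGm : Measurable Gs := measurable_commMajorant hM k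
  set G : EuclideanSpace ℝ (Fin n) → ℝ≥0∞ := fun x => cG * Gs x ^ (p₀ : ℝ) with hG
  have hGm' : Measurable G := (hGm.pow_const _).const_mul _
  have hFp : ∀ y, (F y ^ (p₀ : ℝ)) ^ t = F y ^ (p : ℝ) := fun y => by
    rw [← ENNReal.rpow_mul, ← hpt]
  have hFtop : ∫⁻ y, F y ^ (p₀ : ℝ) ≠ ∞ := by
    rw [lintegral_rpow_eq_eLpNorm_rpow hp0]
    exact ENNReal.rpow_ne_top_of_nonneg hp0'.le (hT.eLpNorm_commAbs_ne_top hp₀ hb hP hN k)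
  have hcG₁ : C₁ ≤ cG := le_add_self.trans le_self_add
  have hcG₂ : C₂ ≤ cG := le_add_self
  have hGsG : ∀ x, Gs x ^ (p₀ : ℝ) ≤ G x := fun x =>
    le_mul_of_one_le_left' (le_self_add.trans le_self_add)
  have hlocal : ∀ z, ∫⁻ y in ball z (δ * τ z / 2), F y ^ (p : ℝ) ∂(volume.withDensity w) ≤
      CL * ∫⁻ y in ball z ((n + 1) * (δ * τ z)), G y ^ t ∂(volume.withDensity w) := by
    intro z
    have hρz := hρ.pos z
    have hτz := hτ0 z
    have hτρz := hτρ z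
    have hℓ : 0 < δ * τ z := by positivity
    have hℓρ : 100 * (n + 1) ^ 2 * (δ * τ z) ≤ κ ^ 2 * ρ z := by
      calc _ = (100 * (n + 1) ^ 2 * δ) * τ z := by ring
        _ ≤ κ ^ 2 * ρ z := by gcongr
    have hℓρ3 : 64 * ((n + 1) * (δ * τ z)) ≤ κ * ρ z := by
      calc _ = (64 * (n + 1) * δ) * τ z := by ring
        _ ≤ κ * ρ z := by gcongr
    have hℓρ2 : 4 * ((n + 1) * (δ * τ z)) ≤ c₀ * (κ * ρ z) := by
      calc _ = (4 * (n + 1) * δ) * τ z := by ring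
        _ ≤ (c₀ * κ) * ρ z := by gcongr
        _ = _ := by ring
    have hNℓ : δ * τ z ≤ (n + 1) * (δ * τ z) := by nlinarith
    have hNℓ0 : 0 < (n + 1) * (δ * τ z) := by positivity
    have hκρ : κ * ρ z ≤ ρ z := by nlinarith
    have hlow : ∀ x r', dist z x ≤ ρ z → δ * τ z ≤ r' → ρ x ≤ 2 ^ m₀ * r' := by
      intro x r' hzx hr'
      have h1 := (hκ z x hzx).2
      have h2 := hρτ z
      have hρx := hρ.pos x
      calc ρ x ≤ 2 ^ m₀ * (κ * (δ * κ')) * ρ x := le_mul_of_one_le_left hρx.le hm₀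
        _ = 2 ^ m₀ * (δ * (κ' * (κ * ρ x))) := by ring
        _ ≤ 2 ^ m₀ * (δ * (κ' * ρ z)) := by gcongr
        _ ≤ 2 ^ m₀ * (δ * τ z) := by gcongr
        _ ≤ _ := by gcongr
    have h := hloc z (δ * τ z) hℓ hℓρ (fun y => F y ^ (p₀ : ℝ)) G (hFm.pow_const _) hGm'
      (ne_top_of_le_ne_top hFtop (setLIntegral_le_lintegral _ _)) ?_ ?_
    · simpa only [hFp] using h
    · intro x hx
      refine (havg β b f P N hO hb hP hN z x _ (by positivity) (by linarith) ?_
        (ball_subset_ball (by linarith) hx)).trans (mul_le_mul_left hcG₂ _)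
      exact hlow z _ (by simpa using hρz.le) (by linarith)
    · intro x hx r hr hr2 lam hlam hle x' hx'
      have hzx : dist z x ≤ ρ z := by
        rw [mem_ball, dist_comm] at hx; linarith
      have hκx := (hκ z x hzx).1
      have hcκ : c₀ * (κ * ρ z) ≤ c₀ * ρ x := by gcongr
      obtain ⟨g, H, hg, hH, h1, h2, h3⟩ := hsplit β b f P N hO hb hP hN x x' r
        (8 * ((n + 1) * (δ * τ z))) hr (by linarith) (by linarith)
        (fun r' hr' => hlow x r' hzx (by linarith)) hx' lam hle
      refine ⟨g, H, hg, hH, h1, h2.trans (mul_le_mul_left hcG₁ _), h3.trans ?_⟩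
      refine mul_le_mul_left (mul_le_mul_right (ENNReal.rpow_le_rpow ?_ ht0) _) _
      exact add_le_add_right (hGsG x') _
  have hball : ∀ z, ∫⁻ y, w y * F y ^ (p : ℝ) ∂avgMeasure z (δ * τ z / 2) ≤
      CL * ENNReal.ofReal ((2 * (n + 1)) ^ n) *
        ∫⁻ y, w y * G y ^ t ∂avgMeasure z ((n + 1) * (δ * τ z)) := by
    intro z
    have hτz := hτ0 z
    have hℓ : 0 < δ * τ z / 2 := by positivity
    have hℓ' : 0 < (n + 1) * (δ * τ z) := by positivity
    have h1 := hlocal z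
    rw [setLIntegral_withDensity_eq_setLIntegral_mul _ hw (hFm.pow_const _) measurableSet_ball,
      setLIntegral_withDensity_eq_setLIntegral_mul _ hw (hGm'.pow_const _) measurableSet_ball,
      setLIntegral_ball_eq_mul_avg z hℓ, setLIntegral_ball_eq_mul_avg z hℓ'] at h1
    rw [← ENNReal.mul_le_mul_iff_right (volume_ball_ne_zero z hℓ) (volume_ball_ne_top z _)]
    refine h1.trans ?_
    have hv : volume (ball z ((n + 1) * (δ * τ z))) ≤
        ENNReal.ofReal ((2 * (n + 1)) ^ n) * volume (ball z (δ * τ z / 2)) :=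
      volume_ball_le_mul z z (by positivity) (by linarith)
    refine (mul_le_mul_right (mul_le_mul_left hv _) _).trans (le_of_eq ?_)
    simp only [Pi.mul_apply]
    ring
  -- Both families of radii used in the gluing, c = 1/2 below and c = n + 1 above, have slope at
  -- most 1/2.
  have hlip : ∀ c : ℝ, 0 ≤ c → c * δ ≤ 1 / 2 → ∀ x y, c * (δ * τ x) ≤ c * (δ * τ y) + dist x y / 2 := by
    intro c hc hcδ x y
    have h1 := hτlip x y
    have h2 := mul_le_mul_of_nonneg_left h1 (mul_nonneg hc hδ0.le)
    have h3 := mul_le_mul_of_nonneg_right hcδ (dist_nonneg (x := x) (y := y))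
    linarith
  have hmain : ∫⁻ y, F y ^ (p : ℝ) ∂(volume.withDensity w) ≤
      K * ∫⁻ y, Gs y ^ (p : ℝ) ∂(volume.withDensity w) := by
    rw [lintegral_withDensity_eq_lintegral_mul _ hw (hFm.pow_const _),
      lintegral_withDensity_eq_lintegral_mul _ hw (hGm.pow_const _)]
    simp only [Pi.mul_apply]
    calc ∫⁻ y, w y * F y ^ (p : ℝ) = ∫⁻ y in Set.univ, w y * F y ^ (p : ℝ) := by
          rw [Measure.restrict_univ]
      _ ≤ ENNReal.ofReal (3 ^ n) * ∫⁻ z in Set.univ, ∫⁻ y, w y * F y ^ (p : ℝ)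
            ∂avgMeasure z (δ * τ z / 2) := by
          refine setLIntegral_le_lintegral_avg_ball (fun z => by have := hτ0 z; positivity)
            (fun x y => ?_) (hw.mul (hFm.pow_const _)) MeasurableSet.univ MeasurableSet.univ
            fun _ _ => Set.subset_univ _
          have := hlip (1 / 2) (by norm_num) (by linarith) x y
          linarith
      _ ≤ ENNReal.ofReal (3 ^ n) * ∫⁻ z, CL * ENNReal.ofReal ((2 * (n + 1)) ^ n) *
            ∫⁻ y, w y * G y ^ t ∂avgMeasure z ((n + 1) * (δ * τ z)) := by
          rw [Measure.restrict_univ]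
          exact mul_le_mul_right (lintegral_mono hball) _
      _ ≤ ENNReal.ofReal (3 ^ n) * (CL * ENNReal.ofReal ((2 * (n + 1)) ^ n) *
            (ENNReal.ofReal (3 ^ n) * ∫⁻ y, w y * G y ^ t)) := by
          rw [lintegral_const_mul' _ _ (ENNReal.mul_ne_top hCL ENNReal.ofReal_ne_top)]
          refine mul_le_mul_right (mul_le_mul_right ?_ _) _
          exact lintegral_avg_ball_le (fun z => by have := hτ0 z; positivity)
            (hlip (n + 1) (by positivity) hδ4) (hw.mul (hGm'.pow_const _))
      _ = _ := by
          have e1 : ∀ y, w y * G y ^ t = cG ^ t * (w y * Gs y ^ (p : ℝ)) := fun y => by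
            simp only [hG]
            rw [ENNReal.mul_rpow_of_nonneg _ _ ht0, ← ENNReal.rpow_mul (Gs y), ← hpt]
            ring
          have hwG : Measurable fun y => w y * Gs y ^ (p : ℝ) := hw.mul (hGm.pow_const _)
          simp only [e1]
          rw [lintegral_const_mul _ hwG, hK]
          ring
  rw [eLpNorm_nnreal_eq_lintegral hpne, eLpNorm_nnreal_eq_lintegral hpne]
  simp only [enorm_eq_self]
  rw [← ENNReal.mul_rpow_of_nonneg _ _ (by positivity)]
  exact ENNReal.rpow_le_rpow hmain (by positivity)

end WeightedStep

/-! ### The weighted estimate for bounded b. -/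

section BoundedCommutator

variable {n : ℕ} {ρ : EuclideanSpace ℝ (Fin n) → ℝ} {𝕜 : Type*} [RCLike 𝕜] {p₀ p : ℝ≥0}
  {q₀ : ℝ≥0∞} {ω : EuclideanSpace ℝ (Fin n) → ℝ}

/-- Boundedness on L^p of the rescaled maximal operator is boundedness of the maximal function on
L^{p/(p₀s)}. -/
lemma eLpNorm_maximalPow_le {θ s : ℝ} (hp₀ : p₀ ≠ 0) (hp : p ≠ 0) (hs : 0 < s)
    {μ : Measure (EuclideanSpace ℝ (Fin n))} {CM : ℝ≥0∞}
    (hM : ∀ h : EuclideanSpace ℝ (Fin n) → ℝ≥0∞, Measurable h →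
      ∫⁻ x, maximalRho ρ θ h x ^ ((p : ℝ) / p₀ / s) ∂μ ≤ CM * ∫⁻ x, h x ^ ((p : ℝ) / p₀ / s) ∂μ)
    {h : EuclideanSpace ℝ (Fin n) → ℝ≥0∞} (hh : Measurable h) :
    eLpNorm (maximalPow ρ θ (p₀ * s) h) p μ ≤ CM ^ (1 / (p : ℝ)) * eLpNorm h p μ := by
  have hp0 : (0:ℝ) < p₀ := by exact_mod_cast pos_of_ne_zero hp₀
  have hpr : (0:ℝ) < p := by exact_mod_cast pos_of_ne_zero hp
  rw [eLpNorm_nnreal_eq_lintegral hp, eLpNorm_nnreal_eq_lintegral hp,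
    ← ENNReal.mul_rpow_of_nonneg _ _ (by positivity)]
  refine ENNReal.rpow_le_rpow ?_ (by positivity)
  simp only [enorm_eq_self]
  refine le_of_eq_of_le ?_ ((hM (fun y => h y ^ (p₀ * s)) (hh.pow_const _)).trans (le_of_eq ?_))
  · congr 1 with x
    rw [maximalPow, ← ENNReal.rpow_mul]
    congr 1; field_simp
  · congr 2 with x
    rw [← ENNReal.rpow_mul]
    congr 1; field_simp

/-- Hölder with exponent q₀/p, the weight being estimated by its reverse Hölder inequality with
exactly the conjugate exponent. No integrability is lost, and p = q₀ corresponds to a bounded weight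
ratio. -/
lemma setLIntegral_enorm_rpow_withDensity_le (hp : p ≠ 0) (hpq : (p : ℝ≥0∞) ≤ q₀)
    (hω : IsWeight ω) {w : EuclideanSpace ℝ (Fin n) → ℝ≥0∞} (hw : Measurable w)
    (hωw : (fun x => ENNReal.ofReal (ω x)) =ᵐ[volume] w) {C : ℝ≥0∞}
    {x : EuclideanSpace ℝ (Fin n)} {r : ℝ} (hr : 0 < r)
    (hRH : eLpNorm ω (ENNReal.conjExponent (q₀ / p)) (avgMeasure x r) ≤
      C * ∫⁻ y, ENNReal.ofReal (ω y) ∂(avgMeasure x r))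
    {h : EuclideanSpace ℝ (Fin n) → 𝕜} (hh : AEStronglyMeasurable h volume) :
    ∫⁻ y in ball x r, ‖h y‖ₑ ^ (p : ℝ) ∂(volume.withDensity w) ≤
      C * eLpNorm h q₀ (avgMeasure x r) ^ (p : ℝ) * volume.withDensity w (ball x r) := by
  have hac := avgMeasure_absolutelyContinuous_volume x r
  have h1 : ∫⁻ y in ball x r, ‖h y‖ₑ ^ (p : ℝ) ∂(volume.withDensity w) =
      ∫⁻ y in ball x r, ‖h y‖ₑ ^ (p : ℝ) * ENNReal.ofReal (ω y) := by
    rw [setLIntegral_withDensity_eq_lintegral_mul₀ hw.aemeasurable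
      (hh.enorm.pow_const _) measurableSet_ball]
    refine lintegral_congr_ae (ae_restrict_of_ae ?_)
    filter_upwards [hωw] with y hy
    rw [hy, Pi.mul_apply, mul_comm]
  have h2 : ∫⁻ y, ENNReal.ofReal (ω y) ∂(avgMeasure x r) = ∫⁻ y, w y ∂(avgMeasure x r) :=
    lintegral_congr_ae (hac.ae_le hωw)
  rw [h1, setLIntegral_ball_eq_mul_avg x hr, withDensity_apply _ measurableSet_ball,
    setLIntegral_ball_eq_mul_avg x hr w]
  calc _ ≤ volume (ball x r) * (eLpNorm h q₀ (avgMeasure x r) ^ (p : ℝ) *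
        eLpNorm ω (ENNReal.conjExponent (q₀ / p)) (avgMeasure x r)) :=
        mul_le_mul_right (lintegral_enorm_rpow_mul_le hp hpq (hh.mono_ac hac)
          (hω.locallyIntegrable.aestronglyMeasurable.mono_ac hac)) _
    _ ≤ volume (ball x r) * (eLpNorm h q₀ (avgMeasure x r) ^ (p : ℝ) *
        (C * ∫⁻ y, w y ∂(avgMeasure x r))) := by
        rw [← h2]
        exact mul_le_mul_right (mul_le_mul_right hRH _) _
    _ = _ := by ring

lemma tsum_mul_three_mul_pow_ne_top {α : ℕ+ → ℝ≥0} {k : ℕ}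
    (hα : Summable fun j : ℕ+ => α j * (j : ℝ≥0) ^ k) {i : ℕ} (hi : i ≤ k) :
    ∑' j : ℕ+, (α j : ℝ≥0∞) * (3 * (j : ℕ)) ^ i ≠ ∞ := by
  have h1 := ENNReal.tsum_coe_ne_top_iff_summable.2 hα
  refine ne_top_of_le_ne_top (ENNReal.mul_ne_top (by finiteness : (3 : ℝ≥0∞) ^ k ≠ ∞) h1) ?_
  rw [← ENNReal.tsum_mul_left]
  refine ENNReal.tsum_le_tsum fun j => ?_
  have h3 : (1 : ℝ≥0∞) ≤ 3 * (j : ℕ) := by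
    have := j.pos
    exact_mod_cast (by omega : 1 ≤ 3 * (j : ℕ))
  calc _ ≤ (α j : ℝ≥0∞) * (3 * (j : ℕ)) ^ k := by gcongr
    _ = _ := by push_cast; rw [mul_pow]; ring

variable
  {T : Lp (α := EuclideanSpace ℝ (Fin n)) 𝕜 (p₀ : ℝ≥0∞) volume →
    Lp (α := EuclideanSpace ℝ (Fin n)) 𝕜 (p₀ : ℝ≥0∞) volume}
  {A : ℝ → LcInfty n 𝕜 p₀ → Lp (α := EuclideanSpace ℝ (Fin n)) 𝕜 (p₀ : ℝ≥0∞) volume}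
  {c₀ : ℝ} {α : ℕ+ → ℝ≥0} {k : ℕ}

/-- The weighted commutator estimate for bounded `b`. -/
theorem exists_eLpNorm_commAbs_le (hn : 1 ≤ n) (hρ : IsAdmissible ρ) (hp₀ : 1 ≤ p₀)
    (hp : p₀ < p) (hpq : (p : ℝ≥0∞) ≤ q₀) (hT : IsBoundedSublinear T) (hc₀ : 0 < c₀)
    (hα : Summable fun j : ℕ+ => α j * (j : ℝ≥0) ^ k)
    (hE : ∀ θ : ℝ, 0 < θ → ∃ C : ℝ≥0, OffDiagonalEstimates ρ q₀ T A c₀ α θ C)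
    (hω : IsWeight ω) (hωA : MuckenhouptRhoInfty ρ ((p : ℝ) / (p₀ : ℝ)) ω)
    (hωRH : ReverseHolderLoc ρ (ENNReal.conjExponent (q₀ / p)) ω) (hω0 : ¬ ω =ᵐ[volume] 0)
    {θ₁ : ℝ} (hθ₁ : 0 ≤ θ₁) :
    ∃ C : ℝ≥0∞, C ≠ ∞ ∧ ∀ (f : LcInfty n 𝕜 p₀) (b : EuclideanSpace ℝ (Fin n) → 𝕜)
      (P : ℕ → Lp (α := EuclideanSpace ℝ (Fin n)) 𝕜 (p₀ : ℝ≥0∞) volume) (N : ℝ),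
      Measurable b → LocallyIntegrable b volume → (∀ x, ‖b x‖ ≤ N) →
      IsPowerFamily b (f : Lp 𝕜 (p₀ : ℝ≥0∞) volume) P →
      eLpNorm (commAbs T P b k) p (weightMeasure ω) ≤ C * bmoNorm ρ θ₁ b ^ k *
        eLpNorm (absFun (f : Lp 𝕜 (p₀ : ℝ≥0∞) volume)) p (weightMeasure ω) := by
  have hp0 : p₀ ≠ 0 := (one_pos.trans_le hp₀).ne'
  have hp0' : (0:ℝ) < p₀ := by exact_mod_cast one_pos.trans_le hp₀
  have hpne : p ≠ 0 := (pos_of_ne_zero hp0 |>.trans hp).ne'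
  have hp1 : 1 ≤ p := hp₀.trans hp.le
  have hpr : (0:ℝ) < p := by exact_mod_cast pos_of_ne_zero hpne
  set t : ℝ := (p : ℝ) / p₀ with ht
  have ht1 : 1 < t := by rw [ht, one_lt_div hp0']; exact_mod_cast hp
  obtain ⟨w, σ, hωw, θ, hθ, Cw, hCw, hD⟩ := exists_dualWeights hρ ht1 hω hωA hω0
  rw [weightMeasure_eq_withDensity hωw]
  have hA := hD.localAInfty_left hρ ht1 hθ
  have hCA : Cw * ENNReal.ofReal (2 ^ θ) ≠ ∞ := ENNReal.mul_ne_top hCw ENNReal.ofReal_ne_top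
  obtain ⟨u, hu1, hut, θ', hθ', CW, hCW, hW⟩ := hD.exists_weakTypeCondition hn hρ ht1 hθ hCw
  have hu0 : 0 < u := by linarith
  -- A point strictly between 1 and t/u, so that t/s still exceeds the weak type exponent u.
  set s : ℝ := (1 + t / u) / 2 with hs
  have htu : 1 < t / u := by rwa [one_lt_div hu0]
  have hs1 : 1 < s := by rw [hs]; linarith
  have hus : u < t / s := by
    have h1 : s < t / u := by rw [hs]; linarith
    rw [lt_div_iff₀ hu0] at h1
    rw [lt_div_iff₀ (by linarith)]
    linarith
  obtain ⟨CM, hCM, hM⟩ := hW.strong_type hρ hθ' hu0 hut hCW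
  obtain ⟨CM', hCM', hM'⟩ := hW.strong_type hρ hθ' hu0 hus hCW
  obtain ⟨CR, hRH⟩ := hωRH
  have hSm : ∀ κ : ℝ, 0 < κ → κ ≤ 1 →
      (∀ x y, dist x y ≤ ρ x → κ * ρ x ≤ ρ y ∧ κ * ρ y ≤ ρ x) →
      SmallnessCondition ρ κ (volume.withDensity w) := fun κ _ hκ1 hκ => by
    obtain ⟨ε, hε, C', hC', h⟩ := hA.exists_reverse_holder hn hρ hκ1 hκ (by linarith) hCA
      hD.measurable_left hD.lintegral_left_ne_top
    exact smallnessCondition_of_reverse_holder hε hC' hD.measurable_left h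
  set M := maximalPow ρ θ' (p₀ * s) with hMdef
  have hMm : ∀ h, Measurable (M h) := fun h => measurable_maximalPow ρ θ' _ h
  set D := CM' ^ (1 / (p : ℝ)) with hDdef
  have hDt : D ≠ ∞ := ENNReal.rpow_ne_top_of_nonneg (by positivity) hCM'
  have hMle : ∀ h, Measurable h → eLpNorm (M h) p (volume.withDensity w) ≤
      D * eLpNorm h p (volume.withDensity w) := fun h hh =>
    eLpNorm_maximalPow_le hp0 hpne (by linarith) hM' hh
  suffices H : ∀ i, i ≤ k → ∃ C : ℝ≥0∞, C ≠ ∞ ∧ ∀ (f : LcInfty n 𝕜 p₀)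
      (b : EuclideanSpace ℝ (Fin n) → 𝕜)
      (P : ℕ → Lp (α := EuclideanSpace ℝ (Fin n)) 𝕜 (p₀ : ℝ≥0∞) volume) (N : ℝ),
      Measurable b → LocallyIntegrable b volume → (∀ x, ‖b x‖ ≤ N) →
      IsPowerFamily b (f : Lp 𝕜 (p₀ : ℝ≥0∞) volume) P →
      eLpNorm (commAbs T P b i) p (volume.withDensity w) ≤ C * bmoNorm ρ θ₁ b ^ i *
        eLpNorm (absFun (f : Lp 𝕜 (p₀ : ℝ≥0∞) volume)) p (volume.withDensity w) from H k le_rfl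
  intro i
  induction i using Nat.strong_induction_on with
  | _ i ih =>
  intro hi
  choose! Cl hCl hlow using fun j (hj : j < i) => ih j hj (hj.le.trans hi)
  -- The growth exponent Θ is dictated by the oscillation bounds for the order i; only then are the
  -- off-diagonal hypotheses invoked with this Θ.
  obtain ⟨CO, hCO, Θ, hΘ, hosc⟩ := exists_eLpNorm_oscillation_mul_le (𝕜 := 𝕜) hn hρ hp₀ hs1 hθ₁ hθ'
    i
  obtain ⟨CT, hE⟩ := hE Θ hΘ
  obtain ⟨C₁, hC₁, hstep⟩ := hE.exists_eLpNorm_commAbs_le_majorant (k := i) (CO := CO) (M := M)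
    hn hT hρ hp₀ hΘ.le hc₀ hp.le hD.measurable_left hD.lintegral_left_ne_top (by linarith) hCA hA
    hSm hθ' hCM hM
    (fun h hh x r hr hrρ => setLIntegral_enorm_rpow_withDensity_le hpne hpq hω hD.measurable_left
      hωw hr (hRH x r hr hrρ) hh) ENNReal.coe_ne_top hCO ENNReal.coe_ne_top
    (tsum_mul_three_mul_pow_ne_top hα hi) hMm
  refine ⟨C₁ * (D * (1 + ∑ j ∈ Finset.range i, Cl j)), ?_, fun f b P N hb hbi hN hP => ?_⟩
  · have : ∑ j ∈ Finset.range i, Cl j ≠ ∞ :=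
      ENNReal.sum_ne_top.2 fun j hj => hCl j (Finset.mem_range.1 hj)
    finiteness
  set β := bmoNorm ρ θ₁ b with hβ
  set Nf := eLpNorm (absFun (f : Lp 𝕜 (p₀ : ℝ≥0∞) volume)) p (volume.withDensity w) with hNf
  refine (hstep β b f P N (fun e he h hh x r r' m hr h1 h2 x' hx' =>
    hosc e he b hb hbi h hh x r r' m hr h1 h2 x' hx') hb hP hN).trans ?_
  rw [mul_assoc C₁, mul_assoc C₁]
  refine mul_le_mul_right ?_ _
  have h1 : eLpNorm (commMajorant M β T (f : Lp 𝕜 (p₀ : ℝ≥0∞) volume) P b i) p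
      (volume.withDensity w) ≤ β ^ i * eLpNorm (M (absFun (f : Lp 𝕜 (p₀ : ℝ≥0∞) volume))) p
        (volume.withDensity w) + ∑ j ∈ Finset.range i, β ^ (i - j) *
          eLpNorm (M (commAbs T P b j)) p (volume.withDensity w) := by
    have hm1 : Measurable fun x => β ^ i * M (absFun (f : Lp 𝕜 (p₀ : ℝ≥0∞) volume)) x :=
      (hMm _).const_mul _
    have hm2 : Measurable fun x => ∑ j ∈ Finset.range i, β ^ (i - j) * M (commAbs T P b j) x :=
      Finset.measurable_fun_sum _ fun _ _ => (hMm _).const_mul _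
    refine (eLpNorm_add_le hm1.aestronglyMeasurable hm2.aestronglyMeasurable
      (by exact_mod_cast hp1)).trans (add_le_add ?_ ?_)
    · rw [eLpNorm_const_mul_ennreal hpne _ (hMm _).aemeasurable]
    · exact eLpNorm_sum_mul_le hp1 _ _ fun j => hMm _
  refine h1.trans ?_
  calc _ ≤ β ^ i * (D * Nf) + ∑ j ∈ Finset.range i, β ^ (i - j) * (D * (Cl j * β ^ j * Nf)) := by
        refine add_le_add (mul_le_mul_right (hMle _ (measurable_absFun _)) _)
          (Finset.sum_le_sum fun j hj => mul_le_mul_right ?_ _)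
        exact (hMle _ (measurable_commAbs hb j)).trans (mul_le_mul_right
          (hlow j (Finset.mem_range.1 hj) f b P N hb hbi hN hP) _)
    _ = β ^ i * (D * Nf) + ∑ j ∈ Finset.range i, Cl j * (D * (β ^ i * Nf)) := by
        congr 1
        refine Finset.sum_congr rfl fun j hj => ?_
        have : β ^ i = β ^ (i - j) * β ^ j := by
          rw [← pow_add, Nat.sub_add_cancel (Finset.mem_range.1 hj).le]
        rw [this]; ring
    _ = _ := by rw [← Finset.sum_mul]; ring

end BoundedCommutator

/-! ### Truncation of b and its effect on the BMO norm. -/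

section Truncation

variable {𝕜 : Type*} [RCLike 𝕜]

/-- Truncation of the real and imaginary parts at height `N`. -/
def truncate (N : ℝ) (v : 𝕜) : 𝕜 :=
  ((max (-N) (min N (RCLike.re v)) : ℝ) : 𝕜) + ((max (-N) (min N (RCLike.im v)) : ℝ) : 𝕜) * RCLike.I

lemma abs_clip_sub_clip_le (N a c : ℝ) :
    |max (-N) (min N a) - max (-N) (min N c)| ≤ |a - c| := by
  refine (abs_max_sub_max_le_max (-N) (min N a) (-N) (min N c)).trans (max_le (by simp) ?_)
  exact (abs_min_sub_min_le_max N a N c).trans (max_le (by simp) le_rfl)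

lemma abs_clip_le {N : ℝ} (hN : 0 ≤ N) (a : ℝ) : |max (-N) (min N a)| ≤ N := by
  rw [abs_le]
  exact ⟨le_max_left _ _, max_le (by linarith) (min_le_left _ _)⟩

lemma clip_eq_self {N a : ℝ} (h : |a| ≤ N) : max (-N) (min N a) = a := by
  rw [abs_le] at h
  rw [min_eq_right h.2, max_eq_right h.1]

lemma continuous_truncate (N : ℝ) : Continuous (truncate N : 𝕜 → 𝕜) := by
  unfold truncate
  fun_prop

lemma norm_truncate_sub_le (N : ℝ) (v w : 𝕜) : ‖truncate N v - truncate N w‖ ≤ 2 * ‖v - w‖ := by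
  have e : truncate N v - truncate N w =
      ((max (-N) (min N (RCLike.re v)) - max (-N) (min N (RCLike.re w)) : ℝ) : 𝕜) +
      ((max (-N) (min N (RCLike.im v)) - max (-N) (min N (RCLike.im w)) : ℝ) : 𝕜) * RCLike.I := by
    rw [truncate, truncate]; push_cast; ring
  have h1 := abs_clip_sub_clip_le N (RCLike.re v) (RCLike.re w)
  have h2 := abs_clip_sub_clip_le N (RCLike.im v) (RCLike.im w)
  rw [← map_sub] at h1 h2
  have h3 := RCLike.abs_re_le_norm (v - w)
  have h4 := RCLike.abs_im_le_norm (v - w)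
  have h5 : ‖(RCLike.I : 𝕜)‖ ≤ 1 := by
    rcases RCLike.I_eq_zero_or_im_I_eq_one (K := 𝕜) with h | h
    · simp [h]
    · rw [RCLike.norm_I_of_ne_zero]
      intro h0; simp [h0] at h
  rw [e]
  refine (norm_add_le _ _).trans ?_
  rw [norm_mul, RCLike.norm_ofReal, RCLike.norm_ofReal]
  have h6 := mul_le_mul_of_nonneg_left h5
    (abs_nonneg (max (-N) (min N (RCLike.im v)) - max (-N) (min N (RCLike.im w))))
  linarith

lemma truncate_zero {N : ℝ} (hN : 0 ≤ N) : truncate N (0 : 𝕜) = 0 := by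
  simp [truncate, hN]

lemma norm_truncate_le_two_mul {N : ℝ} (hN : 0 ≤ N) (v : 𝕜) : ‖truncate N v‖ ≤ 2 * ‖v‖ := by
  simpa [truncate_zero hN] using norm_truncate_sub_le N v 0

lemma truncate_eq_self {N : ℝ} {v : 𝕜} (h : ‖v‖ ≤ N) : truncate N v = v := by
  rw [truncate, clip_eq_self ((RCLike.abs_re_le_norm v).trans h),
    clip_eq_self ((RCLike.abs_im_le_norm v).trans h), RCLike.re_add_im]

lemma norm_truncate_le {N : ℝ} (hN : 0 ≤ N) (v : 𝕜) : ‖truncate N v‖ ≤ 2 * N := by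
  have h5 : ‖(RCLike.I : 𝕜)‖ ≤ 1 := by
    rcases RCLike.I_eq_zero_or_im_I_eq_one (K := 𝕜) with h | h
    · simp [h]
    · rw [RCLike.norm_I_of_ne_zero]
      intro h0; simp [h0] at h
  rw [truncate]
  refine (norm_add_le _ _).trans ?_
  rw [norm_mul, RCLike.norm_ofReal, RCLike.norm_ofReal]
  have h1 := abs_clip_le hN (RCLike.re v)
  have h2 := abs_clip_le hN (RCLike.im v)
  have h6 := mul_le_mul_of_nonneg_left h5 (abs_nonneg (max (-N) (min N (RCLike.im v))))
  linarith

variable {n : ℕ} {ρ : EuclideanSpace ℝ (Fin n) → ℝ} {b : EuclideanSpace ℝ (Fin n) → 𝕜}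

lemma locallyIntegrable_truncate (hb : LocallyIntegrable b volume) {N : ℝ} (hN : 0 ≤ N) :
    LocallyIntegrable (fun x => truncate N (b x)) volume := by
  refine (hb.smul (2 : 𝕜)).mono
    ((continuous_truncate N).comp_aestronglyMeasurable hb.aestronglyMeasurable) ?_
  refine .of_forall fun x => ?_
  rw [Pi.smul_apply, norm_smul]
  simpa using norm_truncate_le_two_mul hN (b x)

/-- A 2-Lipschitz map at most doubles the mean oscillation about the image of the mean, and
recentring at the true mean costs another factor 2. -/
lemma bmoNorm_truncate_le (hρ : IsAdmissible ρ) (θ : ℝ) (hb : LocallyIntegrable b volume) {N : ℝ}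
    (hN : 0 ≤ N) : bmoNorm ρ θ (fun x => truncate N (b x)) ≤ 4 * bmoNorm ρ θ b := by
  refine iSup_le fun x => iSup_le fun r => iSup_le fun hr => ?_
  have hp := isProbabilityMeasure_avgMeasure x hr
  set m := ballMean b x r with hm
  set m' := ballMean (fun x => truncate N (b x)) x r with hm'
  have h1 : ∫⁻ y, ‖truncate N (b y) - truncate N m‖ₑ ∂avgMeasure x r ≤
      2 * ∫⁻ y, ‖b y - m‖ₑ ∂avgMeasure x r := by
    rw [← lintegral_const_mul' _ _ (by simp)]
    refine lintegral_mono fun y => ?_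
    have h : ‖truncate N (b y) - truncate N m‖₊ ≤ 2 * ‖b y - m‖₊ := norm_truncate_sub_le N (b y) m
    rw [enorm_eq_nnnorm, enorm_eq_nnnorm]
    exact (ENNReal.coe_le_coe.2 h).trans_eq (ENNReal.coe_mul _ _)
  have h2 := enorm_ballMean_sub_le (locallyIntegrable_truncate hb hN) x hr (truncate N m)
  have h3 : ∫⁻ y, ‖truncate N (b y) - m'‖ₑ ∂avgMeasure x r ≤
      4 * ∫⁻ y, ‖b y - m‖ₑ ∂avgMeasure x r := by
    calc _ ≤ ∫⁻ y, (‖truncate N (b y) - truncate N m‖ₑ + ‖m' - truncate N m‖ₑ) ∂avgMeasure x r := by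
          refine lintegral_mono fun y => ?_
          rw [← sub_sub_sub_cancel_right _ _ (truncate N m)]
          exact enorm_sub_le
      _ = ∫⁻ y, ‖truncate N (b y) - truncate N m‖ₑ ∂avgMeasure x r + ‖m' - truncate N m‖ₑ := by
          rw [lintegral_add_right _ measurable_const]
          simp
      _ ≤ 2 * ∫⁻ y, ‖b y - m‖ₑ ∂avgMeasure x r + 2 * ∫⁻ y, ‖b y - m‖ₑ ∂avgMeasure x r :=
          add_le_add h1 (h2.trans h1)
      _ = _ := by ring
  have h4 : ∫⁻ y, ‖b y - m‖ₑ ∂psiMeasure ρ θ x r ≤ bmoNorm ρ θ b :=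
    le_iSup_of_le x (le_iSup_of_le r (le_iSup_of_le hr le_rfl))
  calc ∫⁻ y, ‖truncate N (b y) - m'‖ₑ ∂psiMeasure ρ θ x r
      ≤ 4 * ∫⁻ y, ‖b y - m‖ₑ ∂psiMeasure ρ θ x r := by
        rw [lintegral_psiMeasure_eq hρ θ x hr.le, lintegral_psiMeasure_eq hρ θ x hr.le,
          mul_left_comm]
        exact mul_le_mul_right h3 _
    _ ≤ _ := mul_le_mul_right h4 _

lemma memBMO_truncate (hρ : IsAdmissible ρ) {θ : ℝ} (hb : MemBMO ρ θ b) {N : ℝ} (hN : 0 ≤ N) :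
    MemBMO ρ θ (fun x => truncate N (b x)) :=
  ⟨locallyIntegrable_truncate hb.locallyIntegrable hN,
    (bmoNorm_truncate_le hρ θ hb.locallyIntegrable hN).trans_lt
      (ENNReal.mul_lt_top (by simp) hb.bmoNorm_lt_top)⟩

lemma bmoNorm_congr (ρ : EuclideanSpace ℝ (Fin n) → ℝ) (θ : ℝ)
    {b' : EuclideanSpace ℝ (Fin n) → 𝕜} (h : b =ᵐ[volume] b') :
    bmoNorm ρ θ b = bmoNorm ρ θ b' := by
  unfold bmoNorm
  congr 1 with x
  congr 1 with r
  congr 1 with hr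
  rw [setAverage_congr_fun measurableSet_ball (h.mono fun y hy _ => hy)]
  refine lintegral_congr_ae ((psiMeasure_absolutelyContinuous ρ θ x r).ae_le ?_)
  filter_upwards [h] with y hy
  rw [hy]

lemma MemBMO.congr {θ : ℝ} (hb : MemBMO ρ θ b) {b' : EuclideanSpace ℝ (Fin n) → 𝕜}
    (h : b =ᵐ[volume] b') : MemBMO ρ θ b' :=
  ⟨fun x => (hb.locallyIntegrable x).congr h, bmoNorm_congr ρ θ h ▸ hb.bmoNorm_lt_top⟩

end Truncation

/-! ### Passage from truncated to general b. -/

section Approximation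

variable {n : ℕ} {ρ : EuclideanSpace ℝ (Fin n) → ℝ} {𝕜 : Type*} [RCLike 𝕜] {p₀ p : ℝ≥0}
  {T : Lp (α := EuclideanSpace ℝ (Fin n)) 𝕜 (p₀ : ℝ≥0∞) volume →
    Lp (α := EuclideanSpace ℝ (Fin n)) 𝕜 (p₀ : ℝ≥0∞) volume}
  {b b' : EuclideanSpace ℝ (Fin n) → 𝕜} {k : ℕ}
  {f : Lp (α := EuclideanSpace ℝ (Fin n)) 𝕜 (p₀ : ℝ≥0∞) volume}
  {P : ℕ → Lp (α := EuclideanSpace ℝ (Fin n)) 𝕜 (p₀ : ℝ≥0∞) volume}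

lemma IsCommutator.congr {F : EuclideanSpace ℝ (Fin n) → 𝕜} (hF : IsCommutator T b k f F)
    (h : b =ᵐ[volume] b') : IsCommutator T b' k f F := by
  obtain ⟨Φ, h1, h2, h3⟩ := hF
  refine ⟨Φ, fun c => ?_, h2, ?_⟩
  · obtain ⟨g, hg, hgΦ⟩ := h1 c
    refine ⟨g, ?_, hgΦ⟩
    filter_upwards [hg, h] with y hy1 hy2
    rw [hy1, hy2]
  · filter_upwards [h3, h] with x hx1 hx2
    rw [hx1, hx2]

lemma IsBoundedSublinear.exists_eLpNorm_le (hT : IsBoundedSublinear T) :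
    ∃ C : ℝ≥0, ∀ g, eLpNorm (T g) p₀ volume ≤ C * eLpNorm g p₀ volume := by
  obtain ⟨C, hC⟩ := hT.bounded
  refine ⟨C, fun g => ?_⟩
  have h := hC g
  rw [Lp.norm_def, Lp.norm_def, ← ENNReal.coe_toReal, ← ENNReal.toReal_mul] at h
  exact (ENNReal.toReal_le_toReal (Lp.memLp _).2.ne
    (ENNReal.mul_ne_top ENNReal.coe_ne_top (Lp.memLp _).2.ne)).1 h

/-- Dominated convergence: the truncation is eventually equal to b(x), and its m-th power is at most
2^m |b(x)|^m. -/
lemma tendsto_eLpNorm_sub_truncate (hp₀ : p₀ ≠ 0) (hP : IsPowerFamily b f P)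
    {PN : ℕ → ℕ → Lp (α := EuclideanSpace ℝ (Fin n)) 𝕜 (p₀ : ℝ≥0∞) volume}
    (hPN : ∀ N : ℕ, IsPowerFamily (fun x => truncate N (b x)) f (PN N)) (m : ℕ) :
    Filter.Tendsto (fun N => eLpNorm (P m - PN N m : Lp 𝕜 (p₀ : ℝ≥0∞) volume) p₀ volume)
      Filter.atTop (nhds 0) := by
  have hp0 : (0:ℝ) < p₀ := by exact_mod_cast pos_of_ne_zero hp₀
  have h1 : Filter.Tendsto (fun N => ∫⁻ x, ‖(P m - PN N m : Lp 𝕜 (p₀ : ℝ≥0∞) volume) x‖ₑ ^ (p₀ : ℝ))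
      Filter.atTop (nhds (∫⁻ _ : EuclideanSpace ℝ (Fin n), (0 : ℝ≥0∞))) := by
    refine tendsto_lintegral_of_dominated_convergence
      (fun x => (1 + 2 ^ m : ℝ≥0∞) ^ (p₀ : ℝ) * ‖P m x‖ₑ ^ (p₀ : ℝ))
      (fun N => (Lp.stronglyMeasurable _).enorm.pow_const _) (fun N => ?_) ?_ ?_
    · filter_upwards [hP m, hPN N m, Lp.coeFn_sub (P m) (PN N m)] with x h1 h2 h3
      rw [← ENNReal.mul_rpow_of_nonneg _ _ hp0.le]
      refine ENNReal.rpow_le_rpow ?_ hp0.le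
      have h4 : ‖truncate (N : ℝ) (b x)‖₊ ≤ 2 * ‖b x‖₊ :=
        norm_truncate_le_two_mul (Nat.cast_nonneg N) (b x)
      rw [h3, Pi.sub_apply, add_mul, one_mul]
      refine enorm_sub_le.trans (add_le_add le_rfl ?_)
      rw [h1, h2, enorm_mul, enorm_mul, enorm_pow, enorm_pow, ← mul_assoc, ← mul_pow]
      refine mul_le_mul_left (pow_le_pow_left₀ zero_le ?_ m) _
      rw [enorm_eq_nnnorm, enorm_eq_nnnorm]
      exact_mod_cast h4
    · rw [lintegral_const_mul _ ((Lp.stronglyMeasurable _).enorm.pow_const _)]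
      refine ENNReal.mul_ne_top (ENNReal.rpow_ne_top_of_nonneg hp0.le (by finiteness)) ?_
      rw [← eLpNorm_nnreal_pow_eq_lintegral hp₀]
      exact ENNReal.rpow_ne_top_of_nonneg hp0.le (Lp.memLp (P m)).2.ne
    · filter_upwards [hP m, ae_all_iff.2 fun N => hPN N m,
        ae_all_iff.2 fun N => Lp.coeFn_sub (P m) (PN N m)] with x h1 h2 h3
      refine tendsto_const_nhds.congr' ?_
      obtain ⟨N₀, hN₀⟩ := exists_nat_ge ‖b x‖
      filter_upwards [Filter.eventually_ge_atTop N₀] with N hN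
      have h4 : truncate (N : ℝ) (b x) = b x :=
        truncate_eq_self (hN₀.trans (by exact_mod_cast hN))
      rw [h3, Pi.sub_apply, h1, h2, h4, sub_self, enorm_zero, ENNReal.zero_rpow_of_pos hp0]
  rw [lintegral_zero] at h1
  have h2 := (ENNReal.continuous_rpow_const (y := 1 / (p₀ : ℝ))).tendsto 0 |>.comp h1
  rw [ENNReal.zero_rpow_of_pos (by positivity)] at h2
  refine h2.congr fun N => ?_
  rw [eLpNorm_nnreal_eq_lintegral hp₀]
  rfl

/-- The weighted norm of the commutator is lower semicontinuous under truncation. -/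
lemma IsBoundedSublinear.eLpNorm_commAbs_le_of_truncate (hT : IsBoundedSublinear T) (hp₀ : 1 ≤ p₀)
    (hp : p ≠ 0) (hb : Measurable b) (hP : IsPowerFamily b f P)
    {PN : ℕ → ℕ → Lp (α := EuclideanSpace ℝ (Fin n)) 𝕜 (p₀ : ℝ≥0∞) volume}
    (hPN : ∀ N : ℕ, IsPowerFamily (fun x => truncate N (b x)) f (PN N)) (k : ℕ)
    {μ : Measure (EuclideanSpace ℝ (Fin n))} (hμ : μ ≪ volume) {K : ℝ≥0∞}
    (hK : ∀ N : ℕ, eLpNorm (commAbs T (PN N) (fun x => truncate N (b x)) k) p μ ≤ K) :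
    eLpNorm (commAbs T P b k) p μ ≤ K := by
  have hp0 : p₀ ≠ 0 := (one_pos.trans_le hp₀).ne'
  have hpr : (0:ℝ) < p := by exact_mod_cast pos_of_ne_zero hp
  obtain ⟨C, hC⟩ := hT.exists_eLpNorm_le
  set W : ℕ → EuclideanSpace ℝ (Fin n) → ℝ := fun N =>
    ∑ m ∈ Finset.range (k + 1), fun x => ‖T (P m - PN N m) x‖ with hW
  have hWm : ∀ N m, AEStronglyMeasurable (fun x => ‖T (P m - PN N m) x‖) volume :=
    fun N m => (Lp.aestronglyMeasurable _).norm
  have hW0 : Filter.Tendsto (fun N => eLpNorm (W N) p₀ volume) Filter.atTop (nhds 0) := by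
    have h1 : Filter.Tendsto (fun N => ∑ m ∈ Finset.range (k + 1), (C : ℝ≥0∞) *
        eLpNorm (P m - PN N m : Lp 𝕜 (p₀ : ℝ≥0∞) volume) p₀ volume) Filter.atTop
        (nhds (∑ m ∈ Finset.range (k + 1), (C : ℝ≥0∞) * 0)) :=
      tendsto_finsetSum _ fun m _ => ENNReal.Tendsto.const_mul
        (tendsto_eLpNorm_sub_truncate hp0 hP hPN m) (.inr ENNReal.coe_ne_top)
    simp only [mul_zero, Finset.sum_const_zero] at h1
    refine tendsto_of_tendsto_of_tendsto_of_le_of_le tendsto_const_nhds h1 (fun _ => zero_le)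
      fun N => (eLpNorm_sum_le (fun m _ => hWm N m) (by exact_mod_cast hp₀)).trans ?_
    refine Finset.sum_le_sum fun m _ => ?_
    rw [eLpNorm_norm]
    exact hC _
  have hW1 : TendstoInMeasure volume W Filter.atTop 0 := by
    refine tendstoInMeasure_of_tendsto_eLpNorm (p := p₀) (by simpa using hp0)
      (fun N => Finset.aestronglyMeasurable_sum _ fun m _ => hWm N m) aestronglyMeasurable_zero ?_
    simpa only [sub_zero] using hW0
  -- L^{p₀} boundedness of T gives convergence in measure, hence a.e. along a subsequence, of all
  -- the errors T(P m - PN N m). Such an error bounds the commutator uniformly for c in bounded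
  -- sets, so c = b(x) may be inserted.
  obtain ⟨ns, hns, hlim⟩ := hW1.exists_seq_tendsto_ae
  have hpt : ∀ᵐ x, commAbs T P b k x ^ (p : ℝ) ≤ Filter.liminf (fun i =>
      commAbs T (PN (ns i)) (fun x => truncate (ns i : ℕ) (b x)) k x ^ (p : ℝ)) Filter.atTop := by
    filter_upwards [hlim, ae_all_iff.2 fun N => hT.commNorm_le_add_sum P (PN N) k] with x hx hN
    set E : ℕ → ℝ≥0 := fun i => ∑ m ∈ Finset.range (k + 1),
      ‖b x‖₊ ^ (k - m) * k.choose m * ‖T (P m - PN (ns i) m) x‖₊ with hE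
    have hE0 : Filter.Tendsto E Filter.atTop (nhds 0) := by
      have h1 : Filter.Tendsto E Filter.atTop (nhds (∑ m ∈ Finset.range (k + 1),
          ‖b x‖₊ ^ (k - m) * k.choose m * 0)) := by
        refine tendsto_finsetSum _ fun m hm => Filter.Tendsto.const_mul _ ?_
        rw [← NNReal.tendsto_coe]
        refine squeeze_zero (fun _ => NNReal.coe_nonneg _) (fun i => ?_) hx
        simp only [hW, Finset.sum_apply]
        exact Finset.single_le_sum (f := fun m => ‖T (P m - PN (ns i) m) x‖)
          (fun _ _ => norm_nonneg _) hm
      simpa using h1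
    have h2 : Filter.Tendsto (fun i => ((commFun T P b k x - E i : ℝ≥0) : ℝ≥0∞) ^ (p : ℝ))
        Filter.atTop (nhds (commAbs T P b k x ^ (p : ℝ))) := by
      have h3 := (tendsto_const_nhds (x := commFun T P b k x)).sub hE0
      rw [tsub_zero] at h3
      exact (ENNReal.continuous_rpow_const.tendsto _).comp (ENNReal.tendsto_coe.2 h3)
    rw [← h2.liminf_eq]
    refine Filter.liminf_le_liminf ?_
    -- Once the truncation height exceeds |b(x)|, both commutators are evaluated at the same scalar.
    obtain ⟨N₀, hN₀⟩ := exists_nat_ge ‖b x‖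
    filter_upwards [Filter.eventually_ge_atTop N₀] with i hi
    refine ENNReal.rpow_le_rpow (ENNReal.coe_le_coe.2 ?_) hpr.le
    have h4 : truncate ((ns i : ℕ) : ℝ) (b x) = b x :=
      truncate_eq_self (hN₀.trans (by exact_mod_cast hi.trans (hns.id_le i)))
    rw [tsub_le_iff_right, commFun, commFun, h4]
    exact hN (ns i) (b x)
  rw [eLpNorm_nnreal_eq_lintegral hp, one_div, ENNReal.rpow_inv_le_iff hpr]
  simp only [enorm_eq_self]
  calc _ ≤ ∫⁻ x, Filter.liminf (fun i =>
        commAbs T (PN (ns i)) (fun x => truncate (ns i : ℕ) (b x)) k x ^ (p : ℝ)) Filter.atTop ∂μ :=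
        lintegral_mono_ae (hμ.ae_le hpt)
    _ ≤ Filter.liminf (fun i => ∫⁻ x,
        commAbs T (PN (ns i)) (fun x => truncate (ns i : ℕ) (b x)) k x ^ (p : ℝ) ∂μ) Filter.atTop :=
        lintegral_liminf_le fun i => (measurable_commAbs
          ((continuous_truncate _).measurable.comp hb) k).pow_const _
    _ ≤ K ^ (p : ℝ) := by
        refine Filter.liminf_le_of_le (by isBoundedDefault) fun a ha => ?_
        obtain ⟨i, hi⟩ := ha.exists
        refine hi.trans ?_
        rw [lintegral_rpow_eq_eLpNorm_rpow hp]
        exact ENNReal.rpow_le_rpow (hK _) hpr.le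

end Approximation
end

/-! ### The theorem. -/

theorem theorem3p3 {𝕜 : Type*} [RCLike 𝕜] (n : ℕ) (hn : 1 ≤ n)
    (ρ : EuclideanSpace ℝ (Fin n) → ℝ) (hρ : IsAdmissible ρ)
    (p₀ p : ℝ≥0) (q₀ : ℝ≥0∞) (hp₀ : 1 ≤ p₀) (hpq₀ : (p₀ : ℝ≥0∞) < q₀)
    (hp : p₀ < p) (hpq : (p : ℝ≥0∞) < q₀ ∨ ((p : ℝ≥0∞) = q₀ ∧ q₀ < ∞))
    (T : Lp (α := EuclideanSpace ℝ (Fin n)) 𝕜 (p₀ : ℝ≥0∞) volume →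
      Lp (α := EuclideanSpace ℝ (Fin n)) 𝕜 (p₀ : ℝ≥0∞) volume)
    (hT : IsBoundedSublinear T)
    (A : ℝ → LcInfty n 𝕜 p₀ → Lp (α := EuclideanSpace ℝ (Fin n)) 𝕜 (p₀ : ℝ≥0∞) volume)
    (c₀ : ℝ) (hc₀ : 0 < c₀) (k : ℕ) (α : ℕ+ → ℝ≥0)
    (hα : Summable fun j : ℕ+ => α j * (j : ℝ≥0) ^ k)
    -- off-diagonal estimate for `T(I - A_r)` on small balls
    (hTIA : ∀ θ : ℝ, 0 < θ → ∃ C : ℝ≥0, ∀ (f : LcInfty n 𝕜 p₀)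
      (x₀ : EuclideanSpace ℝ (Fin n)) (r : ℝ), 0 < r → r < ρ x₀ →
        eLpNorm (T (f - A (c₀ * r) f)) p₀ (avgMeasure x₀ (c₀ * r)) ≤
          C * ∑' j : ℕ+, (α j : ℝ≥0∞) *
            eLpNorm (f : Lp (α := EuclideanSpace ℝ (Fin n)) 𝕜 (p₀ : ℝ≥0∞) volume) p₀
              (psiMeasure ρ θ x₀ (2 ^ ((j : ℕ) + 1) * (c₀ * r))))
    -- estimate for `T` on large balls
    (hTlarge : ∀ θ : ℝ, 0 < θ → ∃ C : ℝ≥0, ∀ (f : LcInfty n 𝕜 p₀)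
      (x₀ : EuclideanSpace ℝ (Fin n)) (r : ℝ), ρ x₀ ≤ r →
        eLpNorm (T f) p₀ (psiMeasure ρ θ x₀ r) ≤
          C * ∑' j : ℕ+, (α j : ℝ≥0∞) *
            eLpNorm (f : Lp (α := EuclideanSpace ℝ (Fin n)) 𝕜 (p₀ : ℝ≥0∞) volume) p₀
              (psiMeasure ρ θ x₀ (2 ^ ((j : ℕ) + 1) * r)))
    -- off-diagonal estimate for `T A_r` on small balls
    (hTA : ∀ θ : ℝ, 0 < θ → ∃ C : ℝ≥0, ∀ (f : LcInfty n 𝕜 p₀)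
      (x₀ : EuclideanSpace ℝ (Fin n)) (r : ℝ), 0 < r → r < ρ x₀ →
        eLpNorm (T (A (c₀ * r) f)) q₀ (avgMeasure x₀ (c₀ * r)) ≤
          C * ∑' j : ℕ+, (α j : ℝ≥0∞) *
            eLpNorm (T f) p₀ (psiMeasure ρ θ x₀ (2 ^ ((j : ℕ) + 1) * (c₀ * r))))
    (ω : EuclideanSpace ℝ (Fin n) → ℝ) (hω : IsWeight ω)
    (hωA : MuckenhouptRhoInfty ρ ((p : ℝ) / (p₀ : ℝ)) ω)
    (hωRH : ReverseHolderLoc ρ (ENNReal.conjExponent (q₀ / p)) ω)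
    (θ₁ : ℝ) (hθ₁ : 0 < θ₁) :
    ∃ C : ℝ≥0, ∀ (f : LcInfty n 𝕜 p₀) (b : EuclideanSpace ℝ (Fin n) → 𝕜), MemBMO ρ θ₁ b →
      (∃ F, IsCommutator T b k f F) ∧
      ∀ F, IsCommutator T b k f F →
        eLpNorm F p (weightMeasure ω) ≤ C * bmoNorm ρ θ₁ b ^ k *
          eLpNorm (f : Lp (α := EuclideanSpace ℝ (Fin n)) 𝕜 (p₀ : ℝ≥0∞) volume) p
            (weightMeasure ω) := by
  have hpq' : (p : ℝ≥0∞) ≤ q₀ := hpq.elim le_of_lt fun h => h.1.le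
  have hp0 : p ≠ 0 := (zero_le.trans_lt hp).ne'
  have hE : ∀ θ : ℝ, 0 < θ → ∃ C : ℝ≥0, OffDiagonalEstimates ρ q₀ T A c₀ α θ C := fun θ hθ => by
    obtain ⟨C₁, h₁⟩ := hTIA θ hθ
    obtain ⟨C₂, h₂⟩ := hTlarge θ hθ
    obtain ⟨C₃, h₃⟩ := hTA θ hθ
    refine ⟨C₁ + C₂ + C₃, fun f x r hr hrρ => (h₁ f x r hr hrρ).trans (mul_le_mul_left ?_ _),
      fun f x r hr => (h₂ f x r hr).trans (mul_le_mul_left ?_ _),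
      fun f x r hr hrρ => (h₃ f x r hr hrρ).trans (mul_le_mul_left ?_ _)⟩
    · exact ENNReal.coe_le_coe.2 (le_self_add.trans le_self_add)
    · exact ENNReal.coe_le_coe.2 (le_add_self.trans le_self_add)
    · exact ENNReal.coe_le_coe.2 le_add_self
  have hμ : weightMeasure ω ≪ volume := withDensity_absolutelyContinuous _ _
  obtain ⟨C, hC, hCb⟩ : ∃ C : ℝ≥0∞, C ≠ ∞ ∧ ∀ (f : LcInfty n 𝕜 p₀)
      (b : EuclideanSpace ℝ (Fin n) → 𝕜)
      (P : ℕ → Lp (α := EuclideanSpace ℝ (Fin n)) 𝕜 (p₀ : ℝ≥0∞) volume) (N : ℝ),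
      Measurable b → LocallyIntegrable b volume → (∀ x, ‖b x‖ ≤ N) →
      IsPowerFamily b (f : Lp 𝕜 (p₀ : ℝ≥0∞) volume) P →
      eLpNorm (commAbs T P b k) p (weightMeasure ω) ≤ C * bmoNorm ρ θ₁ b ^ k *
        eLpNorm (absFun (f : Lp 𝕜 (p₀ : ℝ≥0∞) volume)) p (weightMeasure ω) := by
    -- The zero weight has no dual weight, but its measure vanishes and the estimate is trivial.
    by_cases hω0 : ω =ᵐ[volume] 0
    · have h0 : weightMeasure ω = 0 := by
        rw [weightMeasure, withDensity_congr_ae (g := 0), withDensity_zero]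
        filter_upwards [hω0] with x hx
        simp [hx]
      exact ⟨0, by simp, fun f b P N _ _ _ _ => by simp [h0]⟩
    · exact exists_eLpNorm_commAbs_le hn hρ hp₀ hp hpq' hT hc₀ hα hE hω hωA hωRH hω0 hθ₁.le
  -- The factor 4^k accounts for the norm of the truncations.
  have hC4 : C * 4 ^ k ≠ ∞ := by finiteness
  refine ⟨(C * 4 ^ k).toNNReal, fun f b hb => ?_⟩
  obtain ⟨b', hb'm, hbb'⟩ : ∃ b' : EuclideanSpace ℝ (Fin n) → 𝕜, Measurable b' ∧
      b =ᵐ[volume] b' :=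
    ⟨_, hb.locallyIntegrable.aestronglyMeasurable.stronglyMeasurable_mk.measurable,
      hb.locallyIntegrable.aestronglyMeasurable.ae_eq_mk⟩
  have hb' := hb.congr hbb'
  obtain ⟨P, hP⟩ := exists_isPowerFamily hn hρ hp₀ hθ₁.le hb'm hb' f
  refine ⟨(hT.exists_isCommutator hP k).imp fun F hF => hF.congr hbb'.symm, fun F hF => ?_⟩
  have hm : ∀ N : ℕ, Measurable fun x => truncate (N : ℝ) (b' x) := fun N =>
    (continuous_truncate _).measurable.comp hb'm
  choose PN hPN using fun N : ℕ => exists_isPowerFamily hn hρ hp₀ hθ₁.le (hm N)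
    (memBMO_truncate hρ hb' N.cast_nonneg) f
  rw [ENNReal.coe_toNNReal hC4, bmoNorm_congr ρ θ₁ hbb']
  calc eLpNorm F p (weightMeasure ω) = eLpNorm (commAbs T P b' k) p (weightMeasure ω) := by
        refine eLpNorm_congr_enorm_ae (hμ.ae_le ?_)
        filter_upwards [hT.nnnorm_isCommutator hP (hF.congr hbb')] with x hx
        rw [enorm_eq_self, commAbs, enorm_eq_nnnorm, hx]
    _ ≤ C * 4 ^ k * bmoNorm ρ θ₁ b' ^ k *
        eLpNorm (absFun (f : Lp 𝕜 (p₀ : ℝ≥0∞) volume)) p (weightMeasure ω) := by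
        refine hT.eLpNorm_commAbs_le_of_truncate hp₀ hp0 hb'm hP hPN k hμ fun N => ?_
        refine (hCb f _ (PN N) _ (hm N) (locallyIntegrable_truncate hb'.locallyIntegrable
          N.cast_nonneg) (fun x => norm_truncate_le N.cast_nonneg _) (hPN N)).trans ?_
        rw [mul_assoc C (4 ^ k), ← mul_pow]
        gcongr
        exact bmoNorm_truncate_le hρ θ₁ hb'.locallyIntegrable N.cast_nonneg
    _ = _ := by congr 1
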